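/- Logarithms are to base $2$. Let $\mathbf A$ be a finite alphabet. For $\beta>1$, $0<\alpha,\delta<1$, $R>0$ and integers $k_0\ge 0$, $1\le \ell\le n_0$, let $M=M_{k_0,\alpha,\beta,\delta,R,\ell,n_0}$ be the class of stationary ergodic laws $P$ on $\mathbf A^{\mathbb Z}$ such that: (A) $P(X_1=a\mid X_j,\ j\neq 1)\ge\delta$ almost surely for every $a\in\mathbf A$; (B) $\frac1\beta\le \frac{P(B)}{P(B|A)}\le\beta$ for all $k\ge k_0$, $A\in\sigma(X_{-\infty}^0)$, $B\in\sigma(X_k^\infty)$ of positive probability; (C) $P[P(X_1^\ell)\le 2^{-\ell R}]\le\alpha$, and $P[P(X_1^n)\le 2^{-nR}]\le \frac1n$ for all $n\ge n_0$. Let $D_{KL,n}(P\|Q)=\frac1n\sum_{z\in\mathbf A^n}P(z)\log\frac{P(z)}{Q(z)}$. For a classifier $f:\mathbf A^{\bar N}\times\mathbf A^{\bar N}\to\{0,1\}$ and a set $S$ of sources, let $\lambda_{KL,n,\bar N,f,\Delta,S}$ be the supremum over $P,Q\in S$ of the probability, for independent $\mathbf X\sim P$ and $\mathbf Y\sim Q$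 of length $\bar N$, that either $f(\mathbf X,\mathbf Y)=1$ and $P_{\bar N}=Q_{\bar N}$ (equality of the $\bar N$-th order marginals), or $D_{KL,n}(P\|Q)\ge\Delta$ and $f(\mathbf X,\mathbf Y)=0$. The empirical statistics classifier (ESC) with parameters $K\ge 1$, $k_0$, $\delta$, $\varepsilon_0>0$, $\Delta$ acts on sequences of length $\bar N=K(N+k_0)+N$. The first $K(N+k_0)$ letters of each sequence are training data: $K$ vectors of length $N$, each followed by $k_0$ unused letters. Let $n=\left\lfloor\frac{\log\bar N}{\log(1/\delta)+\varepsilon_0}\right\rfloor$ (replaced by $N$ if it exceeds $N$) and let $Z_1^n$ be the first $n$ letters of the suffix of length $N$ of $\mathbf X$. Let $\hat N(Z_1^n|\mathbf X')$ be the least $k\ge1$ such that $Z_1^n$ occupies the places $k,\dots,k+n-1$ of one of the $K$ training vectors of $\mathbf X$; put $\hat P_{\mathbf X}(Z_1^n)=1/\hat N(Z_1^n|\mathbf X')$ if this is defined and at most $N$, and $\hat P_{\mathbf X}(Z_1^n)=1/N$ otherwise; define $\hat Q_{\mathbf Y}(Z_1^n)$ in the same way from $\mathbf Y$. The ESC declares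 $f(\mathbf X,\mathbf Y)=1$ if $\frac1n\log\hat P_{\mathbf X}(Z_1^n)-\frac1n\log\hat Q_{\mathbf Y}(Z_1^n)\ge\frac\Delta2$, and $f(\mathbf X,\mathbf Y)=0$ otherwise. (1) (Asymptotic optimality.) For every class $M$ as above, every $K\ge1$, $\varepsilon_0>0$ and $\Delta>4\varepsilon_0$, and with $n$ and $\bar N$ as above, $\lambda_{KL,n,\bar N,\mathrm{ESC},\Delta,M}\to0$ as $N\to\infty$ (hence $\bar N\to\infty$). (2) (Failure of essential optimality.) Let $\mathbf A=\{0,1\}$. For a cyclic set $B\subset\{0,1\}^\ell$ (closed under the cyclic shift) and $\nu\ge1$ let $P_B$ be the law of the following stationary process: independent cycles are concatenated with a random phase, where a cycle consists of a vector drawn uniformly from $B$, repeated $\nu$ times and followed by its first $\nu'$ letters with $\nu'$ uniform on $\{1,\dots,\ell\}$; then an i.i.d. noise which equals $1$ with probability $\delta$ is added modulo $2$. For every $R\in(0,1)$ there are $\beta_0\in(0,\frac12)$ and $c>0$ such that for all $\varepsilon_0\in(0,R)$, $\alpha\in(0,1)$ and $\Delta>0$ there is $\delta_0\in(0,1)$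 such that for all $\delta\in(0,\delta_0]$, $\beta>1$, $K\ge1$ and $\eta>0$, and for all sufficiently large $\ell$, the following holds with $N_0=2^{R\ell}$ and $N=\lceil N_02^{\varepsilon_0\ell}\rceil$. There are $\nu\ge1$, thresholds $k_1\le N$ and $n_1\ge\ell$, and a collection of at least $2^{c\ell}$ cyclic sets $B\subset\{0,1\}^\ell$ with $2^{(R-\varepsilon_0/2)\ell}\le|B|\le2^{R\ell}$, elements of distinct sets being at Hamming distance at least $\beta_0\ell$, such that the set $\hat M$ of the corresponding sources $P_B$ satisfies $D_{KL,\ell}(P_B\|P_{B'})\ge\Delta$ for $B\ne B'$ and such that, for all $k_1\le k_0\le N$ and $n_0\ge n_1$, $$\hat M\subset M_{k_0,\alpha,\beta,\delta,R,\ell,n_0}\quad\text{and}\quad \lambda_{KL,\ell,\bar N,\mathrm{ESC},\Delta,\hat M}\ge1-\eta,\qquad \bar N=K(N+k_0)+N .$$ -/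

import Mathlib

open MeasureTheory ProbabilityTheory Filter Topology

noncomputable section

namespace ZivClassifier

/-! ### Sources: laws of doubly infinite sequences, blocks, and the class of sources -/

section Sources

variable {𝒜 : Type*}

/-- The left shift on doubly infinite sequences. -/
def shift (ω : ℤ → 𝒜) : ℤ → 𝒜 := fun i => ω (i + 1)

/-- The block `X_1, …, X_n` of a doubly infinite sequence. -/
def block (n : ℕ) (ω : ℤ → 𝒜) : Fin n → 𝒜 := fun i => ω ((i : ℤ) + 1)

variable [MeasurableSpace 𝒜]

/-- The `n`-th order marginal `P_n` of `P`, that is, the law of `X_1, …, X_n`. -/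
def marginal (P : Measure (ℤ → 𝒜)) (n : ℕ) : Measure (Fin n → 𝒜) := P.map (block n)

/-- The probability `P(z)` of an `n`-vector `z`. -/
def blockProb (P : Measure (ℤ → 𝒜)) {n : ℕ} (z : Fin n → 𝒜) : ℝ := P.real {ω | block n ω = z}

/-- The `σ`-field generated by the letters `X_i`, `i ∈ S`. -/
abbrev coordSigma (S : Set ℤ) : MeasurableSpace (ℤ → 𝒜) :=
  ⨆ i ∈ S, MeasurableSpace.comap (fun ω : ℤ → 𝒜 => ω i) inferInstance

/-- The class `M` of vanishing memory sources with parameters `k₀, α, β, δ, R, ℓ, n₀`. -/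
structure IsVanishingMemory (k₀ : ℕ) (α β δ R : ℝ) (ℓ n₀ : ℕ) (P : Measure (ℤ → 𝒜)) : Prop where
  isProb : IsProbabilityMeasure P
  /-- `P` is stationary and ergodic. -/
  ergodic : Ergodic shift P
  /-- Positive transitions: given all the other letters, each value of the letter `X_1` has
  conditional probability at least `δ`. -/
  positive : ∀ a : 𝒜, ∀ᵐ ω ∂P, δ ≤ (P⟦{ω' : ℤ → 𝒜 | ω' 1 = a} | coordSigma {i | i ≠ 1}⟧) ω
  /-- Strong (`Ψ`-) mixing. -/
  mixing : ∀ k : ℕ, k₀ ≤ k → ∀ A B : Set (ℤ → 𝒜),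
    MeasurableSet[coordSigma (Set.Iic 0)] A → MeasurableSet[coordSigma (Set.Ici (k : ℤ))] B →
    0 < P.real A → 0 < P.real B →
      1 / β ≤ P.real B / (P[|A]).real B ∧ P.real B / (P[|A]).real B ≤ β
  /-- Vectors of length `ℓ` of probability at most `2^{-ℓR}` have total probability `≤ α`. -/
  small_ell : P.real {ω | blockProb P (block ℓ ω) ≤ (2 : ℝ) ^ (-((ℓ : ℝ) * R))} ≤ α
  /-- For `n ≥ n₀`, vectors of length `n` of probability at most `2^{-nR}` have total
  probability `≤ 1/n`. -/
  small_n : ∀ n : ℕ, n₀ ≤ n →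
    P.real {ω | blockProb P (block n ω) ≤ (2 : ℝ) ^ (-((n : ℝ) * R))} ≤ 1 / (n : ℝ)

/-- The class `M` as a set of laws. -/
def memoryClass (𝒜 : Type*) [MeasurableSpace 𝒜] (k₀ : ℕ) (α β δ R : ℝ) (ℓ n₀ : ℕ) :
    Set (Measure (ℤ → 𝒜)) :=
  {P | IsVanishingMemory k₀ α β δ R ℓ n₀ P}

/-- The normalized `n`-th order Kullback-Leibler divergence (base 2). -/
def klDivergence [Fintype 𝒜] [DecidableEq 𝒜] (n : ℕ) (P Q : Measure (ℤ → 𝒜)) : ℝ :=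
  (1 / (n : ℝ)) *
    ∑ z : Fin n → 𝒜, blockProb P z * Real.logb 2 (blockProb P z / blockProb Q z)

/-! ### Classifiers and the classification error -/

/-- A classifier maps a pair `(X, Y)` of sequences of length `L` to `{0, 1}`; the value `1`
declares that the two sources differ, the value `0` that `P_L = Q_L`. -/
abbrev Classifier (𝒜 : Type*) (L : ℕ) := (Fin L → 𝒜) → (Fin L → 𝒜) → Fin 2

/-- The probability, for independent `X` with law `P` and `Y` with law `Q`, that either
`f(X, Y) = 1` although `P_L = Q_L`, or `f(X, Y) = 0` although `D_{KL,n}(P‖Q) ≥ Δ`. -/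
def pairError [Fintype 𝒜] [DecidableEq 𝒜] (n L : ℕ) (f : Classifier 𝒜 L) (Δ : ℝ)
    (P Q : Measure (ℤ → 𝒜)) : ENNReal :=
  ((marginal P L).prod (marginal Q L))
    {xy | (f xy.1 xy.2 = 1 ∧ marginal P L = marginal Q L) ∨
          (Δ ≤ klDivergence n P Q ∧ f xy.1 xy.2 = 0)}

/-- The classification error `λ_{KL,n,L,f,Δ,S}` over a collection `S` of sources. -/
def classificationError [Fintype 𝒜] [DecidableEq 𝒜] (n L : ℕ) (f : Classifier 𝒜 L) (Δ : ℝ)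
    (S : Set (Measure (ℤ → 𝒜))) : ENNReal :=
  ⨆ P ∈ S, ⨆ Q ∈ S, pairError n L f Δ P Q

end Sources

/-! ### The empirical statistics classifier -/

section ESC

variable {𝒜 : Type*}

/-- The length `N̄ = K(N + k₀) + N` of the two observed sequences. -/
def sampleLength (K k₀ N : ℕ) : ℕ := K * (N + k₀) + N

/-- `z` occurs in `x` with its first letter at the (zero-based) position `s`. -/
def OccursAt {L n : ℕ} (x : Fin L → 𝒜) (z : Fin n → 𝒜) (s : ℕ) : Prop :=
  ∀ i : Fin n, ∃ h : s + i < L, x ⟨s + i, h⟩ = z i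

/-- The recurrence time of `z` in the training part of `x`, which consists of `K` vectors of
length `N`, each followed by a guard space of `k₀` letters: the smallest `k ≥ 1` such that `z`
fills the places `k, …, k + n - 1` of one of these `K` vectors, and `⊤` if there is none. -/
def recurrenceTime (K k₀ N : ℕ) {n : ℕ} (x : Fin (sampleLength K k₀ N) → 𝒜) (z : Fin n → 𝒜) :
    ℕ∞ :=
  ⨅ k ∈ {k : ℕ | 1 ≤ k ∧ k + n ≤ N + 1 ∧ ∃ j < K, OccursAt x z (j * (N + k₀) + (k - 1))},
    (k : ℕ∞)

open Classical in
/-- The recurrence-time estimate of the probability of `z`. -/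
def empiricalProb (K k₀ N : ℕ) {n : ℕ} (x : Fin (sampleLength K k₀ N) → 𝒜) (z : Fin n → 𝒜) : ℝ :=
  if recurrenceTime K k₀ N x z ≤ (N : ℕ∞) then
    1 / ((recurrenceTime K k₀ N x z).toNat : ℝ)
  else 1 / (N : ℝ)

/-- The integer part of `n = log N̄ / (log (1/δ) + ε₀)`. The minimum with `N` (the tested vector
is a prefix of a vector of length `N`) is only effective for small `N`. -/
def escBlockLength (K k₀ : ℕ) (δ ε₀ : ℝ) (N : ℕ) : ℕ :=
  min N ⌊Real.logb 2 (sampleLength K k₀ N : ℝ) / (Real.logb 2 (1 / δ) + ε₀)⌋₊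

/-- The tested vector `Z_1^n`: the first `n` letters of the suffix of length `N` of `x`. -/
def testVector (K k₀ N : ℕ) {n : ℕ} (hn : n ≤ N) (x : Fin (sampleLength K k₀ N) → 𝒜) :
    Fin n → 𝒜 :=
  fun i => x ⟨K * (N + k₀) + i, Nat.add_lt_add_left (lt_of_lt_of_le i.isLt hn) _⟩

open Classical in
/-- The empirical statistics classifier: it declares `1` iff
`(1/n) log P̂_X(Z_1^n) - (1/n) log Q̂_Y(Z_1^n) ≥ Δ/2`. -/
def esc (K k₀ : ℕ) (δ ε₀ Δ : ℝ) (N : ℕ) : Classifier 𝒜 (sampleLength K k₀ N) := fun x y =>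
  let n := escBlockLength K k₀ δ ε₀ N
  let z : Fin n → 𝒜 := testVector K k₀ N (min_le_left _ _) x
  if Δ / 2 ≤ (1 / (n : ℝ)) * Real.logb 2 (empiricalProb K k₀ N x z)
      - (1 / (n : ℝ)) * Real.logb 2 (empiricalProb K k₀ N y z)
  then 1 else 0

end ESC

/-! ### The binary sources that make up the sub-class -/

section SubClass

/-- A set of binary `ℓ`-vectors is cyclic if it is closed under the right cyclic shift. -/
def IsCyclic {ℓ : ℕ} (B : Finset (Fin ℓ → Bool)) : Prop :=
  ∀ x ∈ B, (fun i => x ((finRotate ℓ).symm i)) ∈ B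

/-- The states of the concatenation process: `(x, v, t)` says that the present letter is at
place `t` (from `0`) of a cycle of `ν ℓ + v` letters in which `x` is repeated periodically. -/
abbrev CycleState (ℓ : ℕ) := (Fin ℓ → Bool) × ℕ × ℕ

/-- The admissible states: `x ∈ B`, `1 ≤ v ≤ ℓ`, `0 ≤ t < ν ℓ + v`. -/
def cycleStates (ν : ℕ) {ℓ : ℕ} (B : Finset (Fin ℓ → Bool)) : Finset (CycleState ℓ) :=
  (B ×ˢ (Finset.Icc 1 ℓ ×ˢ Finset.range (ν * ℓ + ℓ))).filter fun s => s.2.2 < ν * ℓ + s.2.1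

/-- The noiseless letter in a given state. -/
def cycleLetter {ℓ : ℕ} (s : CycleState ℓ) : Bool :=
  if h : 0 < ℓ then s.1 ⟨s.2.2 % ℓ, Nat.mod_lt _ h⟩ else false

/-- Transition probabilities: inside a cycle the place advances by one; after the last place of
a cycle a new cycle starts, with `x` uniform on `B` and `v` uniform on `{1, …, ℓ}`. -/
def cycleTransition (ν : ℕ) {ℓ : ℕ} (B : Finset (Fin ℓ → Bool)) (s s' : CycleState ℓ) : ℝ :=
  if s.2.2 + 1 < ν * ℓ + s.2.1 then
    (if s' = (s.1, s.2.1, s.2.2 + 1) then 1 else 0)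
  else
    (if s'.2.2 = 0 then 1 / ((B.card : ℝ) * (ℓ : ℝ)) else 0)

/-- The probability that `n + 1` consecutive letters of the dithered process are `y`: the initial
state is uniform on the admissible states (this is the stationary random phase), the states
move by `cycleTransition`, and each letter is flipped independently with probability `δ`. -/
def ditheredBlockProb (ν : ℕ) (δ : ℝ) {ℓ : ℕ} (B : Finset (Fin ℓ → Bool)) {n : ℕ}
    (y : Fin (n + 1) → Bool) : ℝ :=
  ∑ s ∈ Fintype.piFinset (fun _ : Fin (n + 1) => cycleStates ν B),
    (1 / ((cycleStates ν B).card : ℝ)) *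
      (∏ i : Fin n, cycleTransition ν B (s i.castSucc) (s i.succ)) *
      ∏ i : Fin (n + 1), (if y i = cycleLetter (s i) then 1 - δ else δ)

/-- `P` is the law of the stationary process obtained by concatenating independent cycles (a
vector drawn uniformly from `B`, repeated `ν` times and followed by its first `v` letters, with
`v` uniform on `{1, …, ℓ}`), with a random phase, and by adding modulo 2 an i.i.d. noise that
equals `1` with probability `δ`. The law is given by its finite-dimensional distributions. -/
structure IsDitheredRepetition (ν : ℕ) (δ : ℝ) {ℓ : ℕ} (B : Finset (Fin ℓ → Bool))
    (P : Measure (ℤ → Bool)) : Prop where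
  isProb : IsProbabilityMeasure P
  stationary : MeasurePreserving shift P P
  blocks : ∀ (n : ℕ) (y : Fin (n + 1) → Bool), blockProb P y = ditheredBlockProb ν δ B y

end SubClass

end ZivClassifier

end

/-! Asymptotic optimality. The tested word is short compared with the training data: every `n`-word
has probability at least `δ^n`, and `n` is chosen so that `δ^{-n} 2^{nε₀}` is at most `N̄`, a
bounded multiple of `N`. Hence a recurrence time estimates the probability of the word up to a
factor `2^{nε₀/2}`. It is rarely too short, by a union bound over the places. It is rarely too long,
because in successive slots separated by the mixing gap the word is missed with conditional
probability at most `1 - p/β` each time. The guard space decouples the training part of `X` from the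
tested word at the price of a factor `β` (`measure_inaccurate_le`). So the statistic is within `ε₀`
of the normalised log-likelihood ratio of the tested word.

It remains to see that this ratio concentrates about its mean, the divergence, uniformly over the
class. A variance of order `o(n²)` suffices, by Chebyshev's inequality. Mixing and positive
transitions make the log-likelihood ratio additive, up to a bounded error, over two blocks separated
by a gap, and mixing prevents the two blocks from being fully correlated. When `n` doubles, the
variance therefore grows at most by the factor `4 - 1/β < 4`, up to a bounded term. Iteration drives
the variance divided by `n²` to zero (`logRatioVar_recursion`, `exists_logRatioVar_le`).

Failure of essential optimality. For small `δ` the tested word has at most `ℓ/60` letters. It is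
enough to find sources whose words of that length have the same probabilities up to a factor
polynomial in `ℓ`, although the sources diverge at length `ℓ`: the two estimates then nearly agree
and the answer is `0` (`le_pairError_esc`).

The codes are built as follows. A sparse grid of places is divided into chains of step `s`, with `s`
between `ℓ/60` and `ℓ/30`. The first letter of a chain is free, and consecutive letters of a chain
differ by a prescribed signature. A window of length at most `s` meets each chain at most once, so
flipping free letters turns one signature into another without changing the number of codewords that
show a given window (`card_windowSet_le`). A window of length `2s` reveals the signature, so
different signatures force mismatches (`le_card_earlyMismatches`). The grid meets all its
translates, which makes this robust under rotations, and a Gilbert-Varshamov count gives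
exponentially many signatures (`exists_signatures`, `exists_isCodeFamily`).

The source of a code is a hidden Markov process over a doubly stochastic chain of cycles. The random
cycle length gives a Doeblin condition, hence mixing with a gap polynomial in `ℓ`; the noise gives
positive transitions. Words of small probability are controlled by the sum of the square roots of
the word probabilities, and the divergence is bounded below through the Bhattacharyya coefficient
(`klDivergence_ge`). -/

noncomputable section

namespace ZivClassifier

set_option linter.unusedSectionVars false

/-! ### Coordinate events -/

section CoordinateEvents

variable {𝒜 : Type*}

/-- Membership in `A` depends only on the letters at the places in `J`. -/
def DependsOnCoords (J : Finset ℤ) (A : Set (ℤ → 𝒜)) : Prop :=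
  ∀ ω ω' : ℤ → 𝒜, (∀ i ∈ J, ω i = ω' i) → (ω ∈ A ↔ ω' ∈ A)

/-- The event that the letters at the places in `J` are those of `y`. -/
def atom (J : Finset ℤ) (y : ℤ → 𝒜) : Set (ℤ → 𝒜) := {ω | ∀ i ∈ J, ω i = y i}

/-- The shift by `t` places. -/
def shiftBy (t : ℤ) (ω : ℤ → 𝒜) : ℤ → 𝒜 := fun i => ω (i + t)

/-- The event that the word `z` is read at the places `t, t + 1, …`. -/
def occ (t : ℤ) {n : ℕ} (z : Fin n → 𝒜) : Set (ℤ → 𝒜) := {ω | ∀ i : Fin n, ω (t + (i : ℤ)) = z i}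

lemma shiftBy_shiftBy (s t : ℤ) (ω : ℤ → 𝒜) : shiftBy s (shiftBy t ω) = shiftBy (s + t) ω := by
  funext i; simp [shiftBy, add_assoc]

lemma DependsOnCoords.mono {J J' : Finset ℤ} {A : Set (ℤ → 𝒜)} (h : DependsOnCoords J A)
    (hJ : J ⊆ J') : DependsOnCoords J' A := fun ω ω' h' => h ω ω' fun i hi => h' i (hJ hi)

lemma dependsOnCoords_atom (J : Finset ℤ) (y : ℤ → 𝒜) : DependsOnCoords J (atom J y) :=
  fun ω ω' h => forall₂_congr fun i hi => by rw [h i hi]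

lemma preimage_shiftBy_occ (s t : ℤ) {n : ℕ} (z : Fin n → 𝒜) :
    shiftBy s ⁻¹' occ t z = occ (t + s) z := by
  ext ω
  refine forall_congr' fun i => ?_
  simp only [shiftBy]
  rw [show t + (i : ℤ) + s = t + s + i by ring]

lemma setOf_block_eq {n : ℕ} (z : Fin n → 𝒜) : {ω | block n ω = z} = occ 1 z := by
  ext ω
  simp only [Set.mem_ofPred_eq, funext_iff, block, occ]
  refine forall_congr' fun i => ?_
  rw [add_comm]

lemma isSetAlgebra_dependsOnCoords (S : Set ℤ) :
    IsSetAlgebra {A : Set (ℤ → 𝒜) | ∃ J : Finset ℤ, (J : Set ℤ) ⊆ S ∧ DependsOnCoords J A} where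
  empty_mem := ⟨∅, by simp, fun _ _ _ => by simp⟩
  compl_mem := by
    rintro A ⟨J, hJ, hA⟩
    exact ⟨J, hJ, fun ω ω' h => not_congr (hA ω ω' h)⟩
  union_mem := by
    rintro A B ⟨J, hJ, hA⟩ ⟨J', hJ', hB⟩
    exact ⟨J ∪ J', by simp [hJ, hJ'], fun ω ω' h =>
      or_congr (hA.mono Finset.subset_union_left ω ω' h)
        (hB.mono Finset.subset_union_right ω ω' h)⟩

variable [MeasurableSpace 𝒜]

lemma coordSigma_mono {S T : Set ℤ} (h : S ⊆ T) : coordSigma (𝒜 := 𝒜) S ≤ coordSigma T :=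
  biSup_mono h

lemma coordSigma_le (S : Set ℤ) : coordSigma (𝒜 := 𝒜) S ≤ MeasurableSpace.pi :=
  iSup₂_le fun i _ => le_iSup (fun i : ℤ => MeasurableSpace.comap (fun ω : ℤ → 𝒜 => ω i) _) i

lemma coordSigma_univ : coordSigma (𝒜 := 𝒜) Set.univ = MeasurableSpace.pi := by
  simp [coordSigma, MeasurableSpace.pi]

lemma measurable_coord {S : Set ℤ} {i : ℤ} (hi : i ∈ S) :
    Measurable[coordSigma S] (fun ω : ℤ → 𝒜 => ω i) := by
  rw [measurable_iff_comap_le]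
  exact le_iSup₂ (f := fun (i : ℤ) (_ : i ∈ S) =>
    MeasurableSpace.comap (fun ω : ℤ → 𝒜 => ω i) inferInstance) i hi

lemma measurable_shiftBy (t : ℤ) (S : Set ℤ) :
    @Measurable _ _ (coordSigma ((fun i => i + t) '' S)) (coordSigma S)
      (shiftBy t : (ℤ → 𝒜) → ℤ → 𝒜) := by
  rw [measurable_iff_comap_le, MeasurableSpace.comap_iSup]
  refine iSup_le fun i => ?_
  rw [MeasurableSpace.comap_iSup]
  refine iSup_le fun hi => ?_
  rw [MeasurableSpace.comap_comp]
  exact le_iSup₂ (f := fun (i : ℤ) (_ : i ∈ (fun i => i + t) '' S) =>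
    MeasurableSpace.comap (fun ω : ℤ → 𝒜 => ω i) inferInstance) (i + t) ⟨i, hi, rfl⟩

lemma measurable_shiftBy' (t : ℤ) : Measurable (shiftBy t : (ℤ → 𝒜) → ℤ → 𝒜) :=
  measurable_pi_lambda _ fun _ => measurable_pi_apply _

lemma measurePreserving_shiftBy {P : Measure (ℤ → 𝒜)} (h : MeasurePreserving shift P P) (t : ℤ) :
    MeasurePreserving (shiftBy t) P P := by
  have hn : ∀ n : ℕ, MeasurePreserving (shiftBy (n : ℤ)) P P := by
    intro n
    have h1 : (shiftBy (n : ℤ) : (ℤ → 𝒜) → ℤ → 𝒜) = shift^[n] := by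
      induction n with
      | zero => funext ω i; simp [shiftBy]
      | succ n ih =>
        funext ω
        rw [Function.iterate_succ_apply', ← ih]
        funext i
        simp [shiftBy, shift, add_comm, add_left_comm]
    rw [h1]; exact h.iterate n
  obtain ⟨n, rfl | rfl⟩ := t.eq_nat_or_neg
  · exact hn n
  · refine ⟨measurable_shiftBy' _, ?_⟩
    conv_lhs => rw [← (hn n).map_eq]
    rw [Measure.map_map (measurable_shiftBy' _) (measurable_shiftBy' _)]
    have : (shiftBy (-(n : ℤ)) ∘ shiftBy (n : ℤ) : (ℤ → 𝒜) → ℤ → 𝒜) = id := by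
      funext ω i; simp [shiftBy]
    rw [this, Measure.map_id]

lemma DependsOnCoords.measurableSet [Finite 𝒜] [DiscreteMeasurableSpace 𝒜] {J : Finset ℤ}
    {A : Set (ℤ → 𝒜)} (h : DependsOnCoords J A) {S : Set ℤ} (hJ : (J : Set ℤ) ⊆ S) :
    MeasurableSet[coordSigma S] A := by
  have hA : A = (fun (ω : ℤ → 𝒜) (i : J) => ω i) ⁻¹' ((fun (ω : ℤ → 𝒜) (i : J) => ω i) '' A) := by
    refine Set.Subset.antisymm (Set.subset_preimage_image _ _) ?_
    rintro ω ⟨ω', h', he⟩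
    exact (h ω' ω fun i hi => congrFun he ⟨i, hi⟩).1 h'
  rw [hA]
  have hm : Measurable[coordSigma S] (fun (ω : ℤ → 𝒜) (i : J) => ω i) :=
    @measurable_pi_lambda _ _ _ (coordSigma S) _ _ fun i => measurable_coord (hJ i.2)
  exact hm (Set.toFinite _).measurableSet

lemma coordSigma_eq_generateFrom [Finite 𝒜] [DiscreteMeasurableSpace 𝒜] (S : Set ℤ) :
    coordSigma (𝒜 := 𝒜) S =
      MeasurableSpace.generateFrom {A | ∃ J : Finset ℤ, (J : Set ℤ) ⊆ S ∧ DependsOnCoords J A} := by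
  apply le_antisymm
  · refine iSup₂_le fun i hi => ?_
    rintro _ ⟨B, -, rfl⟩
    refine MeasurableSpace.measurableSet_generateFrom ⟨{i}, by simpa using hi, ?_⟩
    intro ω ω' h
    simp [h i (by simp)]
  · refine MeasurableSpace.generateFrom_le ?_
    rintro A ⟨J, hJ, hA⟩
    exact hA.measurableSet hJ

/-- Events on finitely many coordinates form an algebra that generates the σ-field, so they are
dense in it for the measure of the symmetric difference. This is what carries statements about words
over to infinite pasts and futures. -/
lemma exists_dependsOnCoords_approx [Finite 𝒜] [DiscreteMeasurableSpace 𝒜]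
    (P : Measure (ℤ → 𝒜)) [IsFiniteMeasure P] {S : Set ℤ} {A : Set (ℤ → 𝒜)}
    (hA : MeasurableSet[coordSigma S] A) {ε : ENNReal} (hε : 0 < ε) :
    ∃ C, (∃ J : Finset ℤ, (J : Set ℤ) ⊆ S ∧ DependsOnCoords J C) ∧ P (symmDiff C A) < ε := by
  have halg := isSetAlgebra_dependsOnCoords (𝒜 := 𝒜) S
  have hm := coordSigma_le (𝒜 := 𝒜) S
  have : IsFiniteMeasure (P.trim hm) := isFiniteMeasure_trim hm
  obtain ⟨C, hC, h⟩ := @exists_measure_symmDiff_lt_of_generateFrom_isSetRing _ (coordSigma S)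
    (P.trim hm) _ _ halg.isSetRing
    ⟨{Set.univ}, Set.countable_singleton _, by
      intro x hx
      rw [Set.mem_singleton_iff] at hx
      rw [hx]; exact halg.univ_mem, by simp⟩
    (coordSigma_eq_generateFrom S) A hA ε hε
  refine ⟨C, hC, ?_⟩
  obtain ⟨J, hJ, hCJ⟩ := hC
  rwa [trim_measurableSet_eq hm (MeasurableSet.symmDiff (hCJ.measurableSet hJ) hA)] at h

/-- An inequality between measures of finite-dimensional rectangles extends to the `σ`-field. -/
lemma measure_le_of_atoms [Finite 𝒜] [DiscreteMeasurableSpace 𝒜] (μ ν : Measure (ℤ → 𝒜))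
    [IsFiniteMeasure μ] [IsFiniteMeasure ν] (S : Set ℤ)
    (h : ∀ J : Finset ℤ, (J : Set ℤ) ⊆ S → ∃ J' : Finset ℤ, J ⊆ J' ∧ (J' : Set ℤ) ⊆ S ∧
      ∀ y : ℤ → 𝒜, μ (atom J' y) ≤ ν (atom J' y))
    {A : Set (ℤ → 𝒜)} (hA : MeasurableSet[coordSigma S] A) : μ A ≤ ν A := by
  have hC : ∀ C, (∃ J : Finset ℤ, (J : Set ℤ) ⊆ S ∧ DependsOnCoords J C) → μ C ≤ ν C := by
    rintro C ⟨J, hJ, hC⟩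
    rcases C.eq_empty_or_nonempty with rfl | ⟨ω₀, -⟩
    · simp
    have : Nonempty (ℤ → 𝒜) := ⟨ω₀⟩
    obtain ⟨J', hJJ', hJ', hle⟩ := h J hJ
    have hC' := hC.mono hJJ'
    set r : (ℤ → 𝒜) → (J' → 𝒜) := fun ω i => ω i with hr
    have hfin : (r '' C).Finite := Set.toFinite _
    choose! g hg using fun (u : J' → 𝒜) (hu : u ∈ r '' C) => hu
    -- The alphabet is finite, so `C` is a finite disjoint union of atoms over `J'`, one for each
    -- pattern that `C` shows there.
    have hU : C = ⋃ u ∈ hfin.toFinset, atom J' (g u) := by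
      ext ω
      simp only [Set.Finite.mem_toFinset, Set.mem_iUnion, exists_prop]
      constructor
      · intro hω
        refine ⟨r ω, ⟨ω, hω, rfl⟩, fun i hi => ?_⟩
        exact (congrFun (hg (r ω) ⟨ω, hω, rfl⟩).2 ⟨i, hi⟩).symm
      · rintro ⟨u, hu, hω⟩
        exact (hC' ω (g u) hω).2 (hg u hu).1
    have hdisj : Set.PairwiseDisjoint (hfin.toFinset : Set (J' → 𝒜)) fun u => atom J' (g u) := by
      intro u hu v hv huv
      refine Set.disjoint_left.2 fun ω h1 h2 => huv ?_
      have hu' := (hg u (by simpa using hu)).2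
      have hv' := (hg v (by simpa using hv)).2
      rw [← hu', ← hv']
      funext i
      exact (h1 i i.2).symm.trans (h2 i i.2)
    have hmeas : ∀ y, MeasurableSet (atom J' y : Set (ℤ → 𝒜)) := fun y =>
      coordSigma_le Set.univ _ ((dependsOnCoords_atom J' y).measurableSet (Set.subset_univ _))
    rw [hU, measure_biUnion_finset hdisj fun u _ => hmeas _,
      measure_biUnion_finset hdisj fun u _ => hmeas _]
    exact Finset.sum_le_sum fun u _ => hle _
  refine ENNReal.le_of_forall_pos_le_add fun ε hε _ => ?_
  have hε' : (0 : ENNReal) < ε := by exact_mod_cast hε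
  -- Approximation under `μ + ν` makes the error small for both measures at once.
  obtain ⟨C, hCJ, hlt⟩ := exists_dependsOnCoords_approx (μ + ν) hA hε'
  rw [Measure.add_apply] at hlt
  have h1 : μ A ≤ μ C + μ (symmDiff C A) := by
    refine (measure_mono ?_).trans (measure_union_le _ _)
    intro ω hω
    by_cases hc : ω ∈ C
    · exact Or.inl hc
    · exact Or.inr (Or.inr ⟨hω, hc⟩)
  have h2 : ν C ≤ ν A + ν (symmDiff C A) := by
    refine (measure_mono ?_).trans (measure_union_le _ _)
    intro ω hω
    by_cases hc : ω ∈ A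
    · exact Or.inl hc
    · exact Or.inr (Or.inl ⟨hω, hc⟩)
  calc μ A ≤ μ C + μ (symmDiff C A) := h1
    _ ≤ ν A + ν (symmDiff C A) + μ (symmDiff C A) := by gcongr; exact (hC C hCJ).trans h2
    _ = ν A + (μ (symmDiff C A) + ν (symmDiff C A)) := by rw [add_assoc, add_comm (ν _) (μ _)]
    _ ≤ ν A + ε := by gcongr

lemma measurableSet_occ [Finite 𝒜] [DiscreteMeasurableSpace 𝒜] (t : ℤ) {n : ℕ} (z : Fin n → 𝒜)
    {S : Set ℤ} (hS : Set.Ico t (t + n) ⊆ S) : MeasurableSet[coordSigma S] (occ t z) := by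
  refine DependsOnCoords.measurableSet (J := Finset.Ico t (t + n)) (fun ω ω' h => ?_) (by simpa)
  refine forall_congr' fun i => ?_
  rw [h _ (by simp)]

lemma measureReal_occ [Finite 𝒜] [DiscreteMeasurableSpace 𝒜] {P : Measure (ℤ → 𝒜)}
    (h : MeasurePreserving shift P P) (t : ℤ) {n : ℕ} (z : Fin n → 𝒜) :
    P.real (occ t z) = blockProb P z := by
  have h1 := (measurePreserving_shiftBy h (t - 1)).measureReal_preimage (s := occ 1 z)
    (coordSigma_le _ _ (measurableSet_occ 1 z (Set.subset_univ _))).nullMeasurableSet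
  rw [preimage_shiftBy_occ, show 1 + (t - 1) = t by ring] at h1
  rw [h1, blockProb, setOf_block_eq]

end CoordinateEvents

/-! ### Mixing and positive transitions -/

section MixingFacts

variable {𝒜 : Type*} [MeasurableSpace 𝒜]

/-- Strong mixing for all gaps of at least `κ` letters, in product form. -/
structure StronglyMixing (κ : ℕ) (β : ℝ) (P : Measure (ℤ → 𝒜)) : Prop where
  lower : ∀ s t : ℤ, s + κ ≤ t → ∀ A B : Set (ℤ → 𝒜), MeasurableSet[coordSigma (Set.Iic s)] A →
    MeasurableSet[coordSigma (Set.Ici t)] B → P.real A * P.real B ≤ β * P.real (A ∩ B)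
  upper : ∀ s t : ℤ, s + κ ≤ t → ∀ A B : Set (ℤ → 𝒜), MeasurableSet[coordSigma (Set.Iic s)] A →
    MeasurableSet[coordSigma (Set.Ici t)] B → P.real (A ∩ B) ≤ β * (P.real A * P.real B)

/-- Each letter has conditional probability at least `δ` given all the others. -/
def PositiveTransitions (δ : ℝ) (P : Measure (ℤ → 𝒜)) : Prop :=
  ∀ (t : ℤ) (a : 𝒜) (A : Set (ℤ → 𝒜)), MeasurableSet[coordSigma {i | i ≠ t}] A →
    δ * P.real A ≤ P.real (A ∩ {ω | ω t = a})

lemma image_add_const_Iic (s t : ℤ) : (fun i => i + t) '' Set.Iic s = Set.Iic (s + t) := by simp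

lemma image_add_const_Ici (s t : ℤ) : (fun i => i + t) '' Set.Ici s = Set.Ici (s + t) := by simp

lemma IsVanishingMemory.stationary {k₀ : ℕ} {α β δ R : ℝ} {ℓ n₀ : ℕ} {P : Measure (ℤ → 𝒜)}
    (h : IsVanishingMemory k₀ α β δ R ℓ n₀ P) : MeasurePreserving shift P P :=
  h.ergodic.toMeasurePreserving

/-- Stationarity moves the cut from `0` to any place, and clearing denominators gives a form that
also covers events of probability zero. -/
lemma IsVanishingMemory.stronglyMixing {k₀ : ℕ} {α β δ R : ℝ} {ℓ n₀ : ℕ} {P : Measure (ℤ → 𝒜)}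
    (hβ : 1 < β) (h : IsVanishingMemory k₀ α β δ R ℓ n₀ P) : StronglyMixing k₀ β P := by
  have := h.isProb
  have key : ∀ s t : ℤ, s + k₀ ≤ t → ∀ A B : Set (ℤ → 𝒜),
      MeasurableSet[coordSigma (Set.Iic s)] A → MeasurableSet[coordSigma (Set.Ici t)] B →
      P.real A * P.real B ≤ β * P.real (A ∩ B) ∧
        P.real (A ∩ B) ≤ β * (P.real A * P.real B) := by
    intro s t hst A B hA hB
    have hmp := measurePreserving_shiftBy h.stationary (-s)
    have hA0 := coordSigma_le _ _ hA
    have hB0 := coordSigma_le _ _ hB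
    have hA' : MeasurableSet[coordSigma (Set.Iic 0)] (shiftBy (-s) ⁻¹' A) := by
      have := measurable_shiftBy (𝒜 := 𝒜) (-s) (Set.Iic s) hA
      rwa [image_add_const_Iic, show s + -s = 0 by ring] at this
    obtain ⟨k, hk⟩ : ∃ k : ℕ, t + -s = k := ⟨(t - s).toNat, by omega⟩
    have hB' : MeasurableSet[coordSigma (Set.Ici (k : ℤ))] (shiftBy (-s) ⁻¹' B) := by
      have := measurable_shiftBy (𝒜 := 𝒜) (-s) (Set.Ici t) hB
      rwa [image_add_const_Ici, hk] at this
    have eA := hmp.measureReal_preimage hA0.nullMeasurableSet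
    have eB := hmp.measureReal_preimage hB0.nullMeasurableSet
    have eAB := hmp.measureReal_preimage (hA0.inter hB0).nullMeasurableSet
    rcases (measureReal_nonneg (μ := P) (s := A)).eq_or_lt with hA1 | hA1
    · have : P.real (A ∩ B) = 0 := le_antisymm
        ((measureReal_mono Set.inter_subset_left).trans hA1.symm.le) measureReal_nonneg
      simp [← hA1, this]
    rcases (measureReal_nonneg (μ := P) (s := B)).eq_or_lt with hB1 | hB1
    · have : P.real (A ∩ B) = 0 := le_antisymm
        ((measureReal_mono Set.inter_subset_right).trans hB1.symm.le) measureReal_nonneg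
      simp [← hB1, this]
    have hm := h.mixing k (by omega) _ _ hA' hB' (by rwa [eA]) (by rwa [eB])
    have hc : (P[|shiftBy (-s) ⁻¹' A]).real (shiftBy (-s) ⁻¹' B) =
        (P.real (shiftBy (-s) ⁻¹' A))⁻¹ * P.real (shiftBy (-s) ⁻¹' A ∩ shiftBy (-s) ⁻¹' B) := by
      simp only [Measure.real, cond_apply (coordSigma_le _ _ hA'), ENNReal.toReal_mul,
        ENNReal.toReal_inv]
    rw [hc, ← Set.preimage_inter, eA, eB, eAB] at hm
    obtain ⟨h1, h2⟩ := hm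
    have hβ0 : 0 < β := by linarith
    -- A null intersection is impossible: division by zero would give the quotient the value `0`,
    -- below its lower bound `1/β`.
    have hpos : 0 < P.real (A ∩ B) := by
      rcases (measureReal_nonneg (μ := P) (s := A ∩ B)).eq_or_lt with h0 | h0
      · rw [← h0] at h1
        simp only [mul_zero, div_zero] at h1
        exact absurd h1 (not_le.2 (by positivity))
      · exact h0
    have he : P.real B / ((P.real A)⁻¹ * P.real (A ∩ B)) =
        P.real A * P.real B / P.real (A ∩ B) := by field_simp
    rw [he] at h1 h2
    rw [div_le_iff₀ hpos] at h2
    rw [div_le_div_iff₀ hβ0 hpos] at h1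
    exact ⟨h2, by linarith⟩
  exact ⟨fun s t hst A B hA hB => (key s t hst A B hA hB).1,
    fun s t hst A B hA hB => (key s t hst A B hA hB).2⟩

/-- The pointwise bound on the conditional probability is integrated over the event, after
stationarity has moved the place `t` to the place `1`. -/
lemma IsVanishingMemory.positiveTransitions [DiscreteMeasurableSpace 𝒜] {k₀ : ℕ} {α β δ R : ℝ}
    {ℓ n₀ : ℕ} {P : Measure (ℤ → 𝒜)}
    (h : IsVanishingMemory k₀ α β δ R ℓ n₀ P) : PositiveTransitions δ P := by
  have := h.isProb
  intro t a A hA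
  have hmp := measurePreserving_shiftBy h.stationary (1 - t)
  have hE : MeasurableSet {ω : ℤ → 𝒜 | ω t = a} := 
    (measurable_pi_apply (X := fun _ : ℤ => 𝒜) t) (MeasurableSet.of_discrete (s := {a}))
  have hE1 : MeasurableSet {ω : ℤ → 𝒜 | ω 1 = a} := 
    (measurable_pi_apply (X := fun _ : ℤ => 𝒜) 1) (MeasurableSet.of_discrete (s := {a}))
  have hA0 := coordSigma_le _ _ hA
  -- The three shifts compose to the single shift by `1 - t`, as `e1` records.
  have hA' : MeasurableSet[coordSigma {i | i ≠ 1}] (shiftBy (t - 1) ⁻¹' (shiftBy (1 - t) ⁻¹' (shiftBy (1 - t) ⁻¹' A))) := by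
    have h1 := measurable_shiftBy (𝒜 := 𝒜) (1 - t) {i | i ≠ t} hA
    have h2 : (fun i => i + (1 - t)) '' {i : ℤ | i ≠ t} = {i | i ≠ 1} := by
      ext i
      simp only [Set.mem_image, Set.mem_ofPred_eq]
      constructor
      · rintro ⟨j, hj, rfl⟩; omega
      · intro hi; exact ⟨i - (1 - t), by omega, by ring⟩
    rw [h2] at h1
    convert h1 using 1
    ext ω
    simp only [Set.mem_preimage, shiftBy_shiftBy]
    rw [show 1 - t + (1 - t + (t - 1)) = 1 - t by ring]
  have e1 : shiftBy (t - 1) ⁻¹' (shiftBy (1 - t) ⁻¹' (shiftBy (1 - t) ⁻¹' A)) = shiftBy (1 - t) ⁻¹' A := by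
    ext ω
    simp only [Set.mem_preimage, shiftBy_shiftBy]
    rw [show 1 - t + (1 - t + (t - 1)) = 1 - t by ring]
  rw [e1] at hA'
  have hm := coordSigma_le (𝒜 := 𝒜) {i | i ≠ 1}
  have hi : Integrable (({ω' : ℤ → 𝒜 | ω' 1 = a}).indicator fun _ => (1 : ℝ)) P :=
    (integrable_const _).indicator hE1
  have hint := setIntegral_condExp hm hi hA'
  rw [setIntegral_indicator hE1, setIntegral_const, smul_eq_mul, mul_one] at hint
  have hge : ∫ ω in shiftBy (1 - t) ⁻¹' A, δ ∂P ≤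
      ∫ ω in shiftBy (1 - t) ⁻¹' A, (P⟦{ω' : ℤ → 𝒜 | ω' 1 = a} | coordSigma {i | i ≠ 1}⟧) ω ∂P :=
    setIntegral_mono_ae (integrable_const _).integrableOn integrable_condExp.integrableOn (h.positive a)
  rw [hint, setIntegral_const, smul_eq_mul, hmp.measureReal_preimage hA0.nullMeasurableSet] at hge
  have e2 : shiftBy (1 - t) ⁻¹' A ∩ {ω : ℤ → 𝒜 | ω 1 = a} = shiftBy (1 - t) ⁻¹' (A ∩ {ω | ω t = a}) := by
    ext ω
    simp [shiftBy]
  rw [e2, hmp.measureReal_preimage (hA0.inter hE).nullMeasurableSet] at hge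
  linarith

/-- The letters are prescribed one at a time, each at the cost of a factor `δ`, whatever the other
letters are. The event `A` may look at both sides of the window, as is needed to fill a gap between
two blocks. -/
lemma PositiveTransitions.occ_ge [Finite 𝒜] [DiscreteMeasurableSpace 𝒜] {δ : ℝ} (hδ : 0 ≤ δ)
    {P : Measure (ℤ → 𝒜)} (h : PositiveTransitions δ P) (t : ℤ) {n : ℕ} (z : Fin n → 𝒜)
    {A : Set (ℤ → 𝒜)} (hA : MeasurableSet[coordSigma (Set.Ico t (t + n))ᶜ] A) :
    δ ^ n * P.real A ≤ P.real (A ∩ occ t z) := by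
  induction n with
  | zero =>
    have : occ t z = Set.univ := Set.eq_univ_of_forall fun ω i => i.elim0
    simp [this]
  | succ n ih =>
    have h1 := ih (fun i => z i.castSucc) (coordSigma_mono
      (Set.compl_subset_compl.2 (Set.Ico_subset_Ico_right (by push_cast; omega))) _ hA)
    have h2 : occ t z = occ t (fun i => z i.castSucc) ∩ {ω | ω (t + n) = z (Fin.last n)} := by
      ext ω
      simp [occ, Fin.forall_fin_succ']
    rw [h2, ← Set.inter_assoc]
    have h3 := h (t + n) (z (Fin.last n)) (A ∩ occ t (fun i => z i.castSucc))
      (MeasurableSet.inter (coordSigma_mono (fun i hi => ?_) _ hA)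
        (measurableSet_occ t _ (fun i hi => ?_)))
    · calc δ ^ (n + 1) * P.real A = δ * (δ ^ n * P.real A) := by ring
        _ ≤ δ * P.real (A ∩ occ t (fun i => z i.castSucc)) := by gcongr
        _ ≤ _ := h3
    · simp only [Set.mem_compl_iff, Set.mem_Ico, not_and, not_lt, Set.mem_ofPred_eq] at hi ⊢
      push_cast at hi
      intro h; subst h; omega
    · simp only [Set.mem_Ico, Set.mem_ofPred_eq] at hi ⊢
      omega

lemma PositiveTransitions.blockProb_ge [Finite 𝒜] [DiscreteMeasurableSpace 𝒜] {δ : ℝ} (hδ : 0 ≤ δ)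
    {P : Measure (ℤ → 𝒜)} [IsProbabilityMeasure P] (h : PositiveTransitions δ P)
    {n : ℕ} (z : Fin n → 𝒜) : δ ^ n ≤ blockProb P z := by
  have := h.occ_ge hδ 1 z (A := Set.univ) (@MeasurableSet.univ _ (_))
  simpa [blockProb, setOf_block_eq] using this

lemma sum_blockProb [Fintype 𝒜] [DecidableEq 𝒜] [DiscreteMeasurableSpace 𝒜] (P : Measure (ℤ → 𝒜)) [IsProbabilityMeasure P]
    (n : ℕ) : ∑ z : Fin n → 𝒜, blockProb P z = 1 := by
  have hb : Measurable (block n : (ℤ → 𝒜) → Fin n → 𝒜) :=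
    measurable_pi_lambda _ fun _ => measurable_pi_apply _
  have : IsProbabilityMeasure (P.map (block n)) := Measure.isProbabilityMeasure_map hb.aemeasurable
  have h1 := sum_measureReal_singleton (μ := P.map (block n)) (Finset.univ)
  simp only [Finset.coe_univ, probReal_univ] at h1
  rw [← h1]
  refine Finset.sum_congr rfl fun z _ => ?_
  rw [map_measureReal_apply hb (MeasurableSet.singleton z)]
  rfl

end MixingFacts

/-! ### Recurrence times -/

section Recurrence

variable {𝒜 : Type*}

/-- The default value `1/N` does not exceed `c`, so a larger estimate comes from a genuine
occurrence. -/
lemma empiricalProb_eq_of_lt {K k₀ N n : ℕ} {x : Fin (sampleLength K k₀ N) → 𝒜} {z : Fin n → 𝒜}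
    {c : ℝ} (hN : 1 / (N : ℝ) ≤ c) (h : c < empiricalProb K k₀ N x z) :
    ∃ k : ℕ, 1 ≤ k ∧ k + n ≤ N + 1 ∧ c < 1 / (k : ℝ) ∧
      ∃ j < K, OccursAt x z (j * (N + k₀) + (k - 1)) := by
  unfold empiricalProb at h
  split_ifs at h with h1
  · obtain ⟨m, hm⟩ := ENat.ne_top_iff_exists.1 (ne_top_of_le_ne_top (ENat.natCast_ne_top N) h1)
    have h2 : recurrenceTime K k₀ N x z < ((m + 1 : ℕ) : ℕ∞) := by
      rw [← hm]; exact_mod_cast Nat.lt_succ_self m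
    simp only [recurrenceTime, iInf_lt_iff] at h2
    obtain ⟨k, ⟨hk1, hk2, hk3⟩, hlt⟩ := h2
    refine ⟨k, hk1, hk2, ?_, hk3⟩
    rw [← hm, ENat.toNat_natCast] at h
    refine h.trans_le ?_
    have : k ≤ m := by
      have : k < m + 1 := by exact_mod_cast hlt
      omega
    have hk1' : (0 : ℝ) < k := by exact_mod_cast hk1
    exact one_div_le_one_div_of_le hk1' (by exact_mod_cast this)
  · linarith

lemma le_empiricalProb {K k₀ N n : ℕ} {x : Fin (sampleLength K k₀ N) → 𝒜} {z : Fin n → 𝒜}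
    {k : ℕ} (hn : 1 ≤ n) (hk : 1 ≤ k) (hkn : k + n ≤ N + 1) {j : ℕ} (hj : j < K)
    (h : OccursAt x z (j * (N + k₀) + (k - 1))) :
    1 / (k : ℝ) ≤ empiricalProb K k₀ N x z := by
  have h1 : recurrenceTime K k₀ N x z ≤ k := iInf₂_le k ⟨hk, hkn, j, hj, h⟩
  have h2 : 1 ≤ recurrenceTime K k₀ N x z := le_iInf₂ fun i hi => by exact_mod_cast hi.1
  unfold empiricalProb
  -- As `n ≥ 1`, the constraint `k + n ≤ N + 1` gives `k ≤ N`, so the estimate is not the default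
  -- value.
  rw [if_pos (h1.trans (by exact_mod_cast (by omega)))]
  obtain ⟨m, hm⟩ := ENat.ne_top_iff_exists.1 (ne_top_of_le_ne_top (ENat.natCast_ne_top k) h1)
  rw [← hm] at h1 h2 ⊢
  have h1' : m ≤ k := by exact_mod_cast h1
  have h2' : 1 ≤ m := by exact_mod_cast h2
  rw [ENat.toNat_natCast]
  exact one_div_le_one_div_of_le (by exact_mod_cast h2') (by exact_mod_cast h1')

lemma empiricalProb_pos {K k₀ N n : ℕ} (hN : 1 ≤ N) (x : Fin (sampleLength K k₀ N) → 𝒜)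
    (z : Fin n → 𝒜) : 0 < empiricalProb K k₀ N x z := by
  have hN' : (0 : ℝ) < N := by exact_mod_cast hN
  unfold empiricalProb
  split_ifs with h1
  · have h2 : 1 ≤ recurrenceTime K k₀ N x z := le_iInf₂ fun i hi => by exact_mod_cast hi.1
    obtain ⟨m, hm⟩ := ENat.ne_top_iff_exists.1 (ne_top_of_le_ne_top (ENat.natCast_ne_top N) h1)
    rw [← hm] at h2 ⊢
    have h2' : 0 < m := by
      have : 1 ≤ m := by exact_mod_cast h2
      omega
    rw [ENat.toNat_natCast]
    have : (0 : ℝ) < m := by exact_mod_cast h2'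
    positivity
  · positivity

lemma occursAt_block_iff {L n : ℕ} {z : Fin n → 𝒜} {s : ℕ} (hs : s + n ≤ L) (ω : ℤ → 𝒜) :
    OccursAt (block L ω) z s ↔ ω ∈ occ ((s : ℤ) + 1) z := by
  refine forall_congr' fun i => ?_
  have hi : s + (i : ℕ) < L := by have := i.2; omega
  have e : ((s + (i : ℕ) : ℕ) : ℤ) + 1 = (s : ℤ) + 1 + (i : ℕ) := by push_cast; ring
  constructor
  · rintro ⟨h, h'⟩
    rw [← h', block, ← e]
  · intro h
    exact ⟨hi, by rw [← h, block, ← e]⟩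

lemma trainingPlace_le {K k₀ N n k j : ℕ} (hk : 1 ≤ k) (hkn : k + n ≤ N + 1) (hj : j < K) :
    j * (N + k₀) + (k - 1) + n + k₀ ≤ K * (N + k₀) := by
  have : (j + 1) * (N + k₀) ≤ K * (N + k₀) := Nat.mul_le_mul_right _ hj
  have h2 : (j + 1) * (N + k₀) = j * (N + k₀) + (N + k₀) := by ring
  omega

/-- The last guard space is not read, so the letters that matter end `k₀` places before the suffix.
This is the separation that lets mixing act between the training part and the tested word. -/
lemma empiricalProb_block_congr {K k₀ N n : ℕ} (z : Fin n → 𝒜) {ω ω' : ℤ → 𝒜}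
    (h : ∀ i ∈ Finset.Icc (1 : ℤ) (K * (N + k₀) - k₀), ω i = ω' i) :
    empiricalProb K k₀ N (block (sampleLength K k₀ N) ω) z =
      empiricalProb K k₀ N (block (sampleLength K k₀ N) ω') z := by
  have hrec : recurrenceTime K k₀ N (block (sampleLength K k₀ N) ω) z =
      recurrenceTime K k₀ N (block (sampleLength K k₀ N) ω') z := by
    unfold recurrenceTime
    have : ∀ k : ℕ, k ∈ {k : ℕ | 1 ≤ k ∧ k + n ≤ N + 1 ∧ ∃ j < K,
          OccursAt (block (sampleLength K k₀ N) ω) z (j * (N + k₀) + (k - 1))} ↔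
        k ∈ {k : ℕ | 1 ≤ k ∧ k + n ≤ N + 1 ∧ ∃ j < K,
          OccursAt (block (sampleLength K k₀ N) ω') z (j * (N + k₀) + (k - 1))} := by
      intro k
      refine and_congr_right fun hk => and_congr_right fun hkn => exists_congr fun j =>
        and_congr_right fun hj => ?_
      have hle := trainingPlace_le (k₀ := k₀) hk hkn hj
      have hL : j * (N + k₀) + (k - 1) + n ≤ sampleLength K k₀ N := by
        unfold sampleLength; omega
      rw [occursAt_block_iff hL, occursAt_block_iff hL]
      refine forall_congr' fun i => ?_
      rw [h]
      have := i.2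
      simp only [Finset.mem_Icc]
      have hle' : ((j * (N + k₀) + (k - 1) : ℕ) : ℤ) + n + k₀ ≤ K * (N + k₀) := by
        exact_mod_cast hle
      omega
    simp only [this]
  unfold empiricalProb
  rw [hrec]

lemma testVector_block {K k₀ N n : ℕ} (hn : n ≤ N) (ω : ℤ → 𝒜) (z : Fin n → 𝒜) :
    testVector K k₀ N hn (block (sampleLength K k₀ N) ω) = z ↔
      ω ∈ occ ((K : ℤ) * (N + k₀) + 1) z := by
  simp only [funext_iff, testVector, block, occ, Set.mem_ofPred_eq]
  refine forall_congr' fun i => ?_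
  push_cast
  rw [show (K : ℤ) * (N + k₀) + i + 1 = K * (N + k₀) + 1 + i by ring]

variable [Finite 𝒜] [MeasurableSpace 𝒜] [DiscreteMeasurableSpace 𝒜]

lemma measurableSet_empiricalProb (K k₀ N : ℕ) {n : ℕ} (z : Fin n → 𝒜) (T : Set ℝ) :
    MeasurableSet[coordSigma (Set.Iic ((K : ℤ) * (N + k₀) - k₀))]
      {ω : ℤ → 𝒜 | empiricalProb K k₀ N (block (sampleLength K k₀ N) ω) z ∈ T} := by
  refine DependsOnCoords.measurableSet (J := Finset.Icc (1 : ℤ) (K * (N + k₀) - k₀))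
    (fun ω ω' h => ?_) (fun i hi => ?_)
  · simp only [Set.mem_ofPred_eq, empiricalProb_block_congr z h]
  · simp only [Finset.coe_Icc, Set.mem_Icc] at hi
    exact hi.2

/-- A short recurrence time is unlikely. -/
lemma measureReal_lt_empiricalProb_le {P : Measure (ℤ → 𝒜)} [IsProbabilityMeasure P]
    (hP : MeasurePreserving shift P P) (K k₀ : ℕ) {N n : ℕ} (z : Fin n → 𝒜) {c : ℝ} (hc : 0 < c)
    (hN : 1 / (N : ℝ) ≤ c) :
    P.real {ω | c < empiricalProb K k₀ N (block (sampleLength K k₀ N) ω) z} ≤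
      K * (1 / c) * blockProb P z := by
  -- Union bound: an estimate above `c` forces an occurrence at one of the first `⌊1/c⌋` places of
  -- one of the `K` vectors.
  have hsub : {ω : ℤ → 𝒜 | c < empiricalProb K k₀ N (block (sampleLength K k₀ N) ω) z} ⊆
      ⋃ q ∈ Finset.range K ×ˢ Finset.Icc 1 ⌊1 / c⌋₊,
        occ (((q.1 * (N + k₀) + (q.2 - 1) : ℕ) : ℤ) + 1) z := by
    intro ω hω
    obtain ⟨k, hk1, hkn, hck, j, hj, ho⟩ := empiricalProb_eq_of_lt hN hω
    have hk0 : (0 : ℝ) < k := by exact_mod_cast hk1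
    rw [lt_div_iff₀ hk0, mul_comm, ← lt_div_iff₀ hc] at hck
    simp only [Set.mem_iUnion]
    refine ⟨(j, k), ?_, ?_⟩
    · simp only [Finset.mem_product, Finset.mem_range, Finset.mem_Icc]
      exact ⟨hj, hk1, Nat.le_floor hck.le⟩
    · rwa [occursAt_block_iff] at ho
      have hle := trainingPlace_le (k₀ := k₀) hk1 hkn hj
      unfold sampleLength; omega
  refine (measureReal_mono hsub (measure_ne_top _ _)).trans
    ((measureReal_biUnion_finset_le _ _).trans ?_)
  simp only [measureReal_occ hP]
  rw [Finset.sum_const, Finset.card_product, Finset.card_range, Nat.card_Icc, nsmul_eq_mul]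
  have h0 : 0 ≤ blockProb P z := measureReal_nonneg
  have hfl : ((⌊1 / c⌋₊ : ℕ) : ℝ) ≤ 1 / c := Nat.floor_le (by positivity)
  push_cast [Nat.add_sub_cancel]
  gcongr

/-- The event that the word `z` occurs in none of the first `m` slots of length `n + κ`. -/
def noOcc (κ : ℕ) {n : ℕ} (z : Fin n → 𝒜) (m : ℕ) : Set (ℤ → 𝒜) :=
  {ω | ∀ i < m, ω ∉ occ ((i : ℤ) * (n + κ) + 1) z}

lemma measurableSet_noOcc (κ : ℕ) {n : ℕ} (z : Fin n → 𝒜) (m : ℕ) :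
    MeasurableSet[coordSigma (Set.Iic ((m : ℤ) * (n + κ) - κ))] (noOcc κ z m) := by
  have : noOcc κ z m = ⋂ i ∈ Finset.range m, (occ ((i : ℤ) * (n + κ) + 1) z)ᶜ := by
    ext ω; simp [noOcc]
  rw [this]
  refine @Finset.measurableSet_biInter _ _ (_) _ _ fun i hi => ?_
  refine @MeasurableSet.compl _ _ (_) (measurableSet_occ _ _ fun j hj => ?_)
  rw [Finset.mem_range] at hi
  simp only [Set.mem_Ico, Set.mem_Iic] at hj ⊢
  have h1 : ((i : ℤ) + 1) * (n + κ) ≤ m * (n + κ) :=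
    mul_le_mul_of_nonneg_right (by exact_mod_cast hi) (by positivity)
  nlinarith [hj.2]

/-- The slots are separated by `κ` letters. By the lower mixing bound the word fills the next slot
with conditional probability at least `p/β`, given that the earlier slots miss it. -/
lemma measureReal_noOcc_le {P : Measure (ℤ → 𝒜)} [IsProbabilityMeasure P]
    (hP : MeasurePreserving shift P P) {κ : ℕ} {β : ℝ} (hβ : 1 < β) (hm : StronglyMixing κ β P)
    {n : ℕ} (z : Fin n → 𝒜) (m : ℕ) :
    P.real (noOcc κ z m) ≤ (1 - blockProb P z / β) ^ m := by
  have hp1 : blockProb P z ≤ 1 := measureReal_le_one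
  have hq : 0 ≤ 1 - blockProb P z / β := by
    have : blockProb P z / β ≤ 1 := by
      rw [div_le_one (by linarith)]; linarith
    linarith
  induction m with
  | zero => simp
  | succ m ih =>
    have hE : noOcc κ z (m + 1) = noOcc κ z m \ occ ((m : ℤ) * (n + κ) + 1) z := by
      ext ω
      simp only [noOcc, Set.mem_ofPred_eq, Set.mem_sdiff, Nat.lt_succ_iff_lt_or_eq]
      constructor
      · intro h; exact ⟨fun i hi => h i (Or.inl hi), h m (Or.inr rfl)⟩
      · rintro ⟨h1, h2⟩ i (hi | rfl)
        · exact h1 i hi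
        · exact h2
    have hocc := measurableSet_occ (𝒜 := 𝒜) ((m : ℤ) * (n + κ) + 1) z
      (S := Set.Ici ((m : ℤ) * (n + κ) + 1)) (fun j hj => hj.1)
    have hlow := hm.lower _ _ (by linarith) _ _ (measurableSet_noOcc κ z m) hocc
    rw [measureReal_occ hP] at hlow
    have hsplit := measureReal_inter_add_sdiff (μ := P) (s := noOcc κ z m)
      (coordSigma_le _ _ hocc)
    rw [hE]
    calc P.real (noOcc κ z m \ occ ((m : ℤ) * (n + κ) + 1) z)
        = P.real (noOcc κ z m) - P.real (noOcc κ z m ∩ occ ((m : ℤ) * (n + κ) + 1) z) := by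
          linarith
      _ ≤ P.real (noOcc κ z m) - P.real (noOcc κ z m) * blockProb P z / β := by
          have : P.real (noOcc κ z m) * blockProb P z / β ≤
              P.real (noOcc κ z m ∩ occ ((m : ℤ) * (n + κ) + 1) z) := by
            rw [div_le_iff₀ (by linarith)]; linarith
          linarith
      _ = (1 - blockProb P z / β) * P.real (noOcc κ z m) := by ring
      _ ≤ (1 - blockProb P z / β) * (1 - blockProb P z / β) ^ m := by gcongr
      _ = _ := by ring

/-- A long recurrence time is unlikely. -/
lemma measureReal_empiricalProb_lt_le {P : Measure (ℤ → 𝒜)} [IsProbabilityMeasure P]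
    (hP : MeasurePreserving shift P P) {κ : ℕ} {β : ℝ} (hβ : 1 < β) (hm : StronglyMixing κ β P)
    {K : ℕ} (hK : 1 ≤ K) (k₀ : ℕ) {N n : ℕ} (hn : 1 ≤ n) (z : Fin n → 𝒜) {A : ℝ} (hA : 0 < A)
    (hp : 0 < blockProb P z) (hN : A / blockProb P z ≤ N) :
    P.real {ω | empiricalProb K k₀ N (block (sampleLength K k₀ N) ω) z < blockProb P z / A} ≤
      Real.exp (1 - A / (β * (n + κ))) := by
  set p := blockProb P z with hpdef
  have hnκ : (0 : ℝ) < n + κ := by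
    have : (1 : ℝ) ≤ n := by exact_mod_cast hn
    positivity
  -- The number of slots that fit into the first `A/p` places; since `A/p ≤ N`, they all lie in the
  -- first training vector.
  set m := ⌊A / (p * (n + κ))⌋₊ with hmdef
  have hmle : (m : ℝ) * (n + κ) ≤ A / p := by
    have : (m : ℝ) ≤ A / (p * (n + κ)) := Nat.floor_le (by positivity)
    calc (m : ℝ) * (n + κ) ≤ A / (p * (n + κ)) * (n + κ) := by gcongr
      _ = A / p := by field_simp
  have hsub : {ω : ℤ → 𝒜 | empiricalProb K k₀ N (block (sampleLength K k₀ N) ω) z < p / A} ⊆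
      noOcc κ z m := by
    intro ω hω i hi ho
    have h1 : (i + 1) * (n + κ) ≤ m * (n + κ) := Nat.mul_le_mul_right _ hi
    have h2 : m * (n + κ) ≤ N := by exact_mod_cast hmle.trans hN
    have h3 : (i + 1) * (n + κ) = i * (n + κ) + n + κ := by ring
    have hle := le_empiricalProb (K := K) (k₀ := k₀) (N := N)
      (x := block (sampleLength K k₀ N) ω) (z := z) (k := i * (n + κ) + 1) hn (by omega) (by omega)
      (j := 0) (by omega) (by
        rw [occursAt_block_iff]
        · convert ho using 2
          push_cast; simp
        · have := trainingPlace_le (k := i * (n + κ) + 1) (n := n) (N := N) (k₀ := k₀) (j := 0)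
            (K := K) (by omega) (by omega) (by omega)
          unfold sampleLength; omega)
    rw [Set.mem_ofPred_eq] at hω
    have h4 : ((i * (n + κ) + 1 : ℕ) : ℝ) ≤ A / p := by
      refine le_trans ?_ hmle
      exact_mod_cast (by omega)
    have h5 : p / A ≤ 1 / ((i * (n + κ) + 1 : ℕ) : ℝ) := by
      rw [le_one_div (by positivity) (by positivity), one_div_div]
      exact h4
    linarith
  refine (measureReal_mono hsub).trans ((measureReal_noOcc_le hP hβ hm z m).trans ?_)
  have h1 : 1 - p / β ≤ Real.exp (-(p / β)) := by
    have := Real.add_one_le_exp (-(p / β)); linarith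
  have hp1 : p ≤ 1 := measureReal_le_one
  have hpβ : p / β ≤ 1 := by rw [div_le_one (by linarith)]; linarith
  calc (1 - p / β) ^ m ≤ Real.exp (-(p / β)) ^ m := by gcongr
    _ = Real.exp (-(p / β) * m) := by rw [← Real.exp_nat_mul]; ring_nf
    _ ≤ _ := by
      apply Real.exp_le_exp.2
      -- Rounding `m` down costs at most `p/β ≤ 1` in the exponent, which is the `1` in the bound.
      have h2 : A / (p * (n + κ)) < m + 1 := Nat.lt_floor_add_one _
      have h3 : p / β * (A / (p * (n + κ))) ≤ p / β * (m + 1) := by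
        have : 0 ≤ p / β := by positivity
        gcongr
      have h4 : p / β * (A / (p * (n + κ))) = A / (β * (n + κ)) := by
        field_simp
      linarith

/-- The recurrence-time estimates of the probabilities of the tested vector are accurate up to
the factor `A`, with a small error probability. -/
lemma measure_inaccurate_le {P Q : Measure (ℤ → 𝒜)} [IsProbabilityMeasure P]
    [IsProbabilityMeasure Q] (hP : MeasurePreserving shift P P) (hQ : MeasurePreserving shift Q Q)
    {κ k₀ : ℕ} (hκ : κ ≤ k₀) {β : ℝ} (hβ : 1 < β) (hPm : StronglyMixing κ β P)
    (hQm : StronglyMixing κ β Q) {δ : ℝ} (hδ : 0 < δ) {n : ℕ}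
    (hPp : ∀ z : Fin n → 𝒜, δ ^ n ≤ blockProb P z) (hQp : ∀ z : Fin n → 𝒜, δ ^ n ≤ blockProb Q z)
    {K : ℕ} (hK : 1 ≤ K) {N : ℕ} (hn : 1 ≤ n) (hnN : n ≤ N) {A : ℝ} (hA : 1 ≤ A)
    (hN : A / δ ^ n ≤ N) :
    (P.prod Q) {ωω | ¬ (
      let z := testVector K k₀ N hnN (block (sampleLength K k₀ N) ωω.1)
      let x := empiricalProb K k₀ N (block (sampleLength K k₀ N) ωω.1) z
      let y := empiricalProb K k₀ N (block (sampleLength K k₀ N) ωω.2) z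
      blockProb P z / A ≤ x ∧ x ≤ blockProb P z * A ∧
      blockProb Q z / A ≤ y ∧ y ≤ blockProb Q z * A)} ≤
      ENNReal.ofReal ((β + 1) * (Real.exp (1 - A / (β * (n + κ))) + K / A)) := by
  classical
  have : Fintype 𝒜 := Fintype.ofFinite 𝒜
  set r := Real.exp (1 - A / (β * (n + κ))) + K / A with hr
  have hr0 : 0 ≤ r := by positivity
  have hA0 : 0 < A := by linarith
  have hδn : 0 < δ ^ n := by positivity
  have hN1 : (1 : ℝ) ≤ N := by
    have : 1 ≤ N := hn.trans hnN
    exact_mod_cast this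
  set T : Measure (ℤ → 𝒜) → (Fin n → 𝒜) → Set (ℤ → 𝒜) := fun P z =>
    {ω | empiricalProb K k₀ N (block (sampleLength K k₀ N) ω) z ∈
      {v | ¬ (blockProb P z / A ≤ v ∧ v ≤ blockProb P z * A)}} with hT
  have hTm : ∀ P z, MeasurableSet[coordSigma (Set.Iic ((K : ℤ) * (N + k₀) - k₀))] (T P z) :=
    fun P z => measurableSet_empiricalProb K k₀ N z _
  have hTle : ∀ (P : Measure (ℤ → 𝒜)) [IsProbabilityMeasure P], MeasurePreserving shift P P →
      StronglyMixing κ β P → (∀ z : Fin n → 𝒜, δ ^ n ≤ blockProb P z) →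
      ∀ z, P.real (T P z) ≤ r := by
    intro P _ hP hPm hPp z
    have hp : 0 < blockProb P z := hδn.trans_le (hPp z)
    have hsub : T P z ⊆
        {ω | empiricalProb K k₀ N (block (sampleLength K k₀ N) ω) z < blockProb P z / A} ∪
        {ω | blockProb P z * A < empiricalProb K k₀ N (block (sampleLength K k₀ N) ω) z} := by
      intro ω hω
      simp only [hT, Set.mem_ofPred_eq, not_and_or, not_le] at hω
      exact hω
    have hAN : A / blockProb P z ≤ N :=
      (div_le_div_of_nonneg_left hA0.le hδn (hPp z)).trans hN
    refine (measureReal_mono hsub).trans ((measureReal_union_le _ _).trans (add_le_add ?_ ?_))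
    · exact measureReal_empiricalProb_lt_le hP hβ hPm hK k₀ hn z hA0 hp hAN
    · refine (measureReal_lt_empiricalProb_le hP K k₀ z (c := blockProb P z * A) (by positivity)
        ?_).trans (le_of_eq (by field_simp))
      rw [div_le_iff₀ (by linarith)]
      rw [div_le_iff₀ hp] at hAN
      nlinarith
  set o : (Fin n → 𝒜) → Set (ℤ → 𝒜) := fun z => occ ((K : ℤ) * (N + k₀) + 1) z with ho
  have hbound : ∀ z, (P.prod Q) ((T P z ∩ o z) ×ˢ Set.univ ∪ o z ×ˢ T Q z) ≤
      ENNReal.ofReal (blockProb P z * ((β + 1) * r)) := by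
    intro z
    refine (measure_union_le _ _).trans ?_
    rw [Measure.prod_prod, Measure.prod_prod, measure_univ, mul_one, ← ofReal_measureReal,
      ← ofReal_measureReal (s := o z), ← ofReal_measureReal (μ := Q),
      ← ENNReal.ofReal_mul measureReal_nonneg,
      ← ENNReal.ofReal_add measureReal_nonneg (mul_nonneg measureReal_nonneg measureReal_nonneg)]
    refine ENNReal.ofReal_le_ofReal ?_
    -- `X` supplies both the tested word and training data, and separating the two by mixing costs a
    -- factor `β`. The independent `Y` costs nothing more, whence `β + 1` in total.
    have h1 := hPm.upper ((K : ℤ) * (N + k₀) - k₀) ((K : ℤ) * (N + k₀) + 1)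
      (by have : (κ : ℤ) ≤ k₀ := by exact_mod_cast hκ
          linarith) (T P z) (o z) (hTm P z)
      (measurableSet_occ _ _ fun j hj => hj.1)
    have h2 := hTle P hP hPm hPp z
    have h3 := hTle Q hQ hQm hQp z
    rw [measureReal_occ hP] at h1
    rw [measureReal_occ hP]
    have h0 : 0 ≤ blockProb P z := measureReal_nonneg
    calc P.real (T P z ∩ o z) + blockProb P z * Q.real (T Q z)
        ≤ β * (r * blockProb P z) + blockProb P z * r := by
          refine add_le_add (h1.trans ?_) ?_ <;> gcongr
      _ = _ := by ring
  have hsub : {ωω : (ℤ → 𝒜) × (ℤ → 𝒜) | ¬ (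
      let z := testVector K k₀ N hnN (block (sampleLength K k₀ N) ωω.1)
      let x := empiricalProb K k₀ N (block (sampleLength K k₀ N) ωω.1) z
      let y := empiricalProb K k₀ N (block (sampleLength K k₀ N) ωω.2) z
      blockProb P z / A ≤ x ∧ x ≤ blockProb P z * A ∧
      blockProb Q z / A ≤ y ∧ y ≤ blockProb Q z * A)} ⊆
      ⋃ z ∈ (Finset.univ : Finset (Fin n → 𝒜)),
        ((T P z ∩ o z) ×ˢ Set.univ ∪ o z ×ˢ T Q z) := by
    rintro ⟨ω, ω'⟩ h
    simp only [Set.mem_ofPred_eq] at h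
    have hz := (testVector_block (k₀ := k₀) (K := K) hnN ω _).1 rfl
    simp only [Set.mem_iUnion, Finset.mem_univ, exists_prop, true_and]
    refine ⟨testVector K k₀ N hnN (block (sampleLength K k₀ N) ω), ?_⟩
    simp only [hT, Set.mem_union, Set.mem_prod, Set.mem_inter_iff, Set.mem_univ, and_true,
      Set.mem_ofPred_eq]
    tauto
  refine (measure_mono hsub).trans ((measure_biUnion_finset_le _ _).trans ?_)
  refine (Finset.sum_le_sum fun z _ => hbound z).trans ?_
  rw [← ENNReal.ofReal_sum_of_nonneg fun z _ => ?_]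
  · rw [← Finset.sum_mul, sum_blockProb, one_mul]
  · have : 0 ≤ blockProb P z := measureReal_nonneg
    positivity

end Recurrence

/-! ### Concentration of the log-likelihood ratio -/

section Concentration

variable {𝒜 : Type*} [Fintype 𝒜] [MeasurableSpace 𝒜]

/-- The properties of the sources of the class that enter the analysis of the classifier. -/
structure IsRegular (κ : ℕ) (β δ : ℝ) (P : Measure (ℤ → 𝒜)) : Prop where
  isProb : IsProbabilityMeasure P
  stationary : MeasurePreserving shift P P
  mixing : StronglyMixing κ β P
  positive : PositiveTransitions δ P

/-- The log-likelihood ratio of a word. -/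
def logRatio (P Q : Measure (ℤ → 𝒜)) {n : ℕ} (z : Fin n → 𝒜) : ℝ :=
  Real.logb 2 (blockProb P z / blockProb Q z)

variable [DecidableEq 𝒜]

/-- The mean of the log-likelihood ratio. -/
def logRatioMean (P Q : Measure (ℤ → 𝒜)) (n : ℕ) : ℝ :=
  ∑ z : Fin n → 𝒜, blockProb P z * logRatio P Q z

/-- The variance of the log-likelihood ratio. -/
def logRatioVar (P Q : Measure (ℤ → 𝒜)) (n : ℕ) : ℝ :=
  ∑ z : Fin n → 𝒜, blockProb P z * (logRatio P Q z - logRatioMean P Q n) ^ 2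

lemma integral_comp_eq_sum {Ω ι : Type*} [MeasurableSpace Ω] [Fintype ι] [MeasurableSpace ι]
    [DiscreteMeasurableSpace ι] (P : Measure Ω) [IsFiniteMeasure P] {X : Ω → ι}
    (hX : Measurable X) (F : ι → ℝ) :
    ∫ ω, F (X ω) ∂P = ∑ i, P.real {ω | X ω = i} * F i := by
  rw [← integral_map (φ := X) (f := F) hX.aemeasurable
    (Measurable.of_discrete).aestronglyMeasurable, integral_fintype Integrable.of_finite]
  refine Finset.sum_congr rfl fun i _ => ?_
  rw [map_measureReal_apply hX (MeasurableSet.singleton i), smul_eq_mul]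
  rfl

variable [DiscreteMeasurableSpace 𝒜]

lemma measurable_block (n : ℕ) : Measurable (block n : (ℤ → 𝒜) → Fin n → 𝒜) :=
  measurable_pi_lambda _ fun _ => measurable_pi_apply _

lemma integral_block (P : Measure (ℤ → 𝒜)) [IsFiniteMeasure P] {n : ℕ} (F : (Fin n → 𝒜) → ℝ) :
    ∫ ω, F (block n ω) ∂P = ∑ z, blockProb P z * F z :=
  integral_comp_eq_sum P (measurable_block n) F

/-- The joint probability of two words, the second at distance `s` from the first. -/
def jointProb (P : Measure (ℤ → 𝒜)) (s : ℤ) {m : ℕ} (a b : Fin m → 𝒜) : ℝ :=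
  P.real (occ 1 a ∩ occ (1 + s) b)

lemma setOf_block_shiftBy_eq {m : ℕ} (s : ℤ) (b : Fin m → 𝒜) :
    {ω : ℤ → 𝒜 | block m (shiftBy s ω) = b} = occ (1 + s) b := by
  rw [← preimage_shiftBy_occ, ← setOf_block_eq]; rfl

lemma integral_joint (P : Measure (ℤ → 𝒜)) [IsFiniteMeasure P] {m : ℕ} (s : ℤ)
    (F : (Fin m → 𝒜) → (Fin m → 𝒜) → ℝ) :
    ∫ ω, F (block m ω) (block m (shiftBy s ω)) ∂P = ∑ a, ∑ b, jointProb P s a b * F a b := by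
  have hX : Measurable fun ω : ℤ → 𝒜 => (block m ω, block m (shiftBy s ω)) :=
    (measurable_block m).prodMk ((measurable_block m).comp (measurable_shiftBy' s))
  rw [integral_comp_eq_sum P hX (fun p => F p.1 p.2), Fintype.sum_prod_type]
  refine Finset.sum_congr rfl fun a _ => Finset.sum_congr rfl fun b _ => ?_
  have : {ω : ℤ → 𝒜 | (block m ω, block m (shiftBy s ω)) = (a, b)} = occ 1 a ∩ occ (1 + s) b := by
    rw [← setOf_block_eq, ← setOf_block_shiftBy_eq]
    ext ω; simp
  rw [this, jointProb]

lemma IsRegular.blockProb_pos {κ : ℕ} {β δ : ℝ} {P : Measure (ℤ → 𝒜)} (h : IsRegular κ β δ P)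
    (hδ : 0 < δ) {n : ℕ} (z : Fin n → 𝒜) : 0 < blockProb P z := by
  have := h.isProb
  exact (pow_pos hδ n).trans_le (h.positive.blockProb_ge hδ.le z)

lemma IsRegular.le_one {κ : ℕ} {β δ : ℝ} {P : Measure (ℤ → 𝒜)} (h : IsRegular κ β δ P)
    (hδ : 0 < δ) : δ ≤ 1 := by
  have := h.isProb
  obtain ⟨ω⟩ : Nonempty (ℤ → 𝒜) := nonempty_of_isProbabilityMeasure P
  have h1 := h.positive.blockProb_ge hδ.le (n := 1) (fun _ => ω 0)
  rw [pow_one] at h1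
  exact h1.trans measureReal_le_one

/-- Mixing makes centered functions of two separated blocks less than fully correlated. -/
lemma IsRegular.sum_joint_sq_le {κ : ℕ} {β δ : ℝ} {P : Measure (ℤ → 𝒜)} (h : IsRegular κ β δ P)
    (hβ : 1 < β) {m g : ℕ} (hg : κ ≤ g) (u : (Fin m → 𝒜) → ℝ) (hu : ∑ a, blockProb P a * u a = 0) :
    ∑ a, ∑ b, jointProb P ((m : ℤ) + g) a b * (u a + u b) ^ 2 ≤
      (4 - 2 / β) * ∑ a, blockProb P a * u a ^ 2 := by
  have := h.isProb
  set S := ∑ a, blockProb P a * u a ^ 2 with hS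
  have hl : ∑ a, ∑ b, jointProb P ((m : ℤ) + g) a b * u a ^ 2 = S := by
    rw [← integral_joint P _ fun a _ => u a ^ 2, integral_block P fun a => u a ^ 2]
  have hr : ∑ a, ∑ b, jointProb P ((m : ℤ) + g) a b * u b ^ 2 = S := by
    rw [← integral_joint P _ fun _ b => u b ^ 2, hS, ← integral_block P fun a => u a ^ 2]
    have hmp := measurePreserving_shiftBy h.stationary ((m : ℤ) + g)
    conv_rhs => rw [← hmp.map_eq]
    rw [integral_map hmp.measurable.aemeasurable]
    exact ((Measurable.of_discrete (f := fun a : Fin m → 𝒜 => u a ^ 2)).comp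
      (measurable_block m)).aestronglyMeasurable
  have hpl : ∑ a, ∑ b : Fin m → 𝒜, blockProb P a * blockProb P b * u a ^ 2 = S := by
    rw [hS]
    refine Finset.sum_congr rfl fun a _ => ?_
    have := sum_blockProb P m
    calc ∑ b : Fin m → 𝒜, blockProb P a * blockProb P b * u a ^ 2
        = (blockProb P a * u a ^ 2) * ∑ b : Fin m → 𝒜, blockProb P b := by
          rw [Finset.mul_sum]; exact Finset.sum_congr rfl fun b _ => by ring
      _ = _ := by rw [this, mul_one]
  have hpr : ∑ a : Fin m → 𝒜, ∑ b, blockProb P a * blockProb P b * u b ^ 2 = S := by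
    rw [Finset.sum_comm, ← hpl]
    exact Finset.sum_congr rfl fun a _ => Finset.sum_congr rfl fun b _ => by ring
  have hpc : ∑ a, ∑ b, blockProb P a * blockProb P b * (u a * u b) = 0 := by
    calc ∑ a, ∑ b, blockProb P a * blockProb P b * (u a * u b)
        = (∑ a, blockProb P a * u a) * ∑ b, blockProb P b * u b := by
          rw [Finset.sum_mul_sum]
          exact Finset.sum_congr rfl fun a _ => Finset.sum_congr rfl fun b _ => by ring
      _ = 0 := by rw [hu, zero_mul]
  -- By the lower mixing bound, the joint law minus the fraction `1/β` of the product law is still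
  -- nonnegative. Integrating `(u a - u b)²` against it yields the gain `2/β`, since the cross term
  -- of a centred `u` vanishes under the product law.
  have hJ : ∀ a b : Fin m → 𝒜, 0 ≤ jointProb P ((m : ℤ) + g) a b -
      blockProb P a * blockProb P b / β := by
    intro a b
    have := h.mixing.lower (m : ℤ) (1 + ((m : ℤ) + g)) (by
      have : (κ : ℤ) ≤ g := by exact_mod_cast hg
      omega) (occ 1 a) (occ (1 + ((m : ℤ) + g)) b)
      (measurableSet_occ _ _ fun i hi => by simp only [Set.mem_Ico, Set.mem_Iic] at hi ⊢; omega)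
      (measurableSet_occ _ _ fun i hi => hi.1)
    rw [measureReal_occ h.stationary, measureReal_occ h.stationary] at this
    rw [sub_nonneg, div_le_iff₀ (by linarith), mul_comm]
    rw [jointProb, mul_comm]
    linarith
  have hcov : ∑ a, ∑ b, (jointProb P ((m : ℤ) + g) a b - blockProb P a * blockProb P b / β) *
      (u a - u b) ^ 2 ≥ 0 :=
    Finset.sum_nonneg fun a _ => Finset.sum_nonneg fun b _ => mul_nonneg (hJ a b) (sq_nonneg _)
  have hexp : ∑ a, ∑ b, (jointProb P ((m : ℤ) + g) a b - blockProb P a * blockProb P b / β) *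
      (u a - u b) ^ 2 =
      (2 * (∑ a, ∑ b, jointProb P ((m : ℤ) + g) a b * u a ^ 2) +
        2 * ∑ a, ∑ b, jointProb P ((m : ℤ) + g) a b * u b ^ 2) -
        ∑ a, ∑ b, jointProb P ((m : ℤ) + g) a b * (u a + u b) ^ 2 -
        (1 / β) * ((∑ a, ∑ b : Fin m → 𝒜, blockProb P a * blockProb P b * u a ^ 2) +
          (∑ a : Fin m → 𝒜, ∑ b, blockProb P a * blockProb P b * u b ^ 2) -
          2 * ∑ a, ∑ b, blockProb P a * blockProb P b * (u a * u b)) := by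
    simp only [Finset.mul_sum, ← Finset.sum_add_distrib, ← Finset.sum_sub_distrib]
    exact Finset.sum_congr rfl fun a _ => Finset.sum_congr rfl fun b _ => by ring
  rw [hl, hr, hpl, hpr, hpc] at hexp
  rw [hexp] at hcov
  have : (4 - 2 / β) * S = 2 * S + 2 * S - 1 / β * (S + S - 2 * 0) := by ring
  rw [this]
  linarith

/-- Near-additivity of the logarithm of the probability of a word. -/
lemma IsRegular.abs_logb_sub_le {κ : ℕ} {β δ : ℝ} {P : Measure (ℤ → 𝒜)} (h : IsRegular κ β δ P)
    (hβ : 1 < β) (hδ : 0 < δ) {m g : ℕ} (hg : κ ≤ g) (ω : ℤ → 𝒜) :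
    |Real.logb 2 (blockProb P (block (m + g + m) ω)) - Real.logb 2 (blockProb P (block m ω)) -
      Real.logb 2 (blockProb P (block m (shiftBy ((m : ℤ) + g) ω)))| ≤
      Real.logb 2 β + g * Real.logb 2 (1 / δ) := by
  have := h.isProb
  set z := block (m + g + m) ω with hz
  set a := block m ω with ha
  set b := block m (shiftBy ((m : ℤ) + g) ω) with hb
  set c : Fin g → 𝒜 := block g (shiftBy m ω) with hc
  have hocc : occ 1 z = (occ 1 a ∩ occ (1 + ((m : ℤ) + g)) b) ∩ occ (1 + (m : ℤ)) c := by
    ext ω'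
    simp only [occ, Set.mem_ofPred_eq, Set.mem_inter_iff, hz, ha, hb, hc, block, shiftBy]
    constructor
    · intro H
      refine ⟨⟨fun i => ?_, fun i => ?_⟩, fun i => ?_⟩
      · exact H ⟨i, by omega⟩
      · have := H ⟨m + g + i, by omega⟩
        push_cast at this
        convert this using 2 <;> ring
      · have := H ⟨m + i, by omega⟩
        push_cast at this
        convert this using 2 <;> ring
    · rintro ⟨⟨h1, h2⟩, h3⟩ i
      by_cases hi : (i : ℕ) < m
      · exact h1 ⟨i, hi⟩
      by_cases hi2 : (i : ℕ) < m + g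
      · have := h3 ⟨i - m, by omega⟩
        simp only at this
        convert this using 2 <;> omega
      · have := h2 ⟨i - (m + g), by omega⟩
        simp only at this
        convert this using 2 <;> omega
  have hma : MeasurableSet[coordSigma (Set.Iic (m : ℤ))] (occ 1 a) :=
    measurableSet_occ _ _ fun i hi => by simp only [Set.mem_Ico, Set.mem_Iic] at hi ⊢; omega
  have hmb : MeasurableSet[coordSigma (Set.Ici (1 + ((m : ℤ) + g)))] (occ (1 + ((m : ℤ) + g)) b) :=
    measurableSet_occ _ _ fun i hi => hi.1
  have hgap : (m : ℤ) + κ ≤ 1 + ((m : ℤ) + g) := by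
    have : (κ : ℤ) ≤ g := by exact_mod_cast hg
    omega
  have hlow := h.mixing.lower _ _ hgap _ _ hma hmb
  have hup := h.mixing.upper _ _ hgap _ _ hma hmb
  rw [measureReal_occ h.stationary, measureReal_occ h.stationary] at hlow hup
  -- The lower bound for the whole word: prescribing the gap letters costs at most a factor `δ^g`.
  -- For the upper bound the gap letters are dropped.
  have hfill := h.positive.occ_ge hδ.le (1 + (m : ℤ)) c
    (A := occ 1 a ∩ occ (1 + ((m : ℤ) + g)) b)
    (MeasurableSet.inter
      (measurableSet_occ _ _ fun i hi => by
        simp only [Set.mem_Ico, Set.mem_compl_iff] at hi ⊢; omega)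
      (measurableSet_occ _ _ fun i hi => by
        simp only [Set.mem_Ico, Set.mem_compl_iff] at hi ⊢; omega))
  rw [← hocc, measureReal_occ h.stationary] at hfill
  have hzle : blockProb P z ≤ P.real (occ 1 a ∩ occ (1 + ((m : ℤ) + g)) b) := by
    rw [← measureReal_occ h.stationary 1 z, hocc]
    exact measureReal_mono Set.inter_subset_left
  have hpa := h.blockProb_pos hδ a
  have hpb := h.blockProb_pos hδ b
  have hpz := h.blockProb_pos hδ z
  have hβ0 : 0 < β := by linarith
  have hδ1 := h.le_one hδ
  have hlβ : 0 ≤ Real.logb 2 β := Real.logb_nonneg (by norm_num) hβ.le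
  have hlδ : 0 ≤ Real.logb 2 (1 / δ) :=
    Real.logb_nonneg (by norm_num) (by rw [le_div_iff₀ hδ]; linarith)
  rw [abs_le]
  constructor
  · have h1 : blockProb P a * blockProb P b ≤ β * (1 / δ) ^ g * blockProb P z := by
      have hδg : 0 < δ ^ g := by positivity
      rw [one_div, inv_pow]
      calc blockProb P a * blockProb P b ≤ β * P.real (occ 1 a ∩ occ (1 + ((m : ℤ) + g)) b) := hlow
        _ = β * (δ ^ g)⁻¹ * (δ ^ g * P.real (occ 1 a ∩ occ (1 + ((m : ℤ) + g)) b)) := by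
          field_simp
        _ ≤ β * (δ ^ g)⁻¹ * blockProb P z := by gcongr
    have h2 := Real.logb_le_logb_of_le (b := 2) (by norm_num) (by positivity) h1
    rw [Real.logb_mul hpa.ne' hpb.ne', Real.logb_mul (by positivity) hpz.ne',
      Real.logb_mul hβ0.ne' (by positivity), Real.logb_pow] at h2
    linarith
  · have h1 : blockProb P z ≤ β * (blockProb P a * blockProb P b) := hzle.trans hup
    have h2 := Real.logb_le_logb_of_le (b := 2) (by norm_num) hpz h1
    rw [Real.logb_mul hβ0.ne' (by positivity), Real.logb_mul hpa.ne' hpb.ne'] at h2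
    have : 0 ≤ (g : ℝ) * Real.logb 2 (1 / δ) := by positivity
    linarith

lemma sq_add_le_weighted {x y l : ℝ} (hl : 0 < l) :
    (x + y) ^ 2 ≤ (1 + l) * x ^ 2 + (1 + 1 / l) * y ^ 2 := by
  have h : (1 + l) * x ^ 2 + (1 + 1 / l) * y ^ 2 - (x + y) ^ 2 = (l * x - y) ^ 2 / l := by
    field_simp; ring
  have : 0 ≤ (l * x - y) ^ 2 / l := by positivity
  linarith

/-- The mean minimises the mean square deviation, so any convenient centre may replace it. -/
lemma logRatioVar_le (P Q : Measure (ℤ → 𝒜)) [IsProbabilityMeasure P] (n : ℕ) (c : ℝ) :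
    logRatioVar P Q n ≤ ∑ z : Fin n → 𝒜, blockProb P z * (logRatio P Q z - c) ^ 2 := by
  have h1 := sum_blockProb P n
  have h2 : ∑ z : Fin n → 𝒜, blockProb P z * (logRatio P Q z - c) ^ 2 - logRatioVar P Q n =
      (logRatioMean P Q n - c) ^ 2 := by
    have e : ∀ z : Fin n → 𝒜, blockProb P z * (logRatio P Q z - c) ^ 2 -
        blockProb P z * (logRatio P Q z - logRatioMean P Q n) ^ 2 =
        2 * (logRatioMean P Q n - c) * (blockProb P z * logRatio P Q z) +
        (c ^ 2 - logRatioMean P Q n ^ 2) * blockProb P z := fun z => by ring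
    rw [logRatioVar, ← Finset.sum_sub_distrib, Finset.sum_congr rfl fun z _ => e z,
      Finset.sum_add_distrib, ← Finset.mul_sum, ← Finset.mul_sum, h1]
    rw [show ∑ z : Fin n → 𝒜, blockProb P z * logRatio P Q z = logRatioMean P Q n from rfl]
    ring
  have : 0 ≤ (logRatioMean P Q n - c) ^ 2 := sq_nonneg _
  linarith

/-- The ratio of the long word is the sum of those of its two end blocks, up to a bounded error. Two
fully correlated blocks would give the factor `4`; lack of full correlation keeps it strictly below
`4`, which is what makes the variance `o(n²)`. -/
lemma logRatioVar_recursion {κ : ℕ} {β δ : ℝ} (hβ : 1 < β) (hδ : 0 < δ)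
    {P Q : Measure (ℤ → 𝒜)} (hP : IsRegular κ β δ P) (hQ : IsRegular κ β δ Q) {m g : ℕ}
    (hg : κ ≤ g) :
    logRatioVar P Q (m + g + m) ≤ (4 - 1 / β) * logRatioVar P Q m +
      (4 * β - 1) * (2 * (Real.logb 2 β + g * Real.logb 2 (1 / δ))) ^ 2 := by
  have := hP.isProb
  set c := Real.logb 2 β + g * Real.logb 2 (1 / δ) with hc
  set μ := logRatioMean P Q m with hμ
  set u : (Fin m → 𝒜) → ℝ := fun a => logRatio P Q a - μ with hu
  -- Chosen so that `(1 + l)(4 - 2/β) = 4 - 1/β`: half of the gain from mixing pays for the cross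
  -- term with the error of additivity.
  set l : ℝ := 1 / (4 * β - 2) with hl
  have hb : 0 < 4 * β - 2 := by linarith
  have hl0 : 0 < l := by positivity
  have hu0 : ∑ a, blockProb P a * u a = 0 := by
    simp only [hu, mul_sub, Finset.sum_sub_distrib, ← Finset.sum_mul]
    rw [sum_blockProb, one_mul, hμ]
    simp [logRatioMean]
  have hmain := hP.sum_joint_sq_le hβ hg u hu0
  have hpt : ∀ ω : ℤ → 𝒜, (logRatio P Q (block (m + g + m) ω) - 2 * μ) ^ 2 ≤
      (1 + l) * (u (block m ω) + u (block m (shiftBy ((m : ℤ) + g) ω))) ^ 2 +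
        (1 + 1 / l) * (2 * c) ^ 2 := by
    intro ω
    have h1 := hP.abs_logb_sub_le hβ hδ hg (m := m) ω
    have h2 := hQ.abs_logb_sub_le hβ hδ hg (m := m) ω
    have e : ∀ {n : ℕ} (z : Fin n → 𝒜), logRatio P Q z =
        Real.logb 2 (blockProb P z) - Real.logb 2 (blockProb Q z) := fun z =>
      Real.logb_div (hP.blockProb_pos hδ z).ne' (hQ.blockProb_pos hδ z).ne'
    set d := logRatio P Q (block (m + g + m) ω) - logRatio P Q (block m ω) -
      logRatio P Q (block m (shiftBy ((m : ℤ) + g) ω)) with hd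
    have hdc : |d| ≤ 2 * c := by
      rw [hd, e, e, e]
      rw [abs_le] at *
      constructor <;> linarith [h1.1, h1.2, h2.1, h2.2]
    have h3 := sq_add_le_weighted (x := u (block m ω) + u (block m (shiftBy ((m : ℤ) + g) ω)))
      (y := d) hl0
    have h4 : d ^ 2 ≤ (2 * c) ^ 2 := sq_le_sq' (abs_le.1 hdc).1 (abs_le.1 hdc).2
    have h5 : logRatio P Q (block (m + g + m) ω) - 2 * μ =
        u (block m ω) + u (block m (shiftBy ((m : ℤ) + g) ω)) + d := by
      simp only [hu, hd]; ring
    rw [h5]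
    refine h3.trans ?_
    gcongr
  have hint : ∑ z : Fin (m + g + m) → 𝒜, blockProb P z * (logRatio P Q z - 2 * μ) ^ 2 ≤
      (1 + l) * (∑ a, ∑ b, jointProb P ((m : ℤ) + g) a b * (u a + u b) ^ 2) +
        (1 + 1 / l) * (2 * c) ^ 2 := by
    rw [← integral_block P fun z : Fin (m + g + m) → 𝒜 => (logRatio P Q z - 2 * μ) ^ 2,
      ← integral_joint P _ fun a b => (u a + u b) ^ 2]
    have hmeas : Measurable fun ω : ℤ → 𝒜 => (block m ω, block m (shiftBy ((m : ℤ) + g) ω)) :=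
      (measurable_block m).prodMk ((measurable_block m).comp (measurable_shiftBy' _))
    have hi1 : Integrable (fun ω : ℤ → 𝒜 =>
        (u (block m ω) + u (block m (shiftBy ((m : ℤ) + g) ω))) ^ 2) P :=
      (Integrable.of_finite (μ := P.map fun ω : ℤ → 𝒜 =>
        (block m ω, block m (shiftBy ((m : ℤ) + g) ω)))
        (f := fun p => (u p.1 + u p.2) ^ 2)).comp_measurable hmeas
    have hi2 : Integrable (fun ω : ℤ → 𝒜 =>
        (logRatio P Q (block (m + g + m) ω) - 2 * μ) ^ 2) P :=
      (Integrable.of_finite (μ := P.map (block (m + g + m)))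
        (f := fun z => (logRatio P Q z - 2 * μ) ^ 2)).comp_measurable (measurable_block _)
    calc _ ≤ ∫ ω, ((1 + l) * (u (block m ω) + u (block m (shiftBy ((m : ℤ) + g) ω))) ^ 2 +
        (1 + 1 / l) * (2 * c) ^ 2) ∂P :=
          integral_mono hi2 ((hi1.const_mul _).add (integrable_const _)) hpt
      _ = _ := by
        rw [integral_add (hi1.const_mul _) (integrable_const _), integral_const_mul,
          integral_const]
        simp
  refine (logRatioVar_le P Q (m + g + m) (2 * μ)).trans (hint.trans ?_)
  have e1 : (1 + l) * (4 - 2 / β) = 4 - 1 / β := by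
    rw [hl]
    have hb' : β * 2 - 1 ≠ 0 := by linarith
    field_simp
    ring
  have e2 : 1 + 1 / l = 4 * β - 1 := by rw [hl, one_div_one_div]; ring
  rw [e2, ← e1, mul_assoc (1 + l)]
  have : logRatioVar P Q m = ∑ a, blockProb P a * u a ^ 2 := rfl
  rw [this]
  gcongr

/-- Both log-probabilities lie between `-n log (1/δ)` and `0`. This crude bound starts the
iteration. -/
lemma logRatioVar_le_sq {κ : ℕ} {β δ : ℝ} (hδ : 0 < δ)
    {P Q : Measure (ℤ → 𝒜)} (hP : IsRegular κ β δ P) (hQ : IsRegular κ β δ Q) (n : ℕ) :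
    logRatioVar P Q n ≤ Real.logb 2 (1 / δ) ^ 2 * (n : ℝ) ^ 2 := by
  have := hP.isProb
  have := hQ.isProb
  refine (logRatioVar_le P Q n 0).trans ?_
  have hb : ∀ (P : Measure (ℤ → 𝒜)), IsRegular κ β δ P → ∀ z : Fin n → 𝒜,
      -(n * Real.logb 2 (1 / δ)) ≤ Real.logb 2 (blockProb P z) ∧
        Real.logb 2 (blockProb P z) ≤ 0 := by
    intro P hP z
    have := hP.isProb
    have h1 := hP.positive.blockProb_ge hδ.le z
    have h2 := Real.logb_le_logb_of_le (b := 2) (by norm_num) (by positivity) h1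
    rw [Real.logb_pow] at h2
    constructor
    · rw [one_div, Real.logb_inv]; linarith
    · exact Real.logb_nonpos (by norm_num) measureReal_nonneg measureReal_le_one
  calc ∑ z : Fin n → 𝒜, blockProb P z * (logRatio P Q z - 0) ^ 2
      ≤ ∑ z : Fin n → 𝒜, blockProb P z * (Real.logb 2 (1 / δ) ^ 2 * (n : ℝ) ^ 2) := by
        refine Finset.sum_le_sum fun z _ => ?_
        have h0 : 0 ≤ blockProb P z := measureReal_nonneg
        have e : logRatio P Q z = Real.logb 2 (blockProb P z) - Real.logb 2 (blockProb Q z) :=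
          Real.logb_div (hP.blockProb_pos hδ z).ne' (hQ.blockProb_pos hδ z).ne'
        have h1 := hb P hP z
        have h2 := hb Q hQ z
        rw [← mul_pow, sub_zero, e]
        refine mul_le_mul_of_nonneg_left (sq_le_sq' ?_ ?_) h0 <;> linarith
    _ = _ := by rw [← Finset.sum_mul, sum_blockProb, one_mul]

/-- The variance of the log-likelihood ratio of `n`-words is `o(n²)`, uniformly. -/
lemma exists_logRatioVar_le {κ : ℕ} {β δ : ℝ} (hβ : 1 < β) (hδ : 0 < δ) {ε : ℝ} (hε : 0 < ε) :
    ∃ n₀ : ℕ, ∀ n : ℕ, n₀ ≤ n → ∀ P Q : Measure (ℤ → 𝒜), IsRegular κ β δ P → IsRegular κ β δ Q →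
      logRatioVar P Q n ≤ ε * (n : ℝ) ^ 2 := by
  by_cases hδ1 : δ ≤ 1
  swap
  · exact ⟨0, fun n _ P Q hP _ => absurd (hP.le_one hδ) hδ1⟩
  set lδ := Real.logb 2 (1 / δ) with hlδ
  have hlδ0 : 0 ≤ lδ := Real.logb_nonneg (by norm_num) (by rw [le_div_iff₀ hδ]; linarith)
  have hlβ : 0 ≤ Real.logb 2 β := Real.logb_nonneg (by norm_num) hβ.le
  set C := (4 * β - 1) * (2 * (Real.logb 2 β + (κ + 1 : ℕ) * lδ)) ^ 2 with hC
  set θ := 1 - 1 / (4 * β) with hθ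
  -- Doubling multiplies the variance divided by `n²` by at most `θ = (4 - 1/β)/4`, up to the
  -- constant `C`. The slightly larger `ρ < 1` absorbs `C` once `n` is large.
  set ρ := 1 - 1 / (8 * β) with hρ
  have hβ4 : 0 < 1 / (8 * β) := by positivity
  have hβ5 : 1 / (8 * β) < 1 := by rw [div_lt_one (by linarith)]; linarith
  have hρθ : ρ = θ + 1 / (8 * β) := by rw [hρ, hθ]; field_simp; ring
  have hρ0 : 0 < ρ := by rw [hρ]; linarith
  have hρ1 : ρ < 1 := by rw [hρ]; linarith
  have step : ∀ c : ℝ, 0 < c → (∃ n₀ : ℕ, ∀ n : ℕ, n₀ ≤ n → ∀ P Q : Measure (ℤ → 𝒜),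
      IsRegular κ β δ P → IsRegular κ β δ Q → logRatioVar P Q n ≤ c * (n : ℝ) ^ 2) →
      ∃ n₀ : ℕ, ∀ n : ℕ, n₀ ≤ n → ∀ P Q : Measure (ℤ → 𝒜),
      IsRegular κ β δ P → IsRegular κ β δ Q → logRatioVar P Q n ≤ (c * ρ) * (n : ℝ) ^ 2 := by
    rintro c hc ⟨n₀, hn₀⟩
    obtain ⟨n₁, hn₁⟩ := exists_nat_gt (C / (1 / (8 * β) * c))
    refine ⟨max (2 * n₀ + κ + 2) (n₁ + 1), fun n hn P Q hP hQ => ?_⟩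
    have hn1 : 2 * n₀ + κ + 2 ≤ n := (le_max_left _ _).trans hn
    have hn2 : n₁ + 1 ≤ n := (le_max_right _ _).trans hn
    -- The gap is `κ` or `κ + 1`, according to parity.
    obtain ⟨m, g, rfl, hg, hg1⟩ : ∃ m g : ℕ, n = m + g + m ∧ κ ≤ g ∧ g ≤ κ + 1 :=
      ⟨(n - κ) / 2, n - 2 * ((n - κ) / 2), by omega, by omega, by omega⟩
    set n := m + g + m with hndef
    have hm := hn₀ m (by omega) P Q hP hQ
    have hrec := logRatioVar_recursion hβ hδ hP hQ (m := m) hg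
    have hCg : (4 * β - 1) * (2 * (Real.logb 2 β + g * lδ)) ^ 2 ≤ C := by
      have : (g : ℝ) ≤ ((κ + 1 : ℕ) : ℝ) := by exact_mod_cast hg1
      have h4 : 0 ≤ 4 * β - 1 := by linarith
      rw [hC]; gcongr
    have hmn : (2 * (m : ℝ)) ^ 2 ≤ (n : ℝ) ^ 2 := by
      have : 2 * (m : ℝ) ≤ n := by rw [hndef]; push_cast; linarith [(Nat.cast_nonneg g : (0:ℝ) ≤ g)]
      gcongr
    have hn1' : (1 : ℝ) ≤ n := by exact_mod_cast (by omega : 1 ≤ n)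
    have hCn : C ≤ 1 / (8 * β) * c * (n : ℝ) ^ 2 := by
      have h1 : (n₁ : ℝ) ≤ n := by exact_mod_cast (by omega : n₁ ≤ n)
      rw [div_lt_iff₀ (by positivity)] at hn₁
      have h2 : (n : ℝ) ≤ (n : ℝ) ^ 2 := by nlinarith
      calc C ≤ n₁ * (1 / (8 * β) * c) := hn₁.le
        _ ≤ (n : ℝ) ^ 2 * (1 / (8 * β) * c) := by gcongr; linarith
        _ = _ := by ring
    have h4β : 4 - 1 / β = 4 * θ := by rw [hθ]; field_simp
    have hθ0 : 0 ≤ θ := by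
      rw [hθ, sub_nonneg, div_le_one (by linarith)]; linarith
    rw [h4β] at hrec
    calc logRatioVar P Q n ≤ 4 * θ * logRatioVar P Q m + C := hrec.trans (by gcongr)
      _ ≤ 4 * θ * (c * (m : ℝ) ^ 2) + C := by gcongr
      _ = θ * c * (2 * (m : ℝ)) ^ 2 + C := by ring
      _ ≤ θ * c * (n : ℝ) ^ 2 + 1 / (8 * β) * c * (n : ℝ) ^ 2 := by gcongr
      _ = _ := by rw [hρθ]; ring
  have hall : ∀ j : ℕ, ∃ n₀ : ℕ, ∀ n : ℕ, n₀ ≤ n → ∀ P Q : Measure (ℤ → 𝒜),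
      IsRegular κ β δ P → IsRegular κ β δ Q →
      logRatioVar P Q n ≤ ((lδ ^ 2 + 1) * ρ ^ j) * (n : ℝ) ^ 2 := by
    intro j
    induction j with
    | zero =>
      refine ⟨0, fun n _ P Q hP hQ => (logRatioVar_le_sq hδ hP hQ n).trans ?_⟩
      have : 0 ≤ (n : ℝ) ^ 2 := by positivity
      rw [pow_zero, mul_one]; nlinarith
    | succ j ih =>
      have := step _ (by positivity) ih
      simpa only [pow_succ, mul_assoc] using this
  obtain ⟨j, hj⟩ := exists_pow_lt_of_lt_one (show 0 < ε / (lδ ^ 2 + 1) by positivity) hρ1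
  obtain ⟨n₀, hn₀⟩ := hall j
  refine ⟨n₀, fun n hn P Q hP hQ => (hn₀ n hn P Q hP hQ).trans ?_⟩
  rw [lt_div_iff₀ (by positivity)] at hj
  have : (lδ ^ 2 + 1) * ρ ^ j ≤ ε := by linarith
  gcongr

end Concentration

/-! ### Asymptotic optimality -/

section Optimality

/-- The reason for the choice of `n`: even for a word of the least possible probability `δ^n`, the
expected waiting time is below the sample length by a factor `2^{nε₀}`. The minimum with `N` only
decreases `n`. -/
lemma rpow_div_pow_escBlockLength_le {K k₀ N : ℕ} {δ ε₀ : ℝ} (hδ : 0 < δ) (hδ1 : δ < 1)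
    (hε : 0 < ε₀) (hN : 1 ≤ N) :
    (2 : ℝ) ^ ((escBlockLength K k₀ δ ε₀ N : ℝ) * ε₀) / δ ^ escBlockLength K k₀ δ ε₀ N ≤
      (sampleLength K k₀ N : ℝ) := by
  set n := escBlockLength K k₀ δ ε₀ N with hn
  have hL : (1 : ℝ) ≤ sampleLength K k₀ N := by
    have : 1 ≤ sampleLength K k₀ N := by unfold sampleLength; omega
    exact_mod_cast this
  have hlδ : 0 < Real.logb 2 (1 / δ) :=
    Real.logb_pos (by norm_num) (by rw [lt_div_iff₀ hδ]; linarith)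
  have hl0 : 0 ≤ Real.logb 2 (sampleLength K k₀ N : ℝ) := Real.logb_nonneg (by norm_num) hL
  have h1 : (n : ℝ) ≤ Real.logb 2 (sampleLength K k₀ N : ℝ) / (Real.logb 2 (1 / δ) + ε₀) :=
    (Nat.cast_le.2 (min_le_right _ _)).trans (Nat.floor_le (by positivity))
  rw [le_div_iff₀ (by positivity)] at h1
  have h2 : (2 : ℝ) ^ ((n : ℝ) * ε₀) / δ ^ n =
      2 ^ ((n : ℝ) * (Real.logb 2 (1 / δ) + ε₀)) := by
    have h3 : (2 : ℝ) ^ ((n : ℝ) * Real.logb 2 (1 / δ)) = (1 / δ) ^ n := by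
      rw [mul_comm, Real.rpow_mul (by norm_num),
        Real.rpow_logb (b := 2) (by norm_num) (by norm_num) (by positivity), Real.rpow_natCast]
    rw [mul_add, Real.rpow_add (by norm_num), h3, one_div, inv_pow]
    field_simp
  rw [h2]
  calc (2 : ℝ) ^ ((n : ℝ) * (Real.logb 2 (1 / δ) + ε₀))
      ≤ 2 ^ (Real.logb 2 (sampleLength K k₀ N : ℝ)) :=
        Real.rpow_le_rpow_of_exponent_le (by norm_num) h1
    _ = _ := Real.rpow_logb (by norm_num) (by norm_num) (by linarith)

lemma tendsto_escBlockLength (K k₀ : ℕ) {δ ε₀ : ℝ} (hδ : 0 < δ) (hδ1 : δ < 1) (hε : 0 < ε₀) :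
    Tendsto (escBlockLength K k₀ δ ε₀) atTop atTop := by
  have hlδ : 0 < Real.logb 2 (1 / δ) :=
    Real.logb_pos (by norm_num) (by rw [lt_div_iff₀ hδ]; linarith)
  have h1 : Tendsto (fun N => ⌊Real.logb 2 (sampleLength K k₀ N : ℝ) /
      (Real.logb 2 (1 / δ) + ε₀)⌋₊) atTop atTop := by
    refine tendsto_nat_floor_atTop.comp (Tendsto.atTop_div_const (by positivity) ?_)
    refine (Real.tendsto_logb_atTop (by norm_num)).comp (tendsto_natCast_atTop_atTop.comp ?_)
    exact tendsto_atTop_mono (fun N => Nat.le_add_left _ _) tendsto_id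
  refine tendsto_atTop.2 fun b => ?_
  filter_upwards [tendsto_atTop.1 h1 b, eventually_ge_atTop b] with N h2 h3
  exact le_min h3 h2

lemma tendsto_inaccuracy_bound (β : ℝ) (hβ : 1 < β) (K κ : ℕ) {ε : ℝ} (hε : 0 < ε) :
    Tendsto (fun n : ℕ => (β + 1) * (Real.exp (1 - (2 : ℝ) ^ ((n : ℝ) * ε) / (β * (n + κ))) +
      K / (2 : ℝ) ^ ((n : ℝ) * ε))) atTop (𝓝 0) := by
  have hA : Tendsto (fun n : ℕ => (2 : ℝ) ^ ((n : ℝ) * ε)) atTop atTop := by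
    have : ∀ n : ℕ, (2 : ℝ) ^ ((n : ℝ) * ε) = ((2 : ℝ) ^ ε) ^ n := fun n => by
      rw [mul_comm, Real.rpow_mul (by norm_num), Real.rpow_natCast]
    simp only [this]
    exact tendsto_pow_atTop_atTop_of_one_lt (Real.one_lt_rpow (by norm_num) hε)
  have hq : Tendsto (fun n : ℕ => (β * (n + κ)) / (2 : ℝ) ^ ((n : ℝ) * ε)) atTop (𝓝 0) := by
    have hb : 1 < (2 : ℝ) ^ ε := Real.one_lt_rpow (by norm_num) hε
    have h1 := (tendsto_pow_const_div_const_pow_of_one_lt 1 hb).const_mul β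
    have h2 := (tendsto_const_nhds (x := β * κ)).div_atTop hA
    have h3 := h1.add h2
    simp only [mul_zero, add_zero] at h3
    refine h3.congr fun n => ?_
    rw [mul_comm (n : ℝ) ε, Real.rpow_mul (by norm_num), Real.rpow_natCast]
    ring
  have hq' : Tendsto (fun n : ℕ => (2 : ℝ) ^ ((n : ℝ) * ε) / (β * (n + κ))) atTop atTop := by
    have : Tendsto (fun n : ℕ => ((β * (n + κ)) / (2 : ℝ) ^ ((n : ℝ) * ε))⁻¹) atTop atTop := by
      refine Tendsto.inv_tendsto_nhdsGT_zero (tendsto_nhdsWithin_iff.2 ⟨hq, ?_⟩)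
      filter_upwards [eventually_ge_atTop 1] with n hn
      have hn' : (1 : ℝ) ≤ n := by exact_mod_cast hn
      have : (0 : ℝ) < n + κ := by positivity
      have : 0 < β := by linarith
      simp only [Set.mem_Ioi]
      positivity
    simpa only [inv_div] using this
  have h1 : Tendsto (fun n : ℕ => Real.exp (1 - (2 : ℝ) ^ ((n : ℝ) * ε) / (β * (n + κ))))
      atTop (𝓝 0) := by
    refine Real.tendsto_exp_atBot.comp ?_
    exact tendsto_atBot_add_const_left _ 1 (tendsto_neg_atTop_atBot.comp hq')
  have h2 : Tendsto (fun n : ℕ => (K : ℝ) / (2 : ℝ) ^ ((n : ℝ) * ε)) atTop (𝓝 0) :=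
    tendsto_const_nhds.div_atTop hA
  simpa using (h1.add h2).const_mul (β + 1)

variable {𝒜 : Type*} [Fintype 𝒜] [DecidableEq 𝒜] [MeasurableSpace 𝒜] [DiscreteMeasurableSpace 𝒜]

lemma IsVanishingMemory.isRegular {k₀ : ℕ} {α β δ R : ℝ} {ℓ n₀ : ℕ} {P : Measure (ℤ → 𝒜)}
    (hβ : 1 < β) (h : IsVanishingMemory k₀ α β δ R ℓ n₀ P) : IsRegular k₀ β δ P :=
  ⟨h.isProb, h.stationary, h.stronglyMixing hβ, h.positiveTransitions⟩

lemma pairError_eq (n L : ℕ) (f : Classifier 𝒜 L) (Δ : ℝ) (P Q : Measure (ℤ → 𝒜))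
    [IsProbabilityMeasure P] [IsProbabilityMeasure Q] :
    pairError n L f Δ P Q = (P.prod Q) {p |
      (f (block L p.1) (block L p.2) = 1 ∧ marginal P L = marginal Q L) ∨
        (Δ ≤ klDivergence n P Q ∧ f (block L p.1) (block L p.2) = 0)} := by
  unfold pairError
  conv_lhs => rw [marginal, marginal,
    Measure.map_prod_map P Q (measurable_block L) (measurable_block L)]
  rw [Measure.map_apply ((measurable_block L).prodMap (measurable_block L))
    (Set.toFinite _).measurableSet]
  rfl

lemma blockProb_eq_of_marginal_eq {P Q : Measure (ℤ → 𝒜)} {L n : ℕ} (hn : n ≤ L)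
    (h : marginal P L = marginal Q L) (z : Fin n → 𝒜) : blockProb P z = blockProb Q z := by
  have e : ∀ P : Measure (ℤ → 𝒜), blockProb P z =
      (marginal P L).real {y | ∀ i : Fin n, y (Fin.castLE hn i) = z i} := by
    intro P
    rw [marginal, map_measureReal_apply (measurable_block L) (Set.toFinite _).measurableSet,
      blockProb]
    congr 1
    ext ω
    simp [funext_iff, block]
  rw [e, e, h]

lemma klDivergence_eq (n : ℕ) (P Q : Measure (ℤ → 𝒜)) :
    klDivergence n P Q = (1 / (n : ℝ)) * logRatioMean P Q n := rfl

/-- Chebyshev's inequality for the tested word, whose law is the `n`-th marginal of `P` by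
stationarity. -/
lemma measure_atypical_le {P Q : Measure (ℤ → 𝒜)} [IsProbabilityMeasure P]
    [IsProbabilityMeasure Q] (hP : MeasurePreserving shift P P) {K k₀ N n : ℕ} (hn : 1 ≤ n)
    (hnN : n ≤ N) {v t : ℝ} (ht : 0 < t) (hv : logRatioVar P Q n ≤ v * (n : ℝ) ^ 2) :
    (P.prod Q) {p | (1 / (n : ℝ)) * logRatio P Q
      (testVector K k₀ N hnN (block (sampleLength K k₀ N) p.1)) < klDivergence n P Q - t} ≤
      ENNReal.ofReal (v / t ^ 2) := by
  have hn0 : (0 : ℝ) < n := by exact_mod_cast hn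
  set T : Finset (Fin n → 𝒜) :=
    Finset.univ.filter fun z => (1 / (n : ℝ)) * logRatio P Q z < klDivergence n P Q - t with hT
  have hsub : {p : (ℤ → 𝒜) × (ℤ → 𝒜) | (1 / (n : ℝ)) * logRatio P Q
      (testVector K k₀ N hnN (block (sampleLength K k₀ N) p.1)) < klDivergence n P Q - t} ⊆
      ⋃ z ∈ T, occ ((K : ℤ) * (N + k₀) + 1) z ×ˢ Set.univ := by
    rintro ⟨ω, ω'⟩ h
    simp only [Set.mem_iUnion]
    exact ⟨_, Finset.mem_filter.2 ⟨Finset.mem_univ _, h⟩,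
      (testVector_block hnN ω _).1 rfl, Set.mem_univ _⟩
  refine (measure_mono hsub).trans ((measure_biUnion_finset_le _ _).trans ?_)
  have e : ∀ z : Fin n → 𝒜, (P.prod Q) (occ ((K : ℤ) * (N + k₀) + 1) z ×ˢ Set.univ) =
      ENNReal.ofReal (blockProb P z) := fun z => by
    rw [Measure.prod_prod, measure_univ, mul_one,
      ← measureReal_occ hP ((K : ℤ) * (N + k₀) + 1) z, ofReal_measureReal]
  simp only [e]
  rw [← ENNReal.ofReal_sum_of_nonneg (f := fun z => blockProb P z)
    fun z _ => measureReal_nonneg]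
  refine ENNReal.ofReal_le_ofReal ?_
  have h1 : ∑ z ∈ T, blockProb P z * (n * t) ^ 2 ≤ logRatioVar P Q n := by
    refine (Finset.sum_le_sum fun z hz => ?_).trans
      (Finset.sum_le_univ_sum_of_nonneg fun z => mul_nonneg measureReal_nonneg (sq_nonneg _))
    have hz' := (Finset.mem_filter.1 hz).2
    rw [klDivergence_eq] at hz'
    have h2 : logRatio P Q z < logRatioMean P Q n - n * t := by
      have := mul_lt_mul_of_pos_left hz' hn0
      field_simp at this
      linarith
    have h0 : 0 ≤ blockProb P z := measureReal_nonneg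
    have h3 : (n * t) ^ 2 ≤ (logRatio P Q z - logRatioMean P Q n) ^ 2 := by
      rw [← neg_sq (logRatio P Q z - _)]
      have : 0 ≤ n * t := by positivity
      gcongr
      linarith
    gcongr
  rw [← Finset.sum_mul] at h1
  rw [le_div_iff₀ (by positivity)]
  have h2 := h1.trans hv
  have : (n : ℝ) ^ 2 * ((∑ z ∈ T, blockProb P z) * t ^ 2) ≤ (n : ℝ) ^ 2 * v := by
    nlinarith
  exact le_of_mul_le_mul_left this (by positivity)

lemma esc_eq_one_iff {K k₀ N n : ℕ} {δ ε₀ : ℝ} (Δ : ℝ) (hn : escBlockLength K k₀ δ ε₀ N = n)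
    (hnN : n ≤ N) (x y : Fin (sampleLength K k₀ N) → 𝒜) :
    esc K k₀ δ ε₀ Δ N x y = 1 ↔
      Δ / 2 ≤ (1 / (n : ℝ)) * Real.logb 2 (empiricalProb K k₀ N x (testVector K k₀ N hnN x)) -
        (1 / (n : ℝ)) * Real.logb 2 (empiricalProb K k₀ N y (testVector K k₀ N hnN x)) := by
  subst hn
  unfold esc
  simp only
  split_ifs with h
  · exact ⟨fun _ => h, fun _ => rfl⟩
  · simpa using h

lemma esc_eq_zero_iff {K k₀ N n : ℕ} {δ ε₀ : ℝ} (Δ : ℝ) (hn : escBlockLength K k₀ δ ε₀ N = n)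
    (hnN : n ≤ N) (x y : Fin (sampleLength K k₀ N) → 𝒜) :
    esc K k₀ δ ε₀ Δ N x y = 0 ↔
      (1 / (n : ℝ)) * Real.logb 2 (empiricalProb K k₀ N x (testVector K k₀ N hnN x)) -
        (1 / (n : ℝ)) * Real.logb 2 (empiricalProb K k₀ N y (testVector K k₀ N hnN x)) < Δ / 2 := by
  rw [← not_le, ← esc_eq_one_iff Δ hn hnN]
  generalize esc K k₀ δ ε₀ Δ N x y = b
  fin_cases b <;> simp

/-- With accuracy factor `2^{nε₀/2}`, the two normalised log-estimates are off by at most `ε₀`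
together. If the marginals agree, the statistic is at most `ε₀ < Δ/2`. If the divergence is at least
`Δ`, a log-ratio that falls short of its mean by at most `Δ/2 - ε₀` leaves the statistic at least
`Δ/2`. -/
lemma pairError_esc_le {κ : ℕ} {β δ : ℝ} (hβ : 1 < β) (hδ : 0 < δ)
    {P Q : Measure (ℤ → 𝒜)} (hP : IsRegular κ β δ P) (hQ : IsRegular κ β δ Q) {K N : ℕ}
    (hK : 1 ≤ K) {ε₀ Δ v : ℝ} (hε : 0 < ε₀) (hΔ : 4 * ε₀ < Δ)
    (hn : 1 ≤ escBlockLength K κ δ ε₀ N)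
    (hN : (2 : ℝ) ^ ((escBlockLength K κ δ ε₀ N : ℝ) * (ε₀ / 2)) /
      δ ^ escBlockLength K κ δ ε₀ N ≤ N)
    (hv : logRatioVar P Q (escBlockLength K κ δ ε₀ N) ≤ v * (escBlockLength K κ δ ε₀ N : ℝ) ^ 2) :
    pairError (escBlockLength K κ δ ε₀ N) (sampleLength K κ N) (esc K κ δ ε₀ Δ N) Δ P Q ≤
      ENNReal.ofReal ((β + 1) * (Real.exp (1 - (2 : ℝ) ^ ((escBlockLength K κ δ ε₀ N : ℝ) *
        (ε₀ / 2)) / (β * (escBlockLength K κ δ ε₀ N + κ))) +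
        K / (2 : ℝ) ^ ((escBlockLength K κ δ ε₀ N : ℝ) * (ε₀ / 2)))) +
      ENNReal.ofReal (v / (Δ / 2 - ε₀) ^ 2) := by
  have := hP.isProb
  have := hQ.isProb
  have hnN : escBlockLength K κ δ ε₀ N ≤ N := min_le_left _ _
  rw [pairError_eq]
  obtain ⟨n, hndef⟩ : ∃ n, escBlockLength K κ δ ε₀ N = n := ⟨_, rfl⟩
  rw [hndef] at hn hN hv hnN ⊢
  have hn0 : (0 : ℝ) < n := by exact_mod_cast hn
  set A := (2 : ℝ) ^ ((n : ℝ) * (ε₀ / 2)) with hA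
  have hA1 : 1 ≤ A := Real.one_le_rpow (by norm_num) (by positivity)
  have hA0 : 0 < A := by linarith
  have hlA : Real.logb 2 A = n * (ε₀ / 2) := Real.logb_rpow (by norm_num) (by norm_num)
  have h1 := measure_inaccurate_le hP.stationary hQ.stationary le_rfl hβ hP.mixing hQ.mixing hδ
    (n := n) (hP.positive.blockProb_ge hδ.le) (hQ.positive.blockProb_ge hδ.le) hK hn hnN hA1 hN
  have h2 := measure_atypical_le (K := K) (k₀ := κ) (Q := Q) hP.stationary hn hnN
    (t := Δ / 2 - ε₀) (by linarith) hv
  refine le_trans (measure_mono ?_) ((measure_union_le _ _).trans (add_le_add h1 h2))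
  rintro ⟨ω, ω'⟩ hω
  by_contra hcon
  simp only [Set.mem_union, Set.mem_ofPred_eq, not_or, not_not, not_lt] at hcon
  obtain ⟨⟨hx1, hx2, hy1, hy2⟩, htyp⟩ := hcon
  simp only [Set.mem_ofPred_eq] at hω
  have hN1 : 1 ≤ N := hn.trans hnN
  set x := block (sampleLength K κ N) ω
  set y := block (sampleLength K κ N) ω'
  set z := testVector K κ N hnN x with hz
  have hp := hP.blockProb_pos hδ z
  have hq := hQ.blockProb_pos hδ z
  have hxp := empiricalProb_pos hN1 x z
  have hyp := empiricalProb_pos hN1 y z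
  have lx1 := Real.logb_le_logb_of_le (b := 2) (by norm_num) (by positivity) hx1
  have lx2 := Real.logb_le_logb_of_le (b := 2) (by norm_num) hxp hx2
  have ly1 := Real.logb_le_logb_of_le (b := 2) (by norm_num) (by positivity) hy1
  have ly2 := Real.logb_le_logb_of_le (b := 2) (by norm_num) hyp hy2
  rw [Real.logb_div hp.ne' hA0.ne', hlA] at lx1
  rw [Real.logb_div hq.ne' hA0.ne', hlA] at ly1
  rw [Real.logb_mul hp.ne' hA0.ne', hlA] at lx2
  rw [Real.logb_mul hq.ne' hA0.ne', hlA] at ly2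
  rcases hω with ⟨hf, hm⟩ | ⟨hD, hf⟩
  · rw [esc_eq_one_iff Δ hndef hnN, ← mul_sub] at hf
    have hpq : blockProb P z = blockProb Q z := blockProb_eq_of_marginal_eq
      (hnN.trans (Nat.le_add_left _ _)) hm z
    rw [← hpq] at ly1 ly2
    have h5 : n * (Δ / 2) ≤ Real.logb 2 (empiricalProb K κ N x z) -
        Real.logb 2 (empiricalProb K κ N y z) := by
      have := mul_le_mul_of_nonneg_left hf hn0.le
      rwa [← mul_assoc, mul_one_div_cancel hn0.ne', one_mul] at this
    have h6 : n * (Δ / 2) ≤ n * ε₀ := by linarith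
    have := le_of_mul_le_mul_left h6 hn0
    linarith
  · rw [esc_eq_zero_iff Δ hndef hnN, ← mul_sub] at hf
    have h5 : Real.logb 2 (empiricalProb K κ N x z) - Real.logb 2 (empiricalProb K κ N y z) <
        n * (Δ / 2) := by
      have := mul_lt_mul_of_pos_left hf hn0
      rwa [← mul_assoc, mul_one_div_cancel hn0.ne', one_mul] at this
    have h6 : n * (Δ - (Δ / 2 - ε₀)) ≤ logRatio P Q z := by
      have := mul_le_mul_of_nonneg_left ((sub_le_sub_right hD _).trans htyp) hn0.le
      rwa [← mul_assoc, mul_one_div_cancel hn0.ne', one_mul] at this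
    rw [logRatio, Real.logb_div hp.ne' hq.ne'] at h6
    have : n * (Δ - (Δ / 2 - ε₀)) = n * (Δ / 2) + n * ε₀ := by ring
    linarith

theorem tendsto_classificationError_esc (k₀ : ℕ) (α β δ R : ℝ) (ℓ n₀ : ℕ) (hβ : 1 < β)
    (hδ : 0 < δ) (hδ1 : δ < 1) (K : ℕ) (ε₀ Δ : ℝ) (hK : 1 ≤ K) (hε : 0 < ε₀) (hΔ : 4 * ε₀ < Δ) :
    Tendsto (fun N : ℕ => classificationError (escBlockLength K k₀ δ ε₀ N) (sampleLength K k₀ N)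
      (esc K k₀ δ ε₀ Δ N) Δ (memoryClass 𝒜 k₀ α β δ R ℓ n₀)) atTop (𝓝 0) := by
  rw [ENNReal.tendsto_nhds_zero]
  intro ε hεpos
  obtain ⟨r, hr0, hr⟩ : ∃ r : ℝ, 0 < r ∧ ENNReal.ofReal r + ENNReal.ofReal r ≤ ε := by
    rcases eq_or_ne ε ⊤ with rfl | htop
    · exact ⟨1, one_pos, le_top⟩
    · have := ENNReal.toReal_pos hεpos.ne' htop
      refine ⟨ε.toReal / 2, by positivity, ?_⟩
      rw [← ENNReal.ofReal_add (by positivity) (by positivity), add_halves,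
        ENNReal.ofReal_toReal htop]
  have ht : 0 < Δ / 2 - ε₀ := by linarith
  obtain ⟨n₁, hn₁⟩ := exists_logRatioVar_le (𝒜 := 𝒜) (κ := k₀) hβ hδ
    (ε := r * (Δ / 2 - ε₀) ^ 2) (by positivity)
  have hlim := tendsto_escBlockLength K k₀ hδ hδ1 hε
  have hA : Tendsto (fun n : ℕ => (2 : ℝ) ^ ((n : ℝ) * (ε₀ / 2))) atTop atTop := by
    have : ∀ n : ℕ, (2 : ℝ) ^ ((n : ℝ) * (ε₀ / 2)) = ((2 : ℝ) ^ (ε₀ / 2)) ^ n := fun n => by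
      rw [mul_comm, Real.rpow_mul (by norm_num), Real.rpow_natCast]
    simp only [this]
    exact tendsto_pow_atTop_atTop_of_one_lt (Real.one_lt_rpow (by norm_num) (by positivity))
  have hacc := (tendsto_inaccuracy_bound β hβ K k₀ (half_pos hε)).comp hlim
  filter_upwards [eventually_ge_atTop 1, tendsto_atTop.1 hlim 1, tendsto_atTop.1 hlim n₁,
    tendsto_atTop.1 (hA.comp hlim) (K + 1 + K * k₀ : ℝ), hacc.eventually_le_const hr0]
    with N hN1 hn hnn hAK hb
  simp only [Function.comp] at hAK hb
  refine iSup₂_le fun P hP => iSup₂_le fun Q hQ => ?_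
  have hP' := IsVanishingMemory.isRegular hβ hP
  have hQ' := IsVanishingMemory.isRegular hβ hQ
  refine (pairError_esc_le hβ hδ hP' hQ' hK hε hΔ hn ?_ (hn₁ _ hnn P Q hP' hQ')).trans
    (le_trans (add_le_add (ENNReal.ofReal_le_ofReal hb) (ENNReal.ofReal_le_ofReal ?_)) hr)
  -- One half of the surplus exponent `nε₀` pays for the bounded ratio of `N̄` to `N`; the other
  -- half is the accuracy factor.
  · have h1 := rpow_div_pow_escBlockLength_le (K := K) (k₀ := k₀) (N := N) hδ hδ1 hε hN1
    set n := escBlockLength K k₀ δ ε₀ N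
    have hN1' : (1 : ℝ) ≤ N := by exact_mod_cast hN1
    have hL : (sampleLength K k₀ N : ℝ) ≤ (K + 1 + K * k₀) * N := by
      unfold sampleLength
      push_cast
      have : (0 : ℝ) ≤ K * k₀ := by positivity
      nlinarith
    have e : (2 : ℝ) ^ ((n : ℝ) * ε₀) = 2 ^ ((n : ℝ) * (ε₀ / 2)) * 2 ^ ((n : ℝ) * (ε₀ / 2)) := by
      rw [← Real.rpow_add (by norm_num)]; ring_nf
    have hA0 : (0 : ℝ) < 2 ^ ((n : ℝ) * (ε₀ / 2)) := by positivity
    rw [e, mul_div_assoc] at h1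
    have h2 : (2 : ℝ) ^ ((n : ℝ) * (ε₀ / 2)) * (2 ^ ((n : ℝ) * (ε₀ / 2)) / δ ^ n) ≤
        2 ^ ((n : ℝ) * (ε₀ / 2)) * N := h1.trans (hL.trans (by gcongr))
    exact le_of_mul_le_mul_left h2 hA0
  · rw [mul_div_assoc, div_self (by positivity), mul_one]

end Optimality

/-! ### Word events and the extension of finite-dimensional distributions -/

section Words

variable {𝒜 : Type*}

/-- The event that the word `l` is read at the places `t, t + 1, …`. -/
def wordAt : ℤ → List 𝒜 → Set (ℤ → 𝒜)
  | _, [] => Set.univ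
  | t, a :: l => {ω | ω t = a} ∩ wordAt (t + 1) l

lemma wordAt_append (t : ℤ) (l l' : List 𝒜) :
    wordAt t (l ++ l') = wordAt t l ∩ wordAt (t + l.length) l' := by
  induction l generalizing t with
  | nil => simp [wordAt]
  | cons a l ih =>
    simp only [List.cons_append, wordAt, ih, Set.inter_assoc, List.length_cons]
    rw [show t + 1 + (l.length : ℤ) = t + ((l.length + 1 : ℕ) : ℤ) by push_cast; ring]

lemma wordAt_ofFn (t : ℤ) {n : ℕ} (z : Fin n → 𝒜) : wordAt t (List.ofFn z) = occ t z := by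
  induction n generalizing t with
  | zero => ext ω; simp [wordAt, occ]
  | succ n ih =>
    rw [List.ofFn_succ, wordAt, ih]
    ext ω
    simp only [occ, Set.mem_inter_iff, Set.mem_ofPred_eq, Fin.forall_fin_succ, Fin.val_zero,
      Fin.val_succ]
    push_cast
    simp only [add_zero, add_assoc, add_comm (1 : ℤ)]

lemma wordAt_eq_occ (t : ℤ) (l : List 𝒜) : wordAt t l = occ t l.get := by
  rw [← wordAt_ofFn, List.ofFn_get]

lemma atom_Ico (t : ℤ) (n : ℕ) (y : ℤ → 𝒜) :
    atom (Finset.Ico t (t + n)) y = wordAt t (List.ofFn fun i : Fin n => y (t + i)) := by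
  rw [wordAt_ofFn]
  ext ω
  simp only [atom, occ, Set.mem_ofPred_eq, Finset.mem_Ico]
  constructor
  · intro h i
    exact h _ ⟨by omega, by omega⟩
  · rintro h i ⟨h1, h2⟩
    have := h ⟨(i - t).toNat, by omega⟩
    simpa [Int.toNat_of_nonneg (sub_nonneg.2 h1)] using this

lemma preimage_shiftBy_wordAt (s t : ℤ) (l : List 𝒜) :
    shiftBy s ⁻¹' wordAt t l = wordAt (t + s) l := by
  rw [wordAt_eq_occ, wordAt_eq_occ, preimage_shiftBy_occ]

variable [Fintype 𝒜] [MeasurableSpace 𝒜] [DiscreteMeasurableSpace 𝒜]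

lemma measurableSet_wordAt (t : ℤ) (l : List 𝒜) {S : Set ℤ} (hS : Set.Ico t (t + l.length) ⊆ S) :
    MeasurableSet[coordSigma S] (wordAt t l) := by
  rw [wordAt_eq_occ]
  exact measurableSet_occ t _ hS

lemma measurableSet_wordAt' (t : ℤ) (l : List 𝒜) : MeasurableSet (wordAt t l) :=
  coordSigma_le _ _ (measurableSet_wordAt t l (Set.subset_univ _))

/-- Splitting an event according to the letter at the place `t`. -/
lemma sum_measureReal_inter_letter (P : Measure (ℤ → 𝒜)) [IsFiniteMeasure P] (t : ℤ)
    (A : Set (ℤ → 𝒜)) : ∑ a, P.real (A ∩ {ω | ω t = a}) = P.real A := by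
  classical
  have hU : A = ⋃ a ∈ (Finset.univ : Finset 𝒜), (A ∩ {ω | ω t = a}) := by
    ext ω; simp
  have hm : ∀ a : 𝒜, MeasurableSet {ω : ℤ → 𝒜 | ω t = a} := fun a =>
    (measurable_pi_apply (X := fun _ : ℤ => 𝒜) t) (MeasurableSet.of_discrete (s := {a}))
  have hf : Measurable fun ω : ℤ → 𝒜 => ω t := measurable_pi_apply t
  have h1 : ∀ a, P.real (A ∩ {ω | ω t = a}) = ((P.restrict A).map fun ω => ω t).real {a} := by
    intro a
    rw [map_measureReal_apply hf (MeasurableSet.singleton a),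
      measureReal_restrict_apply (hf (MeasurableSet.singleton a)), Set.inter_comm]
    rfl
  simp only [h1]
  rw [sum_measureReal_singleton, Finset.coe_univ, map_measureReal_apply hf MeasurableSet.univ]
  simp

lemma sum_measureReal_wordAt_cons (P : Measure (ℤ → 𝒜)) [IsFiniteMeasure P] (t : ℤ) (l : List 𝒜) :
    ∑ a, P.real (wordAt t (a :: l)) = P.real (wordAt (t + 1) l) := by
  rw [← sum_measureReal_inter_letter P t]
  simp only [wordAt, Set.inter_comm]

lemma sum_measureReal_wordAt_concat (P : Measure (ℤ → 𝒜)) [IsFiniteMeasure P] (t : ℤ)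
    (l : List 𝒜) : ∑ a, P.real (wordAt t (l ++ [a])) = P.real (wordAt t l) := by
  rw [← sum_measureReal_inter_letter P (t + l.length) (wordAt t l)]
  simp only [wordAt_append, wordAt, Set.inter_univ]

/-- Inequalities between finite measures extend from finite-dimensional rectangles. -/
lemma measureReal_le_of_atoms (μ ν : Measure (ℤ → 𝒜)) [IsFiniteMeasure μ] [IsFiniteMeasure ν]
    {c d : ℝ} (hc : 0 ≤ c) (hd : 0 ≤ d) (S : Set ℤ)
    (h : ∀ J : Finset ℤ, (J : Set ℤ) ⊆ S → ∃ J' : Finset ℤ, J ⊆ J' ∧ (J' : Set ℤ) ⊆ S ∧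
      ∀ y : ℤ → 𝒜, c * μ.real (atom J' y) ≤ d * ν.real (atom J' y))
    {A : Set (ℤ → 𝒜)} (hA : MeasurableSet[coordSigma S] A) : c * μ.real A ≤ d * ν.real A := by
  lift c to NNReal using hc
  lift d to NNReal using hd
  have := measure_le_of_atoms (c • μ) (d • ν) S (fun J hJ => ?_) hA
  · have h2 := ENNReal.toReal_mono (measure_ne_top _ _) this
    simpa [Measure.real] using h2
  · obtain ⟨J', h1, h2, h3⟩ := h J hJ
    refine ⟨J', h1, h2, fun y => ?_⟩
    rw [← ENNReal.toReal_le_toReal (measure_ne_top _ _) (measure_ne_top _ _)]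
    simpa [Measure.real] using h3 y

/-- A finite set of places up to `s` lies in an interval that ends exactly at `s`, so words ending
at `s` suffice. -/
lemma measureReal_le_of_words_Iic (μ ν : Measure (ℤ → 𝒜)) [IsFiniteMeasure μ] [IsFiniteMeasure ν]
    {c d : ℝ} (hc : 0 ≤ c) (hd : 0 ≤ d) (s : ℤ) (h : ∀ (t : ℤ) (l : List 𝒜), t + l.length = s + 1 →
      c * μ.real (wordAt t l) ≤ d * ν.real (wordAt t l))
    {A : Set (ℤ → 𝒜)} (hA : MeasurableSet[coordSigma (Set.Iic s)] A) :
    c * μ.real A ≤ d * ν.real A := by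
  refine measureReal_le_of_atoms μ ν hc hd (Set.Iic s) (fun J hJ => ?_) hA
  obtain ⟨b, hb⟩ := J.finite_toSet.bddBelow
  refine ⟨Finset.Ico (min b s) (min b s + (s + 1 - min b s).toNat), fun i hi => ?_, ?_,
    fun y => ?_⟩
  · have h1 := hb hi
    have h2 : i ≤ s := hJ hi
    rw [Finset.mem_Ico]; omega
  · intro i hi
    simp only [Finset.coe_Ico, Set.mem_Ico, Set.mem_Iic] at hi ⊢
    omega
  · rw [atom_Ico]
    exact h _ _ (by rw [List.length_ofFn]; omega)

lemma measureReal_le_of_words_Ici (μ ν : Measure (ℤ → 𝒜)) [IsFiniteMeasure μ] [IsFiniteMeasure ν]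
    {c d : ℝ} (hc : 0 ≤ c) (hd : 0 ≤ d) (s : ℤ) (h : ∀ (l : List 𝒜), c * μ.real (wordAt s l) ≤ d * ν.real (wordAt s l))
    {A : Set (ℤ → 𝒜)} (hA : MeasurableSet[coordSigma (Set.Ici s)] A) :
    c * μ.real A ≤ d * ν.real A := by
  refine measureReal_le_of_atoms μ ν hc hd (Set.Ici s) (fun J hJ => ?_) hA
  obtain ⟨b, hb⟩ := J.finite_toSet.bddAbove
  refine ⟨Finset.Ico s (s + (b + 1 - s).toNat), fun i hi => ?_, ?_, fun y => ?_⟩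
  · have h1 := hb hi
    have h2 : s ≤ i := hJ hi
    rw [Finset.mem_Ico]; omega
  · intro i hi
    simp only [Finset.coe_Ico, Set.mem_Ico, Set.mem_Ici] at hi ⊢
    omega
  · rw [atom_Ico]
    exact h _

/-- The two events are generalised in turn. With a word as the future, both sides are measures in
the past event; with the past event then fixed, both sides are measures in the future event. -/
lemma stronglyMixing_of_words {P : Measure (ℤ → 𝒜)} [IsProbabilityMeasure P] {κ : ℕ} (hκ : 1 ≤ κ)
    {β : ℝ} (hβ : 0 < β)
    (h : ∀ (t : ℤ) (l l' : List 𝒜) (j : ℕ), κ ≤ j + 1 →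
      P.real (wordAt t l) * P.real (wordAt (t + l.length + j) l') ≤
        β * P.real (wordAt t l ∩ wordAt (t + l.length + j) l') ∧
      P.real (wordAt t l ∩ wordAt (t + l.length + j) l') ≤
        β * (P.real (wordAt t l) * P.real (wordAt (t + l.length + j) l'))) :
    StronglyMixing κ β P := by
  have key : ∀ s t : ℤ, s + κ ≤ t → ∀ A B : Set (ℤ → 𝒜), MeasurableSet[coordSigma (Set.Iic s)] A →
      MeasurableSet[coordSigma (Set.Ici t)] B →
      P.real A * P.real B ≤ β * P.real (A ∩ B) ∧
        P.real (A ∩ B) ≤ β * (P.real A * P.real B) := by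
    intro s t hst A B hA hB
    have hA0 := coordSigma_le _ _ hA
    have hB0 := coordSigma_le _ _ hB
    have past : ∀ l' : List 𝒜, P.real A * P.real (wordAt t l') ≤ β * P.real (A ∩ wordAt t l') ∧
        P.real (A ∩ wordAt t l') ≤ β * (P.real A * P.real (wordAt t l')) := by
      intro l'
      have hw := measurableSet_wordAt' (𝒜 := 𝒜) t l'
      have hword : ∀ (t' : ℤ) (l : List 𝒜), t' + l.length = s + 1 →
          P.real (wordAt t' l) * P.real (wordAt t l') ≤
            β * P.real (wordAt t' l ∩ wordAt t l') ∧
          P.real (wordAt t' l ∩ wordAt t l') ≤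
            β * (P.real (wordAt t' l) * P.real (wordAt t l')) := by
        intro t' l hl
        have := h t' l l' (t - s - 1).toNat (by omega)
        rwa [show t' + (l.length : ℤ) + ((t - s - 1).toNat : ℤ) = t by omega] at this
      constructor
      · have := measureReal_le_of_words_Iic P (P.restrict (wordAt t l')) measureReal_nonneg hβ.le s
          (c := P.real (wordAt t l')) (fun t' l hl => ?_) hA
        · rw [measureReal_restrict_apply' hw] at this
          linarith
        · rw [measureReal_restrict_apply' hw]
          linarith [(hword t' l hl).1]
      · have := measureReal_le_of_words_Iic (P.restrict (wordAt t l')) P zero_le_one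
          (mul_nonneg hβ.le measureReal_nonneg) s (d := β * P.real (wordAt t l'))
          (fun t' l hl => ?_) hA
        · rw [measureReal_restrict_apply' hw] at this
          linarith
        · rw [measureReal_restrict_apply' hw]
          linarith [(hword t' l hl).2]
    constructor
    · have := measureReal_le_of_words_Ici P (P.restrict A) measureReal_nonneg hβ.le t
        (c := P.real A) (fun l => ?_) hB
      · rwa [measureReal_restrict_apply' hA0, Set.inter_comm] at this
      · rw [measureReal_restrict_apply' hA0, Set.inter_comm]
        exact (past l).1
    · have := measureReal_le_of_words_Ici (P.restrict A) P zero_le_one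
        (mul_nonneg hβ.le measureReal_nonneg) t (d := β * P.real A) (fun l => ?_) hB
      · rw [measureReal_restrict_apply' hA0, Set.inter_comm] at this
        linarith
      · rw [measureReal_restrict_apply' hA0, Set.inter_comm]
        linarith [(past l).2]
  exact ⟨fun s t hst A B hA hB => (key s t hst A B hA hB).1,
    fun s t hst A B hA hB => (key s t hst A B hA hB).2⟩

/-- An interval around `t` with `t` removed has as atoms pairs of words, and prescribing the letter
at `t` joins such a pair to a single word. -/
lemma positiveTransitions_of_words {P : Measure (ℤ → 𝒜)} [IsProbabilityMeasure P] {δ : ℝ}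
    (hδ : 0 ≤ δ)
    (h : ∀ (t : ℤ) (l l' : List 𝒜) (a : 𝒜),
      δ * ∑ b, P.real (wordAt t (l ++ b :: l')) ≤ P.real (wordAt t (l ++ a :: l'))) :
    PositiveTransitions δ P := by
  intro t a A hA
  have hE : MeasurableSet {ω : ℤ → 𝒜 | ω t = a} :=
    (measurable_pi_apply (X := fun _ : ℤ => 𝒜) t) (MeasurableSet.of_discrete (s := {a}))
  have hA0 := coordSigma_le _ _ hA
  have := measureReal_le_of_atoms P (P.restrict {ω : ℤ → 𝒜 | ω t = a}) hδ zero_le_one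
    {i | i ≠ t} (fun J hJ => ?_) hA
  · rwa [measureReal_restrict_apply' hE, one_mul] at this
  · obtain ⟨b, hb⟩ := J.finite_toSet.bddAbove
    obtain ⟨b', hb'⟩ := J.finite_toSet.bddBelow
    set m := (t - b').toNat with hm
    set m' := (b - t).toNat with hm'
    refine ⟨(Finset.Ico (t - m) (t + m' + 1)).erase t, fun i hi => ?_, ?_, fun y => ?_⟩
    · have h1 := hb hi
      have h2 := hb' hi
      have h3 : i ≠ t := hJ hi
      rw [Finset.mem_erase, Finset.mem_Ico]
      exact ⟨h3, by omega, by omega⟩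
    · intro i hi
      simpa using (Finset.mem_erase.1 hi).1
    · set l := List.ofFn fun i : Fin m => y (t - m + i) with hl
      set l' := List.ofFn fun i : Fin m' => y (t + 1 + i) with hl'
      have hll : (l.length : ℤ) = m := by simp [hl]
      have hatom : atom ((Finset.Ico (t - m) (t + m' + 1)).erase t) y =
          wordAt (t - m) l ∩ wordAt (t + 1) l' := by
        rw [hl, hl', ← atom_Ico, ← atom_Ico]
        ext ω
        simp only [atom, Set.mem_ofPred_eq, Finset.mem_erase, Finset.mem_Ico, Set.mem_inter_iff]
        constructor
        · intro H
          exact ⟨fun i hi => H i ⟨by omega, by omega, by omega⟩,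
            fun i hi => H i ⟨by omega, by omega, by omega⟩⟩
        · rintro ⟨h1, h2⟩ i ⟨h3, h4, h5⟩
          by_cases hit : i < t
          · exact h1 i ⟨by omega, by omega⟩
          · exact h2 i ⟨by omega, by omega⟩
      have hword : ∀ b : 𝒜, wordAt (t - m) (l ++ b :: l') =
          atom ((Finset.Ico (t - m) (t + m' + 1)).erase t) y ∩ {ω | ω t = b} := by
        intro b
        rw [hatom, wordAt_append, wordAt, hll, show t - (m : ℤ) + m = t by ring,
          Set.inter_assoc, Set.inter_comm (wordAt (t + 1) l')]
      have h1 := h (t - m) l l' a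
      simp only [hword] at h1
      rw [sum_measureReal_inter_letter] at h1
      rwa [measureReal_restrict_apply' hE, one_mul]

end Words

/-! ### Stationary laws with given word probabilities -/

section Extension

lemma isClopen_wordAt (t : ℤ) (l : List Bool) : IsClopen (wordAt t l) := by
  induction l generalizing t with
  | nil => exact isClopen_univ
  | cons a l ih =>
    exact ((isClopen_discrete {a}).preimage (continuous_apply (A := fun _ : ℤ => Bool) t)).inter
      (ih _)

/-- Shorter words inside the window are recovered by summing out letters: on the right up to the end
of the window, on the left to move the starting place. -/
lemma measureReal_wordAt_of_length_eq (μ : Measure (ℤ → Bool)) [IsFiniteMeasure μ]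
    {p : List Bool → ℝ} (hl : ∀ l, ∑ a, p (a :: l) = p l) (hr : ∀ l, ∑ a, p (l ++ [a]) = p l)
    {s : ℤ} {M : ℕ} (h : ∀ l : List Bool, l.length = M → μ.real (wordAt s l) = p l) (k : ℕ)
    (l : List Bool) (hkl : k + l.length ≤ M) : μ.real (wordAt (s + k) l) = p l := by
  induction k generalizing l with
  | zero =>
    obtain ⟨d, hd⟩ := Nat.exists_eq_add_of_le hkl
    induction d generalizing l with
    | zero => simpa using h l (by omega)
    | succ d ih =>
      rw [← hr l, ← sum_measureReal_wordAt_concat]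
      exact Finset.sum_congr rfl fun a _ => ih _ (by simp; omega) (by simp; omega)
  | succ k ih =>
    rw [← hl l]
    push_cast
    rw [← add_assoc, ← sum_measureReal_wordAt_cons]
    exact Finset.sum_congr rfl fun a _ => ih _ (by simp; omega)

/-- A finite mixture of point masses, one for each word of length `M`; what happens outside the
window is irrelevant. -/
lemma exists_measure_wordAt_of_length_eq {p : List Bool → ℝ} (h0 : ∀ l, 0 ≤ p l)
    (h1 : p [] = 1) (hl : ∀ l, ∑ a, p (a :: l) = p l) (s : ℤ) (M : ℕ) :
    ∃ μ : ProbabilityMeasure (ℤ → Bool), ∀ l : List Bool, l.length = M →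
      (μ : Measure (ℤ → Bool)).real (wordAt s l) = p l := by
  have hsum : ∀ n : ℕ, ∑ z : Fin n → Bool, p (List.ofFn z) = 1 := by
    intro n
    induction n with
    | zero => simpa using h1
    | succ n ih =>
      rw [← (Fin.consEquiv fun _ => Bool).sum_comp, Fintype.sum_prod_type_right, ← ih]
      refine Finset.sum_congr rfl fun z _ => ?_
      rw [← hl]
      simp [Fin.consEquiv, List.ofFn_succ]
  set ext : (Fin M → Bool) → ℤ → Bool := fun z i =>
    if h : (i - s).toNat < M then z ⟨(i - s).toNat, h⟩ else false with hext
  set μ : Measure (ℤ → Bool) :=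
    ∑ z : Fin M → Bool, ENNReal.ofReal (p (List.ofFn z)) • Measure.dirac (ext z) with hμ
  have hprob : IsProbabilityMeasure μ := by
    constructor
    simp only [hμ, Measure.finsetSum_apply, Measure.smul_apply, measure_univ, smul_eq_mul, mul_one]
    rw [← ENNReal.ofReal_sum_of_nonneg fun z _ => h0 _, hsum, ENNReal.ofReal_one]
  refine ⟨⟨μ, hprob⟩, fun l hlM => ?_⟩
  subst hlM
  have hmem : ∀ z : Fin l.length → Bool, ext z ∈ wordAt s l ↔ z = l.get := by
    intro z
    rw [wordAt_eq_occ, occ, Set.mem_ofPred_eq, funext_iff]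
    refine forall_congr' fun i => ?_
    simp [hext]
  have hval : μ (wordAt s l) = ENNReal.ofReal (p l) := by
    simp only [hμ, Measure.finsetSum_apply, Measure.smul_apply, smul_eq_mul]
    rw [Finset.sum_eq_single l.get]
    · rw [Measure.dirac_apply' _ (measurableSet_wordAt' s l),
        Set.indicator_of_mem ((hmem _).2 rfl), List.ofFn_get]
      simp
    · intro z _ hz
      rw [Measure.dirac_apply' _ (measurableSet_wordAt' s l),
        Set.indicator_of_notMem (fun h => hz ((hmem _).1 h)), mul_zero]
    · simp
  simp only [ProbabilityMeasure.coe_mk, Measure.real, hval, ENNReal.toReal_ofReal (h0 l)]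

/-- Consistent stationary word probabilities are those of a law on binary sequences. -/
theorem exists_measure_wordAt {p : List Bool → ℝ} (h0 : ∀ l, 0 ≤ p l) (h1 : p [] = 1)
    (hl : ∀ l, ∑ a, p (a :: l) = p l) (hr : ∀ l, ∑ a, p (l ++ [a]) = p l) :
    ∃ P : Measure (ℤ → Bool), IsProbabilityMeasure P ∧
      ∀ (t : ℤ) (l : List Bool), P.real (wordAt t l) = p l := by
  choose μ hμ using fun m : ℕ =>
    exists_measure_wordAt_of_length_eq h0 h1 hl (-(m : ℤ)) (2 * m + 1)
  -- The probability measures on a compact space form a compact space, so the laws that are right on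
  -- growing windows converge along an ultrafilter. Word events are clopen, hence their
  -- probabilities pass to the limit.
  set F : Ultrafilter (ProbabilityMeasure (ℤ → Bool)) := (hyperfilter ℕ).map μ with hF
  have hlim : Tendsto μ (hyperfilter ℕ) (𝓝 F.lim) := F.le_nhds_lim
  refine ⟨(F.lim : ProbabilityMeasure (ℤ → Bool)), inferInstance, fun t l => ?_⟩
  have h2 := ProbabilityMeasure.tendsto_measure_of_null_frontier_of_tendsto' hlim
    (E := wordAt t l) (by rw [(isClopen_wordAt t l).frontier_eq]; simp)
  have h3 : Tendsto (fun m => (μ m : Measure (ℤ → Bool)).real (wordAt t l)) (hyperfilter ℕ)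
      (𝓝 ((F.lim : Measure (ℤ → Bool)).real (wordAt t l))) :=
    (ENNReal.tendsto_toReal (measure_ne_top _ _)).comp h2
  refine tendsto_nhds_unique h3 (tendsto_const_nhds.congr' ?_)
  refine Filter.Eventually.filter_mono Nat.hyperfilter_le_atTop ?_
  filter_upwards [eventually_ge_atTop (t.natAbs + l.length)] with m hm
  have h4 := measureReal_wordAt_of_length_eq (μ m : Measure (ℤ → Bool)) hl hr (hμ m)
    (t + m).toNat l (by omega)
  rw [← h4]
  congr 2
  omega

lemma measurePreserving_shift_of_wordAt {P : Measure (ℤ → Bool)} [IsProbabilityMeasure P]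
    {p : List Bool → ℝ} (h : ∀ (t : ℤ) (l : List Bool), P.real (wordAt t l) = p l) :
    MeasurePreserving shift P P := by
  have hs : (shift : (ℤ → Bool) → ℤ → Bool) = shiftBy 1 := rfl
  rw [hs]
  have hm := measurable_shiftBy' (𝒜 := Bool) 1
  refine ⟨hm, ?_⟩
  have hprob : IsProbabilityMeasure (P.map (shiftBy 1)) :=
    Measure.isProbabilityMeasure_map hm.aemeasurable
  have hmap : ∀ t l, (P.map (shiftBy 1)).real (wordAt t l) = p l := fun t l => by
    rw [map_measureReal_apply hm (measurableSet_wordAt' t l), preimage_shiftBy_wordAt, h]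
  have key : ∀ (μ ν : Measure (ℤ → Bool)) [IsProbabilityMeasure μ] [IsProbabilityMeasure ν],
      (∀ t l, μ.real (wordAt t l) = p l) → (∀ t l, ν.real (wordAt t l) = p l) →
      ∀ A, MeasurableSet A → μ A ≤ ν A := by
    intro μ ν _ _ hμ hν A hA
    have hA' : MeasurableSet[coordSigma Set.univ] A := by rwa [coordSigma_univ]
    refine measure_le_of_atoms μ ν Set.univ (fun J _ => ?_) hA'
    obtain ⟨b, hb⟩ := J.finite_toSet.bddAbove
    obtain ⟨b', hb'⟩ := J.finite_toSet.bddBelow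
    refine ⟨Finset.Ico b' (b' + (b + 1 - b').toNat), fun i hi => ?_, Set.subset_univ _,
      fun y => ?_⟩
    · have h1 := hb hi
      have h2 := hb' hi
      rw [Finset.mem_Ico]; omega
    · rw [atom_Ico, ← ofReal_measureReal, ← ofReal_measureReal, hμ, hν]
  exact Measure.ext fun A hA => le_antisymm (key _ _ hmap h A hA) (key _ _ h hmap A hA)

end Extension

/-! ### Ergodicity from mixing, and the return from product forms to the class. -/

section Ergodicity

variable {𝒜 : Type*} [Fintype 𝒜] [MeasurableSpace 𝒜] [DiscreteMeasurableSpace 𝒜]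

lemma iterate_invariant_shiftBy {A : Set (ℤ → 𝒜)} (hA : shift ⁻¹' A = A) (k : ℕ) (ω : ℤ → 𝒜) :
    shiftBy k ω ∈ A ↔ ω ∈ A := by
  induction k generalizing ω with
  | zero =>
    have : shiftBy (0 : ℕ) ω = ω := by funext i; simp [shiftBy]
    rw [this]
  | succ k ih =>
    have h1 : shiftBy ((k + 1 : ℕ) : ℤ) ω = shiftBy k (shift ω) := by
      funext i; simp [shiftBy, shift, add_assoc]
    rw [h1, ih]
    exact Set.ext_iff.1 hA ω

/-- Let `C` be a finite-coordinate approximation of the invariant set `A`. A far translate of `Cᶜ`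
still approximates `Aᶜ`, so it nearly misses `C`; yet mixing bounds the probability of the
intersection below by `P(C) P(Cᶜ)/β`. Hence `P(A) P(Aᶜ) = 0`. -/
lemma StronglyMixing.ergodic {P : Measure (ℤ → 𝒜)} [IsProbabilityMeasure P]
    (hP : MeasurePreserving shift P P) {κ : ℕ} {β : ℝ} (hβ : 1 < β) (h : StronglyMixing κ β P) :
    Ergodic shift P := by
  refine ⟨hP, ⟨fun A hA hinv => ?_⟩⟩
  have hA' : MeasurableSet[coordSigma Set.univ] A := by rwa [coordSigma_univ]
  have hprod : P.real A * P.real Aᶜ = 0 := by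
    refine le_antisymm ?_ (mul_nonneg measureReal_nonneg measureReal_nonneg)
    refine le_of_forall_pos_le_add fun ε hε => ?_
    set η := min 1 (ε / (2 * β + 3)) with hη
    have hη0 : 0 < η := lt_min one_pos (by positivity)
    have hη1 : η ≤ 1 := min_le_left _ _
    have hηε : (2 * β + 3) * η ≤ ε := by
      have := min_le_right 1 (ε / (2 * β + 3))
      rw [← hη, le_div_iff₀ (by linarith)] at this
      linarith
    obtain ⟨C, ⟨J, -, hCJ⟩, hC⟩ := exists_dependsOnCoords_approx P hA'
      (ENNReal.ofReal_pos.2 hη0)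
    have hC0 : MeasurableSet C := coordSigma_le _ _ (hCJ.measurableSet (Set.subset_univ _))
    have hCr : P.real (symmDiff C A) ≤ η := by
      have := (ENNReal.toReal_mono ENNReal.ofReal_ne_top hC.le)
      rwa [ENNReal.toReal_ofReal hη0.le] at this
    obtain ⟨b, hb⟩ := J.finite_toSet.bddAbove
    obtain ⟨b', hb'⟩ := J.finite_toSet.bddBelow
    set k := (b - b' + κ).toNat with hk
    have hmp := measurePreserving_shiftBy hP (k : ℤ)
    have hD : MeasurableSet[coordSigma (Set.Ici (b' + k))] (shiftBy (k : ℤ) ⁻¹' Cᶜ) := by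
      have h1 : MeasurableSet[coordSigma (Set.Ici b')] C := hCJ.measurableSet fun i hi => hb' hi
      have := measurable_shiftBy (𝒜 := 𝒜) (k : ℤ) (Set.Ici b') (@MeasurableSet.compl _ _ (_) h1)
      rwa [image_add_const_Ici] at this
    have h1 := h.lower b (b' + k) (by omega) C _ (hCJ.measurableSet fun i hi => hb hi) hD
    rw [hmp.measureReal_preimage hC0.compl.nullMeasurableSet] at h1
    have hsub : C ∩ shiftBy (k : ℤ) ⁻¹' Cᶜ ⊆
        symmDiff C A ∪ shiftBy (k : ℤ) ⁻¹' symmDiff C A := by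
      intro ω hω
      by_cases hωA : ω ∈ A
      · exact Or.inr (Or.inr ⟨(iterate_invariant_shiftBy hinv k ω).2 hωA, hω.2⟩)
      · exact Or.inl (Or.inl ⟨hω.1, hωA⟩)
    have h2 : P.real (C ∩ shiftBy (k : ℤ) ⁻¹' Cᶜ) ≤ η + η := by
      refine (measureReal_mono hsub).trans ((measureReal_union_le _ _).trans (add_le_add hCr ?_))
      rwa [hmp.measureReal_preimage (hC0.symmDiff hA).nullMeasurableSet]
    have h3 : P.real A ≤ P.real C + η := by
      have : A ⊆ C ∪ symmDiff C A := by
        intro ω hω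
        by_cases hc : ω ∈ C
        · exact Or.inl hc
        · exact Or.inr (Or.inr ⟨hω, hc⟩)
      exact (measureReal_mono this).trans ((measureReal_union_le _ _).trans (by gcongr))
    have h4 : P.real Aᶜ ≤ P.real Cᶜ + η := by
      have : Aᶜ ⊆ Cᶜ ∪ symmDiff C A := by
        intro ω hω
        by_cases hc : ω ∈ C
        · exact Or.inr (Or.inl ⟨hc, hω⟩)
        · exact Or.inl hc
      exact (measureReal_mono this).trans ((measureReal_union_le _ _).trans (by gcongr))
    have hC1 : P.real C ≤ 1 := measureReal_le_one
    have hC2 : P.real Cᶜ ≤ 1 := measureReal_le_one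
    have hC3 : 0 ≤ P.real C := measureReal_nonneg
    have hC4 : 0 ≤ P.real Aᶜ := measureReal_nonneg
    calc P.real A * P.real Aᶜ ≤ (P.real C + η) * (P.real Cᶜ + η) := by gcongr
      _ = P.real C * P.real Cᶜ + (P.real C + P.real Cᶜ + η) * η := by ring
      _ ≤ β * (η + η) + 3 * η := by
        refine add_le_add (h1.trans (by gcongr)) ?_
        gcongr
        linarith
      _ ≤ 0 + ε := by linarith
  rw [eventuallyConst_set']
  rcases mul_eq_zero.1 hprod with h0 | h0
  · left
    rw [measureReal_eq_zero_iff] at h0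
    exact ae_eq_empty.2 h0
  · right
    rw [measureReal_eq_zero_iff] at h0
    exact ae_eq_univ.2 h0

/-- The conditional probability is measurable for the smaller σ-field, so comparing integrals over
its events is enough for an almost sure bound. -/
lemma PositiveTransitions.condExp_ge {P : Measure (ℤ → 𝒜)} [IsProbabilityMeasure P] {δ : ℝ}
    (h : PositiveTransitions δ P) (a : 𝒜) :
    ∀ᵐ ω ∂P, δ ≤ (P⟦{ω' : ℤ → 𝒜 | ω' 1 = a} | coordSigma {i | i ≠ 1}⟧) ω := by
  have hm := coordSigma_le (𝒜 := 𝒜) {i | i ≠ 1}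
  have hE : MeasurableSet {ω : ℤ → 𝒜 | ω 1 = a} :=
    (measurable_pi_apply (X := fun _ : ℤ => 𝒜) 1) (MeasurableSet.of_discrete (s := {a}))
  have hi : Integrable (({ω' : ℤ → 𝒜 | ω' 1 = a}).indicator fun _ => (1 : ℝ)) P :=
    (integrable_const _).indicator hE
  have : IsFiniteMeasure (P.trim hm) := isFiniteMeasure_trim hm
  refine ae_le_of_ae_le_trim (hm := hm) (f₁ := fun _ => δ) ?_
  refine ae_le_of_forall_setIntegral_le (integrable_const _)
    (integrable_condExp.trim hm stronglyMeasurable_condExp) fun A hA _ => ?_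
  rw [← setIntegral_trim hm stronglyMeasurable_condExp hA, setIntegral_condExp hm hi hA,
    setIntegral_indicator hE, setIntegral_const, setIntegral_const, smul_eq_mul, smul_eq_mul,
    mul_one]
  have h1 := h 1 a A hA
  have h2 : (P.trim hm).real A = P.real A := by
    rw [Measure.real, Measure.real, trim_measurableSet_eq hm hA]
  rw [h2]
  linarith

/-- A regular source with the two bounds on words of small probability is in the class. -/
lemma IsRegular.isVanishingMemory {κ : ℕ} {β δ : ℝ} {P : Measure (ℤ → 𝒜)} (hβ : 1 < β)
    (h : IsRegular κ β δ P) {k₀ : ℕ} (hk : κ ≤ k₀) {α R : ℝ} {ℓ n₀ : ℕ}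
    (h1 : P.real {ω | blockProb P (block ℓ ω) ≤ (2 : ℝ) ^ (-((ℓ : ℝ) * R))} ≤ α)
    (h2 : ∀ n : ℕ, n₀ ≤ n →
      P.real {ω | blockProb P (block n ω) ≤ (2 : ℝ) ^ (-((n : ℝ) * R))} ≤ 1 / (n : ℝ)) :
    IsVanishingMemory k₀ α β δ R ℓ n₀ P := by
  have := h.isProb
  refine ⟨h.isProb, h.mixing.ergodic h.stationary hβ, h.positive.condExp_ge, ?_, h1, h2⟩
  intro k hk₀ A B hA hB hA0 hB0
  have hgap : (0 : ℤ) + κ ≤ k := by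
    have : κ ≤ k := hk.trans hk₀
    omega
  have hlow := h.mixing.lower 0 k hgap A B hA hB
  have hup := h.mixing.upper 0 k hgap A B hA hB
  have hβ0 : 0 < β := by linarith
  have hAB : 0 < P.real (A ∩ B) := by
    by_contra hcon
    have : P.real (A ∩ B) = 0 := le_antisymm (not_lt.1 hcon) measureReal_nonneg
    rw [this, mul_zero] at hlow
    exact absurd hlow (not_le.2 (mul_pos hA0 hB0))
  have hc : (P[|A]).real B = (P.real A)⁻¹ * P.real (A ∩ B) := by
    simp only [Measure.real, cond_apply (coordSigma_le _ _ hA), ENNReal.toReal_mul,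
      ENNReal.toReal_inv]
  have he : P.real B / ((P.real A)⁻¹ * P.real (A ∩ B)) =
      P.real A * P.real B / P.real (A ∩ B) := by field_simp
  rw [hc, he, div_le_iff₀ hAB, div_le_div_iff₀ hβ0 hAB]
  exact ⟨by linarith, hlow⟩

end Ergodicity

/-! ### Hidden Markov chains with uniform stationary distribution -/

section HiddenMarkov

variable {σ : Type*}

/-- The average of a function over a finite set of states. -/
def avgOn (S : Finset σ) (f : σ → ℝ) : ℝ := (∑ s ∈ S, f s) / S.card

/-- The transition operator of a Markov chain. -/
def stepOp (S : Finset σ) (T : σ → σ → ℝ) (f : σ → ℝ) (s : σ) : ℝ := ∑ s' ∈ S, T s s' * f s'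

/-- The expectation of `f` at the state following an emitted word, on the event that this word is
emitted, as a function of the initial state. -/
def wordOp (S : Finset σ) (T : σ → σ → ℝ) (e : σ → Bool → ℝ) : List Bool → (σ → ℝ) → σ → ℝ
  | [], f => f
  | a :: l, f => fun s => e s a * stepOp S T (wordOp S T e l f) s

/-- The probability that a word is emitted when the initial state is uniform. -/
def wordProb (S : Finset σ) (T : σ → σ → ℝ) (e : σ → Bool → ℝ) (l : List Bool) : ℝ :=
  avgOn S (wordOp S T e l fun _ => 1)

/-- A doubly stochastic chain on `S` with emission probabilities `e`. -/
structure IsHiddenMarkov (S : Finset σ) (T : σ → σ → ℝ) (e : σ → Bool → ℝ) : Prop where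
  nonempty : S.Nonempty
  trans_nonneg : ∀ s s', 0 ≤ T s s'
  row_sum : ∀ s ∈ S, ∑ s' ∈ S, T s s' = 1
  col_sum : ∀ s' ∈ S, ∑ s ∈ S, T s s' = 1
  emit_nonneg : ∀ s a, 0 ≤ e s a
  emit_sum : ∀ s, ∑ a, e s a = 1

variable {S : Finset σ} {T : σ → σ → ℝ} {e : σ → Bool → ℝ}

lemma avgOn_congr {f g : σ → ℝ} (h : ∀ s ∈ S, f s = g s) : avgOn S f = avgOn S g := by
  simp only [avgOn, Finset.sum_congr rfl h]

lemma avgOn_mono {f g : σ → ℝ} (h : ∀ s ∈ S, f s ≤ g s) : avgOn S f ≤ avgOn S g :=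
  div_le_div_of_nonneg_right (Finset.sum_le_sum h) (Nat.cast_nonneg _)

lemma avgOn_nonneg {f : σ → ℝ} (h : ∀ s ∈ S, 0 ≤ f s) : 0 ≤ avgOn S f :=
  div_nonneg (Finset.sum_nonneg h) (Nat.cast_nonneg _)

lemma avgOn_const_mul (c : ℝ) (f : σ → ℝ) : avgOn S (fun s => c * f s) = c * avgOn S f := by
  simp only [avgOn, ← Finset.mul_sum, mul_div_assoc]

lemma avgOn_finsetSum {ι : Type*} (J : Finset ι) (f : ι → σ → ℝ) :
    avgOn S (fun s => ∑ i ∈ J, f i s) = ∑ i ∈ J, avgOn S (f i) := by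
  simp only [avgOn, Finset.sum_comm (s := S), Finset.sum_div]

lemma avgOn_const (hS : S.Nonempty) (c : ℝ) : avgOn S (fun _ => c) = c := by
  have : (S.card : ℝ) ≠ 0 := by exact_mod_cast hS.card_pos.ne'
  simp only [avgOn, Finset.sum_const, nsmul_eq_mul]
  field_simp

lemma le_card_mul_avgOn {f : σ → ℝ} (h : ∀ s ∈ S, 0 ≤ f s) {s : σ} (hs : s ∈ S) :
    f s ≤ S.card * avgOn S f := by
  have : (S.card : ℝ) ≠ 0 := by exact_mod_cast (Finset.card_pos.2 ⟨s, hs⟩).ne'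
  rw [avgOn, mul_div_cancel₀ _ this]
  exact Finset.single_le_sum h hs

lemma stepOp_congr {f g : σ → ℝ} (h : ∀ s ∈ S, f s = g s) (s : σ) :
    stepOp S T f s = stepOp S T g s :=
  Finset.sum_congr rfl fun s' hs' => by rw [h s' hs']

lemma stepOp_const_mul (c : ℝ) (f : σ → ℝ) (s : σ) :
    stepOp S T (fun s => c * f s) s = c * stepOp S T f s := by
  simp only [stepOp, Finset.mul_sum, mul_left_comm]

lemma stepOp_finsetSum {ι : Type*} (J : Finset ι) (f : ι → σ → ℝ) (s : σ) :
    stepOp S T (fun s => ∑ i ∈ J, f i s) s = ∑ i ∈ J, stepOp S T (f i) s := by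
  simp only [stepOp, Finset.mul_sum]
  exact Finset.sum_comm

lemma wordOp_congr {f g : σ → ℝ} (h : ∀ s ∈ S, f s = g s) :
    ∀ (l : List Bool), ∀ s ∈ S, wordOp S T e l f s = wordOp S T e l g s
  | [], s, hs => h s hs
  | a :: l, s, _ => by
    simp only [wordOp]
    rw [stepOp_congr (wordOp_congr h l)]

lemma wordOp_append (l l' : List Bool) (f : σ → ℝ) :
    wordOp S T e (l ++ l') f = wordOp S T e l (wordOp S T e l' f) := by
  induction l with
  | nil => rfl
  | cons a l ih => simp only [List.cons_append, wordOp, ih]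

lemma wordOp_const_mul (l : List Bool) (c : ℝ) (f : σ → ℝ) :
    wordOp S T e l (fun s => c * f s) = fun s => c * wordOp S T e l f s := by
  induction l with
  | nil => rfl
  | cons a l ih =>
    funext s
    simp only [wordOp, ih, stepOp_const_mul, mul_left_comm]

lemma wordOp_finsetSum {ι : Type*} (J : Finset ι) (l : List Bool) (f : ι → σ → ℝ) :
    wordOp S T e l (fun s => ∑ i ∈ J, f i s) = fun s => ∑ i ∈ J, wordOp S T e l (f i) s := by
  induction l with
  | nil => rfl
  | cons a l ih =>
    funext s
    simp only [wordOp, ih, stepOp_finsetSum, Finset.mul_sum]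

namespace IsHiddenMarkov

variable (h : IsHiddenMarkov S T e)
include h

lemma stepOp_mono {f g : σ → ℝ} (hfg : ∀ s ∈ S, f s ≤ g s) (s : σ) :
    stepOp S T f s ≤ stepOp S T g s :=
  Finset.sum_le_sum fun s' hs' => mul_le_mul_of_nonneg_left (hfg s' hs') (h.trans_nonneg s s')

lemma stepOp_nonneg {f : σ → ℝ} (hf : ∀ s ∈ S, 0 ≤ f s) (s : σ) : 0 ≤ stepOp S T f s :=
  Finset.sum_nonneg fun s' hs' => mul_nonneg (h.trans_nonneg s s') (hf s' hs')

lemma stepOp_const (c : ℝ) {s : σ} (hs : s ∈ S) : stepOp S T (fun _ => c) s = c := by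
  rw [stepOp, ← Finset.sum_mul, h.row_sum s hs, one_mul]

/-- Columns sum to one, so the uniform law is stationary. -/
lemma avgOn_stepOp (f : σ → ℝ) : avgOn S (stepOp S T f) = avgOn S f := by
  simp only [avgOn, stepOp]
  rw [Finset.sum_comm]
  simp only [← Finset.sum_mul]
  rw [Finset.sum_congr rfl fun s hs => by rw [h.col_sum s hs, one_mul]]

lemma avgOn_iterate_stepOp (j : ℕ) (f : σ → ℝ) : avgOn S ((stepOp S T)^[j] f) = avgOn S f := by
  induction j with
  | zero => rfl
  | succ j ih => rw [Function.iterate_succ_apply', h.avgOn_stepOp, ih]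

lemma iterate_stepOp_nonneg (j : ℕ) {f : σ → ℝ} (hf : ∀ s ∈ S, 0 ≤ f s) :
    ∀ s ∈ S, 0 ≤ (stepOp S T)^[j] f s := by
  induction j with
  | zero => exact hf
  | succ j ih =>
    intro s _
    rw [Function.iterate_succ_apply']
    exact h.stepOp_nonneg ih s

lemma wordOp_mono {f g : σ → ℝ} (hfg : ∀ s ∈ S, f s ≤ g s) :
    ∀ (l : List Bool), ∀ s ∈ S, wordOp S T e l f s ≤ wordOp S T e l g s
  | [], s, hs => hfg s hs
  | a :: l, s, _ =>
    mul_le_mul_of_nonneg_left (h.stepOp_mono (wordOp_mono hfg l) s) (h.emit_nonneg s a)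

lemma wordOp_nonneg {f : σ → ℝ} (hf : ∀ s ∈ S, 0 ≤ f s) :
    ∀ (l : List Bool), ∀ s ∈ S, 0 ≤ wordOp S T e l f s
  | [], s, hs => hf s hs
  | a :: l, s, _ => mul_nonneg (h.emit_nonneg s a) (h.stepOp_nonneg (wordOp_nonneg hf l) s)

lemma wordProb_nonneg (l : List Bool) : 0 ≤ wordProb S T e l :=
  avgOn_nonneg (h.wordOp_nonneg (fun _ _ => zero_le_one) l)

lemma wordProb_nil : wordProb S T e [] = 1 := avgOn_const h.nonempty 1

lemma sum_wordOp_cons (l : List Bool) (f : σ → ℝ) (s : σ) :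
    ∑ a, wordOp S T e (a :: l) f s = stepOp S T (wordOp S T e l f) s := by
  simp only [wordOp, ← Finset.sum_mul, h.emit_sum, one_mul]

lemma sum_wordOp_concat (l : List Bool) (f : σ → ℝ) :
    (fun s => ∑ a, wordOp S T e (l ++ [a]) f s) = wordOp S T e l (stepOp S T f) := by
  simp only [wordOp_append]
  rw [← wordOp_finsetSum]
  congr 1
  funext s
  exact h.sum_wordOp_cons [] f s

lemma sum_wordProb_cons (l : List Bool) : ∑ a, wordProb S T e (a :: l) = wordProb S T e l := by
  simp only [wordProb]
  rw [← avgOn_finsetSum]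
  simp only [h.sum_wordOp_cons]
  exact h.avgOn_stepOp _

lemma sum_wordProb_concat (l : List Bool) : ∑ a, wordProb S T e (l ++ [a]) = wordProb S T e l := by
  simp only [wordProb]
  rw [← avgOn_finsetSum, h.sum_wordOp_concat]
  exact avgOn_congr (wordOp_congr (fun s hs => h.stepOp_const 1 hs) l)

/-- The law of the process emitted by a stationary hidden Markov chain. -/
lemma exists_measure : ∃ P : Measure (ℤ → Bool), IsProbabilityMeasure P ∧
    ∀ (t : ℤ) (l : List Bool), P.real (wordAt t l) = wordProb S T e l :=
  exists_measure_wordAt h.wordProb_nonneg h.wordProb_nil h.sum_wordProb_cons h.sum_wordProb_concat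

/-- Summing over an unread letter removes its emission factor, so each place of the gap contributes
a bare transition. -/
lemma measureReal_wordAt_inter {P : Measure (ℤ → Bool)} [IsProbabilityMeasure P]
    (hP : ∀ (t : ℤ) (l : List Bool), P.real (wordAt t l) = wordProb S T e l) (t : ℤ)
    (l' : List Bool) (j : ℕ) (l : List Bool) :
    P.real (wordAt t l ∩ wordAt (t + l.length + j) l') =
      avgOn S (wordOp S T e l ((stepOp S T)^[j] (wordOp S T e l' fun _ => 1))) := by
  induction j generalizing l with
  | zero =>
    rw [Nat.cast_zero, add_zero, ← wordAt_append, hP, wordProb, wordOp_append]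
    rfl
  | succ j ih =>
    rw [← sum_measureReal_inter_letter P (t + l.length)]
    have : ∀ a, P.real (wordAt t l ∩ wordAt (t + l.length + (j + 1 : ℕ)) l' ∩
        {ω | ω (t + l.length) = a}) = avgOn S (wordOp S T e (l ++ [a])
          ((stepOp S T)^[j] (wordOp S T e l' fun _ => 1))) := by
      intro a
      rw [← ih (l ++ [a]), wordAt_append]
      congr 1
      simp only [wordAt, Set.inter_univ, List.length_append, List.length_cons, List.length_nil]
      rw [Set.inter_right_comm]
      congr 2
      push_cast
      ring
    simp only [this]
    rw [← avgOn_finsetSum, h.sum_wordOp_concat, ← Function.iterate_succ_apply' (stepOp S T)]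

/-- Uniform ergodicity of the chain makes the emitted process strongly mixing. -/
lemma stronglyMixing {P : Measure (ℤ → Bool)} [IsProbabilityMeasure P]
    (hP : ∀ (t : ℤ) (l : List Bool), P.real (wordAt t l) = wordProb S T e l) {β : ℝ} (hβ : 0 < β)
    {k : ℕ} (hk : ∀ j, k ≤ j → ∀ f : σ → ℝ, (∀ s ∈ S, 0 ≤ f s) → ∀ s ∈ S,
      avgOn S f ≤ β * (stepOp S T)^[j] f s ∧ (stepOp S T)^[j] f s ≤ β * avgOn S f) :
    StronglyMixing (k + 1) β P := by
  refine stronglyMixing_of_words (Nat.le_add_left 1 k) hβ fun t l l' j hj => ?_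
  rw [hP, hP, h.measureReal_wordAt_inter hP]
  set g := wordOp S T e l' fun _ => 1 with hg
  have hgn : ∀ s ∈ S, 0 ≤ g s := h.wordOp_nonneg (fun _ _ => zero_le_one) l'
  have hkj := hk j (by omega) g hgn
  have key : wordProb S T e l * wordProb S T e l' =
      avgOn S (wordOp S T e l fun _ => avgOn S g) := by
    have : (fun _ : σ => avgOn S g) = fun _ => avgOn S g * 1 := by simp
    rw [this, wordOp_const_mul, avgOn_const_mul, mul_comm]
    rfl
  rw [key]
  constructor
  · rw [← avgOn_const_mul, ← wordOp_const_mul]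
    exact avgOn_mono (h.wordOp_mono (fun s hs => (hkj s hs).1) l)
  · rw [← avgOn_const_mul, ← wordOp_const_mul]
    exact avgOn_mono (h.wordOp_mono (fun s hs => (hkj s hs).2) l)

/-- Given the hidden states the letters are independent, and each takes each value with probability
at least `δ`. -/
lemma positiveTransitions {P : Measure (ℤ → Bool)} [IsProbabilityMeasure P]
    (hP : ∀ (t : ℤ) (l : List Bool), P.real (wordAt t l) = wordProb S T e l) {δ : ℝ} (hδ : 0 ≤ δ)
    (he : ∀ s ∈ S, ∀ a, δ ≤ e s a) : PositiveTransitions δ P := by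
  refine positiveTransitions_of_words hδ fun t l l' a => ?_
  simp only [hP, wordProb, wordOp_append]
  rw [← avgOn_finsetSum, ← wordOp_finsetSum, ← avgOn_const_mul, ← wordOp_const_mul]
  refine avgOn_mono (h.wordOp_mono (fun s hs => ?_) l)
  rw [h.sum_wordOp_cons]
  exact mul_le_mul_of_nonneg_right (he s hs a)
    (h.stepOp_nonneg (h.wordOp_nonneg (fun _ _ => zero_le_one) l') s)

lemma iterate_stepOp_affine (j : ℕ) (a c : ℝ) (f : σ → ℝ) :
    ∀ s ∈ S, (stepOp S T)^[j] (fun s => a * f s + c) s = a * (stepOp S T)^[j] f s + c := by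
  induction j with
  | zero => intro s _; rfl
  | succ j ih =>
    intro s hs
    rw [Function.iterate_succ_apply', Function.iterate_succ_apply', stepOp_congr ih]
    simp only [stepOp, mul_add, Finset.sum_add_distrib, ← Finset.sum_mul, h.row_sum s hs, one_mul,
      Finset.mul_sum, mul_left_comm]

lemma avgOn_affine (a c : ℝ) (f : σ → ℝ) : avgOn S (fun s => a * f s + c) = a * avgOn S f + c := by
  rw [← avgOn_const_mul]
  have := avgOn_const h.nonempty c
  simp only [avgOn] at this
  simp only [avgOn, Finset.sum_add_distrib, add_div, this]

/-- Doeblin's theorem, for nonnegative functions. -/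
lemma abs_iterate_stepOp_sub_le {H : ℕ} {γ : ℝ}
    (hH : ∀ f : σ → ℝ, (∀ s ∈ S, 0 ≤ f s) → ∀ s ∈ S, γ * avgOn S f ≤ (stepOp S T)^[H] f s)
    {f : σ → ℝ} (hf : ∀ s ∈ S, 0 ≤ f s) (m r : ℕ) :
    ∀ s ∈ S, |(stepOp S T)^[r + H * m] f s - avgOn S f| ≤ (1 - γ) ^ m * (S.card * avgOn S f) := by
  induction m with
  | zero =>
    intro s hs
    have h1 := h.iterate_stepOp_nonneg r hf
    have h2 := le_card_mul_avgOn h1 hs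
    have h3 := h1 s hs
    rw [h.avgOn_iterate_stepOp] at h2
    have h4 : avgOn S f ≤ S.card * avgOn S f :=
      le_mul_of_one_le_left (avgOn_nonneg hf) (by exact_mod_cast h.nonempty.card_pos)
    have h5 := avgOn_nonneg hf
    rw [mul_zero, add_zero, pow_zero, one_mul, abs_le]
    constructor <;> linarith
  | succ m ih =>
    intro s hs
    set D := (1 - γ) ^ m * (S.card * avgOn S f) with hD
    set g := (stepOp S T)^[r + H * m] f with hg
    have hgavg : avgOn S g = avgOn S f := h.avgOn_iterate_stepOp _ _
    have hiter : (stepOp S T)^[r + H * (m + 1)] f = (stepOp S T)^[H] g := by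
      rw [hg, ← Function.iterate_add_apply]
      congr 1
      ring
    -- The induction hypothesis makes `D + (g - avg)` and `D - (g - avg)` nonnegative. The
    -- minorisation applied to both bounds the new deviation by `(1 - γ) D` on either side.
    have h1 := hH (fun s => 1 * g s + (D - avgOn S f))
      (fun s hs => by have := abs_le.1 (ih s hs); linarith) s hs
    have h2 := hH (fun s => (-1) * g s + (D + avgOn S f))
      (fun s hs => by have := abs_le.1 (ih s hs); linarith) s hs
    rw [h.avgOn_affine, h.iterate_stepOp_affine _ _ _ _ s hs, hgavg] at h1 h2
    rw [hiter, pow_succ', mul_assoc, ← hD, abs_le]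
    constructor <;> nlinarith

/-- A relative deviation of at most `1 - 1/β` gives both inequalities, because `2 - 1/β ≤ β`. -/
lemma iterate_stepOp_bounds {H : ℕ} {γ : ℝ}
    (hH : ∀ f : σ → ℝ, (∀ s ∈ S, 0 ≤ f s) → ∀ s ∈ S, γ * avgOn S f ≤ (stepOp S T)^[H] f s)
    {β : ℝ} (hβ : 1 < β) {m : ℕ} (hm : (1 - γ) ^ m * S.card ≤ 1 - 1 / β) :
    ∀ j, H * m ≤ j → ∀ f : σ → ℝ, (∀ s ∈ S, 0 ≤ f s) → ∀ s ∈ S,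
      avgOn S f ≤ β * (stepOp S T)^[j] f s ∧ (stepOp S T)^[j] f s ≤ β * avgOn S f := by
  intro j hj f hf s hs
  have h1 := h.abs_iterate_stepOp_sub_le hH hf m (j - H * m) s hs
  have h0 := avgOn_nonneg hf
  rw [Nat.sub_add_cancel hj, ← mul_assoc] at h1
  have h2 := abs_le.1 (h1.trans (mul_le_mul_of_nonneg_right hm h0))
  have hβ0 : 0 < β := by linarith
  have h3 : β * (1 / β) = 1 := by field_simp
  have h4 : 2 - 1 / β ≤ β := by
    have : 0 ≤ (β - 1) ^ 2 / β := by positivity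
    have e : (β - 1) ^ 2 / β = β - 2 + 1 / β := by field_simp; ring
    linarith
  constructor
  · have h5 : avgOn S f * (1 / β) ≤ (stepOp S T)^[j] f s := by linarith [h2.1]
    calc avgOn S f = β * (avgOn S f * (1 / β)) := by field_simp
      _ ≤ _ := mul_le_mul_of_nonneg_left h5 hβ0.le
  · calc (stepOp S T)^[j] f s ≤ (2 - 1 / β) * avgOn S f := by linarith [h2.2]
      _ ≤ _ := mul_le_mul_of_nonneg_right h4 h0

end IsHiddenMarkov

end HiddenMarkov

/-! ### The chain of cycles -/

section Cycles

variable {ℓ ν : ℕ} {B : Finset (Fin ℓ → Bool)} {δ : ℝ}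

/-- The probability of observing `a` when the noiseless letter is `b`. -/
def flipProb (δ : ℝ) (b a : Bool) : ℝ := if a = b then 1 - δ else δ

lemma flipProb_nonneg (h0 : 0 ≤ δ) (h1 : δ ≤ 1) (b a : Bool) : 0 ≤ flipProb δ b a := by
  unfold flipProb; split_ifs <;> linarith

lemma sum_flipProb (b : Bool) : ∑ a, flipProb δ b a = 1 := by
  cases b <;> simp [flipProb]

lemma mem_cycleStates {s : CycleState ℓ} :
    s ∈ cycleStates ν B ↔ s.1 ∈ B ∧ (1 ≤ s.2.1 ∧ s.2.1 ≤ ℓ) ∧ s.2.2 < ν * ℓ + s.2.1 := by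
  simp only [cycleStates, Finset.mem_filter, Finset.mem_product, Finset.mem_Icc, Finset.mem_range]
  constructor
  · rintro ⟨⟨h1, h2, _⟩, h4⟩; exact ⟨h1, h2, h4⟩
  · rintro ⟨h1, h2, h4⟩; exact ⟨⟨h1, h2, by omega⟩, h4⟩

lemma sum_cycleStates (f : CycleState ℓ → ℝ) :
    ∑ s ∈ cycleStates ν B, f s =
      ∑ x ∈ B, ∑ v ∈ Finset.Icc 1 ℓ, ∑ t ∈ Finset.range (ν * ℓ + v), f (x, v, t) := by
  rw [cycleStates, Finset.sum_filter, Finset.sum_product]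
  refine Finset.sum_congr rfl fun x _ => ?_
  rw [Finset.sum_product]
  refine Finset.sum_congr rfl fun v hv => ?_
  rw [← Finset.sum_filter]
  refine Finset.sum_congr ?_ fun _ _ => rfl
  ext t
  simp only [Finset.mem_filter, Finset.mem_range, Finset.mem_Icc] at hv ⊢
  omega

lemma card_cycleStates_ge : B.card * ℓ * (ν * ℓ) ≤ (cycleStates ν B).card := by
  have h := sum_cycleStates (ν := ν) (B := B) (fun _ => (1 : ℝ))
  simp only [Finset.sum_const, nsmul_eq_mul, mul_one, Finset.card_range] at h
  have h2 : ((B.card * ℓ * (ν * ℓ) : ℕ) : ℝ) ≤ ((cycleStates ν B).card : ℝ) := by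
    rw [h]
    push_cast
    rw [mul_assoc]
    refine mul_le_mul_of_nonneg_left ?_ (Nat.cast_nonneg _)
    calc (ℓ : ℝ) * (ν * ℓ) = ∑ v ∈ Finset.Icc 1 ℓ, (ν * ℓ : ℝ) := by simp
      _ ≤ _ := Finset.sum_le_sum fun v _ => by simp
  exact_mod_cast h2

lemma card_cycleStates_le : (cycleStates ν B).card ≤ B.card * ℓ * ((ν + 1) * ℓ) := by
  refine (Finset.card_filter_le _ _).trans ?_
  simp only [Finset.card_product, Nat.card_Icc, Finset.card_range]
  apply le_of_eq
  simp
  ring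

lemma cycleTransition_nonneg (s s' : CycleState ℓ) : 0 ≤ cycleTransition ν B s s' := by
  unfold cycleTransition
  split_ifs <;> positivity

lemma stepOp_cycle_inside (f : CycleState ℓ → ℝ) {x : Fin ℓ → Bool} {v t : ℕ}
    (hs : (x, v, t) ∈ cycleStates ν B) (h : t + 1 < ν * ℓ + v) :
    stepOp (cycleStates ν B) (cycleTransition ν B) f (x, v, t) = f (x, v, t + 1) := by
  have : (x, v, t + 1) ∈ cycleStates ν B := by
    rw [mem_cycleStates] at hs ⊢
    exact ⟨hs.1, hs.2.1, h⟩
  simp only [stepOp, cycleTransition, if_pos h, ite_mul, one_mul, zero_mul]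
  rw [Finset.sum_ite_eq' _ _ f, if_pos this]

/-- The mean of a function over the first states of a cycle. -/
def restartMean (B : Finset (Fin ℓ → Bool)) (f : CycleState ℓ → ℝ) : ℝ :=
  (∑ x ∈ B, ∑ v ∈ Finset.Icc 1 ℓ, f (x, v, 0)) / (B.card * ℓ)

lemma stepOp_cycle_last (f : CycleState ℓ → ℝ) {x : Fin ℓ → Bool} {v t : ℕ}
    (h : ¬ t + 1 < ν * ℓ + v) :
    stepOp (cycleStates ν B) (cycleTransition ν B) f (x, v, t) = restartMean B f := by
  simp only [stepOp, cycleTransition, if_neg h, ite_mul, zero_mul]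
  rw [sum_cycleStates, restartMean, Finset.sum_div]
  refine Finset.sum_congr rfl fun x _ => ?_
  rw [Finset.sum_div]
  refine Finset.sum_congr rfl fun v hv => ?_
  have : 0 < ν * ℓ + v := by have := (Finset.mem_Icc.1 hv).1; omega
  rw [Finset.sum_ite_eq' (Finset.range (ν * ℓ + v)) 0 fun t => 1 / ((B.card : ℝ) * ℓ) * f (x, v, t),
    if_pos (Finset.mem_range.2 this)]
  ring

lemma restartMean_const (hB : B.Nonempty) (hℓ : 1 ≤ ℓ) (c : ℝ) :
    restartMean B (fun _ => c) = c := by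
  have h1 : (B.card : ℝ) ≠ 0 := by exact_mod_cast hB.card_pos.ne'
  have h2 : (ℓ : ℝ) ≠ 0 := by positivity
  simp only [restartMean, Finset.sum_const, Nat.card_Icc, nsmul_eq_mul, add_tsub_cancel_right]
  field_simp

/-- For the column sums: a later place of a cycle has exactly one predecessor, and a first place is
entered with probability `1/(|B| ℓ)` from each of the `|B| ℓ` last places. This is why the uniform
phase is stationary. -/
lemma isHiddenMarkov_cycle (hB : B.Nonempty) (hℓ : 1 ≤ ℓ) (h0 : 0 ≤ δ) (h1 : δ ≤ 1) :
    IsHiddenMarkov (cycleStates ν B) (cycleTransition ν B) fun s a => flipProb δ (cycleLetter s) a where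
  nonempty := by
    obtain ⟨x, hx⟩ := hB
    exact ⟨(x, 1, 0), mem_cycleStates.2 ⟨hx, ⟨le_rfl, hℓ⟩, by simp⟩⟩
  trans_nonneg := cycleTransition_nonneg
  row_sum := by
    rintro ⟨x, v, t⟩ hs
    have e : ∑ s' ∈ cycleStates ν B, cycleTransition ν B (x, v, t) s' =
        stepOp (cycleStates ν B) (cycleTransition ν B) (fun _ => 1) (x, v, t) := by
      simp [stepOp]
    rw [e]
    by_cases h : t + 1 < ν * ℓ + v
    · rw [stepOp_cycle_inside _ hs h]
    · rw [stepOp_cycle_last _ h, restartMean_const hB hℓ]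
  col_sum := by
    rintro ⟨x', v', t'⟩ hs'
    obtain ⟨hx, hv, ht⟩ := mem_cycleStates.1 hs'
    simp only at hx hv ht
    rcases t' with _ | t'
    · have : ∀ x ∈ B, ∀ v ∈ Finset.Icc 1 ℓ, ∑ t ∈ Finset.range (ν * ℓ + v),
          cycleTransition ν B (x, v, t) (x', v', 0) = 1 / (B.card * ℓ) := by
        intro x _ v hv
        have hv1 := (Finset.mem_Icc.1 hv).1
        rw [Finset.sum_eq_single (ν * ℓ + v - 1)]
        · rw [cycleTransition, if_neg (by simp only; omega), if_pos rfl]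
        · intro t ht hne
          have := Finset.mem_range.1 ht
          rw [cycleTransition, if_pos (by simp only; omega), if_neg (by simp)]
        · intro hn
          exact absurd (Finset.mem_range.2 (by omega)) hn
      rw [sum_cycleStates, Finset.sum_congr rfl fun x hx => Finset.sum_congr rfl (this x hx)]
      have h1 : (B.card : ℝ) ≠ 0 := by exact_mod_cast hB.card_pos.ne'
      have h2 : (ℓ : ℝ) ≠ 0 := by positivity
      simp only [Finset.sum_const, Nat.card_Icc, nsmul_eq_mul, add_tsub_cancel_right]
      field_simp
    · rw [Finset.sum_eq_single (x', v', t')]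
      · rw [cycleTransition, if_pos (by simpa using ht), if_pos rfl]
      · rintro ⟨x, v, t⟩ _ hne
        unfold cycleTransition
        split_ifs with h1 h2 h3
        · simp only [Prod.mk.injEq, add_left_inj] at h2
          exact absurd (by rw [h2.1, h2.2.1, h2.2.2]) hne
        · rfl
        · simp at h3
        · rfl
      · intro hn
        exact absurd (mem_cycleStates.2 ⟨hx, hv, by simp only; omega⟩) hn
  emit_nonneg := fun s a => flipProb_nonneg h0 h1 _ _
  emit_sum := fun s => sum_flipProb _

lemma sum_piFinset_succ {σ : Type*} (S : Finset σ) (n : ℕ) (F : (Fin (n + 1) → σ) → ℝ) :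
    ∑ s ∈ Fintype.piFinset (fun _ : Fin (n + 1) => S), F s =
      ∑ a ∈ S, ∑ s ∈ Fintype.piFinset (fun _ : Fin n => S), F (Fin.cons a s) := by
  rw [← Finset.sum_product']
  refine Finset.sum_nbij' (fun s => (s 0, Fin.tail s)) (fun p => Fin.cons p.1 p.2) ?_ ?_ ?_ ?_ ?_
  · intro s hs
    rw [Fintype.mem_piFinset] at hs
    exact Finset.mem_product.2 ⟨hs 0, Fintype.mem_piFinset.2 fun i => hs i.succ⟩
  · intro p hp
    rw [Finset.mem_product, Fintype.mem_piFinset] at hp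
    refine Fintype.mem_piFinset.2 fun i => ?_
    refine Fin.cases ?_ (fun i => ?_) i
    · exact hp.1
    · simpa using hp.2 i
  · intro s _
    exact Fin.cons_self_tail s
  · intro p _
    simp
  · intro s _
    simp [Fin.cons_self_tail]

lemma IsHiddenMarkov.wordOp_ofFn {σ : Type*} {S : Finset σ} {T : σ → σ → ℝ} {e : σ → Bool → ℝ}
    (h : IsHiddenMarkov S T e) {n : ℕ} (y : Fin (n + 1) → Bool) {s₀ : σ} (hs₀ : s₀ ∈ S) :
    wordOp S T e (List.ofFn y) (fun _ => 1) s₀ =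
      ∑ s ∈ Fintype.piFinset (fun _ : Fin n => S),
        (∏ i : Fin n, T ((Fin.cons s₀ s : Fin (n + 1) → σ) i.castSucc)
          ((Fin.cons s₀ s : Fin (n + 1) → σ) i.succ)) *
        ∏ i : Fin (n + 1), e ((Fin.cons s₀ s : Fin (n + 1) → σ) i) (y i) := by
  induction n generalizing s₀ with
  | zero => simp [wordOp, h.stepOp_const 1 hs₀]
  | succ n ih =>
    rw [List.ofFn_succ, sum_piFinset_succ]
    simp only [wordOp, stepOp, Finset.mul_sum (s := S)]
    refine Finset.sum_congr rfl fun s₁ hs₁ => ?_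
    rw [ih _ hs₁, Finset.mul_sum, Finset.mul_sum]
    refine Finset.sum_congr rfl fun s _ => ?_
    have e1 : ∏ i : Fin (n + 1), T ((Fin.cons s₀ (Fin.cons s₁ s : Fin (n + 1) → σ) :
        Fin (n + 2) → σ) i.castSucc) ((Fin.cons s₀ (Fin.cons s₁ s : Fin (n + 1) → σ) :
        Fin (n + 2) → σ) i.succ) = T s₀ s₁ * ∏ i : Fin n, T ((Fin.cons s₁ s : Fin (n + 1) → σ)
          i.castSucc) ((Fin.cons s₁ s : Fin (n + 1) → σ) i.succ) := by
      rw [Fin.prod_univ_succ]; rfl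
    have e2 : ∏ i : Fin (n + 2), e ((Fin.cons s₀ (Fin.cons s₁ s : Fin (n + 1) → σ) :
        Fin (n + 2) → σ) i) (y i) = e s₀ (y 0) *
          ∏ i : Fin (n + 1), e ((Fin.cons s₁ s : Fin (n + 1) → σ) i) (y i.succ) := by
      rw [Fin.prod_univ_succ]; rfl
    rw [e1, e2]
    ring

lemma ditheredBlockProb_eq (hB : B.Nonempty) (hℓ : 1 ≤ ℓ) (h0 : 0 ≤ δ) (h1 : δ ≤ 1) {n : ℕ}
    (y : Fin (n + 1) → Bool) :
    ditheredBlockProb ν δ B y = wordProb (cycleStates ν B) (cycleTransition ν B)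
      (fun s a => flipProb δ (cycleLetter s) a) (List.ofFn y) := by
  have h := isHiddenMarkov_cycle (ν := ν) hB hℓ h0 h1
  rw [ditheredBlockProb, wordProb, avgOn, sum_piFinset_succ, Finset.sum_div]
  refine Finset.sum_congr rfl fun s₀ hs₀ => ?_
  rw [h.wordOp_ofFn y hs₀, Finset.sum_div]
  refine Finset.sum_congr rfl fun s _ => ?_
  simp only [flipProb]
  ring

/-! #### Doeblin's condition -/

lemma iterate_stepOp_inside (f : CycleState ℓ → ℝ) {x : Fin ℓ → Bool} {v t : ℕ}
    (hx : x ∈ B) (hv : 1 ≤ v ∧ v ≤ ℓ) (j : ℕ) (h : t + j < ν * ℓ + v) :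
    (stepOp (cycleStates ν B) (cycleTransition ν B))^[j] f (x, v, t) = f (x, v, t + j) := by
  induction j generalizing t with
  | zero => rfl
  | succ j ih =>
    rw [Function.iterate_succ_apply', stepOp_cycle_inside _
      (mem_cycleStates.2 ⟨hx, hv, by simp only; omega⟩) (by omega), ih (by omega)]
    congr 3
    omega

/-- From a state of a cycle, one passes to the first state of the next cycle. -/
lemma iterate_stepOp_restart (f : CycleState ℓ → ℝ) {x : Fin ℓ → Bool} {v t : ℕ}
    (hx : x ∈ B) (hv : 1 ≤ v ∧ v ≤ ℓ) (h : t < ν * ℓ + v) (k : ℕ) :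
    (stepOp (cycleStates ν B) (cycleTransition ν B))^[k + (ν * ℓ + v - t)] f (x, v, t) =
      restartMean B ((stepOp (cycleStates ν B) (cycleTransition ν B))^[k] f) := by
  obtain ⟨r, hr⟩ : ∃ r, ν * ℓ + v - t = r + 1 := ⟨ν * ℓ + v - t - 1, by omega⟩
  rw [hr]
  induction r generalizing t with
  | zero =>
    rw [zero_add, Function.iterate_succ_apply', stepOp_cycle_last _ (by omega)]
  | succ r ih =>
    rw [← add_assoc, Function.iterate_succ_apply', stepOp_cycle_inside _
      (mem_cycleStates.2 ⟨hx, hv, h⟩) (by omega), ih (by omega) (by omega)]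

lemma restartMean_nonneg {f : CycleState ℓ → ℝ}
    (hf : ∀ x ∈ B, ∀ v ∈ Finset.Icc 1 ℓ, 0 ≤ f (x, v, 0)) : 0 ≤ restartMean B f :=
  div_nonneg (Finset.sum_nonneg fun x hx => Finset.sum_nonneg (hf x hx)) (by positivity)

variable (hB : B.Nonempty) (hℓ : 1 ≤ ℓ) {f : CycleState ℓ → ℝ}
  (hf : ∀ s ∈ cycleStates ν B, 0 ≤ f s)
include hB hℓ hf

lemma iterate_cycle_nonneg (k : ℕ) : ∀ s ∈ cycleStates ν B,
    0 ≤ (stepOp (cycleStates ν B) (cycleTransition ν B))^[k] f s :=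
  (isHiddenMarkov_cycle hB hℓ le_rfl zero_le_one).iterate_stepOp_nonneg k hf

lemma restartMean_iterate_nonneg (k : ℕ) :
    0 ≤ restartMean B ((stepOp (cycleStates ν B) (cycleTransition ν B))^[k] f) :=
  restartMean_nonneg fun x hx v hv => iterate_cycle_nonneg hB hℓ hf k _
    (mem_cycleStates.2 ⟨hx, Finset.mem_Icc.1 hv, by have := (Finset.mem_Icc.1 hv).1; simp only; omega⟩)

/-- A fresh cycle has length `νℓ + v` with probability `1/ℓ`, and it then ends exactly when the next
one starts. -/
lemma restartMean_le_of_cycle (k : ℕ) {v : ℕ} (hv : 1 ≤ v ∧ v ≤ ℓ) :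
    restartMean B ((stepOp (cycleStates ν B) (cycleTransition ν B))^[k] f) ≤
      ℓ * restartMean B ((stepOp (cycleStates ν B) (cycleTransition ν B))^[k + (ν * ℓ + v)] f) := by
  set u := restartMean B ((stepOp (cycleStates ν B) (cycleTransition ν B))^[k] f) with hu
  have h1 : (B.card : ℝ) ≠ 0 := by exact_mod_cast hB.card_pos.ne'
  have h2 : (ℓ : ℝ) ≠ 0 := by positivity
  have hB' : ∑ x ∈ B, u = B.card * u := by simp
  have key : B.card * u ≤ ∑ x ∈ B, ∑ v' ∈ Finset.Icc 1 ℓ,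
      (stepOp (cycleStates ν B) (cycleTransition ν B))^[k + (ν * ℓ + v)] f (x, v', 0) := by
    rw [← hB']
    refine Finset.sum_le_sum fun x hx => ?_
    have := iterate_stepOp_restart f hx hv (ν := ν) (B := B) (t := 0) (by omega) k
    rw [Nat.sub_zero] at this
    rw [hu, ← this]
    exact Finset.single_le_sum (f := fun v' => (stepOp (cycleStates ν B)
      (cycleTransition ν B))^[k + (ν * ℓ + v)] f (x, v', 0)) (fun v' hv' =>
        iterate_cycle_nonneg hB hℓ hf _ _ (mem_cycleStates.2 ⟨hx, Finset.mem_Icc.1 hv', by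
          have := (Finset.mem_Icc.1 hv').1; simp only; omega⟩)) (Finset.mem_Icc.2 hv)
  rw [restartMean]
  have hpos : (0 : ℝ) < B.card := lt_of_le_of_ne (Nat.cast_nonneg _) (Ne.symm h1)
  calc u = (B.card * u) / B.card := by field_simp
    _ ≤ _ / B.card := div_le_div_of_nonneg_right key hpos.le
    _ = _ := by field_simp

/-- The excess lengths of `q` cycles can add up to any number from `q` to `qℓ`, so renewals are
possible at every time of a whole interval. -/
lemma restartMean_le_of_cycles (k q w : ℕ) (hw : q ≤ w ∧ w ≤ q * ℓ) :
    restartMean B ((stepOp (cycleStates ν B) (cycleTransition ν B))^[k] f) ≤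
      ℓ ^ q * restartMean B
        ((stepOp (cycleStates ν B) (cycleTransition ν B))^[k + (q * (ν * ℓ) + w)] f) := by
  induction q generalizing w with
  | zero =>
    obtain rfl : w = 0 := by omega
    simp
  | succ q ih =>
    obtain ⟨v, w', hv, hw', hvw⟩ : ∃ v w', (1 ≤ v ∧ v ≤ ℓ) ∧ (q ≤ w' ∧ w' ≤ q * ℓ) ∧ w = w' + v := by
      rw [add_mul, one_mul] at hw
      have hq : q ≤ q * ℓ := Nat.le_mul_of_pos_right q hℓ
      by_cases h : w ≤ q + ℓ
      · exact ⟨w - q, q, by omega, ⟨le_rfl, hq⟩, by omega⟩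
      · exact ⟨ℓ, w - ℓ, ⟨hℓ, le_rfl⟩, by omega, by omega⟩
    refine (ih w' hw').trans ?_
    rw [pow_succ, mul_assoc]
    refine mul_le_mul_of_nonneg_left ?_ (by positivity)
    refine (restartMean_le_of_cycle hB hℓ hf _ hv).trans (le_of_eq ?_)
    rw [hvw, show k + (q * (ν * ℓ) + w') + (ν * ℓ + v) =
      k + ((q + 1) * (ν * ℓ) + (w' + v)) by ring]

/-- A state at place `t` is reached from the first state of its cycle in `t` steps. The average over
all states is therefore controlled by renewal values at times below `(ν + 1)ℓ`. -/
lemma avgOn_le_sum_restartMean (hν : 1 ≤ ν) :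
    avgOn (cycleStates ν B) f ≤ (∑ k ∈ Finset.range ((ν + 1) * ℓ), restartMean B
      ((stepOp (cycleStates ν B) (cycleTransition ν B))^[k] f)) / (ν * ℓ) := by
  have h1 : (0 : ℝ) < B.card := by exact_mod_cast hB.card_pos
  have h2 : (0 : ℝ) < ℓ := by positivity
  have h3 : (0 : ℝ) < ν := by positivity
  set U := stepOp (cycleStates ν B) (cycleTransition ν B) with hU
  have hsum : ∑ s ∈ cycleStates ν B, f s ≤
      (B.card * ℓ) * ∑ k ∈ Finset.range ((ν + 1) * ℓ), restartMean B (U^[k] f) := by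
    have e : ∀ k, (B.card * ℓ : ℝ) * restartMean B (U^[k] f) =
        ∑ x ∈ B, ∑ v ∈ Finset.Icc 1 ℓ, U^[k] f (x, v, 0) := fun k => by
      rw [restartMean]; field_simp
    have e' : (B.card * ℓ : ℝ) * ∑ k ∈ Finset.range ((ν + 1) * ℓ), restartMean B (U^[k] f) =
        ∑ x ∈ B, ∑ v ∈ Finset.Icc 1 ℓ, ∑ k ∈ Finset.range ((ν + 1) * ℓ), U^[k] f (x, v, 0) := by
      simp only [Finset.mul_sum, e]
      rw [Finset.sum_comm]
      exact Finset.sum_congr rfl fun x _ => Finset.sum_comm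
    rw [sum_cycleStates, e']
    refine Finset.sum_le_sum fun x hx => Finset.sum_le_sum fun v hv => ?_
    have hv' := Finset.mem_Icc.1 hv
    calc ∑ t ∈ Finset.range (ν * ℓ + v), f (x, v, t)
        = ∑ t ∈ Finset.range (ν * ℓ + v), U^[t] f (x, v, 0) :=
          Finset.sum_congr rfl fun t ht => by
            have := Finset.mem_range.1 ht
            rw [hU, iterate_stepOp_inside f hx hv' t (by omega), zero_add]
      _ ≤ _ := Finset.sum_le_sum_of_subset_of_nonneg
          (Finset.range_mono (by rw [add_mul, one_mul]; omega)) fun t _ _ =>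
            iterate_cycle_nonneg hB hℓ hf t _ (mem_cycleStates.2 ⟨hx, hv', by simp only; omega⟩)
  have hsum0 : 0 ≤ ∑ k ∈ Finset.range ((ν + 1) * ℓ), restartMean B (U^[k] f) :=
    Finset.sum_nonneg fun k _ => restartMean_iterate_nonneg hB hℓ hf k
  have hcard : (B.card * ℓ * (ν * ℓ) : ℝ) ≤ (cycleStates ν B).card := by
    exact_mod_cast card_cycleStates_ge
  rw [avgOn, div_le_div_iff₀ (lt_of_lt_of_le (by positivity) hcard) (by positivity)]
  calc (∑ s ∈ cycleStates ν B, f s) * (ν * ℓ)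
      ≤ (B.card * ℓ) * (∑ k ∈ Finset.range ((ν + 1) * ℓ), restartMean B (U^[k] f)) * (ν * ℓ) :=
        mul_le_mul_of_nonneg_right hsum (by positivity)
    _ = (∑ k ∈ Finset.range ((ν + 1) * ℓ), restartMean B (U^[k] f)) * (B.card * ℓ * (ν * ℓ)) := by
        ring
    _ ≤ _ := mul_le_mul_of_nonneg_left hcard hsum0

/-- Doeblin's condition for the chain of cycles. -/
lemma doeblin_cycle (hν : 1 ≤ ν) (hℓ2 : 2 ≤ ℓ) : ∀ s ∈ cycleStates ν B,
    1 / (2 * (ℓ : ℝ) ^ (4 * (ν + 1))) * avgOn (cycleStates ν B) f ≤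
      (stepOp (cycleStates ν B) (cycleTransition ν B))^[4 * (ν + 1) * (ν * ℓ) + 4 * (ν + 1) +
        2 * ((ν + 1) * ℓ)] f s := by
  rintro ⟨x, v, t⟩ hs
  obtain ⟨hx, hv, ht⟩ := mem_cycleStates.1 hs
  simp only at hx hv ht
  -- For `ℓ ≥ 2`, the renewal times after `q` cycles fill an interval of length at least `2(ν +
  -- 1)ℓ`. This absorbs both the phase of the initial state and the time `k` in the average.
  set q := 4 * (ν + 1) with hq
  set U := stepOp (cycleStates ν B) (cycleTransition ν B) with hU
  set W := (ν + 1) * ℓ with hW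
  have hWν : W = ν * ℓ + ℓ := by rw [hW]; ring
  have hqW : q + 2 * W ≤ q * ℓ := by
    rw [hq, hW]; nlinarith
  obtain ⟨k', hk'⟩ : ∃ k', q * (ν * ℓ) + q + 2 * W = k' + (ν * ℓ + v - t) :=
    ⟨q * (ν * ℓ) + q + 2 * W - (ν * ℓ + v - t), by omega⟩
  rw [hk', hU, iterate_stepOp_restart f hx hv ht, ← hU]
  have hL : (0 : ℝ) < (ℓ : ℝ) ^ q := by positivity
  have hall : ∀ k ∈ Finset.range W, restartMean B (U^[k] f) ≤ ℓ ^ q * restartMean B (U^[k'] f) := by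
    intro k hk
    have hk := Finset.mem_range.1 hk
    have := restartMean_le_of_cycles hB hℓ hf (ν := ν) k q (k' - k - q * (ν * ℓ)) (by omega)
    rwa [show k + (q * (ν * ℓ) + (k' - k - q * (ν * ℓ))) = k' by omega] at this
  have h1 := avgOn_le_sum_restartMean hB hℓ hf hν
  have h2 := Finset.sum_le_sum hall
  rw [Finset.sum_const, Finset.card_range, nsmul_eq_mul] at h2
  have hνℓ : (0 : ℝ) < ν * ℓ := by positivity
  have h0 := restartMean_iterate_nonneg hB hℓ hf k'
  have hW2 : (W : ℝ) ≤ 2 * (ν * ℓ) := by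
    have : W ≤ 2 * (ν * ℓ) := by rw [hW]; nlinarith
    exact_mod_cast this
  have h3 : avgOn (cycleStates ν B) f ≤ 2 * (ℓ ^ q * restartMean B (U^[k'] f)) := by
    refine h1.trans ?_
    rw [div_le_iff₀ hνℓ]
    calc _ ≤ W * (ℓ ^ q * restartMean B (U^[k'] f)) := h2
      _ ≤ 2 * (ν * ℓ) * (ℓ ^ q * restartMean B (U^[k'] f)) :=
        mul_le_mul_of_nonneg_right hW2 (by positivity)
      _ = _ := by ring
  rw [div_mul_eq_mul_div, one_mul, div_le_iff₀ (by positivity)]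
  linarith

end Cycles

/-! ### Short words of the dithered process -/

section Words

variable {δ : ℝ}

lemma wordOp_cons {σ : Type*} (S : Finset σ) (T : σ → σ → ℝ) (e : σ → Bool → ℝ) (a : Bool)
    (l : List Bool) (f : σ → ℝ) (s : σ) :
    wordOp S T e (a :: l) f s = e s a * stepOp S T (wordOp S T e l f) s := rfl

/-- The probability that noise of intensity `δ` turns the first letters of `F` into a word. -/
def seqProb (δ : ℝ) : (ℕ → Bool) → List Bool → ℝ
  | _, [] => 1
  | F, a :: l => flipProb δ (F 0) a * seqProb δ (fun i => F (i + 1)) l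

lemma seqProb_nonneg (h0 : 0 ≤ δ) (h1 : δ ≤ 1) (F : ℕ → Bool) (l : List Bool) :
    0 ≤ seqProb δ F l := by
  induction l generalizing F with
  | nil => exact zero_le_one
  | cons a l ih => exact mul_nonneg (flipProb_nonneg h0 h1 _ _) (ih _)

lemma seqProb_splice (F F' : ℕ → Bool) (r : ℕ) (l : List Bool) :
    seqProb δ F (l.take r) * seqProb δ F' (l.drop r) =
      seqProb δ (fun i => if i < r then F i else F' (i - r)) l := by
  induction r generalizing F l with
  | zero => simp [seqProb]
  | succ r ih =>
    cases l with
    | nil => simp [seqProb]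
    | cons a l =>
      simp only [List.take_succ_cons, List.drop_succ_cons, seqProb, mul_assoc]
      rw [ih]
      simp

lemma seqProb_ofFn (F : ℕ → Bool) {n : ℕ} (z : Fin n → Bool) :
    seqProb δ F (List.ofFn z) = ∏ i : Fin n, flipProb δ (F i) (z i) := by
  induction n generalizing F with
  | zero => simp [seqProb]
  | succ n ih =>
    rw [List.ofFn_succ, seqProb, ih, Fin.prod_univ_succ]
    simp

variable {ℓ ν : ℕ} {B : Finset (Fin ℓ → Bool)}

/-- The letter at place `t` of the periodic repetition of `x`. -/
def periodicLetter (x : Fin ℓ → Bool) (t : ℕ) : Bool := cycleLetter (x, 0, t)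

/-- The probability of a word for the periodic repetition of a random element of `B`. -/
def meanProb (δ : ℝ) (B : Finset (Fin ℓ → Bool)) (l : List Bool) : ℝ :=
  (∑ x ∈ B, seqProb δ (periodicLetter x) l) / B.card

/-- The probability of a word under the dithered process. -/
def cycleWordProb (ν : ℕ) (δ : ℝ) (B : Finset (Fin ℓ → Bool)) (l : List Bool) : ℝ :=
  wordProb (cycleStates ν B) (cycleTransition ν B) (fun s a => flipProb δ (cycleLetter s) a) l

local notation "𝒲" => wordOp (cycleStates ν B) (cycleTransition ν B)
  (fun s a => flipProb δ (cycleLetter s) a)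

variable (hB : B.Nonempty) (hℓ : 1 ≤ ℓ)
include hB hℓ

lemma wordOp_cycle_inside {x : Fin ℓ → Bool} (hx : x ∈ B) {v t : ℕ} (hv : 1 ≤ v ∧ v ≤ ℓ)
    (l : List Bool) (ht : t < ν * ℓ + v) (h : t + l.length ≤ ν * ℓ + v) :
    𝒲 l (fun _ => 1) (x, v, t) = seqProb δ (fun i => periodicLetter x (t + i)) l := by
  induction l generalizing t with
  | nil => rfl
  | cons a l ih =>
    rw [wordOp_cons, seqProb]
    congr 1
    by_cases h' : t + 1 < ν * ℓ + v
    · rw [stepOp_cycle_inside _ (mem_cycleStates.2 ⟨hx, hv, ht⟩) h',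
        ih h' (by simp only [List.length_cons] at h; omega)]
      congr 2
      funext i
      rw [add_assoc, add_comm 1]
    · have : l = [] := by
        rw [← List.length_eq_zero_iff]; simp only [List.length_cons] at h; omega
      subst this
      rw [stepOp_cycle_last _ h']
      exact restartMean_const hB hℓ 1

lemma restartMean_wordOp (l : List Bool) (hl : l.length ≤ ν * ℓ) :
    restartMean B (𝒲 l fun _ => 1) = meanProb δ B l := by
  have h2 : (ℓ : ℝ) ≠ 0 := by positivity
  have h1 : (B.card : ℝ) ≠ 0 := by exact_mod_cast hB.card_pos.ne'
  have : ∀ x ∈ B, ∑ v ∈ Finset.Icc 1 ℓ, 𝒲 l (fun _ => 1) (x, v, 0) =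
      ℓ * seqProb δ (periodicLetter x) l := by
    intro x hx
    rw [Finset.sum_congr rfl fun v hv => wordOp_cycle_inside hB hℓ hx (Finset.mem_Icc.1 hv) l
      (by have := (Finset.mem_Icc.1 hv).1; omega) (by omega)]
    simp
  rw [restartMean, Finset.sum_congr rfl this, meanProb, ← Finset.mul_sum]
  field_simp

/-- A cycle has more than `νℓ` letters, so a word of at most that length meets at most one renewal:
its head is read in the current cycle, its tail in a fresh one. -/
lemma wordOp_cycle {x : Fin ℓ → Bool} (hx : x ∈ B) {v t : ℕ} (hv : 1 ≤ v ∧ v ≤ ℓ)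
    (l : List Bool) (ht : t < ν * ℓ + v) (h : l.length ≤ ν * ℓ) :
    𝒲 l (fun _ => 1) (x, v, t) =
      seqProb δ (fun i => periodicLetter x (t + i)) (l.take (ν * ℓ + v - t)) *
        meanProb δ B (l.drop (ν * ℓ + v - t)) := by
  have h1 : (B.card : ℝ) ≠ 0 := by exact_mod_cast hB.card_pos.ne'
  have hnil : meanProb δ B [] = 1 := by simp [meanProb, seqProb, h1]
  induction l generalizing t with
  | nil => simp [seqProb, hnil, wordOp]
  | cons a l ih =>
    obtain ⟨r, hr⟩ : ∃ r, ν * ℓ + v - t = r + 1 := ⟨ν * ℓ + v - t - 1, by omega⟩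
    simp only [List.length_cons] at h
    rw [hr, List.take_succ_cons, List.drop_succ_cons, wordOp_cons, seqProb, mul_assoc]
    congr 1
    by_cases h' : t + 1 < ν * ℓ + v
    · rw [stepOp_cycle_inside _ (mem_cycleStates.2 ⟨hx, hv, ht⟩) h', ih h' (by omega),
        show ν * ℓ + v - (t + 1) = r by omega]
      congr 2
      funext i
      rw [add_assoc, add_comm 1]
    · have : r = 0 := by omega
      subst this
      rw [stepOp_cycle_last _ h', restartMean_wordOp hB hℓ l (by omega)]
      simp [seqProb]

end Words

/-! ### Cyclic invariance and the comparison of short words. -/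

section Rotation

variable {δ : ℝ} {ℓ ν : ℕ} {B : Finset (Fin ℓ → Bool)}

/-- The right cyclic shift. -/
def rotateRight (x : Fin ℓ → Bool) : Fin ℓ → Bool := fun i => x ((finRotate ℓ).symm i)

lemma rotateRight_injective : Function.Injective (rotateRight (ℓ := ℓ)) := by
  intro x y h
  funext i
  have := congrFun h (finRotate ℓ i)
  simpa only [rotateRight, Equiv.symm_apply_apply] using this

lemma periodicLetter_rotateRight (hℓ : 1 ≤ ℓ) (x : Fin ℓ → Bool) (t : ℕ) :
    periodicLetter (rotateRight x) (t + 1) = periodicLetter x t := by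
  obtain ⟨m, rfl⟩ : ∃ m, ℓ = m + 1 := ⟨ℓ - 1, by omega⟩
  simp only [periodicLetter, cycleLetter, dif_pos (Nat.succ_pos m), rotateRight]
  congr 1
  rw [Equiv.symm_apply_eq, finRotate_apply]
  ext
  rw [Fin.val_add]
  simp [Nat.add_mod]

lemma image_rotateRight (hc : IsCyclic B) : B.image rotateRight = B := by
  refine Finset.eq_of_subset_of_card_le ?_ ?_
  · intro y hy
    obtain ⟨x, hx, rfl⟩ := Finset.mem_image.1 hy
    exact hc x hx
  · rw [Finset.card_image_of_injective _ rotateRight_injective]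

lemma IsCyclic.exists_rotate (hc : IsCyclic B) (hℓ : 1 ≤ ℓ) {x : Fin ℓ → Bool} (hx : x ∈ B)
    (t : ℕ) : ∃ y ∈ B, ∀ k, periodicLetter y k = periodicLetter x (t + k) := by
  induction t with
  | zero => exact ⟨x, hx, fun k => by rw [zero_add]⟩
  | succ t ih =>
    obtain ⟨y, hy, hyx⟩ := ih
    rw [← image_rotateRight hc] at hy
    obtain ⟨w, hw, rfl⟩ := Finset.mem_image.1 hy
    refine ⟨w, hw, fun k => ?_⟩
    rw [← periodicLetter_rotateRight hℓ, hyx]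
    congr 1
    omega

/-- A rotation permutes a cyclic set, so the phase at which a cycle is entered does not matter. -/
lemma sum_seqProb_rotate (hc : IsCyclic B) (hℓ : 1 ≤ ℓ) (t : ℕ) (l : List Bool) :
    ∑ x ∈ B, seqProb δ (fun i => periodicLetter x (t + i)) l =
      ∑ x ∈ B, seqProb δ (periodicLetter x) l := by
  induction t with
  | zero => simp only [zero_add]
  | succ t ih =>
    rw [← ih]
    conv_lhs => rw [← image_rotateRight hc]
    rw [Finset.sum_image fun x _ y _ h => rotateRight_injective h]
    refine Finset.sum_congr rfl fun x _ => ?_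
    congr 1
    funext i
    rw [← periodicLetter_rotateRight hℓ x (t + i)]
    congr 1
    omega

/-- The number of phases of a cycle. -/
def phaseCount (ν ℓ : ℕ) : ℝ := ∑ v ∈ Finset.Icc 1 ℓ, ((ν * ℓ + v : ℕ) : ℝ)

lemma phaseCount_pos (hℓ : 1 ≤ ℓ) : 0 < phaseCount ν ℓ :=
  Finset.sum_pos (fun v hv => by have := (Finset.mem_Icc.1 hv).1; positivity)
    ⟨1, Finset.mem_Icc.2 ⟨le_rfl, hℓ⟩⟩

lemma card_cycleStates_eq : ((cycleStates ν B).card : ℝ) = B.card * phaseCount ν ℓ := by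
  have h := sum_cycleStates (ν := ν) (B := B) (fun _ => (1 : ℝ))
  simpa [phaseCount] using h

/-- Words of length at most `ν ℓ` see at most one renewal. -/
lemma cycleWordProb_eq (hB : B.Nonempty) (hℓ : 1 ≤ ℓ) (hc : IsCyclic B) (l : List Bool)
    (h : l.length ≤ ν * ℓ) :
    cycleWordProb ν δ B l = (∑ v ∈ Finset.Icc 1 ℓ, ∑ t ∈ Finset.range (ν * ℓ + v),
      meanProb δ B (l.take (ν * ℓ + v - t)) * meanProb δ B (l.drop (ν * ℓ + v - t))) /
        phaseCount ν ℓ := by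
  have h1 : (B.card : ℝ) ≠ 0 := by exact_mod_cast hB.card_pos.ne'
  have h2 := (phaseCount_pos (ν := ν) hℓ).ne'
  have e : ∑ x ∈ B, ∑ v ∈ Finset.Icc 1 ℓ, ∑ t ∈ Finset.range (ν * ℓ + v),
      wordOp (cycleStates ν B) (cycleTransition ν B)
        (fun s a => flipProb δ (cycleLetter s) a) l (fun _ => 1) (x, v, t) =
      B.card * ∑ v ∈ Finset.Icc 1 ℓ, ∑ t ∈ Finset.range (ν * ℓ + v),
        meanProb δ B (l.take (ν * ℓ + v - t)) * meanProb δ B (l.drop (ν * ℓ + v - t)) := by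
    rw [Finset.sum_comm, Finset.mul_sum]
    refine Finset.sum_congr rfl fun v hv => ?_
    rw [Finset.sum_comm, Finset.mul_sum]
    refine Finset.sum_congr rfl fun t ht => ?_
    rw [Finset.sum_congr rfl fun x hx => wordOp_cycle hB hℓ hx (Finset.mem_Icc.1 hv) l
      (Finset.mem_range.1 ht) h, ← Finset.sum_mul, sum_seqProb_rotate hc hℓ]
    nth_rewrite 2 [meanProb]
    field_simp
  rw [cycleWordProb, wordProb, avgOn, sum_cycleStates, e, card_cycleStates_eq]
  field_simp

lemma meanProb_nonneg (h0 : 0 ≤ δ) (h1 : δ ≤ 1) (l : List Bool) : 0 ≤ meanProb δ B l :=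
  div_nonneg (Finset.sum_nonneg fun _ _ => seqProb_nonneg h0 h1 _ _) (Nat.cast_nonneg _)

/-- Domination of the short words of one process by those of another one. -/
lemma cycleWordProb_le (h0 : 0 ≤ δ) (h1 : δ ≤ 1) {B' : Finset (Fin ℓ → Bool)} (hB : B.Nonempty)
    (hB' : B'.Nonempty) (hℓ : 1 ≤ ℓ) (hc : IsCyclic B) (hc' : IsCyclic B') {c : ℝ} (hc0 : 0 ≤ c)
    {l : List Bool} (h : l.length ≤ ν * ℓ)
    (hG : ∀ l' : List Bool, l'.length ≤ l.length → meanProb δ B l' ≤ c * meanProb δ B' l') :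
    cycleWordProb ν δ B l ≤ c ^ 2 * cycleWordProb ν δ B' l := by
  rw [cycleWordProb_eq hB hℓ hc l h, cycleWordProb_eq hB' hℓ hc' l h, ← mul_div_assoc]
  refine div_le_div_of_nonneg_right ?_ (phaseCount_pos hℓ).le
  rw [Finset.mul_sum]
  refine Finset.sum_le_sum fun v _ => ?_
  rw [Finset.mul_sum]
  refine Finset.sum_le_sum fun t _ => ?_
  rw [pow_two, mul_mul_mul_comm]
  exact mul_le_mul (hG _ (by rw [List.length_take]; exact min_le_right _ _))
    (hG _ (by rw [List.length_drop]; omega)) (meanProb_nonneg h0 h1 _)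
    (mul_nonneg hc0 (meanProb_nonneg h0 h1 _))

/-- The number of elements of `B` that begin with a given word. -/
def prefixCount (B : Finset (Fin ℓ → Bool)) {m : ℕ} (u : Fin m → Bool) : ℕ :=
  (B.filter fun x => ∀ i : Fin m, periodicLetter x i = u i).card

lemma sum_seqProb_eq (B : Finset (Fin ℓ → Bool)) {m : ℕ} (z : Fin m → Bool) :
    ∑ x ∈ B, seqProb δ (periodicLetter x) (List.ofFn z) =
      ∑ u : Fin m → Bool, prefixCount B u * ∏ i, flipProb δ (u i) (z i) := by
  have : ∀ x ∈ B, seqProb δ (periodicLetter x) (List.ofFn z) =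
      ∑ u : Fin m → Bool, if (∀ i : Fin m, periodicLetter x i = u i) then
        ∏ i, flipProb δ (u i) (z i) else 0 := by
    intro x _
    rw [Finset.sum_eq_single fun i : Fin m => periodicLetter x i, if_pos fun _ => rfl, seqProb_ofFn]
    · intro u _ hu
      exact if_neg fun h => hu (funext fun i => (h i).symm)
    · simp
  rw [Finset.sum_congr rfl this, Finset.sum_comm]
  refine Finset.sum_congr rfl fun u _ => ?_
  rw [← Finset.sum_filter, Finset.sum_const, nsmul_eq_mul, prefixCount]

/-- A word probability is a combination of prefix counts with nonnegative weights that come from the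
noise alone. The factor `d` accounts for the different sizes of the two sets. -/
lemma meanProb_le (h0 : 0 ≤ δ) (h1 : δ ≤ 1) {B' : Finset (Fin ℓ → Bool)} (hB : B.Nonempty)
    (hB' : B'.Nonempty) {c d : ℝ} (hd : (B'.card : ℝ) ≤ d * B.card) {m : ℕ}
    (hG : ∀ u : Fin m → Bool, (prefixCount B u : ℝ) ≤ c * prefixCount B' u) (z : Fin m → Bool) :
    meanProb δ B (List.ofFn z) ≤ c * d * meanProb δ B' (List.ofFn z) := by
  have h2 : (0 : ℝ) < B.card := by exact_mod_cast hB.card_pos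
  have h3 : (0 : ℝ) < B'.card := by exact_mod_cast hB'.card_pos
  have key : ∑ x ∈ B, seqProb δ (periodicLetter x) (List.ofFn z) ≤
      c * ∑ x ∈ B', seqProb δ (periodicLetter x) (List.ofFn z) := by
    rw [sum_seqProb_eq, sum_seqProb_eq, Finset.mul_sum]
    refine Finset.sum_le_sum fun u _ => ?_
    rw [← mul_assoc]
    refine mul_le_mul_of_nonneg_right ?_ (Finset.prod_nonneg fun i _ => flipProb_nonneg h0 h1 _ _)
    exact hG u
  set s' := ∑ x ∈ B', seqProb δ (periodicLetter x) (List.ofFn z) with hs'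
  have hs0 : 0 ≤ c * s' := (Finset.sum_nonneg fun x _ => seqProb_nonneg h0 h1 _ _).trans key
  rw [meanProb, meanProb, ← hs', div_le_iff₀ h2]
  refine key.trans ?_
  rw [mul_div_assoc', div_mul_eq_mul_div, le_div_iff₀ h3]
  calc c * s' * B'.card ≤ c * s' * (d * B.card) := mul_le_mul_of_nonneg_left hd hs0
    _ = _ := by ring

end Rotation

/-! ### Words of small probability -/

/-- Words of probability at most `ρ` have total probability at most `√ρ ∑ √p`; subadditivity of the
root lets this sum be split over hidden paths. -/
lemma sqrt_sum_le_sum_sqrt {ι : Type*} (J : Finset ι) (f : ι → ℝ) (hf : ∀ i ∈ J, 0 ≤ f i) :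
    √(∑ i ∈ J, f i) ≤ ∑ i ∈ J, √(f i) := by
  classical
  induction J using Finset.induction_on with
  | empty => simp
  | insert a J ha ih =>
    rw [Finset.sum_insert ha, Finset.sum_insert ha]
    have h1 := hf a (Finset.mem_insert_self a J)
    have h2 : 0 ≤ ∑ i ∈ J, f i := Finset.sum_nonneg fun i hi => hf i (Finset.mem_insert_of_mem hi)
    have h3 : √(f a + ∑ i ∈ J, f i) ≤ √(f a) + √(∑ i ∈ J, f i) := by
      rw [Real.sqrt_le_left (by positivity), add_sq, Real.sq_sqrt h1, Real.sq_sqrt h2]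
      nlinarith [mul_nonneg (Real.sqrt_nonneg (f a)) (Real.sqrt_nonneg (∑ i ∈ J, f i))]
    refine h3.trans (add_le_add_right ?_ _)
    exact ih fun i hi => hf i (Finset.mem_insert_of_mem hi)

lemma sum_fin_succ {n : ℕ} (F : (Fin (n + 1) → Bool) → ℝ) :
    ∑ z, F z = ∑ a, ∑ z : Fin n → Bool, F (Fin.cons a z) := by
  rw [← Fintype.sum_prod_type']
  exact (Fintype.sum_equiv (Fin.consEquiv fun _ => Bool) _ _ fun _ => rfl).symm

lemma measureReal_block (P : Measure (ℤ → Bool)) [IsFiniteMeasure P] {n : ℕ}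
    (p : (Fin n → Bool) → Prop) [DecidablePred p] :
    P.real {ω | p (block n ω)} = ∑ z with p z, blockProb P z := by
  have h : {ω : ℤ → Bool | p (block n ω)} =
      ⋃ z ∈ Finset.univ.filter p, {ω | block n ω = z} := by
    ext ω
    simp
  rw [h, measureReal_biUnion_finset]
  · rfl
  · intro z _ z' _ hne
    refine Set.disjoint_left.2 fun ω h1 h2 => hne ?_
    rw [Set.mem_ofPred_eq] at h1 h2
    exact h1.symm.trans h2
  · intro z _
    exact (measurable_block n) (measurableSet_singleton z)

/-! ### Square-root sums for hidden Markov chains. -/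

section HiddenMarkov

variable {σ : Type*} {S : Finset σ} {T : σ → σ → ℝ} {e : σ → Bool → ℝ}
  (h : IsHiddenMarkov S T e)
include h

/-- The square root is moved inside the sum over hidden states. The noise then contributes at most
`c` per letter, and the hidden choices contribute the iterates of the kernel `√T`. -/
lemma IsHiddenMarkov.sum_sqrt_wordOp_le {c : ℝ} (hc : ∀ s, ∑ a, √(e s a) ≤ c) (n : ℕ) :
    ∀ s ∈ S, ∑ z : Fin n → Bool, √(wordOp S T e (List.ofFn z) (fun _ => 1) s) ≤
      c ^ n * (stepOp S (fun s s' => √(T s s')))^[n] (fun _ => 1) s := by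
  induction n with
  | zero => intro s _; simp [wordOp]
  | succ n ih =>
    intro s hs
    have hc0 : 0 ≤ c := (Finset.sum_nonneg fun a _ => Real.sqrt_nonneg _).trans (hc s)
    have hw : ∀ (z : Fin n → Bool), ∀ s ∈ S, 0 ≤ wordOp S T e (List.ofFn z) (fun _ => 1) s :=
      fun z => h.wordOp_nonneg (fun _ _ => zero_le_one) _
    rw [sum_fin_succ, Function.iterate_succ_apply']
    simp only [List.ofFn_succ, Fin.cons_zero, Fin.cons_succ, wordOp_cons]
    simp only [Real.sqrt_mul (h.emit_nonneg _ _), ← Finset.mul_sum, ← Finset.sum_mul]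
    rw [pow_succ', mul_assoc]
    refine mul_le_mul (hc s) ?_ (Finset.sum_nonneg fun _ _ => Real.sqrt_nonneg _) hc0
    calc ∑ z : Fin n → Bool, √(stepOp S T (wordOp S T e (List.ofFn z) fun _ => 1) s)
        ≤ ∑ z : Fin n → Bool, ∑ s' ∈ S,
            √(T s s') * √(wordOp S T e (List.ofFn z) (fun _ => 1) s') := by
          refine Finset.sum_le_sum fun z _ => (sqrt_sum_le_sum_sqrt _ _ fun s' hs' =>
            mul_nonneg (h.trans_nonneg _ _) (hw z s' hs')).trans (le_of_eq ?_)
          simp only [Real.sqrt_mul (h.trans_nonneg _ _)]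
      _ = ∑ s' ∈ S, √(T s s') * ∑ z : Fin n → Bool,
            √(wordOp S T e (List.ofFn z) (fun _ => 1) s') := by
          rw [Finset.sum_comm]
          simp only [Finset.mul_sum]
      _ ≤ ∑ s' ∈ S, √(T s s') * (c ^ n * (stepOp S (fun s s' => √(T s s')))^[n] (fun _ => 1) s') :=
          Finset.sum_le_sum fun s' hs' => mul_le_mul_of_nonneg_left (ih s' hs') (Real.sqrt_nonneg _)
      _ = _ := by
          simp only [stepOp, Finset.mul_sum]
          exact Finset.sum_congr rfl fun s' _ => by ring

lemma IsHiddenMarkov.sum_wordOp (n : ℕ) : ∀ s ∈ S,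
    ∑ z : Fin n → Bool, wordOp S T e (List.ofFn z) (fun _ => 1) s = 1 := by
  induction n with
  | zero => intro s _; simp [wordOp]
  | succ n ih =>
    intro s hs
    rw [sum_fin_succ]
    simp only [List.ofFn_succ, Fin.cons_zero, Fin.cons_succ, wordOp_cons]
    simp only [← Finset.mul_sum, ← Finset.sum_mul, h.emit_sum, one_mul]
    rw [← stepOp_finsetSum, stepOp_congr ih, h.stepOp_const 1 hs]

/-- The total probability of the words of small probability. -/
lemma IsHiddenMarkov.sum_wordProb_small_le {c : ℝ} (hc : ∀ s, ∑ a, √(e s a) ≤ c) (n : ℕ)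
    (p : σ → Prop) [DecidablePred p] {D : ℝ} (hD0 : 0 ≤ D)
    (hD : ∀ s ∈ S, p s → (stepOp S (fun s s' => √(T s s')))^[n] (fun _ => 1) s ≤ D) {ρ : ℝ} :
    ∑ z : Fin n → Bool with wordProb S T e (List.ofFn z) ≤ ρ, wordProb S T e (List.ofFn z) ≤
      ((S.filter fun s => ¬ p s).card : ℝ) / S.card + √ρ * (√S.card * c ^ n * D) := by
  have hS : (0 : ℝ) < S.card := by exact_mod_cast h.nonempty.card_pos
  have hc0 : 0 ≤ c := by
    obtain ⟨s, _⟩ := h.nonempty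
    exact (Finset.sum_nonneg fun a _ => Real.sqrt_nonneg _).trans (hc s)
  have hw : ∀ (z : Fin n → Bool), ∀ s ∈ S, 0 ≤ wordOp S T e (List.ofFn z) (fun _ => 1) s :=
    fun z => h.wordOp_nonneg (fun _ _ => zero_le_one) _
  -- The initial states with `p` are treated by square roots; the others contribute their whole
  -- share of `S`.
  set p₁ : (Fin n → Bool) → ℝ := fun z =>
    (∑ s ∈ S with p s, wordOp S T e (List.ofFn z) (fun _ => 1) s) / S.card with hp₁
  set p₂ : (Fin n → Bool) → ℝ := fun z =>
    (∑ s ∈ S with ¬ p s, wordOp S T e (List.ofFn z) (fun _ => 1) s) / S.card with hp₂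
  have hp₁0 : ∀ z, 0 ≤ p₁ z := fun z =>
    div_nonneg (Finset.sum_nonneg fun s hs => hw z s (Finset.mem_filter.1 hs).1) hS.le
  have hp₂0 : ∀ z, 0 ≤ p₂ z := fun z =>
    div_nonneg (Finset.sum_nonneg fun s hs => hw z s (Finset.mem_filter.1 hs).1) hS.le
  have hsplit : ∀ z, wordProb S T e (List.ofFn z) = p₂ z + p₁ z := by
    intro z
    rw [wordProb, avgOn, ← Finset.sum_filter_add_sum_filter_not S p, add_div, add_comm]
  have h2 : ∑ z, p₂ z = ((S.filter fun s => ¬ p s).card : ℝ) / S.card := by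
    rw [hp₂, ← Finset.sum_div, Finset.sum_comm,
      Finset.sum_congr rfl fun s hs => h.sum_wordOp n s (Finset.mem_filter.1 hs).1]
    simp
  have h1 : ∑ z, √(p₁ z) ≤ √S.card * c ^ n * D := by
    calc ∑ z, √(p₁ z) ≤ ∑ z, (∑ s ∈ S with p s,
          √(wordOp S T e (List.ofFn z) (fun _ => 1) s)) / √S.card := by
          refine Finset.sum_le_sum fun z _ => ?_
          rw [hp₁]
          simp only
          rw [Real.sqrt_div' _ hS.le]
          exact div_le_div_of_nonneg_right (sqrt_sum_le_sum_sqrt _ _ fun s hs =>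
            hw z s (Finset.mem_filter.1 hs).1) (Real.sqrt_nonneg _)
      _ = (∑ s ∈ S with p s, ∑ z : Fin n → Bool,
          √(wordOp S T e (List.ofFn z) (fun _ => 1) s)) / √S.card := by
          rw [← Finset.sum_div, Finset.sum_comm]
      _ ≤ (S.card * (c ^ n * D)) / √S.card := by
          refine div_le_div_of_nonneg_right ?_ (Real.sqrt_nonneg _)
          calc _ ≤ ∑ s ∈ S with p s, c ^ n * D := Finset.sum_le_sum fun s hs => by
                obtain ⟨hs, hps⟩ := Finset.mem_filter.1 hs
                exact (h.sum_sqrt_wordOp_le hc n s hs).trans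
                  (mul_le_mul_of_nonneg_left (hD s hs hps) (by positivity))
            _ = ((S.filter p).card : ℝ) * (c ^ n * D) := by simp
            _ ≤ _ := mul_le_mul_of_nonneg_right
                (by exact_mod_cast Finset.card_filter_le _ _) (by positivity)
      _ = _ := by
          rw [mul_div_right_comm, Real.div_sqrt]
          ring
  calc _ ≤ ∑ z : Fin n → Bool with wordProb S T e (List.ofFn z) ≤ ρ, (p₂ z + √ρ * √(p₁ z)) := by
        refine Finset.sum_le_sum fun z hz => ?_
        have hz := (Finset.mem_filter.1 hz).2
        rw [hsplit] at hz ⊢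
        refine add_le_add_right ?_ _
        have : p₁ z ≤ ρ := by linarith [hp₂0 z]
        calc p₁ z = √(p₁ z) * √(p₁ z) := (Real.mul_self_sqrt (hp₁0 z)).symm
          _ ≤ _ := mul_le_mul_of_nonneg_right (Real.sqrt_le_sqrt this) (Real.sqrt_nonneg _)
    _ ≤ ∑ z : Fin n → Bool, (p₂ z + √ρ * √(p₁ z)) :=
        Finset.sum_le_univ_sum_of_nonneg fun z => add_nonneg (hp₂0 z) (by positivity)
    _ ≤ _ := by
        rw [Finset.sum_add_distrib, h2, ← Finset.mul_sum]
        exact add_le_add_right (mul_le_mul_of_nonneg_left h1 (Real.sqrt_nonneg _)) _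

end HiddenMarkov

/-! ### Square-root sums for the chain of cycles. -/

section Cycles

variable {δ : ℝ} {ℓ ν : ℕ} {B : Finset (Fin ℓ → Bool)}

local notation "V" => stepOp (cycleStates ν B) (fun s s' => √(cycleTransition ν B s s'))

lemma sqrtStep_inside (f : CycleState ℓ → ℝ) {x : Fin ℓ → Bool} {v t : ℕ}
    (hs : (x, v, t) ∈ cycleStates ν B) (h : t + 1 < ν * ℓ + v) :
    V f (x, v, t) = f (x, v, t + 1) := by
  rw [← stepOp_cycle_inside f hs h]
  refine Finset.sum_congr rfl fun s' _ => ?_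
  congr 1
  simp only [cycleTransition, if_pos h]
  split_ifs <;> simp

/-- A renewal is a uniform choice among `|B| ℓ` first states, and the square roots of these
probabilities add up to `√(|B| ℓ)`. -/
lemma sqrtStep_last (hB : B.Nonempty) (hℓ : 1 ≤ ℓ) (f : CycleState ℓ → ℝ) {x : Fin ℓ → Bool}
    {v t : ℕ} (h : ¬ t + 1 < ν * ℓ + v) :
    V f (x, v, t) = √(B.card * ℓ) * restartMean B f := by
  have hpos : (0 : ℝ) < B.card * ℓ := by
    have : (0 : ℝ) < B.card := by exact_mod_cast hB.card_pos
    positivity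
  rw [← stepOp_cycle_last (ν := ν) (x := x) f h, stepOp, stepOp, Finset.mul_sum]
  refine Finset.sum_congr rfl fun s' _ => ?_
  simp only [cycleTransition, if_neg h]
  split_ifs
  · rw [← mul_assoc]
    congr 1
    rw [Real.sqrt_div zero_le_one, Real.sqrt_one, mul_one_div, Real.sqrt_div_self']
  · simp

lemma iterate_sqrtStep_inside {x : Fin ℓ → Bool} {v : ℕ} (hx : x ∈ B) (hv : 1 ≤ v ∧ v ≤ ℓ)
    (n t : ℕ) (h : t + n < ν * ℓ + v) : V^[n] (fun _ => 1) (x, v, t) = 1 := by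
  induction n generalizing t with
  | zero => rfl
  | succ n ih =>
    rw [Function.iterate_succ_apply', sqrtStep_inside _
      (mem_cycleStates.2 ⟨hx, hv, by simp only; omega⟩) (by omega), ih (t + 1) (by omega)]

lemma restartMean_le (hB : B.Nonempty) (hℓ : 1 ≤ ℓ) {f : CycleState ℓ → ℝ} {C : ℝ}
    (hf : ∀ x ∈ B, ∀ v ∈ Finset.Icc 1 ℓ, f (x, v, 0) ≤ C) : restartMean B f ≤ C := by
  rw [← restartMean_const hB hℓ C]
  exact div_le_div_of_nonneg_right (Finset.sum_le_sum fun x hx => Finset.sum_le_sum (hf x hx))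
    (by positivity)

/-- A renewal costs `√(|B| ℓ)`, charged to the `νℓ` letters of a cycle at the rate `g` per letter.
The `t` in the exponent credits the letters of the current cycle that precede the start. -/
lemma iterate_sqrtStep_le (hB : B.Nonempty) (hℓ : 1 ≤ ℓ) {g : ℝ} (hg : 1 ≤ g)
    (hθ : √(B.card * ℓ) ≤ g ^ (ν * ℓ)) (n : ℕ) : ∀ x v t, (x, v, t) ∈ cycleStates ν B →
      V^[n] (fun _ => 1) (x, v, t) ≤ g ^ (n + t) * √(B.card * ℓ) := by
  have hθ1 : 1 ≤ √(B.card * ℓ : ℝ) := by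
    rw [Real.one_le_sqrt]
    exact_mod_cast Nat.mul_pos hB.card_pos hℓ
  induction n with
  | zero =>
    intro x v t _
    exact one_le_mul_of_one_le_of_one_le (one_le_pow₀ hg) hθ1
  | succ n ih =>
    intro x v t hs
    obtain ⟨hx, hv, ht⟩ := mem_cycleStates.1 hs
    simp only at hx hv ht
    rw [Function.iterate_succ_apply']
    by_cases h : t + 1 < ν * ℓ + v
    · rw [sqrtStep_inside _ hs h]
      refine (ih x v (t + 1) (mem_cycleStates.2 ⟨hx, hv, h⟩)).trans (le_of_eq ?_)
      congr 2
      ring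
    · rw [sqrtStep_last hB hℓ _ h, mul_comm]
      refine mul_le_mul_of_nonneg_right ?_ (Real.sqrt_nonneg _)
      refine (restartMean_le hB hℓ fun x hx v hv => ih x v 0 (mem_cycleStates.2
        ⟨hx, Finset.mem_Icc.1 hv, by have := (Finset.mem_Icc.1 hv).1; simp only; omega⟩)).trans ?_
      calc g ^ (n + 0) * √(B.card * ℓ) ≤ g ^ n * g ^ (ν * ℓ) :=
            mul_le_mul_of_nonneg_left hθ (by positivity)
        _ ≤ g ^ (n + 1 + t) := by
            rw [← pow_add]
            exact pow_le_pow_right₀ hg (by omega)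

lemma sum_sqrt_flipProb (b : Bool) : ∑ a, √(flipProb δ b a) = √δ + √(1 - δ) := by
  cases b <;> simp [flipProb, add_comm]

/-- The words of length `ℓ` of small probability. -/
lemma sum_cycleWordProb_small_le (hB : B.Nonempty) (hℓ : 1 ≤ ℓ) (hν : 1 ≤ ν) (h0 : 0 ≤ δ)
    (h1 : δ ≤ 1) {ρ : ℝ} :
    ∑ z : Fin ℓ → Bool with cycleWordProb ν δ B (List.ofFn z) ≤ ρ,
      cycleWordProb ν δ B (List.ofFn z) ≤
        1 / ν + √ρ * (√(cycleStates ν B).card * (√δ + √(1 - δ)) ^ ℓ) := by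
  have h := isHiddenMarkov_cycle (ν := ν) hB hℓ h0 h1
  have hmain := h.sum_wordProb_small_le (c := √δ + √(1 - δ)) (ρ := ρ)
    (fun s => (sum_sqrt_flipProb _).le) ℓ (fun s => s.2.2 + ℓ < ν * ℓ + s.2.1) zero_le_one
    (fun s hs hp => (iterate_sqrtStep_inside (mem_cycleStates.1 hs).1 (mem_cycleStates.1 hs).2.1
      ℓ s.2.2 hp).le)
  rw [mul_one] at hmain
  refine hmain.trans (add_le_add_left ?_ _)
  have hBpos : (0 : ℝ) < B.card := by exact_mod_cast hB.card_pos
  have hcard : ((B.card * ℓ * (ν * ℓ) : ℕ) : ℝ) ≤ (cycleStates ν B).card := by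
    exact_mod_cast card_cycleStates_ge
  push_cast at hcard
  -- A renewal within the word requires one of the last `ℓ` phases of a cycle, which is a fraction
  -- of at most `1/ν`.
  have hbd : (((cycleStates ν B).filter fun s => ¬ s.2.2 + ℓ < ν * ℓ + s.2.1).card : ℝ) ≤
      B.card * ℓ * ℓ := by
    rw [← Finset.sum_boole, sum_cycleStates]
    calc _ ≤ ∑ x ∈ B, ∑ v ∈ Finset.Icc 1 ℓ, (ℓ : ℝ) := by
          refine Finset.sum_le_sum fun x _ => Finset.sum_le_sum fun v hv => ?_
          rw [Finset.sum_boole]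
          have hsub : (Finset.range (ν * ℓ + v)).filter (fun t => ¬ t + ℓ < ν * ℓ + v) ⊆
              Finset.Ico (ν * ℓ + v - ℓ) (ν * ℓ + v) := by
            intro t ht
            simp only [Finset.mem_filter, Finset.mem_range, Finset.mem_Ico] at ht ⊢
            omega
          have := (Finset.card_le_card hsub).trans_eq (Nat.card_Ico _ _)
          have h3 : ((Finset.range (ν * ℓ + v)).filter (fun t => ¬ t + ℓ < ν * ℓ + v)).card ≤ ℓ := by
            omega
          exact_mod_cast h3
      _ = _ := by simp; ring
  have hpos : (0 : ℝ) < B.card * ℓ * (ν * ℓ) := by positivity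
  calc _ ≤ (B.card * ℓ * ℓ : ℝ) / (B.card * ℓ * (ν * ℓ)) :=
        div_le_div₀ (by positivity) hbd hpos hcard
    _ = 1 / ν := by field_simp

/-- The words of length `n` of small probability. -/
lemma sum_cycleWordProb_small_le' (hB : B.Nonempty) (hℓ : 1 ≤ ℓ) (h0 : 0 ≤ δ)
    (h1 : δ ≤ 1) {g : ℝ} (hg : 1 ≤ g) (hθ : √(B.card * ℓ) ≤ g ^ (ν * ℓ)) (n : ℕ) {ρ : ℝ} :
    ∑ z : Fin n → Bool with cycleWordProb ν δ B (List.ofFn z) ≤ ρ,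
      cycleWordProb ν δ B (List.ofFn z) ≤
        √ρ * (√(cycleStates ν B).card * (√δ + √(1 - δ)) ^ n *
          (g ^ (n + (ν * ℓ + ℓ)) * √(B.card * ℓ))) := by
  have h := isHiddenMarkov_cycle (ν := ν) hB hℓ h0 h1
  have hmain := h.sum_wordProb_small_le (c := √δ + √(1 - δ)) (ρ := ρ)
    (fun s => (sum_sqrt_flipProb _).le) n (fun _ => True)
    (D := g ^ (n + (ν * ℓ + ℓ)) * √(B.card * ℓ)) (by positivity)
    (fun s hs _ => (iterate_sqrtStep_le hB hℓ hg hθ n s.1 s.2.1 s.2.2 hs).trans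
      (mul_le_mul_of_nonneg_right (pow_le_pow_right₀ hg
        (by have := mem_cycleStates.1 hs; omega)) (Real.sqrt_nonneg _)))
  rw [Finset.filter_false_of_mem fun _ _ => not_not.2 trivial, Finset.card_empty, Nat.cast_zero,
    zero_div, zero_add] at hmain
  exact hmain

end Cycles

/-! ### Divergence of two dithered processes -/

/-- The divergence is at least `-2 log` of the Bhattacharyya coefficient, by `log t ≤ t - 1` at `t =
√(q/p)/C`. Unlike the divergence, this coefficient is easily bounded for mixtures. -/
lemma sum_mul_log_div_ge {ι : Type*} (J : Finset ι) {p q : ι → ℝ} (hp : ∀ i ∈ J, 0 < p i)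
    (hq : ∀ i ∈ J, 0 < q i) (h1 : ∑ i ∈ J, p i = 1) {C : ℝ} (hC : 0 < C)
    (h : ∑ i ∈ J, √(p i * q i) ≤ C) :
    -2 * Real.log C ≤ ∑ i ∈ J, p i * Real.log (p i / q i) := by
  have key : ∀ i ∈ J, p i * (-2 * Real.log C) - 2 * (√(p i * q i) / C - p i) ≤
      p i * Real.log (p i / q i) := by
    intro i hi
    have hpi := hp i hi
    have hqi := hq i hi
    have hu : 0 < √(q i / p i) := Real.sqrt_pos.2 (div_pos hqi hpi)
    have e1 : Real.log (p i / q i) = -2 * Real.log (√(q i / p i)) := by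
      rw [Real.log_sqrt (div_pos hqi hpi).le, ← inv_div (q i) (p i), Real.log_inv]
      ring
    have e2 : √(p i * q i) = p i * √(q i / p i) := by
      rw [Real.sqrt_eq_iff_mul_self_eq_of_pos (by positivity)]
      rw [mul_mul_mul_comm, Real.mul_self_sqrt (div_pos hqi hpi).le]
      field_simp
    have e3 : Real.log (√(q i / p i)) ≤ Real.log C + (√(q i / p i) / C - 1) := by
      have := Real.log_le_sub_one_of_pos (div_pos hu hC)
      rw [Real.log_div hu.ne' hC.ne'] at this
      linarith
    rw [e1, e2]
    have := mul_le_mul_of_nonneg_left e3 hpi.le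
    have e4 : p i * √(q i / p i) / C = p i * (√(q i / p i) / C) := mul_div_assoc _ _ _
    rw [e4]
    linarith
  refine le_trans ?_ (Finset.sum_le_sum key)
  rw [Finset.sum_sub_distrib, ← Finset.sum_mul, h1, ← Finset.mul_sum, Finset.sum_sub_distrib,
    ← Finset.sum_div, h1]
  have : (∑ i ∈ J, √(p i * q i)) / C ≤ 1 := (div_le_one hC).2 h
  linarith

/-! ### Splices of codewords and their Bhattacharyya coefficient. -/

section Cycles

variable {δ : ℝ} {ℓ ν : ℕ} {B B' : Finset (Fin ℓ → Bool)}

/-- The first `r` letters of the repetition of `x`, continued by the repetition of `x'`. -/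
def spliceLetter (w : ℕ × (Fin ℓ → Bool) × (Fin ℓ → Bool)) (i : ℕ) : Bool :=
  if i < w.1 then periodicLetter w.2.1 i else periodicLetter w.2.2 (i - w.1)

/-- The set of splices of two elements of `B`. -/
def splices (B : Finset (Fin ℓ → Bool)) : Finset (ℕ × (Fin ℓ → Bool) × (Fin ℓ → Bool)) :=
  Finset.range (ℓ + 1) ×ˢ B ×ˢ B

lemma meanProb_le_sum (h0 : 0 ≤ δ) (h1 : δ ≤ 1) (hB : B.Nonempty) (l : List Bool) :
    meanProb δ B l ≤ ∑ x ∈ B, seqProb δ (periodicLetter x) l :=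
  div_le_self (Finset.sum_nonneg fun _ _ => seqProb_nonneg h0 h1 _ _)
    (by exact_mod_cast hB.card_pos)

/-- With at most one renewal, a word is a splice of two periodic words seen through noise. Averages
are bounded by sums; the exponential loss is harmless, since small `δ` makes each mismatch as costly
as needed. -/
lemma cycleWordProb_le_sum_splices (h0 : 0 ≤ δ) (h1 : δ ≤ 1) (hB : B.Nonempty) (hℓ : 1 ≤ ℓ)
    (hν : 1 ≤ ν) (hc : IsCyclic B) (z : Fin ℓ → Bool) :
    cycleWordProb ν δ B (List.ofFn z) ≤
      ∑ w ∈ splices B, ∏ i : Fin ℓ, flipProb δ (spliceLetter w i) (z i) := by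
  have hlen : (List.ofFn z).length ≤ ν * ℓ := by
    rw [List.length_ofFn]; exact Nat.le_mul_of_pos_left ℓ hν
  rw [cycleWordProb_eq hB hℓ hc _ hlen, div_le_iff₀ (phaseCount_pos hℓ), phaseCount,
    Finset.mul_sum]
  refine Finset.sum_le_sum fun v _ => ?_
  have hterm : ∀ r, meanProb δ B ((List.ofFn z).take r) * meanProb δ B ((List.ofFn z).drop r) ≤
      ∑ w ∈ splices B, ∏ i : Fin ℓ, flipProb δ (spliceLetter w i) (z i) := by
    intro r
    wlog hr : r ≤ ℓ generalizing r
    · have h2 : (List.ofFn z).length ≤ ℓ := (List.length_ofFn).le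
      have h3 : (List.ofFn z).length ≤ r := h2.trans (by omega)
      have := this ℓ le_rfl
      rw [List.take_of_length_le h2, List.drop_of_length_le h2] at this
      rwa [List.take_of_length_le h3, List.drop_of_length_le h3]
    calc _ ≤ (∑ x ∈ B, seqProb δ (periodicLetter x) ((List.ofFn z).take r)) *
          ∑ x ∈ B, seqProb δ (periodicLetter x) ((List.ofFn z).drop r) :=
          mul_le_mul (meanProb_le_sum h0 h1 hB _) (meanProb_le_sum h0 h1 hB _)
            (meanProb_nonneg h0 h1 _) (Finset.sum_nonneg fun _ _ => seqProb_nonneg h0 h1 _ _)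
      _ = ∑ p ∈ B ×ˢ B, ∏ i : Fin ℓ, flipProb δ (spliceLetter (r, p) i) (z i) := by
          rw [Finset.sum_mul_sum, Finset.sum_product]
          refine Finset.sum_congr rfl fun x _ => Finset.sum_congr rfl fun y _ => ?_
          rw [seqProb_splice, seqProb_ofFn]
          rfl
      _ ≤ ∑ r ∈ Finset.range (ℓ + 1), ∑ p ∈ B ×ˢ B,
            ∏ i : Fin ℓ, flipProb δ (spliceLetter (r, p) i) (z i) :=
          Finset.single_le_sum (f := fun r => ∑ p ∈ B ×ˢ B,
            ∏ i : Fin ℓ, flipProb δ (spliceLetter (r, p) i) (z i))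
            (fun r _ => Finset.sum_nonneg fun p _ => Finset.prod_nonneg fun i _ =>
              flipProb_nonneg h0 h1 _ _) (Finset.mem_range.2 (by omega))
      _ = _ := by rw [splices, ← Finset.sum_product']
  refine (Finset.sum_le_sum fun t _ => hterm _).trans (le_of_eq ?_)
  rw [Finset.sum_const, Finset.card_range, nsmul_eq_mul, mul_comm]

/-- The places of the first third where two words differ. -/
def earlyMismatches (x y : Fin ℓ → Bool) : Finset ℕ :=
  (Finset.range ℓ).filter fun i => 3 * i < ℓ ∧ periodicLetter x i ≠ periodicLetter y i

/-- Away from the seam a splice is a rotation of one element of `B`, and cyclicity keeps that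
rotation in `B`. -/
lemma splice_interval (hc : IsCyclic B) (hℓ : 1 ≤ ℓ) {w : ℕ × (Fin ℓ → Bool) × (Fin ℓ → Bool)}
    (hw : w ∈ splices B) {a k : ℕ} (h : a + k ≤ w.1 ∨ w.1 ≤ a) :
    ∃ x ∈ B, ∀ j < k, spliceLetter w (a + j) = periodicLetter x j := by
  simp only [splices, Finset.mem_product] at hw
  rcases h with h | h
  · obtain ⟨x, hx, hxa⟩ := hc.exists_rotate hℓ hw.2.1 a
    refine ⟨x, hx, fun j hj => ?_⟩
    rw [spliceLetter, if_pos (by omega), hxa]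
  · obtain ⟨x, hx, hxa⟩ := hc.exists_rotate hℓ hw.2.2 (a - w.1)
    refine ⟨x, hx, fun j hj => ?_⟩
    rw [spliceLetter, if_neg (by omega), hxa]
    congr 1
    omega

/-- Two seams cut the `ℓ` places into three intervals, one of which has at least `ℓ/3` places. On it
both splices are words of the codes read from their first letters, which is why mismatches are only
counted in the first third. -/
lemma mismatches_splices (hc : IsCyclic B) (hc' : IsCyclic B') (hℓ : 1 ≤ ℓ) {m : ℕ}
    (hm : ∀ x ∈ B, ∀ y ∈ B', m ≤ (earlyMismatches x y).card)
    {w w' : ℕ × (Fin ℓ → Bool) × (Fin ℓ → Bool)} (hw : w ∈ splices B) (hw' : w' ∈ splices B') :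
    m ≤ (Finset.univ.filter fun i : Fin ℓ => spliceLetter w i ≠ spliceLetter w' i).card := by
  have hr : w.1 ≤ ℓ := by
    have := (Finset.mem_product.1 hw).1; rw [Finset.mem_range] at this; omega
  have hr' : w'.1 ≤ ℓ := by
    have := (Finset.mem_product.1 hw').1; rw [Finset.mem_range] at this; omega
  obtain ⟨a, k, hk, hak, h1, h2⟩ : ∃ a k, ℓ ≤ 3 * k ∧ a + k ≤ ℓ ∧ (a + k ≤ w.1 ∨ w.1 ≤ a) ∧
      (a + k ≤ w'.1 ∨ w'.1 ≤ a) := by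
    set s := min w.1 w'.1 with hs
    set u := max w.1 w'.1 with hu
    by_cases h1 : ℓ ≤ 3 * s
    · exact ⟨0, s, h1, by omega, by omega, by omega⟩
    by_cases h2 : ℓ ≤ 3 * (u - s)
    · exact ⟨s, u - s, h2, by omega, by omega, by omega⟩
    · exact ⟨u, ℓ - u, by omega, by omega, by omega, by omega⟩
  obtain ⟨x, hx, hxw⟩ := splice_interval hc hℓ hw h1
  obtain ⟨y, hy, hyw⟩ := splice_interval hc' hℓ hw' h2
  refine (hm x hx y hy).trans ?_
  refine Finset.card_le_card_of_injOn (fun i => (⟨(a + i) % ℓ, Nat.mod_lt _ hℓ⟩ : Fin ℓ)) ?_ ?_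
  · intro i hi
    obtain ⟨-, h3, h4⟩ := Finset.mem_filter.1 hi
    have : (a + i) % ℓ = a + i := Nat.mod_eq_of_lt (by omega)
    refine Finset.mem_coe.2 (Finset.mem_filter.2 ⟨Finset.mem_univ _, ?_⟩)
    simp only [this]
    rwa [hxw i (by omega), hyw i (by omega)]
  · intro i hi j hj hij
    obtain ⟨-, h3, -⟩ := Finset.mem_filter.1 hi
    obtain ⟨-, h4, -⟩ := Finset.mem_filter.1 hj
    have e := congrArg Fin.val hij
    simp only at e
    rw [Nat.mod_eq_of_lt (by omega), Nat.mod_eq_of_lt (by omega)] at e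
    omega

lemma sum_sqrt_flipProb_mul (h0 : 0 ≤ δ) (h1 : δ ≤ 1) (b b' : Bool) :
    ∑ a, √(flipProb δ b a * flipProb δ b' a) ≤ if b ≠ b' then 2 * √δ else 1 := by
  have h2 : √(δ * (1 - δ)) ≤ √δ := Real.sqrt_le_sqrt (by nlinarith)
  have h3 : √((1 - δ) * (1 - δ)) = 1 - δ := Real.sqrt_mul_self (by linarith)
  have h4 : √(δ * δ) = δ := Real.sqrt_mul_self h0
  cases b <;> cases b' <;> simp [flipProb, h3, h4, mul_comm (1 - δ) δ] <;> linarith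

/-- The coefficient of two product laws factorises: a place of agreement gives at most `1`, a
mismatch at most `2√δ`. -/
lemma sum_sqrt_prod_le (h0 : 0 ≤ δ) (h1 : 2 * √δ ≤ 1) {m : ℕ} (F F' : Fin ℓ → Bool)
    (hm : m ≤ (Finset.univ.filter fun i : Fin ℓ => F i ≠ F' i).card) :
    ∑ z : Fin ℓ → Bool, √((∏ i, flipProb δ (F i) (z i)) * ∏ i, flipProb δ (F' i) (z i)) ≤
      (2 * √δ) ^ m := by
  have hδ : δ ≤ 1 := by
    have : √δ ≤ 1 := by linarith [Real.sqrt_nonneg δ]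
    exact Real.sqrt_le_one.1 this
  have e : ∀ z : Fin ℓ → Bool, √((∏ i, flipProb δ (F i) (z i)) * ∏ i, flipProb δ (F' i) (z i)) =
      ∏ i, √(flipProb δ (F i) (z i) * flipProb δ (F' i) (z i)) := by
    intro z
    rw [← Finset.prod_mul_distrib, Real.sqrt_prod _ fun i _ =>
      mul_nonneg (flipProb_nonneg h0 hδ _ _) (flipProb_nonneg h0 hδ _ _)]
  simp only [e]
  have e2 := Finset.prod_univ_sum (fun _ : Fin ℓ => (Finset.univ : Finset Bool))
    fun i a => √(flipProb δ (F i) a * flipProb δ (F' i) a)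
  rw [Fintype.piFinset_univ] at e2
  rw [← e2]
  calc _ ≤ ∏ i : Fin ℓ, (if F i ≠ F' i then 2 * √δ else 1) :=
        Finset.prod_le_prod (fun i _ => Finset.sum_nonneg fun a _ => Real.sqrt_nonneg _)
          fun i _ => sum_sqrt_flipProb_mul h0 hδ _ _
    _ = (2 * √δ) ^ (Finset.univ.filter fun i : Fin ℓ => F i ≠ F' i).card := by
        rw [Finset.prod_ite, Finset.prod_const, Finset.prod_const_one, mul_one]
    _ ≤ _ := pow_le_pow_of_le_one (by positivity) h1 hm

lemma sum_sqrt_cycleWordProb_le (h0 : 0 ≤ δ) (h1 : 2 * √δ ≤ 1) (hB : B.Nonempty)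
    (hB' : B'.Nonempty) (hℓ : 1 ≤ ℓ) (hν : 1 ≤ ν) (hc : IsCyclic B) (hc' : IsCyclic B') {m : ℕ}
    (hm : ∀ x ∈ B, ∀ y ∈ B', m ≤ (earlyMismatches x y).card) :
    ∑ z : Fin ℓ → Bool,
        √(cycleWordProb ν δ B (List.ofFn z) * cycleWordProb ν δ B' (List.ofFn z)) ≤
      ((ℓ + 1) * B.card ^ 2) * ((ℓ + 1) * B'.card ^ 2) * (2 * √δ) ^ m := by
  have hδ : δ ≤ 1 := by
    have : √δ ≤ 1 := by linarith [Real.sqrt_nonneg δ]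
    exact Real.sqrt_le_one.1 this
  have hf : ∀ (w : ℕ × (Fin ℓ → Bool) × (Fin ℓ → Bool)) (z : Fin ℓ → Bool),
      0 ≤ ∏ i : Fin ℓ, flipProb δ (spliceLetter w i) (z i) :=
    fun w z => Finset.prod_nonneg fun i _ => flipProb_nonneg h0 hδ _ _
  have hterm : ∀ z : Fin ℓ → Bool,
      √(cycleWordProb ν δ B (List.ofFn z) * cycleWordProb ν δ B' (List.ofFn z)) ≤
      ∑ w ∈ splices B, ∑ w' ∈ splices B', √((∏ i : Fin ℓ, flipProb δ (spliceLetter w i) (z i)) *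
        ∏ i : Fin ℓ, flipProb δ (spliceLetter w' i) (z i)) := by
    intro z
    refine (Real.sqrt_le_sqrt (mul_le_mul
      (cycleWordProb_le_sum_splices h0 hδ hB hℓ hν hc z)
      (cycleWordProb_le_sum_splices h0 hδ hB' hℓ hν hc' z)
      ((isHiddenMarkov_cycle hB' hℓ h0 hδ).wordProb_nonneg _)
      (Finset.sum_nonneg fun w _ => hf w z))).trans ?_
    rw [Finset.sum_mul_sum]
    refine (sqrt_sum_le_sum_sqrt _ _ fun w _ => Finset.sum_nonneg fun w' _ =>
      mul_nonneg (hf w z) (hf w' z)).trans (Finset.sum_le_sum fun w _ => ?_)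
    exact sqrt_sum_le_sum_sqrt _ _ fun w' _ => mul_nonneg (hf w z) (hf w' z)
  have hcard : ∀ B : Finset (Fin ℓ → Bool), ((splices B).card : ℝ) = (ℓ + 1) * B.card ^ 2 := by
    intro B
    simp only [splices, Finset.card_product, Finset.card_range]
    push_cast
    ring
  calc _ ≤ ∑ z : Fin ℓ → Bool, ∑ w ∈ splices B, ∑ w' ∈ splices B',
          √((∏ i : Fin ℓ, flipProb δ (spliceLetter w i) (z i)) *
            ∏ i : Fin ℓ, flipProb δ (spliceLetter w' i) (z i)) :=
        Finset.sum_le_sum fun z _ => hterm z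
    _ = ∑ w ∈ splices B, ∑ w' ∈ splices B', ∑ z : Fin ℓ → Bool,
          √((∏ i : Fin ℓ, flipProb δ (spliceLetter w i) (z i)) *
            ∏ i : Fin ℓ, flipProb δ (spliceLetter w' i) (z i)) := by
        rw [Finset.sum_comm]
        exact Finset.sum_congr rfl fun w _ => Finset.sum_comm
    _ ≤ ∑ w ∈ splices B, ∑ w' ∈ splices B', (2 * √δ) ^ m :=
        Finset.sum_le_sum fun w hw => Finset.sum_le_sum fun w' hw' =>
          sum_sqrt_prod_le h0 h1 _ _ (mismatches_splices hc hc' hℓ hm hw hw')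
    _ = _ := by
        simp only [Finset.sum_const, nsmul_eq_mul, hcard]
        ring

/-- Words at large Hamming distance make the processes diverge. -/
lemma klDivergence_ge (h0 : 0 < δ) (h1 : 2 * √δ ≤ 1) (hB : B.Nonempty)
    (hB' : B'.Nonempty) (hℓ : 1 ≤ ℓ) (hν : 1 ≤ ν) (hc : IsCyclic B) (hc' : IsCyclic B') {m : ℕ}
    (hm : ∀ x ∈ B, ∀ y ∈ B', m ≤ (earlyMismatches x y).card) {P Q : Measure (ℤ → Bool)}
    [IsProbabilityMeasure P]
    (hP : ∀ z : Fin ℓ → Bool, blockProb P z = cycleWordProb ν δ B (List.ofFn z))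
    (hQ : ∀ z : Fin ℓ → Bool, blockProb Q z = cycleWordProb ν δ B' (List.ofFn z))
    (hP0 : ∀ z : Fin ℓ → Bool, 0 < blockProb P z) (hQ0 : ∀ z : Fin ℓ → Bool, 0 < blockProb Q z) :
    -(2 / ℓ) * Real.logb 2 (((ℓ + 1) * B.card ^ 2) * ((ℓ + 1) * B'.card ^ 2) * (2 * √δ) ^ m) ≤
      klDivergence ℓ P Q := by
  set C : ℝ := ((ℓ + 1) * B.card ^ 2) * ((ℓ + 1) * B'.card ^ 2) * (2 * √δ) ^ m with hC
  have hC0 : 0 < C := by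
    have h2 : (0 : ℝ) < B.card := by exact_mod_cast hB.card_pos
    have h3 : (0 : ℝ) < B'.card := by exact_mod_cast hB'.card_pos
    have h4 := Real.sqrt_pos.2 h0
    positivity
  have hb : ∑ z : Fin ℓ → Bool, √(blockProb P z * blockProb Q z) ≤ C := by
    simp only [hP, hQ]
    exact sum_sqrt_cycleWordProb_le h0.le h1 hB hB' hℓ hν hc hc' hm
  have := sum_mul_log_div_ge Finset.univ (fun z _ => hP0 z) (fun z _ => hQ0 z)
    (sum_blockProb P ℓ) hC0 hb
  have hlog : (0 : ℝ) < Real.log 2 := Real.log_pos (by norm_num)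
  have hℓ0 : (0 : ℝ) < ℓ := by positivity
  rw [klDivergence]
  simp only [Real.logb, mul_div_assoc', ← Finset.sum_div]
  rw [div_le_div_iff_of_pos_right hlog]
  calc -(2 / ℓ) * Real.log C = 1 / ℓ * (-2 * Real.log C) := by ring
    _ ≤ _ := mul_le_mul_of_nonneg_left this (by positivity)

end Cycles

/-! ### Cyclic codes with prescribed differences -/

/-- The grid of places that carry the signature: it meets all its translates. -/
def InGrid (L i : ℕ) : Prop := i % L ^ 2 < L ∨ L ∣ i

instance (L i : ℕ) : Decidable (InGrid L i) := inferInstanceAs (Decidable (_ ∨ _))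

lemma inGrid_mod {L s : ℕ} (hs : L ^ 2 ∣ s) (i : ℕ) : InGrid L (i % s) ↔ InGrid L i := by
  have h2 : L ∣ s := (Dvd.intro_left L (pow_two L).symm).trans hs
  rw [InGrid, InGrid, Nat.mod_mod_of_dvd _ hs, Nat.dvd_mod_iff h2]

lemma inGrid_add {L s : ℕ} (hs : L ^ 2 ∣ s) (i : ℕ) : InGrid L (i + s) ↔ InGrid L i := by
  rw [← inGrid_mod hs, Nat.add_mod_right, inGrid_mod hs]

/-- One side is kept at multiples of `L`, while steps of `L` bring the other side to one of the
first `L` places of a block of length `L²`. -/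
lemma exists_inGrid_inGrid {L : ℕ} (hL : 1 ≤ L) (p p' : ℕ) :
    ∃ k < L ^ 2, InGrid L (p + k) ∧ InGrid L (p' + k) := by
  have hL2 : 0 < L ^ 2 := by positivity
  -- first reach a multiple of `L` on one side, then the head of a block on the other side
  obtain ⟨k₀, hk₀⟩ : ∃ k₀, L ∣ p + k₀ := ⟨(L - 1) * p, by
    obtain ⟨m, rfl⟩ : ∃ m, L = m + 1 := ⟨L - 1, by omega⟩
    exact ⟨p, by simp; ring⟩⟩
  set w := p' + k₀ with hw
  obtain ⟨j, hj⟩ : ∃ j, (w + j * L) % L ^ 2 < L := by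
    -- With this `j`, the number `w + jL` is `w % L` plus a multiple of `L²`.
    refine ⟨(L - 1) * (w / L), ?_⟩
    obtain ⟨m, rfl⟩ : ∃ m, L = m + 1 := ⟨L - 1, by omega⟩
    have h1 : w + (m + 1 - 1) * (w / (m + 1)) * (m + 1) =
        w % (m + 1) + (m + 1) ^ 2 * (w / (m + 1)) := by
      conv_lhs => rw [← Nat.mod_add_div w (m + 1)]
      have : (w % (m + 1) + (m + 1) * (w / (m + 1))) / (m + 1) = w / (m + 1) := by
        rw [Nat.mod_add_div]
      rw [this]
      simp
      ring
    rw [h1, Nat.add_mul_mod_self_left]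
    exact (Nat.mod_le _ _).trans_lt (Nat.mod_lt _ (Nat.succ_pos m))
  refine ⟨(k₀ + j * L) % L ^ 2, Nat.mod_lt _ hL2, ?_, ?_⟩
  · right
    have h3 : L ∣ p + (k₀ + j * L) := by
      rw [← add_assoc]; exact dvd_add hk₀ (Dvd.intro_left j rfl)
    have h4 : L ∣ L ^ 2 := Dvd.intro_left L (pow_two L).symm
    rw [← Nat.mod_add_div (k₀ + j * L) (L ^ 2), ← add_assoc] at h3
    exact (Nat.dvd_add_left (h4.mul_right _)).1 h3
  · left
    rw [Nat.add_mod_mod, ← add_assoc]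
    exact hj

/-- The grid is sparse. -/
lemma card_inGrid_le {L : ℕ} (hL : 1 ≤ L) (b : ℕ) :
    ((Finset.range (b * L ^ 2)).filter (InGrid L)).card ≤ 2 * (b * L) := by
  have hL2 : 0 < L ^ 2 := by positivity
  have hsub : (Finset.range (b * L ^ 2)).filter (InGrid L) ⊆
      (Finset.range b ×ˢ Finset.range L).image (fun p => p.1 * L ^ 2 + p.2) ∪
        (Finset.range (b * L)).image fun r => r * L := by
    intro i hi
    obtain ⟨h1, h2⟩ := Finset.mem_filter.1 hi
    rw [Finset.mem_range] at h1
    rw [Finset.mem_union]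
    rcases h2 with h2 | ⟨r, rfl⟩
    · left
      refine Finset.mem_image.2 ⟨(i / L ^ 2, i % L ^ 2), Finset.mem_product.2 ⟨?_, ?_⟩, ?_⟩
      · exact Finset.mem_range.2 (Nat.div_lt_of_lt_mul (by rwa [mul_comm] at h1))
      · exact Finset.mem_range.2 h2
      · exact Nat.div_add_mod' _ _
    · right
      refine Finset.mem_image.2 ⟨r, Finset.mem_range.2 ?_, mul_comm _ _⟩
      have : L * r < L * (b * L) := by calc
        L * r < b * L ^ 2 := h1
        _ = _ := by ring
      exact lt_of_mul_lt_mul_left this (Nat.zero_le _)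
  refine (Finset.card_le_card hsub).trans ((Finset.card_union_le _ _).trans ?_)
  refine (Nat.add_le_add Finset.card_image_le Finset.card_image_le).trans (le_of_eq ?_)
  simp
  ring

/-- Partial sums of `A` along an arithmetic progression. -/
def chainSum (A : ℕ → Bool) (s r : ℕ) : ℕ → Bool
  | 0 => false
  | j + 1 => xor (chainSum A s r j) (A (r + j * s))

section Code

variable {ℓ : ℕ} (L s : ℕ)

/-- The places whose letters belong to the signature. -/
def IsSignaturePlace (ℓ L s i : ℕ) : Prop := InGrid L i ∧ i < ℓ / s * s

instance (i : ℕ) : Decidable (IsSignaturePlace ℓ L s i) := inferInstanceAs (Decidable (_ ∧ _))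

/-- The signature letters. -/
def signatureLetter (ℓ L s : ℕ) (A : ℕ → Bool) (i : ℕ) : Bool :=
  if IsSignaturePlace ℓ L s i then chainSum A s (i % s) (i / s) else false

/-- The place of the free letter that enters at place `i`. -/
def rootPlace (ℓ L s i : ℕ) : ℕ := if IsSignaturePlace ℓ L s i then i % s else i

/-- The codeword with free letters equal to `1` on `Y`. -/
def codeword (ℓ L s : ℕ) (A : ℕ → Bool) (Y : Finset ℕ) : Fin ℓ → Bool := fun i =>
  xor (decide (rootPlace ℓ L s i ∈ Y)) (signatureLetter ℓ L s A i)

/-- The rotation by `t` places to the left. -/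
def rotateLeft (t : ℕ) (x : Fin ℓ → Bool) : Fin ℓ → Bool := fun i => periodicLetter x (t + i)

/-- The rotations of the codewords. -/
def rotatedCode (ℓ L s : ℕ) (Φ : Finset ℕ) (A : ℕ → Bool) : Finset (Fin ℓ → Bool) :=
  (Finset.range ℓ ×ˢ Φ.powerset).image fun p => rotateLeft p.1 (codeword ℓ L s A p.2)

variable {L s}

lemma periodicLetter_eq (hℓ : 1 ≤ ℓ) (x : Fin ℓ → Bool) (i : ℕ) :
    periodicLetter x i = x ⟨i % ℓ, Nat.mod_lt _ hℓ⟩ := by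
  simp only [periodicLetter, cycleLetter]
  rw [dif_pos (show 0 < ℓ from hℓ)]

lemma periodicLetter_coe (x : Fin ℓ → Bool) (i : Fin ℓ) : periodicLetter x i = x i := by
  have hℓ : 1 ≤ ℓ := i.pos
  rw [periodicLetter_eq hℓ]
  congr 1
  exact Fin.ext (Nat.mod_eq_of_lt i.2)

lemma periodicLetter_mod (hℓ : 1 ≤ ℓ) (x : Fin ℓ → Bool) (i : ℕ) :
    periodicLetter x (i % ℓ) = periodicLetter x i := by
  rw [periodicLetter_eq hℓ, periodicLetter_eq hℓ]
  congr 1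
  simp

lemma periodicLetter_rotateLeft (hℓ : 1 ≤ ℓ) (t : ℕ) (x : Fin ℓ → Bool) (i : ℕ) :
    periodicLetter (rotateLeft t x) i = periodicLetter x (t + i) := by
  rw [periodicLetter_eq hℓ, rotateLeft]
  simp only
  rw [← periodicLetter_mod hℓ x (t + i), ← periodicLetter_mod hℓ x (t + i % ℓ)]
  congr 1
  simp

lemma eq_of_periodicLetter {x y : Fin ℓ → Bool}
    (h : ∀ i, periodicLetter x i = periodicLetter y i) : x = y := by
  funext i
  rw [← periodicLetter_coe x, ← periodicLetter_coe y, h]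

lemma rotateLeft_injective (hℓ : 1 ≤ ℓ) (t : ℕ) :
    Function.Injective (rotateLeft t : (Fin ℓ → Bool) → Fin ℓ → Bool) := by
  intro x y h
  refine eq_of_periodicLetter fun i => ?_
  have := congrArg (fun w => periodicLetter w (ℓ * t + i - t)) h
  simp only [periodicLetter_rotateLeft hℓ] at this
  have hle : t ≤ ℓ * t := Nat.le_mul_of_pos_left t hℓ
  rw [show t + (ℓ * t + i - t) = ℓ * t + i by omega, ← periodicLetter_mod hℓ x (ℓ * t + i),
    ← periodicLetter_mod hℓ y (ℓ * t + i)] at this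
  simpa [periodicLetter_mod hℓ] using this

lemma rotateLeft_mod (hℓ : 1 ≤ ℓ) (t : ℕ) (x : Fin ℓ → Bool) :
    rotateLeft (t % ℓ) x = rotateLeft t x := by
  refine eq_of_periodicLetter fun i => ?_
  rw [periodicLetter_rotateLeft hℓ, periodicLetter_rotateLeft hℓ, ← periodicLetter_mod hℓ x (t + i),
    ← periodicLetter_mod hℓ x (t % ℓ + i)]
  simp

lemma isCyclic_rotatedCode (hℓ : 1 ≤ ℓ) (Φ : Finset ℕ) (A : ℕ → Bool) :
    IsCyclic (rotatedCode ℓ L s Φ A) := by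
  intro x hx
  obtain ⟨⟨t, Y⟩, hp, rfl⟩ := Finset.mem_image.1 hx
  rw [Finset.mem_product] at hp
  refine Finset.mem_image.2 ⟨((t + ℓ - 1) % ℓ, Y),
    Finset.mem_product.2 ⟨Finset.mem_range.2 (Nat.mod_lt _ hℓ), hp.2⟩, ?_⟩
  simp only
  rw [rotateLeft_mod hℓ]
  change rotateLeft (t + ℓ - 1) (codeword ℓ L s A Y) = rotateRight (rotateLeft t (codeword ℓ L s A Y))
  refine rotateLeft_injective hℓ 1 (eq_of_periodicLetter fun i => ?_)
  rw [periodicLetter_rotateLeft hℓ, periodicLetter_rotateLeft hℓ, periodicLetter_rotateLeft hℓ,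
    add_comm 1 i, periodicLetter_rotateRight hℓ, periodicLetter_rotateLeft hℓ,
    show t + ℓ - 1 + (i + 1) = (t + i) + ℓ by omega, ← periodicLetter_mod hℓ _ (t + i + ℓ),
    Nat.add_mod_right, periodicLetter_mod hℓ]

lemma signatureLetter_add (hs : 1 ≤ s) (hLs : L ^ 2 ∣ s) (A : ℕ → Bool) {i : ℕ}
    (hi : InGrid L i) (h : i + s < ℓ / s * s) :
    signatureLetter ℓ L s A (i + s) = xor (signatureLetter ℓ L s A i) (A i) := by
  rw [signatureLetter, if_pos ⟨(inGrid_add hLs i).2 hi, h⟩, signatureLetter,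
    if_pos ⟨hi, by omega⟩, Nat.add_mod_right, Nat.add_div_right _ hs, chainSum,
    Nat.mod_add_div']

lemma periodicLetter_codeword {A : ℕ → Bool} {Y : Finset ℕ} {i : ℕ} (hi : i < ℓ) :
    periodicLetter (codeword ℓ L s A Y) i =
      xor (decide (rootPlace ℓ L s i ∈ Y)) (signatureLetter ℓ L s A i) :=
  periodicLetter_coe (codeword ℓ L s A Y) ⟨i, hi⟩

/-- The places `i` and `i + s` are neighbours on one chain, so the same free letter enters both and
cancels. Two letters at distance `s` thus reveal the signature, whatever the free letters are. -/
lemma xor_codeword (hs : 1 ≤ s) (hLs : L ^ 2 ∣ s) (A : ℕ → Bool) (Y : Finset ℕ) {i : ℕ}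
    (hi : InGrid L i) (h : i + s < ℓ / s * s) :
    xor (periodicLetter (codeword ℓ L s A Y) (i + s)) (periodicLetter (codeword ℓ L s A Y) i) =
      A i := by
  have hle := Nat.div_mul_le_self ℓ s
  rw [periodicLetter_codeword (by omega), periodicLetter_codeword (by omega),
    signatureLetter_add hs hLs A hi h, rootPlace, rootPlace,
    if_pos ⟨(inGrid_add hLs i).2 hi, h⟩, if_pos ⟨hi, by omega⟩, Nat.add_mod_right]
  cases decide (i % s ∈ Y) <;> cases signatureLetter ℓ L s A i <;> simp

/-- The places of disagreement of two signatures, read from `p` and from `p'`. -/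
def signatureMismatches (L s : ℕ) (A A' : ℕ → Bool) (p p' : ℕ) : Finset ℕ :=
  (Finset.range s).filter fun k =>
    (InGrid L (p + k) ∧ InGrid L (p' + k)) ∧ A (p + k) ≠ A' (p' + k)

/-- Codes with different signatures are far apart. -/
lemma le_card_earlyMismatches (hs : 1 ≤ s) (hLs : L ^ 2 ∣ s) (h30 : 30 * s ≤ ℓ) {A A' : ℕ → Bool}
    {Φ : Finset ℕ} {m : ℕ} (hm : ∀ p p', p + 2 * s ≤ ℓ → p' + 2 * s ≤ ℓ →
      m ≤ (signatureMismatches L s A A' p p').card) :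
    ∀ x ∈ rotatedCode ℓ L s Φ A, ∀ y ∈ rotatedCode ℓ L s Φ A', m ≤ (earlyMismatches x y).card := by
  intro x hx y hy
  obtain ⟨⟨a, Y⟩, ha, rfl⟩ := Finset.mem_image.1 hx
  obtain ⟨⟨b, Y'⟩, hb, rfl⟩ := Finset.mem_image.1 hy
  have ha := Finset.mem_range.1 (Finset.mem_product.1 ha).1
  have hb := Finset.mem_range.1 (Finset.mem_product.1 hb).1
  simp only at ha hb ⊢
  have hℓ : 1 ≤ ℓ := by omega
  have hℓ' : ℓ < ℓ / s * s + s := by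
    have := Nat.div_add_mod' ℓ s
    have := Nat.mod_lt ℓ hs
    omega
  have hle := Nat.div_mul_le_self ℓ s
  set ℓ' := ℓ / s * s with hℓ'def
  -- The candidates are five windows of length `2s`, starting at `2sj`. The wrap-around of a rotated
  -- word, with the unused end beyond `ℓ'`, spoils at most two consecutive ones. Two words spoil at
  -- most four, so some window serves both, and `30 s ≤ ℓ` puts it in the first third.
  have hbase : ∀ a < ℓ, ∃ j₀, ∀ j, j ≠ j₀ → j ≠ j₀ + 1 → j < 5 →
      ∃ p, p + 2 * s ≤ ℓ' ∧ (p = a + 2 * s * j ∨ p + ℓ = a + 2 * s * j) := by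
    intro a ha
    have hj5 : ∀ j < 5, 2 * s * j ≤ 8 * s := fun j hj => by nlinarith
    by_cases h : a + 2 * s ≤ ℓ'
    · have h1 := Nat.mul_div_le (ℓ' - 2 * s - a) (2 * s)
      have h2 := Nat.lt_mul_div_succ (ℓ' - 2 * s - a) (by omega : 0 < 2 * s)
      set q := (ℓ' - 2 * s - a) / (2 * s) with hq
      refine ⟨q + 1, fun j hj1 hj2 hj => ?_⟩
      have h3 := hj5 j hj
      rcases Nat.lt_or_ge q j with hlt | hge
      · have h4 : 2 * s * (q + 1 + 2) ≤ 2 * s * j := Nat.mul_le_mul_left _ (by omega)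
        rw [Nat.mul_add (2 * s) (q + 1) 2] at h4
        exact ⟨a + 2 * s * j - ℓ, by omega, Or.inr (by omega)⟩
      · have h4 : 2 * s * j ≤ 2 * s * q := Nat.mul_le_mul_left _ hge
        exact ⟨a + 2 * s * j, by omega, Or.inl rfl⟩
    · refine ⟨0, fun j hj1 hj2 hj => ?_⟩
      have h3 := hj5 j hj
      have h4 : 2 * s * 2 ≤ 2 * s * j := Nat.mul_le_mul_left _ (by omega)
      exact ⟨a + 2 * s * j - ℓ, by omega, Or.inr (by omega)⟩
  obtain ⟨j, hj, p, p', hp, hp', hpa, hpb⟩ : ∃ j < 5, ∃ p p', p + 2 * s ≤ ℓ' ∧ p' + 2 * s ≤ ℓ' ∧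
      (p = a + 2 * s * j ∨ p + ℓ = a + 2 * s * j) ∧
      (p' = b + 2 * s * j ∨ p' + ℓ = b + 2 * s * j) := by
    obtain ⟨j₀, hj₀⟩ := hbase a ha
    obtain ⟨j₁, hj₁⟩ := hbase b hb
    obtain ⟨j, hj, h1, h2, h3, h4⟩ : ∃ j < 5, j ≠ j₀ ∧ j ≠ j₀ + 1 ∧ j ≠ j₁ ∧ j ≠ j₁ + 1 := by
      by_contra hcon
      push Not at hcon
      have h0 := hcon 0; have h1 := hcon 1; have h2 := hcon 2; have h3 := hcon 3; have h4 := hcon 4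
      omega
    obtain ⟨p, hp, hpa⟩ := hj₀ j h1 h2 hj
    obtain ⟨p', hp', hpb⟩ := hj₁ j h3 h4 hj
    exact ⟨j, hj, p, p', hp, hp', hpa, hpb⟩
  have hX : ∀ (a p : ℕ) (w : Fin ℓ → Bool), (p = a + 2 * s * j ∨ p + ℓ = a + 2 * s * j) → ∀ k,
      periodicLetter (rotateLeft a w) (2 * s * j + k) = periodicLetter w (p + k) := by
    intro a p w hp k
    rw [periodicLetter_rotateLeft hℓ, ← add_assoc]
    rcases hp with rfl | hp
    · rfl
    · rw [← hp, ← periodicLetter_mod hℓ, show p + ℓ + k = p + k + ℓ by omega, Nat.add_mod_right,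
        periodicLetter_mod hℓ]
  set X := rotateLeft a (codeword ℓ L s A Y) with hXdef
  set X' := rotateLeft b (codeword ℓ L s A' Y') with hX'def
  refine (hm p p' (by omega) (by omega)).trans ?_
  have hjs : 2 * s * j ≤ 8 * s := by nlinarith
  -- Different signature letters force a mismatch at `k` or at `k + s`. As `k < s`, the chosen place
  -- determines `k`.
  refine Finset.card_le_card_of_injOn (fun k => if periodicLetter X (2 * s * j + k) ≠
    periodicLetter X' (2 * s * j + k) then 2 * s * j + k else 2 * s * j + (k + s)) ?_ ?_
  · intro k hk
    obtain ⟨hks, ⟨hg, hg'⟩, hne⟩ := Finset.mem_filter.1 hk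
    rw [Finset.mem_range] at hks
    have e1 := xor_codeword hs hLs A Y hg (by omega : p + k + s < ℓ / s * s)
    have e2 := xor_codeword hs hLs A' Y' hg' (by omega : p' + k + s < ℓ / s * s)
    rw [add_assoc, ← hX a p _ hpa, ← hX a p _ hpa, ← hXdef] at e1
    rw [add_assoc, ← hX b p' _ hpb, ← hX b p' _ hpb, ← hX'def] at e2
    simp only
    refine Finset.mem_coe.2 (Finset.mem_filter.2 ?_)
    split_ifs with h
    · exact ⟨Finset.mem_range.2 (by omega), by omega, h⟩
    · refine ⟨Finset.mem_range.2 (by omega), by omega, fun h' => hne ?_⟩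
      rw [← e1, ← e2, not_not.1 h, h']
  · intro k hk k' hk' hkk
    have h1 := Finset.mem_range.1 (Finset.mem_filter.1 hk).1
    have h2 := Finset.mem_range.1 (Finset.mem_filter.1 hk').1
    simp only at hkk
    split_ifs at hkk <;> omega

end Code

/-! ### Local resemblance and size of the codes. -/

section Code

variable {ℓ L s : ℕ}

/-- A set of places for the free letters. -/
structure IsFreeSet (ℓ L s : ℕ) (Φ : Finset ℕ) : Prop where
  root : ∀ i ∈ Φ, i < ℓ ∧ rootPlace ℓ L s i = i
  grid : ∀ r < s, InGrid L r → r ∈ Φ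

lemma codeword_injOn {Φ : Finset ℕ} (hΦ : IsFreeSet ℓ L s Φ) (A : ℕ → Bool) :
    Set.InjOn (codeword ℓ L s A) (Φ.powerset : Set (Finset ℕ)) := by
  have key : ∀ Y ∈ Φ.powerset, ∀ Y', codeword ℓ L s A Y = codeword ℓ L s A Y' → Y ⊆ Y' := by
    intro Y hY Y' h i hi
    obtain ⟨hiℓ, hr⟩ := hΦ.root i (Finset.mem_powerset.1 hY hi)
    have := congrArg (fun w => periodicLetter w i) h
    simp only [periodicLetter_codeword hiℓ, hr, hi, decide_true] at this
    have h2 : true = decide (i ∈ Y') := (Bool.xor_left_inj).1 this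
    exact of_decide_eq_true h2.symm
  intro Y hY Y' hY' h
  exact Finset.Subset.antisymm (key Y hY Y' h) (key Y' hY' Y h.symm)

/-- The codewords that show the word `u` at place `t`. -/
def windowSet (ℓ L s : ℕ) (Φ : Finset ℕ) (A : ℕ → Bool) (t : ℕ) {m : ℕ} (u : Fin m → Bool) :
    Finset (Finset ℕ) :=
  Φ.powerset.filter fun Y => ∀ i : Fin m, periodicLetter (codeword ℓ L s A Y) (t + i) = u i

/-- Windows shorter than the period contain each chain at most once. -/
lemma window_chain_unique {t k k' n : ℕ} (ht : t < ℓ) (hn : n ≤ s) (hk : k < n)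
    (hk' : k' < n) (hi : (t + k) % ℓ < ℓ / s * s) (hi' : (t + k') % ℓ < ℓ / s * s)
    (h : (t + k) % ℓ % s = (t + k') % ℓ % s) : (t + k) % ℓ = (t + k') % ℓ := by
  have hle := Nat.div_mul_le_self ℓ s
  wlog hkk : k ≤ k' generalizing k k'
  · exact (this hk' hk hi' hi h.symm (by omega)).symm
  rcases Nat.eq_zero_or_pos (ℓ / s) with hq | hq
  · rw [hq] at hi; omega
  have hsℓ : s ≤ ℓ := le_trans (Nat.le_mul_of_pos_left s hq) hle
  have hmod : ∀ j < n, (t + j < ℓ ∧ (t + j) % ℓ = t + j) ∨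
      (ℓ ≤ t + j ∧ (t + j) % ℓ = t + j - ℓ) := by
    intro j hj
    rcases Nat.lt_or_ge (t + j) ℓ with h1 | h1
    · exact Or.inl ⟨h1, Nat.mod_eq_of_lt h1⟩
    · refine Or.inr ⟨h1, ?_⟩
      rw [Nat.mod_eq_sub_mod h1, Nat.mod_eq_of_lt (by omega)]
  have hsmall : ∀ a b : ℕ, a ≤ b → b < a + s → a % s = b % s → a = b := by
    intro a b hab hbs hm
    have h1 := (Nat.modEq_iff_dvd' hab).1 hm
    have := Nat.eq_zero_of_dvd_of_lt h1 (by omega)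
    omega
  rcases hmod k hk with ⟨h1, e1⟩ | ⟨h1, e1⟩ <;> rcases hmod k' hk' with ⟨h2, e2⟩ | ⟨h2, e2⟩
  · rw [e1, e2] at h ⊢
    exact hsmall _ _ (by omega) (by omega) h
  · rw [e1] at hi h
    rw [e2] at hi' h
    exfalso
    have h3 : (t + k' - ℓ + ℓ / s * s) % s = (t + k) % s := by
      rw [Nat.add_mul_mod_self_right, h]
    have h4 := hsmall (t + k) (t + k' - ℓ + ℓ / s * s) (by omega) (by omega) h3.symm
    omega
  · omega
  · rw [e1, e2] at h ⊢
    exact hsmall _ _ (by omega) (by omega) h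

/-- A window of at most `s` letters meets each chain at most once, so a change of signature there is
undone by flipping the free letter at the root of the chain. The roots to be flipped form `W`, and
`Y ↦ symmDiff Y W` is injective; roots below `s` are all free by `IsFreeSet.grid`. -/
lemma card_windowSet_le (hs : 1 ≤ s) (hℓ : 1 ≤ ℓ) (hLs : L ^ 2 ∣ s) {Φ : Finset ℕ}
    (hΦ : IsFreeSet ℓ L s Φ) (A A' : ℕ → Bool) {t : ℕ} (ht : t < ℓ) {m : ℕ} (hm : m ≤ s)
    (u : Fin m → Bool) :
    (windowSet ℓ L s Φ A t u).card ≤ (windowSet ℓ L s Φ A' t u).card := by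
  classical
  set W : Finset ℕ := (Finset.range s).filter fun r => InGrid L r ∧ ∃ k < m,
    IsSignaturePlace ℓ L s ((t + k) % ℓ) ∧ (t + k) % ℓ % s = r ∧
    signatureLetter ℓ L s A ((t + k) % ℓ) ≠ signatureLetter ℓ L s A' ((t + k) % ℓ) with hW
  have hWΦ : W ⊆ Φ := fun r hr => by
    obtain ⟨h1, h2, -⟩ := Finset.mem_filter.1 hr
    exact hΦ.grid r (Finset.mem_range.1 h1) h2
  have hmemW : ∀ k < m, IsSignaturePlace ℓ L s ((t + k) % ℓ) → ((t + k) % ℓ % s ∈ W ↔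
      signatureLetter ℓ L s A ((t + k) % ℓ) ≠ signatureLetter ℓ L s A' ((t + k) % ℓ)) := by
    intro k hk hsig
    constructor
    · intro h
      obtain ⟨-, -, k', hk', hsig', hr, hne⟩ := Finset.mem_filter.1 h
      rwa [← window_chain_unique ht hm hk' hk hsig'.2 hsig.2 hr]
    · intro h
      exact Finset.mem_filter.2 ⟨Finset.mem_range.2 (Nat.mod_lt _ hs), (inGrid_mod hLs _).2 hsig.1,
        k, hk, hsig, rfl, h⟩
  have hnotW : ∀ i < ℓ, ¬ IsSignaturePlace ℓ L s i → i ∉ W := by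
    intro i hi hsig h
    obtain ⟨h1, h2, k, -, hsig', hr, -⟩ := Finset.mem_filter.1 h
    have : i ≤ (t + k) % ℓ := hr ▸ Nat.mod_le _ _
    exact hsig ⟨h2, this.trans_lt hsig'.2⟩
  refine Finset.card_le_card_of_injOn (fun Y => symmDiff Y W) ?_ ?_
  · intro Y hY
    obtain ⟨hYΦ, hYu⟩ := Finset.mem_filter.1 hY
    rw [Finset.mem_powerset] at hYΦ
    refine Finset.mem_coe.2 (Finset.mem_filter.2 ⟨Finset.mem_powerset.2 ?_, fun i => ?_⟩)
    · intro r hr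
      rcases Finset.mem_symmDiff.1 hr with h | h
      · exact hYΦ h.1
      · exact hWΦ h.1
    · rw [← hYu i, ← periodicLetter_mod hℓ, ← periodicLetter_mod hℓ (codeword ℓ L s A Y)]
      have hlt : (t + i) % ℓ < ℓ := Nat.mod_lt _ hℓ
      rw [periodicLetter_codeword hlt, periodicLetter_codeword hlt]
      by_cases hsig : IsSignaturePlace ℓ L s ((t + i) % ℓ)
      · have h1 := hmemW i i.2 hsig
        rw [rootPlace, if_pos hsig]
        simp only [Finset.mem_symmDiff]
        by_cases h2 : (t + i) % ℓ % s ∈ Y <;> by_cases h3 : (t + i) % ℓ % s ∈ W <;>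
          simp only [h2, h3, true_iff, false_iff, not_not] at h1 ⊢ <;>
          revert h1 <;>
          cases signatureLetter ℓ L s A ((t + i) % ℓ) <;>
          cases signatureLetter ℓ L s A' ((t + i) % ℓ) <;> simp
      · have h3 := hnotW _ hlt hsig
        rw [rootPlace, if_neg hsig, signatureLetter, signatureLetter, if_neg hsig, if_neg hsig]
        simp [Finset.mem_symmDiff, h3]
  · intro Y _ Y' _ h
    exact symmDiff_left_injective W h

/-- A prefix of a rotated codeword is a window of the codeword. On the left one sums over the `ℓ`
rotations; each single rotation already embeds in the code on the right. -/
lemma prefixCount_rotatedCode_le (hs : 1 ≤ s) (hℓ : 1 ≤ ℓ) (hLs : L ^ 2 ∣ s) {Φ : Finset ℕ}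
    (hΦ : IsFreeSet ℓ L s Φ) (A A' : ℕ → Bool) {m : ℕ} (hm : m ≤ s) (u : Fin m → Bool) :
    prefixCount (rotatedCode ℓ L s Φ A) u ≤ ℓ * prefixCount (rotatedCode ℓ L s Φ A') u := by
  classical
  have h1 : prefixCount (rotatedCode ℓ L s Φ A) u ≤
      ∑ t ∈ Finset.range ℓ, (windowSet ℓ L s Φ A t u).card := by
    refine (Finset.card_le_card (t := (Finset.range ℓ).biUnion fun t =>
      (windowSet ℓ L s Φ A t u).image fun Y => rotateLeft t (codeword ℓ L s A Y)) ?_).trans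
        (Finset.card_biUnion_le.trans (Finset.sum_le_sum fun t _ => Finset.card_image_le))
    intro x hx
    obtain ⟨hx, hxu⟩ := Finset.mem_filter.1 hx
    obtain ⟨⟨t, Y⟩, hp, rfl⟩ := Finset.mem_image.1 hx
    obtain ⟨ht, hY⟩ := Finset.mem_product.1 hp
    refine Finset.mem_biUnion.2 ⟨t, ht, Finset.mem_image.2 ⟨Y, Finset.mem_filter.2 ⟨hY, ?_⟩, rfl⟩⟩
    intro i
    rw [← hxu i, periodicLetter_rotateLeft hℓ]
  have h2 : ∀ t ∈ Finset.range ℓ, (windowSet ℓ L s Φ A t u).card ≤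
      prefixCount (rotatedCode ℓ L s Φ A') u := by
    intro t ht
    refine (card_windowSet_le hs hℓ hLs hΦ A A' (Finset.mem_range.1 ht) hm u).trans ?_
    refine Finset.card_le_card_of_injOn (fun Y => rotateLeft t (codeword ℓ L s A' Y)) ?_ ?_
    · intro Y hY
      obtain ⟨hY, hYu⟩ := Finset.mem_filter.1 hY
      refine Finset.mem_coe.2 (Finset.mem_filter.2 ⟨Finset.mem_image.2
        ⟨(t, Y), Finset.mem_product.2 ⟨ht, hY⟩, rfl⟩, fun i => ?_⟩)
      rw [← hYu i, periodicLetter_rotateLeft hℓ]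
    · intro Y hY Y' hY' h
      exact codeword_injOn hΦ A' (Finset.mem_filter.1 hY).1 (Finset.mem_filter.1 hY').1
        (rotateLeft_injective hℓ t h)
  refine h1.trans ((Finset.sum_le_sum h2).trans (le_of_eq ?_))
  simp

lemma card_rotatedCode_le (Φ : Finset ℕ) (A : ℕ → Bool) :
    (rotatedCode ℓ L s Φ A).card ≤ ℓ * 2 ^ Φ.card := by
  refine Finset.card_image_le.trans (le_of_eq ?_)
  rw [Finset.card_product, Finset.card_range, Finset.card_powerset]

lemma le_card_rotatedCode (hℓ : 1 ≤ ℓ) {Φ : Finset ℕ} (hΦ : IsFreeSet ℓ L s Φ) (A : ℕ → Bool) :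
    2 ^ Φ.card ≤ (rotatedCode ℓ L s Φ A).card := by
  rw [← Finset.card_powerset]
  refine Finset.card_le_card_of_injOn (fun Y => rotateLeft 0 (codeword ℓ L s A Y)) ?_ ?_
  · intro Y hY
    exact Finset.mem_coe.2 (Finset.mem_image.2 ⟨(0, Y), Finset.mem_product.2
      ⟨Finset.mem_range.2 hℓ, hY⟩, rfl⟩)
  · intro Y hY Y' hY' h
    exact codeword_injOn hΦ A hY hY' (rotateLeft_injective hℓ 0 h)

/-- A free set must contain the at most `2πL` chain roots on the grid and avoid the places that copy
a root, at most `2(ℓ/s)πL` in number. Every size in between is possible. -/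
lemma exists_isFreeSet {π : ℕ} (hL : 1 ≤ L) (hπ : s = π * L ^ 2) {T : ℕ}
    (h1 : 2 * (π * L) ≤ T) (h2 : T + 2 * (ℓ / s * π * L) ≤ ℓ) (hsℓ : s ≤ ℓ) :
    ∃ Φ : Finset ℕ, IsFreeSet ℓ L s Φ ∧ Φ.card = T := by
  set D := (Finset.range s).filter (InGrid L) with hD
  set E := (Finset.range ℓ).filter fun i => rootPlace ℓ L s i = i with hE
  have hDE : D ⊆ E := by
    intro r hr
    obtain ⟨hr, -⟩ := Finset.mem_filter.1 hr
    rw [Finset.mem_range] at hr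
    refine Finset.mem_filter.2 ⟨Finset.mem_range.2 (by omega), ?_⟩
    rw [rootPlace, Nat.mod_eq_of_lt hr, ite_self]
  have hDT : D.card ≤ T := by
    refine le_trans ?_ h1
    rw [hD, hπ]
    exact card_inGrid_le hL π
  have hTE : T ≤ E.card := by
    have hc := Finset.card_filter_add_card_filter_not (s := Finset.range ℓ)
      (fun i => rootPlace ℓ L s i = i)
    have hle : ((Finset.range ℓ).filter fun i => ¬ rootPlace ℓ L s i = i).card ≤
        2 * (ℓ / s * π * L) := by
      refine (Finset.card_le_card ?_).trans (card_inGrid_le hL (ℓ / s * π))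
      intro i hi
      obtain ⟨-, hi⟩ := Finset.mem_filter.1 hi
      rw [rootPlace] at hi
      split_ifs at hi with hsig
      · refine Finset.mem_filter.2 ⟨Finset.mem_range.2 ?_, hsig.1⟩
        have := hsig.2
        calc i < ℓ / s * s := this
          _ = _ := by rw [mul_assoc, ← hπ]
      · exact absurd rfl hi
    rw [Finset.card_range] at hc
    rw [hE]
    omega
  obtain ⟨Φ, hDΦ, hΦE, hcard⟩ := Finset.exists_subsuperset_card_eq hDE hDT hTE
  refine ⟨Φ, ⟨fun i hi => ?_, fun r hr hg => ?_⟩, hcard⟩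
  · obtain ⟨h3, h4⟩ := Finset.mem_filter.1 (hΦE hi)
    exact ⟨Finset.mem_range.1 h3, h4⟩
  · exact hDΦ (Finset.mem_filter.2 ⟨Finset.mem_range.2 hr, hg⟩)

end Code

/-! ### A Gilbert-Varshamov family of signatures -/

section GilbertVarshamov

/-- Exponential bound for the size of a Hamming ball in the coordinates `J`. -/
lemma card_ball_le {ι : Type*} [Fintype ι] [DecidableEq ι] (J : Finset ι) (G : ι → Bool) (m : ℕ) :
    ((Finset.univ.filter fun A : ι → Bool => (J.filter fun i => A i ≠ G i).card < m).card : ℝ) ≤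
      2 ^ Fintype.card ι * ((5 / 8 : ℝ) ^ J.card * 4 ^ m) := by
  -- Exponential weights: each disagreement on `J` counts `1/4`, and the mean over one letter is `(1
  -- + 1/4)/2 = 5/8`.
  have h1 : ∑ A : ι → Bool, ∏ i, (if i ∈ J ∧ A i ≠ G i then (1 / 4 : ℝ) else 1) =
      2 ^ Fintype.card ι * (5 / 8 : ℝ) ^ J.card := by
    have e := Finset.prod_univ_sum (fun _ : ι => (Finset.univ : Finset Bool))
      fun i a => if i ∈ J ∧ a ≠ G i then (1 / 4 : ℝ) else 1
    rw [Fintype.piFinset_univ] at e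
    rw [← e]
    have e2 : ∀ i, ∑ a : Bool, (if i ∈ J ∧ a ≠ G i then (1 / 4 : ℝ) else 1) =
        2 * if i ∈ J then 5 / 8 else 1 := by
      intro i
      by_cases h : i ∈ J <;> cases G i <;> simp [h] <;> norm_num
    simp only [e2]
    rw [Finset.prod_mul_distrib, Finset.prod_const, Finset.card_univ, Finset.prod_ite,
      Finset.prod_const, Finset.prod_const_one, mul_one, Finset.filter_mem_eq_inter,
      Finset.univ_inter]
  have h2 : ∀ A : ι → Bool, ∏ i, (if i ∈ J ∧ A i ≠ G i then (1 / 4 : ℝ) else 1) =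
      (1 / 4) ^ (J.filter fun i => A i ≠ G i).card := by
    intro A
    rw [Finset.prod_ite, Finset.prod_const, Finset.prod_const_one, mul_one]
    congr 2
    ext i
    simp
  set Ball := Finset.univ.filter fun A : ι → Bool => (J.filter fun i => A i ≠ G i).card < m
    with hBall
  have h3 : (Ball.card : ℝ) * (1 / 4) ^ m ≤ 2 ^ Fintype.card ι * (5 / 8 : ℝ) ^ J.card := by
    rw [← h1, ← nsmul_eq_mul, ← Finset.sum_const]
    refine (Finset.sum_le_sum fun A hA => ?_).trans (Finset.sum_le_univ_sum_of_nonneg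
      fun A => (h2 A).symm ▸ by positivity)
    rw [h2]
    exact pow_le_pow_of_le_one (by norm_num) (by norm_num) (Finset.mem_filter.1 hA).2.le
  calc (Ball.card : ℝ) = Ball.card * (1 / 4) ^ m * 4 ^ m := by
        rw [mul_assoc, ← mul_pow]; norm_num
    _ ≤ 2 ^ Fintype.card ι * (5 / 8 : ℝ) ^ J.card * 4 ^ m :=
        mul_le_mul_of_nonneg_right h3 (by positivity)
    _ = _ := by ring

/-- Greedy choice of a separated family. -/
lemma exists_separated_family {X : Type*} [Fintype X] [DecidableEq X] (near : X → X → Prop)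
    (hsymm : ∀ x y, near x y → near y x) (hrefl : ∀ x, near x x)
    [DecidableRel near] {b : ℝ}
    (hb : ∀ x, ((Finset.univ.filter fun y => near x y).card : ℝ) ≤ b) :
    ∃ F : Finset X, (∀ x ∈ F, ∀ y ∈ F, x ≠ y → ¬ near x y) ∧ (Fintype.card X : ℝ) ≤ F.card * b := by
  classical
  -- By maximality, the neighbourhoods of the members of a largest separated family cover the whole
  -- space.
  set 𝓕 := (Finset.univ : Finset X).powerset.filter fun F => ∀ x ∈ F, ∀ y ∈ F, x ≠ y → ¬ near x y
    with h𝓕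
  obtain ⟨F, hF, hmax⟩ := 𝓕.exists_max_image Finset.card
    ⟨∅, Finset.mem_filter.2 ⟨Finset.mem_powerset.2 (Finset.empty_subset _), by simp⟩⟩
  have hFs := (Finset.mem_filter.1 hF).2
  refine ⟨F, hFs, ?_⟩
  have hcover : (Finset.univ : Finset X) ⊆ F.biUnion fun x => Finset.univ.filter fun y => near x y := by
    intro y _
    by_contra hy
    simp only [Finset.mem_biUnion, Finset.mem_filter, Finset.mem_univ, true_and, not_exists,
      not_and] at hy
    have hyF : y ∉ F := fun h => hy y h (hrefl y)
    have hins : insert y F ∈ 𝓕 := by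
      refine Finset.mem_filter.2 ⟨Finset.mem_powerset.2 (Finset.subset_univ _), ?_⟩
      intro x hx x' hx' hne
      rcases Finset.mem_insert.1 hx with rfl | hx
      · rcases Finset.mem_insert.1 hx' with rfl | hx'
        · exact absurd rfl hne
        · exact fun h => hy x' hx' (hsymm _ _ h)
      · rcases Finset.mem_insert.1 hx' with h | hx'
        · rw [h]
          exact hy x hx
        · exact hFs x hx x' hx' hne
    have := hmax _ hins
    rw [Finset.card_insert_of_notMem hyF] at this
    omega
  have h1 : Fintype.card X ≤ ∑ x ∈ F, (Finset.univ.filter fun y => near x y).card :=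
    (Finset.card_le_card hcover).trans Finset.card_biUnion_le
  calc (Fintype.card X : ℝ) ≤ ∑ x ∈ F, ((Finset.univ.filter fun y => near x y).card : ℝ) := by
        exact_mod_cast h1
    _ ≤ ∑ x ∈ F, b := Finset.sum_le_sum fun x _ => hb x
    _ = _ := by simp

variable {ℓ L s π : ℕ}

lemma signatureMismatches_card_comm (A A' : ℕ → Bool) (p p' : ℕ) :
    (signatureMismatches L s A A' p p').card = (signatureMismatches L s A' A p' p).card := by
  congr 1
  ext k
  simp only [signatureMismatches, Finset.mem_filter]
  constructor <;> rintro ⟨h1, ⟨h2, h3⟩, h4⟩ <;> exact ⟨h1, ⟨h3, h2⟩, h4.symm⟩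

/-- Each block of `L²` places contains one where both translated grids are present, so the
signatures are compared in at least `π` coordinates, and the ball bound applies to these. -/
lemma card_near_le (hL : 1 ≤ L) (hπ : s = π * L ^ 2) (hs : 1 ≤ s) (A : ℕ → Bool) {p p' : ℕ}
    (hp' : p' + 2 * s ≤ ℓ) (m : ℕ) :
    ((Finset.univ.filter fun A' : Fin ℓ → Bool =>
      (signatureMismatches L s A (periodicLetter A') p p').card < m).card : ℝ) ≤
      2 ^ ℓ * ((5 / 8 : ℝ) ^ π * 4 ^ m) := by
  have hℓ : 1 ≤ ℓ := by omega
  set J : Finset (Fin ℓ) := Finset.univ.filter fun i => p' ≤ i.1 ∧ i.1 < p' + s ∧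
    InGrid L (p + (i.1 - p')) ∧ InGrid L i.1 with hJ
  set G : Fin ℓ → Bool := fun i => A (p + (i.1 - p')) with hG
  have hball := card_ball_le J G m
  rw [Fintype.card_fin] at hball
  have hJcard : π ≤ J.card := by
    choose f hf using fun b : ℕ => exists_inGrid_inGrid hL (p + b * L ^ 2) (p' + b * L ^ 2)
    have hL2 : 0 < L ^ 2 := by positivity
    have hlt : ∀ b < π, b * L ^ 2 + f b < s := by
      intro b hb
      have h1 : (b + 1) * L ^ 2 ≤ π * L ^ 2 := Nat.mul_le_mul_right _ hb
      rw [add_mul, one_mul] at h1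
      have := (hf b).1
      omega
    calc π = (Finset.range π).card := (Finset.card_range π).symm
      _ ≤ J.card := by
        refine Finset.card_le_card_of_injOn
          (fun b => (⟨(p' + (b * L ^ 2 + f b)) % ℓ, Nat.mod_lt _ hℓ⟩ : Fin ℓ)) ?_ ?_
        · intro b hb
          have hb := hlt b (Finset.mem_range.1 hb)
          have e : (p' + (b * L ^ 2 + f b)) % ℓ = p' + (b * L ^ 2 + f b) :=
            Nat.mod_eq_of_lt (by omega)
          refine Finset.mem_coe.2 (Finset.mem_filter.2 ⟨Finset.mem_univ _, ?_⟩)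
          simp only [e]
          refine ⟨by omega, by omega, ?_, ?_⟩
          · rw [show p + (p' + (b * L ^ 2 + f b) - p') = p + b * L ^ 2 + f b by omega]
            exact (hf b).2.1
          · rw [← add_assoc]
            exact (hf b).2.2
        · intro b hb b' hb' h
          have h1 := hlt b (Finset.mem_range.1 hb)
          have h2 := hlt b' (Finset.mem_range.1 hb')
          have h3 := congrArg Fin.val h
          simp only at h3
          rw [Nat.mod_eq_of_lt (by omega), Nat.mod_eq_of_lt (by omega)] at h3
          have h4 : b * L ^ 2 + f b = b' * L ^ 2 + f b' := by omega
          have h5 : (b * L ^ 2 + f b) / L ^ 2 = (b' * L ^ 2 + f b') / L ^ 2 := by rw [h4]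
          rwa [mul_comm b, mul_comm b', Nat.mul_add_div hL2, Nat.mul_add_div hL2,
            Nat.div_eq_of_lt (hf b).1, Nat.div_eq_of_lt (hf b').1, add_zero, add_zero] at h5
  refine le_trans ?_ (hball.trans ?_)
  · refine Nat.cast_le.2 (Finset.card_le_card ?_)
    intro A' hA'
    refine Finset.mem_filter.2 ⟨Finset.mem_univ _, lt_of_le_of_lt ?_ (Finset.mem_filter.1 hA').2⟩
    refine Finset.card_le_card_of_injOn (fun i => i.1 - p') ?_ ?_
    · intro i hi
      obtain ⟨hi, hne⟩ := Finset.mem_filter.1 hi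
      obtain ⟨-, h1, h2, h3, h4⟩ := Finset.mem_filter.1 hi
      have h5 : i.1 - p' < s := by omega
      refine Finset.mem_coe.2 (Finset.mem_filter.2 ⟨Finset.mem_range.2 h5, ⟨h3, ?_⟩, ?_⟩)
      · rwa [show p' + (i.1 - p') = i.1 by omega]
      · rw [show p' + (i.1 - p') = i.1 by omega, periodicLetter_coe]
        exact hne.symm
    · intro i hi i' hi' h
      have h1 := (Finset.mem_filter.1 (Finset.mem_filter.1 hi).1).2.1
      have h2 := (Finset.mem_filter.1 (Finset.mem_filter.1 hi').1).2.1
      simp only at h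
      exact Fin.ext (by omega)
  · refine mul_le_mul_of_nonneg_left (mul_le_mul_of_nonneg_right ?_ (by positivity)) (by positivity)
    exact pow_le_pow_of_le_one (by norm_num) (by norm_num) hJcard

/-- A large family of signatures that differ at all relative positions. -/
lemma exists_signatures (hL : 1 ≤ L) (hπ : s = π * L ^ 2) (hs : 1 ≤ s) {m : ℕ} (hm : 1 ≤ m)
    (h2s : 2 * s ≤ ℓ) :
    ∃ F : Finset (Fin ℓ → Bool), (∀ A ∈ F, ∀ A' ∈ F, A ≠ A' → ∀ p p', p + 2 * s ≤ ℓ →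
      p' + 2 * s ≤ ℓ → m ≤ (signatureMismatches L s (periodicLetter A) (periodicLetter A') p p').card) ∧
      1 ≤ F.card * (ℓ ^ 2 * ((5 / 8 : ℝ) ^ π * 4 ^ m)) := by
  classical
  set near : (Fin ℓ → Bool) → (Fin ℓ → Bool) → Prop := fun A A' => ∃ p ∈ Finset.range ℓ,
    ∃ p' ∈ Finset.range ℓ, p + 2 * s ≤ ℓ ∧ p' + 2 * s ≤ ℓ ∧
      (signatureMismatches L s (periodicLetter A) (periodicLetter A') p p').card < m with hnear
  obtain ⟨F, hF, hcard⟩ := exists_separated_family near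
    (fun A A' ⟨p, hp, p', hp', h1, h2, h3⟩ => ⟨p', hp', p, hp, h2, h1, by
      rwa [signatureMismatches_card_comm]⟩)
    (fun A => ⟨0, Finset.mem_range.2 (by omega), 0, Finset.mem_range.2 (by omega), by omega,
      by omega, by simp [signatureMismatches]; omega⟩)
    -- The factor `ℓ²` counts the pairs of positions `p`, `p'`.
    (b := ℓ ^ 2 * (2 ^ ℓ * ((5 / 8 : ℝ) ^ π * 4 ^ m))) (by
      intro A
      have hsub : (Finset.univ.filter fun A' => near A A') ⊆
          (((Finset.range ℓ) ×ˢ (Finset.range ℓ)).filter fun q => q.2 + 2 * s ≤ ℓ).biUnion fun q =>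
            Finset.univ.filter fun A' : Fin ℓ → Bool =>
              (signatureMismatches L s (periodicLetter A) (periodicLetter A') q.1 q.2).card < m := by
        intro A' hA'
        obtain ⟨p, hp, p', hp', -, h2, h3⟩ := (Finset.mem_filter.1 hA').2
        exact Finset.mem_biUnion.2 ⟨(p, p'), Finset.mem_filter.2
          ⟨Finset.mem_product.2 ⟨hp, hp'⟩, h2⟩, Finset.mem_filter.2 ⟨Finset.mem_univ _, h3⟩⟩
      have h1 := (Finset.card_le_card hsub).trans Finset.card_biUnion_le
      have h2 : ((Finset.univ.filter fun A' => near A A').card : ℝ) ≤ _ := Nat.cast_le.2 h1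
      rw [Nat.cast_sum] at h2
      refine h2.trans ((Finset.sum_le_sum fun q hq => card_near_le hL hπ hs (periodicLetter A)
        (Finset.mem_filter.1 hq).2 m).trans ?_)
      rw [Finset.sum_const, nsmul_eq_mul]
      refine mul_le_mul_of_nonneg_right ?_ (by positivity)
      have h3 := Finset.card_filter_le ((Finset.range ℓ) ×ˢ (Finset.range ℓ))
        fun q => q.2 + 2 * s ≤ ℓ
      rw [Finset.card_product, Finset.card_range, ← pow_two] at h3
      exact_mod_cast h3)
  refine ⟨F, fun A hA A' hA' hne p p' hp hp' => ?_, ?_⟩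
  · by_contra hcon
    exact hF A hA A' hA' hne ⟨p, Finset.mem_range.2 (by omega), p', Finset.mem_range.2 (by omega),
      hp, hp', not_le.1 hcon⟩
  · rw [Fintype.card_fun, Fintype.card_bool, Fintype.card_fin] at hcard
    push_cast at hcard
    have h2 : (0 : ℝ) < 2 ^ ℓ := by positivity
    have : (2 : ℝ) ^ ℓ * 1 ≤ 2 ^ ℓ * (F.card * (ℓ ^ 2 * ((5 / 8 : ℝ) ^ π * 4 ^ m))) := by
      rw [mul_one]
      refine hcard.trans (le_of_eq ?_)
      ring
    exact le_of_mul_le_mul_left this h2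

end GilbertVarshamov

lemma eventually_poly_le_rpow (C : ℝ) (d : ℕ) {κ : ℝ} (hκ : 0 < κ) :
    ∀ᶠ ℓ : ℕ in atTop, C * (ℓ : ℝ) ^ d ≤ (2 : ℝ) ^ (κ * ℓ) := by
  have h1 : |(2 : ℝ) ^ (-κ)| < 1 := by
    rw [abs_of_pos (by positivity)]
    exact Real.rpow_lt_one_of_one_lt_of_neg (by norm_num) (by linarith)
  have h2 := (tendsto_pow_const_mul_const_pow_of_abs_lt_one d h1).const_mul C
  rw [mul_zero] at h2
  filter_upwards [h2.eventually (gt_mem_nhds zero_lt_one)] with ℓ hℓ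
  have e : ((2 : ℝ) ^ (-κ)) ^ ℓ * (2 : ℝ) ^ (κ * ℓ) = 1 := by
    rw [← Real.rpow_natCast, ← Real.rpow_mul (by norm_num), ← Real.rpow_add (by norm_num)]
    simp
  have hpos : (0 : ℝ) < (2 : ℝ) ^ (κ * ℓ) := by positivity
  calc C * (ℓ : ℝ) ^ d = C * ((ℓ : ℝ) ^ d * ((2 : ℝ) ^ (-κ)) ^ ℓ) * (2 : ℝ) ^ (κ * ℓ) := by
        rw [mul_assoc, mul_assoc, e, mul_one]
    _ ≤ 1 * (2 : ℝ) ^ (κ * ℓ) := mul_le_mul_of_nonneg_right hℓ.le hpos.le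
    _ = _ := one_mul _

/-- An exponentially large family of cyclic codes of rate about `R - ε₀ / 2` that are locally
alike but far apart. -/
structure IsCodeFamily (R ε₀ c β₁ : ℝ) (ℓ : ℕ) (𝓑 : Finset (Finset (Fin ℓ → Bool))) : Prop where
  card_ge : (2 : ℝ) ^ (c * (ℓ : ℝ)) ≤ (𝓑.card : ℝ)
  nonempty : ∀ B ∈ 𝓑, B.Nonempty
  cyclic : ∀ B ∈ 𝓑, IsCyclic B
  size_ge : ∀ B ∈ 𝓑, (2 : ℝ) ^ ((R - ε₀ / 2) * (ℓ : ℝ)) ≤ (B.card : ℝ)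
  size_le : ∀ B ∈ 𝓑, (B.card : ℝ) ≤ (2 : ℝ) ^ ((R - ε₀ / 4) * (ℓ : ℝ))
  size_compare : ∀ B ∈ 𝓑, ∀ B' ∈ 𝓑, B'.card ≤ ℓ * B.card
  prefix_compare : ∀ B ∈ 𝓑, ∀ B' ∈ 𝓑, ∀ m, 60 * m ≤ ℓ → ∀ u : Fin m → Bool,
    prefixCount B u ≤ ℓ * prefixCount B' u
  far : ∀ B ∈ 𝓑, ∀ B' ∈ 𝓑, B ≠ B' → ∀ x ∈ B, ∀ y ∈ B',
    β₁ * (ℓ : ℝ) ≤ ((earlyMismatches x y).card : ℝ)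

theorem exists_isCodeFamily {R : ℝ} (hR0 : 0 < R) (hR1 : R < 1) :
    ∃ c β₁ : ℝ, 0 < c ∧ 0 < β₁ ∧ β₁ < 1 / 2 ∧ ∀ ε₀ : ℝ, 0 < ε₀ → ε₀ < R →
      ∀ᶠ ℓ : ℕ in atTop, ∃ 𝓑, IsCodeFamily R ε₀ c β₁ ℓ 𝓑 := by
  -- The grid has density at most `2/L`. This `L` makes it so sparse that the chain roots fit among
  -- the free letters (the term `8/R`) and enough other places remain (the term `8/(1 - R)`).
  obtain ⟨L, hL⟩ := exists_nat_ge (8 / (1 - R) + 8 / R)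
  have hR1' : 0 < 1 - R := by linarith
  have hLR : 8 / R ≤ L := by have : 0 < 8 / (1 - R) := by positivity
                             linarith
  have hLR1 : 8 / (1 - R) ≤ L := by have : 0 < 8 / R := by positivity
                                    linarith
  have hL8 : (8 : ℝ) ≤ L := by
    refine le_trans ?_ hLR
    rw [le_div_iff₀ hR0]; linarith
  have hL0 : (0 : ℝ) < L := by linarith
  have hL1 : 1 ≤ L := by exact_mod_cast (by linarith : (1 : ℝ) ≤ L)
  rw [div_le_iff₀ hR0] at hLR
  rw [div_le_iff₀ hR1'] at hLR1
  refine ⟨1 / (480 * L ^ 2), 1 / (1920 * L ^ 2), by positivity, by positivity, ?_, ?_⟩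
  · rw [div_lt_div_iff₀ (by positivity) (by norm_num)]
    nlinarith
  intro ε₀ hε0 hεR
  have hc : (0 : ℝ) < 1 / (480 * L ^ 2) := by positivity
  filter_upwards [eventually_ge_atTop (960 * L ^ 2), eventually_poly_le_rpow 1 2 hc,
    eventually_poly_le_rpow 2 1 (by positivity : 0 < ε₀ / 4),
    eventually_ge_atTop ⌈1 / ((1 - R) / 2)⌉₊] with ℓ hℓL hℓ2 hℓ3 hℓ4
  have hL2 : 0 < L ^ 2 := by positivity
  -- This puts `s` between `ℓ/60` and `ℓ/30`: a word has room for thirty periods, while windows of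
  -- at most `ℓ/60` letters stay within one.
  set π := ℓ / (30 * L ^ 2) with hπ
  set s := π * L ^ 2 with hs
  have hπ1 : π * (30 * L ^ 2) ≤ ℓ := Nat.div_mul_le_self _ _
  have h30 : 30 * s ≤ ℓ := by rw [hs]; linarith
  have hπ32 : 32 ≤ π := (Nat.le_div_iff_mul_le (by positivity)).2 (by linarith)
  have hπ2 : ℓ < (π + 1) * (30 * L ^ 2) := by
    exact Nat.lt_mul_of_div_lt (Nat.lt_succ_self _) (by positivity)
  have hs1 : 1 ≤ s := Nat.mul_pos (by omega) hL2
  have hs60 : ℓ ≤ 60 * s := by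
    rw [hs]; nlinarith
  -- Since `(5/8)^16 · 4 ≤ 2^{-8}`, the ball bound becomes `2^{-8m}`. With `m ≥ ℓ/(1920 L²)` this is
  -- at most `2^{-2cℓ}`, and half of that exponent pays for the `ℓ²` pairs of positions.
  set m := π / 16 with hm
  have hm1 : 1 ≤ m := by omega
  have hm16 : 16 * m ≤ π := by omega
  have hm32 : π ≤ 32 * m := by omega
  have hmℓ : (ℓ : ℝ) ≤ 1920 * L ^ 2 * m := by
    have : ℓ ≤ 60 * (32 * m * L ^ 2) :=
      hs60.trans (Nat.mul_le_mul_left _ (Nat.mul_le_mul_right _ hm32))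
    have : (ℓ : ℝ) ≤ 60 * (32 * m * L ^ 2) := by exact_mod_cast this
    linarith
  have hℓ1 : 1 ≤ ℓ := by omega
  have hℓ0 : (0 : ℝ) < ℓ := by positivity
  have hLs : L ^ 2 ∣ s := Dvd.intro_left π rfl
  set T := ⌈(R - ε₀ / 2) * ℓ⌉₊ with hT
  have hRε : 0 ≤ (R - ε₀ / 2) * ℓ := mul_nonneg (by linarith) hℓ0.le
  have hTge : (R - ε₀ / 2) * ℓ ≤ T := Nat.le_ceil _
  have hTlt : (T : ℝ) < (R - ε₀ / 2) * ℓ + 1 := Nat.ceil_lt_add_one hRε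
  obtain ⟨Φ, hΦ, hΦT⟩ : ∃ Φ : Finset ℕ, IsFreeSet ℓ L s Φ ∧ Φ.card = T := by
    refine exists_isFreeSet hL1 hs ?_ ?_ (by omega)
    · have h1 : (π : ℝ) * (30 * L ^ 2) ≤ ℓ := by exact_mod_cast hπ1
      have h2 : ((2 * (π * L) : ℕ) : ℝ) ≤ T := by
        push_cast
        refine le_trans ?_ hTge
        have h3 : R / 2 * ℓ ≤ (R - ε₀ / 2) * ℓ :=
          mul_le_mul_of_nonneg_right (by linarith) hℓ0.le
        refine le_trans ?_ h3
        have h4 : (2 * (π * L) : ℝ) * (15 * L) ≤ R / 2 * ℓ * (15 * L) := by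
          calc (2 * (π * L) : ℝ) * (15 * L) = π * (30 * L ^ 2) := by ring
            _ ≤ 1 * ℓ := by linarith
            _ ≤ (15 * (L * R) / 2) * ℓ := mul_le_mul_of_nonneg_right (by nlinarith) hℓ0.le
            _ = _ := by ring
        exact le_of_mul_le_mul_right h4 (by positivity)
      exact_mod_cast h2
    · have h1 : ((ℓ / s * π * L : ℕ) : ℝ) * L ≤ ℓ := by
        have : ℓ / s * π * L * L ≤ ℓ := by
          calc ℓ / s * π * L * L = ℓ / s * s := by rw [hs]; ring
            _ ≤ ℓ := Nat.div_mul_le_self _ _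
        exact_mod_cast this
      have h2 : ((T + 2 * (ℓ / s * π * L) : ℕ) : ℝ) ≤ ℓ := by
        set w := ((ℓ / s * π * L : ℕ) : ℝ) with hw
        have hw0 : 0 ≤ w := Nat.cast_nonneg _
        have h3 : w * 8 ≤ (1 - R) * ℓ := by
          calc w * 8 ≤ w * (L * (1 - R)) := mul_le_mul_of_nonneg_left hLR1 hw0
            _ = (1 - R) * (w * L) := by ring
            _ ≤ _ := mul_le_mul_of_nonneg_left h1 hR1'.le
        have h4 : 1 ≤ (1 - R) / 2 * ℓ := by
          have := (Nat.le_ceil (1 / ((1 - R) / 2))).trans (Nat.cast_le.2 hℓ4)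
          rw [div_le_iff₀ (by positivity)] at this
          linarith
        have h5 : ε₀ / 2 * ℓ ≥ 0 := by positivity
        rw [Nat.cast_add, Nat.cast_mul, ← hw]
        push_cast
        nlinarith
      exact_mod_cast h2
  obtain ⟨F, hFfar, hFcard⟩ := exists_signatures hL1 hs hs1 hm1 (ℓ := ℓ) (by omega)
  classical
  have hfar : ∀ A ∈ F, ∀ A' ∈ F, A ≠ A' → ∀ x ∈ rotatedCode ℓ L s Φ (periodicLetter A),
      ∀ y ∈ rotatedCode ℓ L s Φ (periodicLetter A'), m ≤ (earlyMismatches x y).card :=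
    fun A hA A' hA' hne => le_card_earlyMismatches hs1 hLs h30 (hFfar A hA A' hA' hne)
  have hne : ∀ A : Fin ℓ → Bool, (rotatedCode ℓ L s Φ (periodicLetter A)).Nonempty := fun A =>
    Finset.card_pos.1 (lt_of_lt_of_le (by positivity) (le_card_rotatedCode hℓ1 hΦ _))
  have hinj : Set.InjOn (fun A : Fin ℓ → Bool => rotatedCode ℓ L s Φ (periodicLetter A)) F := by
    intro A hA A' hA' h
    by_contra hAA
    simp only at h
    obtain ⟨x, hx⟩ := hne A
    have := hfar A hA A' hA' hAA x hx x (h ▸ hx)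
    rw [show earlyMismatches x x = ∅ by simp [earlyMismatches], Finset.card_empty] at this
    omega
  refine ⟨F.image fun A => rotatedCode ℓ L s Φ (periodicLetter A), ?_, ?_, ?_, ?_, ?_, ?_, ?_, ?_⟩
  · rw [Finset.card_image_of_injOn hinj]
    have h1 : (5 / 8 : ℝ) ^ π * 4 ^ m ≤ (2 : ℝ) ^ (-(2 * (1 / (480 * (L : ℝ) ^ 2)) * (ℓ : ℝ))) := by
      calc (5 / 8 : ℝ) ^ π * 4 ^ m ≤ (5 / 8 : ℝ) ^ (16 * m) * 4 ^ m :=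
            mul_le_mul_of_nonneg_right (pow_le_pow_of_le_one (by norm_num) (by norm_num) hm16)
              (by positivity)
        _ = ((5 / 8 : ℝ) ^ 16 * 4) ^ m := by rw [pow_mul, mul_pow]
        _ ≤ ((2 : ℝ) ^ (-8 : ℝ)) ^ m := by
            refine pow_le_pow_left₀ (by positivity) ?_ _
            rw [Real.rpow_neg (by norm_num)]
            norm_num
        _ = (2 : ℝ) ^ (-8 * (m : ℝ)) := by
            rw [← Real.rpow_natCast, ← Real.rpow_mul (by norm_num)]
        _ ≤ _ := by
            refine Real.rpow_le_rpow_of_exponent_le (by norm_num) ?_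
            have : 2 * (1 / (480 * (L : ℝ) ^ 2)) * ℓ ≤ 8 * m := by
              rw [mul_one_div, div_mul_eq_mul_div, div_le_iff₀ (by positivity)]
              linarith
            linarith
    set κ := 1 / (480 * (L : ℝ) ^ 2) with hκ
    have h2 : (ℓ : ℝ) ^ 2 * ((5 / 8 : ℝ) ^ π * 4 ^ m) ≤ (2 : ℝ) ^ (-(κ * ℓ)) := by
      calc (ℓ : ℝ) ^ 2 * ((5 / 8 : ℝ) ^ π * 4 ^ m) ≤
          (2 : ℝ) ^ (κ * ℓ) * (2 : ℝ) ^ (-(2 * κ * ℓ)) :=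
            mul_le_mul (by linarith) h1 (by positivity) (by positivity)
        _ = _ := by
            rw [← Real.rpow_add (by norm_num)]
            congr 1
            ring
    have h3 : (1 : ℝ) ≤ F.card * (2 : ℝ) ^ (-(κ * ℓ)) :=
      hFcard.trans (mul_le_mul_of_nonneg_left h2 (Nat.cast_nonneg _))
    rw [Real.rpow_neg (by norm_num), ← div_eq_mul_inv, le_div_iff₀ (by positivity), one_mul] at h3
    exact h3
  · intro B hB
    obtain ⟨A, -, rfl⟩ := Finset.mem_image.1 hB
    exact hne A
  · intro B hB
    obtain ⟨A, -, rfl⟩ := Finset.mem_image.1 hB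
    exact isCyclic_rotatedCode hℓ1 _ _
  · intro B hB
    obtain ⟨A, -, rfl⟩ := Finset.mem_image.1 hB
    have h1 : ((2 ^ Φ.card : ℕ) : ℝ) ≤ _ := Nat.cast_le.2 (le_card_rotatedCode hℓ1 hΦ (periodicLetter A))
    refine le_trans ?_ h1
    rw [hΦT]
    push_cast
    rw [← Real.rpow_natCast]
    exact Real.rpow_le_rpow_of_exponent_le (by norm_num) hTge
  · intro B hB
    obtain ⟨A, -, rfl⟩ := Finset.mem_image.1 hB
    have h1 := Nat.cast_le (α := ℝ).2 (card_rotatedCode_le (ℓ := ℓ) (L := L) (s := s) Φ (periodicLetter A))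
    refine h1.trans ?_
    rw [hΦT]
    push_cast
    calc (ℓ : ℝ) * 2 ^ T ≤ ℓ * (2 : ℝ) ^ ((R - ε₀ / 2) * ℓ + 1) := by
          rw [← Real.rpow_natCast]
          exact mul_le_mul_of_nonneg_left
            (Real.rpow_le_rpow_of_exponent_le (by norm_num) hTlt.le) hℓ0.le
      _ = (2 * (ℓ : ℝ) ^ 1) * (2 : ℝ) ^ ((R - ε₀ / 2) * ℓ) := by
          rw [Real.rpow_add (by norm_num), Real.rpow_one]; ring
      _ ≤ (2 : ℝ) ^ (ε₀ / 4 * ℓ) * (2 : ℝ) ^ ((R - ε₀ / 2) * ℓ) :=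
          mul_le_mul_of_nonneg_right hℓ3 (by positivity)
      _ = _ := by
          rw [← Real.rpow_add (by norm_num)]
          congr 1
          ring
  · intro B hB B' hB'
    obtain ⟨A, -, rfl⟩ := Finset.mem_image.1 hB
    obtain ⟨A', -, rfl⟩ := Finset.mem_image.1 hB'
    exact (card_rotatedCode_le Φ _).trans (Nat.mul_le_mul_left _ (le_card_rotatedCode hℓ1 hΦ _))
  · intro B hB B' hB' n hn u
    obtain ⟨A, -, rfl⟩ := Finset.mem_image.1 hB
    obtain ⟨A', -, rfl⟩ := Finset.mem_image.1 hB'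
    exact prefixCount_rotatedCode_le hs1 hℓ1 hLs hΦ _ _ (by omega) u
  · intro B hB B' hB' hBB x hx y hy
    obtain ⟨A, hA, rfl⟩ := Finset.mem_image.1 hB
    obtain ⟨A', hA', rfl⟩ := Finset.mem_image.1 hB'
    have h1 := hfar A hA A' hA' (fun h => hBB (by rw [h])) x hx y hy
    have h2 : (m : ℝ) ≤ (earlyMismatches x y).card := Nat.cast_le.2 h1
    refine le_trans ?_ h2
    rw [div_mul_eq_mul_div, one_mul, div_le_iff₀ (by positivity)]
    linarith

/-! ### The dithered processes as members of the class -/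

/-- A distance at which the dithered process is strongly mixing. -/
def mixingGap (ν ℓ : ℕ) : ℕ :=
  (4 * (ν + 1) * (ν * ℓ) + 4 * (ν + 1) + 2 * ((ν + 1) * ℓ)) * (2 * ℓ ^ (4 * (ν + 1) + 2)) + 1

/-- The law of a dithered process: it is regular and its words have probability
`cycleWordProb`. -/
structure IsDitheredLaw (ν : ℕ) (β δ : ℝ) {ℓ : ℕ} (B : Finset (Fin ℓ → Bool))
    (P : Measure (ℤ → Bool)) : Prop where
  regular : IsRegular (mixingGap ν ℓ) β δ P
  blockProb_eq : ∀ (n : ℕ) (z : Fin n → Bool), blockProb P z = cycleWordProb ν δ B (List.ofFn z)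

variable {ℓ ν : ℕ} {B : Finset (Fin ℓ → Bool)} {β δ : ℝ}

lemma exists_isDitheredLaw (hB : B.Nonempty) (hℓ : 2 ≤ ℓ) (hν : 1 ≤ ν) (h0 : 0 ≤ δ)
    (h1 : δ ≤ 1 / 2) (hβ : 1 < β)
    (hcard : Real.exp (-(ℓ : ℝ) ^ 2) * (cycleStates ν B).card ≤ 1 - 1 / β) :
    ∃ P, IsDitheredLaw ν β δ B P := by
  have hℓ1 : 1 ≤ ℓ := by omega
  have h := isHiddenMarkov_cycle (ν := ν) hB hℓ1 h0 (by linarith : δ ≤ 1)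
  obtain ⟨P, hPprob, hP⟩ := h.exists_measure
  -- The number of Doeblin steps is `ℓ²/γ`, so the contraction is at most `e^{-ℓ²}`, which beats the
  -- number of states.
  have hγ : (1 - 1 / (2 * (ℓ : ℝ) ^ (4 * (ν + 1)))) ^ (2 * ℓ ^ (4 * (ν + 1) + 2)) *
      (cycleStates ν B).card ≤ 1 - 1 / β := by
    refine le_trans (mul_le_mul_of_nonneg_right ?_ (Nat.cast_nonneg _)) hcard
    have hL : (1 : ℝ) ≤ (ℓ : ℝ) ^ (4 * (ν + 1)) := one_le_pow₀ (by exact_mod_cast hℓ1)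
    set γ := 1 / (2 * (ℓ : ℝ) ^ (4 * (ν + 1))) with hγ
    have hγ1 : γ ≤ 1 := by
      rw [hγ, div_le_one (by positivity)]
      linarith
    calc (1 - γ) ^ (2 * ℓ ^ (4 * (ν + 1) + 2)) ≤ (Real.exp (-γ)) ^ (2 * ℓ ^ (4 * (ν + 1) + 2)) :=
          pow_le_pow_left₀ (by linarith) (Real.one_sub_le_exp_neg γ) _
      _ = Real.exp (-(ℓ : ℝ) ^ 2) := by
          rw [← Real.exp_nat_mul]
          congr 1
          rw [hγ]
          push_cast
          rw [pow_add]
          field_simp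
  refine ⟨P, ⟨hPprob, measurePreserving_shift_of_wordAt hP, ?_, ?_⟩, ?_⟩
  · exact h.stronglyMixing hP (by linarith) (h.iterate_stepOp_bounds
      (fun f hf => doeblin_cycle hB hℓ1 hf hν hℓ) hβ hγ)
  · refine h.positiveTransitions hP h0 fun s _ a => ?_
    unfold flipProb
    split_ifs <;> linarith
  · intro n z
    rw [blockProb, setOf_block_eq, ← wordAt_ofFn, hP]
    rfl

namespace IsDitheredLaw

variable {P : Measure (ℤ → Bool)} (h : IsDitheredLaw ν β δ B P)
include h

lemma isDitheredRepetition (hB : B.Nonempty) (hℓ : 1 ≤ ℓ) (h0 : 0 ≤ δ) (h1 : δ ≤ 1) :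
    IsDitheredRepetition ν δ B P :=
  ⟨h.regular.isProb, h.regular.stationary, fun n y => by
    rw [h.blockProb_eq, ditheredBlockProb_eq hB hℓ h0 h1]
    rfl⟩

lemma measureReal_small (n : ℕ) (ρ : ℝ) : P.real {ω | blockProb P (block n ω) ≤ ρ} =
    ∑ z : Fin n → Bool with cycleWordProb ν δ B (List.ofFn z) ≤ ρ,
      cycleWordProb ν δ B (List.ofFn z) := by
  have := h.regular.isProb
  rw [measureReal_block P fun z : Fin n → Bool => blockProb P z ≤ ρ]
  simp only [h.blockProb_eq]

/-- A renewal is seen from a fraction at most `1/ν ≤ α/2` of the phases. For the rest, up to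
polynomial factors there are `2^{(R - ε₀/4)ℓ}` states, so the two square roots give `2^{-ε₀ℓ/8}`,
while the noise contributes at most `2^{ε₀ℓ/32}`. -/
lemma small_ell (hB : B.Nonempty) (hℓ : 1 ≤ ℓ) (h0 : 0 ≤ δ) (h1 : δ ≤ 1) {α R ε₀ : ℝ}
    (hν0 : 1 ≤ ν) (hν : 1 / (ν : ℝ) ≤ α / 2) (hδ : 1 + √δ ≤ (2 : ℝ) ^ (ε₀ / 32))
    (hcard : (B.card : ℝ) ≤ (2 : ℝ) ^ ((R - ε₀ / 4) * (ℓ : ℝ)))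
    (hlarge : 2 * (ν + 1) / α * (ℓ : ℝ) ^ 1 ≤ (2 : ℝ) ^ (ε₀ / 16 * ℓ)) (hα : 0 < α)
    (hε : 0 < ε₀) :
    P.real {ω | blockProb P (block ℓ ω) ≤ (2 : ℝ) ^ (-((ℓ : ℝ) * R))} ≤ α := by
  rw [h.measureReal_small]
  refine (sum_cycleWordProb_small_le hB hℓ hν0 h0 h1).trans ?_
  have hℓ0 : (0 : ℝ) < ℓ := by positivity
  have hS : ((cycleStates ν B).card : ℝ) ≤ (2 : ℝ) ^ ((R - ε₀ / 4) * (ℓ : ℝ)) * ((ν + 1) * ℓ) ^ 2 := by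
    have e : ((cycleStates ν B).card : ℝ) ≤ B.card * ℓ * ((ν + 1) * ℓ) := by
      exact_mod_cast card_cycleStates_le
    refine e.trans ?_
    rw [mul_assoc]
    refine mul_le_mul hcard ?_ (by positivity) (by positivity)
    have : (0 : ℝ) ≤ ν := Nat.cast_nonneg _
    nlinarith [mul_nonneg this (sq_nonneg (ℓ : ℝ)), mul_nonneg (mul_nonneg this this) (sq_nonneg (ℓ : ℝ))]
  have hsq : √((2 : ℝ) ^ (-((ℓ : ℝ) * R))) * √(cycleStates ν B).card ≤
      (2 : ℝ) ^ (-(ε₀ / 8 * ℓ)) * ((ν + 1) * ℓ) := by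
    rw [← Real.sqrt_mul (by positivity)]
    refine Real.sqrt_le_iff.2 ⟨by positivity, ?_⟩
    refine (mul_le_mul_of_nonneg_left hS (by positivity)).trans (le_of_eq ?_)
    have e : ((2 : ℝ) ^ (-(ε₀ / 8 * ℓ))) ^ 2 = (2 : ℝ) ^ (-((ℓ : ℝ) * R) + (R - ε₀ / 4) * ℓ) := by
      rw [← Real.rpow_natCast, ← Real.rpow_mul (by norm_num)]
      congr 1
      push_cast
      ring
    rw [← mul_assoc, ← Real.rpow_add (by norm_num), mul_pow ((2 : ℝ) ^ (-(ε₀ / 8 * ℓ))), e]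
  have hpow : (√δ + √(1 - δ)) ^ ℓ ≤ (2 : ℝ) ^ (ε₀ / 32 * ℓ) := by
    have h2 : √(1 - δ) ≤ 1 := Real.sqrt_le_one.2 (by linarith)
    rw [Real.rpow_mul (by norm_num), Real.rpow_natCast]
    exact pow_le_pow_left₀ (by positivity) (by linarith) _
  have hmain : √((2 : ℝ) ^ (-((ℓ : ℝ) * R))) * (√(cycleStates ν B).card * (√δ + √(1 - δ)) ^ ℓ) ≤
      α / 2 := by
    rw [← mul_assoc]
    refine (mul_le_mul hsq hpow (by positivity) (by positivity)).trans ?_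
    have e1 : (2 : ℝ) ^ (-(ε₀ / 8 * ℓ)) * (2 : ℝ) ^ (ε₀ / 32 * ℓ) ≤ ((2 : ℝ) ^ (ε₀ / 16 * ℓ))⁻¹ := by
      rw [← Real.rpow_add (by norm_num), ← Real.rpow_neg (by norm_num)]
      refine Real.rpow_le_rpow_of_exponent_le (by norm_num) ?_
      have : 0 < ε₀ * ℓ := by positivity
      linarith
    have e2 : (ν + 1) * (ℓ : ℝ) ≤ α / 2 * (2 : ℝ) ^ (ε₀ / 16 * ℓ) := by
      rw [pow_one, div_mul_eq_mul_div, div_le_iff₀ hα] at hlarge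
      linarith
    calc (2 : ℝ) ^ (-(ε₀ / 8 * ℓ)) * ((ν + 1) * ℓ) * (2 : ℝ) ^ (ε₀ / 32 * ℓ)
        = ((2 : ℝ) ^ (-(ε₀ / 8 * ℓ)) * (2 : ℝ) ^ (ε₀ / 32 * ℓ)) * ((ν + 1) * ℓ) := by ring
      _ ≤ ((2 : ℝ) ^ (ε₀ / 16 * ℓ))⁻¹ * (α / 2 * (2 : ℝ) ^ (ε₀ / 16 * ℓ)) :=
          mul_le_mul e1 e2 (by positivity) (by positivity)
      _ = α / 2 := by
          have : (2 : ℝ) ^ (ε₀ / 16 * ℓ) ≠ 0 := by positivity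
          field_simp
  linarith

/-- Long words meet many renewals, each of cost at most `2^{Rℓ}`. Spread over `νℓ ≥ 8ℓ` letters this
is a rate `R/8`, and with the noise it stays below the rate `R/2` gained from the small probability.
-/
lemma eventually_small_n (hB : B.Nonempty) (hℓ : 1 ≤ ℓ) (h0 : 0 ≤ δ) (h1 : δ ≤ 1) {R : ℝ}
    (hR : 0 < R) (hν : 8 ≤ ν) (hδ : 1 + √δ ≤ (2 : ℝ) ^ (R / 32))
    (hcard : (B.card : ℝ) * ℓ ≤ (2 : ℝ) ^ (2 * R * (ℓ : ℝ))) :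
    ∀ᶠ n : ℕ in atTop,
      P.real {ω | blockProb P (block n ω) ≤ (2 : ℝ) ^ (-((n : ℝ) * R))} ≤ 1 / (n : ℝ) := by
  set g := (2 : ℝ) ^ (R / 8) with hg
  have hg1 : 1 ≤ g := Real.one_le_rpow (by norm_num) (by positivity)
  have hθ : √(B.card * ℓ) ≤ g ^ (ν * ℓ) := by
    refine Real.sqrt_le_iff.2 ⟨by positivity, hcard.trans ?_⟩
    rw [hg, ← pow_mul, ← Real.rpow_natCast, ← Real.rpow_mul (by norm_num)]
    refine Real.rpow_le_rpow_of_exponent_le (by norm_num) ?_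
    have : (8 : ℝ) ≤ ν := by exact_mod_cast hν
    have h2 : (0 : ℝ) ≤ R * ℓ := by positivity
    push_cast
    nlinarith
  set C := √(cycleStates ν B).card * g ^ (ν * ℓ + ℓ) * √(B.card * ℓ) with hC
  filter_upwards [eventually_poly_le_rpow C 1 (by positivity : 0 < R / 4), eventually_ge_atTop 1]
    with n hn hn1
  have hn0 : (0 : ℝ) < n := by positivity
  rw [h.measureReal_small]
  refine (sum_cycleWordProb_small_le' hB hℓ h0 h1 hg1 hθ n).trans ?_
  have hpow : (√δ + √(1 - δ)) ^ n ≤ (2 : ℝ) ^ (R / 32 * n) := by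
    have h2 : √(1 - δ) ≤ 1 := Real.sqrt_le_one.2 (by linarith)
    rw [Real.rpow_mul (by norm_num), Real.rpow_natCast]
    exact pow_le_pow_left₀ (by positivity) (by linarith) _
  have hsq : √((2 : ℝ) ^ (-((n : ℝ) * R))) = (2 : ℝ) ^ (-(R / 2 * n)) := by
    rw [Real.sqrt_eq_rpow, ← Real.rpow_mul (by norm_num)]
    congr 1
    ring
  have hgn : g ^ n = (2 : ℝ) ^ (R / 8 * n) := by
    rw [Real.rpow_mul (by norm_num), Real.rpow_natCast]
  rw [hsq, pow_add, hgn]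
  calc (2 : ℝ) ^ (-(R / 2 * n)) * (√(cycleStates ν B).card * (√δ + √(1 - δ)) ^ n *
        ((2 : ℝ) ^ (R / 8 * n) * g ^ (ν * ℓ + ℓ) * √(B.card * ℓ)))
      = C * ((2 : ℝ) ^ (-(R / 2 * n)) * (2 : ℝ) ^ (R / 8 * n) * (√δ + √(1 - δ)) ^ n) := by
        rw [hC]; ring
    _ ≤ C * ((2 : ℝ) ^ (-(R / 2 * n)) * (2 : ℝ) ^ (R / 8 * n) * (2 : ℝ) ^ (R / 32 * n)) := by
        refine mul_le_mul_of_nonneg_left (mul_le_mul_of_nonneg_left hpow ?_) ?_ <;> positivity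
    _ ≤ C * (2 : ℝ) ^ (-(R / 4 * n)) := by
        refine mul_le_mul_of_nonneg_left ?_ (by positivity)
        rw [← Real.rpow_add (by norm_num), ← Real.rpow_add (by norm_num)]
        refine Real.rpow_le_rpow_of_exponent_le (by norm_num) ?_
        have : 0 < R * n := by positivity
        linarith
    _ ≤ 1 / n := by
        rw [Real.rpow_neg (by norm_num), ← div_eq_mul_inv, div_le_div_iff₀ (by positivity) hn0]
        linarith

end IsDitheredLaw

/-- The divergence of two dithered processes with distant words. -/
lemma IsDitheredLaw.le_klDivergence {B' : Finset (Fin ℓ → Bool)} {P Q : Measure (ℤ → Bool)}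
    (hP : IsDitheredLaw ν β δ B P) (hQ : IsDitheredLaw ν β δ B' Q) (hB : B.Nonempty)
    (hB' : B'.Nonempty) (hℓ : 1 ≤ ℓ) (hν : 1 ≤ ν) (hc : IsCyclic B) (hc' : IsCyclic B') {β₁ Δ : ℝ}
    (hβ₁ : 0 < β₁) (hΔ : 0 < Δ)
    (hm : ∀ x ∈ B, ∀ y ∈ B', β₁ * ℓ ≤ ((earlyMismatches x y).card : ℝ)) (h0 : 0 < δ)
    (hδ : 2 * √δ ≤ (2 : ℝ) ^ (-((6 + Δ) / β₁))) : Δ ≤ klDivergence ℓ P Q := by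
  have h1 : 2 * √δ ≤ 1 := hδ.trans (Real.rpow_le_one_of_one_le_of_nonpos (by norm_num)
    (by rw [neg_nonpos]; positivity))
  have hℓ0 : (0 : ℝ) < ℓ := by positivity
  have hPp := hP.regular.isProb
  set m := ⌈β₁ * ℓ⌉₊ with hmdef
  refine le_trans ?_ (klDivergence_ge h0 h1 hB hB' hℓ hν hc hc' (m := m)
    (fun x hx y hy => Nat.ceil_le.2 (hm x hx y hy)) (hP.blockProb_eq ℓ) (hQ.blockProb_eq ℓ)
    (fun z => hP.regular.blockProb_pos h0 z) (fun z => hQ.regular.blockProb_pos h0 z))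
  set C : ℝ := ((ℓ + 1) * B.card ^ 2) * ((ℓ + 1) * B'.card ^ 2) * (2 * √δ) ^ m with hC
  have hC0 : 0 < C := by
    have h2 : (0 : ℝ) < B.card := by exact_mod_cast hB.card_pos
    have h3 : (0 : ℝ) < B'.card := by exact_mod_cast hB'.card_pos
    have h4 := Real.sqrt_pos.2 h0
    positivity
  have hcard : ∀ B : Finset (Fin ℓ → Bool), (B.card : ℝ) ≤ 2 ^ ℓ := fun B => by
    have := Finset.card_le_univ B
    rw [Fintype.card_fun, Fintype.card_bool, Fintype.card_fin] at this
    exact_mod_cast this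
  have hℓ2 : (ℓ : ℝ) + 1 ≤ 2 ^ ℓ := by
    have := Nat.lt_two_pow_self (n := ℓ)
    exact_mod_cast this
  -- The number of pairs of splices is at most `2^{6ℓ}`. At least `β₁ ℓ` mismatches, each worth
  -- `2^{-(6+Δ)/β₁}`, outweigh it and leave `2^{-Δℓ}`.
  have hCle : C ≤ (2 : ℝ) ^ (-(Δ * ℓ)) := by
    have e1 : (2 * √δ) ^ m ≤ (2 : ℝ) ^ (-((6 + Δ) * ℓ)) := by
      calc (2 * √δ) ^ m ≤ ((2 : ℝ) ^ (-((6 + Δ) / β₁))) ^ m :=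
            pow_le_pow_left₀ (by positivity) hδ _
        _ = (2 : ℝ) ^ (-((6 + Δ) / β₁) * m) := by
            rw [← Real.rpow_natCast, ← Real.rpow_mul (by norm_num)]
        _ ≤ _ := by
            refine Real.rpow_le_rpow_of_exponent_le (by norm_num) ?_
            have h2 : β₁ * ℓ ≤ m := Nat.le_ceil _
            have h3 := mul_le_mul_of_nonneg_left h2 (by positivity : 0 ≤ (6 + Δ) / β₁)
            have h4 : (6 + Δ) / β₁ * (β₁ * ℓ) = (6 + Δ) * ℓ := by field_simp
            linarith
    have e2 : ((ℓ + 1) * (B.card : ℝ) ^ 2) * ((ℓ + 1) * (B'.card : ℝ) ^ 2) ≤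
        (2 : ℝ) ^ (6 * (ℓ : ℝ)) := by
      calc ((ℓ + 1) * (B.card : ℝ) ^ 2) * ((ℓ + 1) * (B'.card : ℝ) ^ 2)
          ≤ (2 ^ ℓ * (2 ^ ℓ) ^ 2) * (2 ^ ℓ * (2 ^ ℓ) ^ 2) := by
            gcongr <;> first | exact hℓ2 | exact hcard _
        _ = (2 : ℝ) ^ (6 * (ℓ : ℝ)) := by
            rw [show (6 : ℝ) * ℓ = ((6 * ℓ : ℕ) : ℝ) by push_cast; ring, Real.rpow_natCast]
            ring
    calc C ≤ (2 : ℝ) ^ (6 * (ℓ : ℝ)) * (2 : ℝ) ^ (-((6 + Δ) * ℓ)) :=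
          mul_le_mul e2 e1 (by positivity) (by positivity)
      _ = _ := by
          rw [← Real.rpow_add (by norm_num)]
          congr 1
          ring
  have hlog : Real.logb 2 C ≤ -(Δ * ℓ) := by
    rw [Real.logb_le_iff_le_rpow (by norm_num) hC0]
    exact hCle
  have h5 : 2 / (ℓ : ℝ) * (Δ * ℓ) = 2 * Δ := by field_simp
  have h6 := mul_le_mul_of_nonneg_left hlog (by positivity : 0 ≤ 2 / (ℓ : ℝ))
  linarith

/-! ### Failure of the classifier on the dithered processes -/

section Failure

variable {ℓ ν : ℕ} {B B' : Finset (Fin ℓ → Bool)} {β δ : ℝ}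

/-- The comparison costs one factor `ℓ` for the prefix counts and one for the sizes of the codes; it
is squared because a renewal may cut the word in two. -/
lemma IsDitheredLaw.blockProb_le {P Q : Measure (ℤ → Bool)} (hP : IsDitheredLaw ν β δ B P)
    (hQ : IsDitheredLaw ν β δ B' Q) (h0 : 0 ≤ δ) (h1 : δ ≤ 1) (hB : B.Nonempty)
    (hB' : B'.Nonempty) (hℓ : 1 ≤ ℓ) (hν : 1 ≤ ν) (hc : IsCyclic B) (hc' : IsCyclic B') {n : ℕ}
    (hn : 60 * n ≤ ℓ) (hcard : B'.card ≤ ℓ * B.card)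
    (hpre : ∀ m, 60 * m ≤ ℓ → ∀ u : Fin m → Bool, prefixCount B u ≤ ℓ * prefixCount B' u)
    (z : Fin n → Bool) : blockProb P z ≤ (ℓ : ℝ) ^ 4 * blockProb Q z := by
  rw [hP.blockProb_eq, hQ.blockProb_eq]
  have hle : (List.ofFn z).length ≤ ν * ℓ := by
    rw [List.length_ofFn]
    have : ℓ ≤ ν * ℓ := Nat.le_mul_of_pos_left ℓ hν
    omega
  refine (cycleWordProb_le h0 h1 hB hB' hℓ hc hc' (c := (ℓ : ℝ) * ℓ) (by positivity) hle
    fun l hl => ?_).trans (le_of_eq (by ring))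
  rw [List.length_ofFn] at hl
  have := meanProb_le h0 h1 hB hB' (c := ℓ) (d := ℓ) (by exact_mod_cast hcard)
    (fun u => by exact_mod_cast hpre l.length (by omega) u) l.get
  rwa [List.ofFn_get] at this

/-- When the tested words are equally likely, up to a factor, for both sources, the classifier
does not separate them. -/
lemma le_pairError_esc {P Q : Measure (ℤ → Bool)} {κ : ℕ} (hP : IsRegular κ β δ P)
    (hQ : IsRegular κ β δ Q) (hβ : 1 < β) (hδ : 0 < δ) {K k₀ N n : ℕ} {ε₀ Δ : ℝ} (hK : 1 ≤ K)
    (hκ : κ ≤ k₀) (hn : escBlockLength K k₀ δ ε₀ N = n) (hn1 : 1 ≤ n) (hnN : n ≤ N)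
    (hD : Δ ≤ klDivergence ℓ P Q) {A D : ℝ} (hA : 1 ≤ A) (hN : A / δ ^ n ≤ N)
    (hPQ : ∀ z : Fin n → Bool, blockProb P z ≤ D * blockProb Q z)
    (hDA : D * A ^ 2 < (2 : ℝ) ^ (n * (Δ / 2))) :
    ENNReal.ofReal (1 - (β + 1) * (Real.exp (1 - A / (β * (n + κ))) + K / A)) ≤
      pairError ℓ (sampleLength K k₀ N) (esc K k₀ δ ε₀ Δ N) Δ P Q := by
  have hPp := hP.isProb
  have hQp := hQ.isProb
  have hA0 : 0 < A := by linarith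
  have hn0 : (0 : ℝ) < n := by positivity
  have hbad := measure_inaccurate_le hP.stationary hQ.stationary hκ hβ hP.mixing hQ.mixing hδ
    (fun z => hP.positive.blockProb_ge hδ.le z) (fun z => hQ.positive.blockProb_ge hδ.le z)
    hK hn1 hnN hA hN
  rw [pairError_eq]
  set bad := {ωω : (ℤ → Bool) × (ℤ → Bool) | ¬ (
      let z := testVector K k₀ N hnN (block (sampleLength K k₀ N) ωω.1)
      let x := empiricalProb K k₀ N (block (sampleLength K k₀ N) ωω.1) z
      let y := empiricalProb K k₀ N (block (sampleLength K k₀ N) ωω.2) z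
      blockProb P z / A ≤ x ∧ x ≤ blockProb P z * A ∧
      blockProb Q z / A ≤ y ∧ y ≤ blockProb Q z * A)} with hbaddef
  set good := {p : (ℤ → Bool) × (ℤ → Bool) |
      (esc K k₀ δ ε₀ Δ N (block (sampleLength K k₀ N) p.1) (block (sampleLength K k₀ N) p.2) = 1 ∧
        marginal P (sampleLength K k₀ N) = marginal Q (sampleLength K k₀ N)) ∨
        (Δ ≤ klDivergence ℓ P Q ∧ esc K k₀ δ ε₀ Δ N (block (sampleLength K k₀ N) p.1)
          (block (sampleLength K k₀ N) p.2) = 0)} with hgooddef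
  have hcover : Set.univ ⊆ good ∪ bad := by
    rintro ⟨ω, ω'⟩ -
    by_cases hb : (ω, ω') ∈ bad
    · exact Or.inr hb
    refine Or.inl (Or.inr ⟨hD, ?_⟩)
    rw [hbaddef, Set.mem_ofPred_eq, not_not] at hb
    simp only at hb ⊢
    obtain ⟨-, hx, hy, -⟩ := hb
    rw [esc_eq_zero_iff Δ hn hnN]
    set z := testVector K k₀ N hnN (block (sampleLength K k₀ N) ω) with hz
    set x := empiricalProb K k₀ N (block (sampleLength K k₀ N) ω) z with hxdef
    set y := empiricalProb K k₀ N (block (sampleLength K k₀ N) ω') z with hydef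
    have hp := hP.blockProb_pos hδ z
    have hq := hQ.blockProb_pos hδ z
    have hN1 : 1 ≤ N := hn1.trans hnN
    have hx0 : 0 < x := empiricalProb_pos hN1 _ _
    have hy0 : 0 < y := lt_of_lt_of_le (by positivity) hy
    -- Accurate estimates of comparable probabilities satisfy `x ≤ D A² y`, which stays below the
    -- threshold although the divergence at length `ℓ` is large.
    have hxy : x < y * (2 : ℝ) ^ (n * (Δ / 2)) := by
      have h1 : blockProb Q z ≤ y * A := (div_le_iff₀ hA0).1 hy
      have hD0 : 0 ≤ D := by
        by_contra hneg
        have := hPQ z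
        nlinarith [mul_pos (neg_pos.2 (not_le.1 hneg)) hq]
      calc x ≤ blockProb P z * A := hx
        _ ≤ D * blockProb Q z * A := mul_le_mul_of_nonneg_right (hPQ z) hA0.le
        _ ≤ D * (y * A) * A :=
            mul_le_mul_of_nonneg_right (mul_le_mul_of_nonneg_left h1 hD0) hA0.le
        _ = y * (D * A ^ 2) := by ring
        _ < _ := mul_lt_mul_of_pos_left hDA hy0
    have hlog : Real.logb 2 x < Real.logb 2 y + n * (Δ / 2) := by
      have := Real.logb_lt_logb (by norm_num : (1 : ℝ) < 2) hx0 hxy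
      rwa [Real.logb_mul hy0.ne' (by positivity), Real.logb_rpow (by norm_num) (by norm_num)] at this
    rw [← mul_sub, one_div_mul_eq_div, div_lt_iff₀ hn0]
    linarith
  have h1 : (1 : ENNReal) ≤ (P.prod Q) good + (P.prod Q) bad := by
    calc (1 : ENNReal) = (P.prod Q) Set.univ := measure_univ.symm
      _ ≤ (P.prod Q) (good ∪ bad) := measure_mono hcover
      _ ≤ _ := measure_union_le _ _
  have he : 0 ≤ (β + 1) * (Real.exp (1 - A / (β * (n + κ))) + K / A) := by
    have := Real.exp_pos (1 - A / (β * (n + κ)))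
    positivity
  rw [ENNReal.ofReal_sub _ he, ENNReal.ofReal_one]
  exact tsub_le_iff_right.2 (h1.trans (by gcongr))

lemma mixingGap_le (hℓ : 1 ≤ ℓ) :
    (mixingGap ν ℓ : ℝ) ≤ (20 * (ν + 1) ^ 2 + 1) * (ℓ : ℝ) ^ (4 * (ν + 1) + 3) := by
  have h : mixingGap ν ℓ ≤ (20 * (ν + 1) ^ 2 + 1) * ℓ ^ (4 * (ν + 1) + 3) := by
    have h1 : 4 * (ν + 1) * (ν * ℓ) + 4 * (ν + 1) + 2 * ((ν + 1) * ℓ) ≤ 10 * (ν + 1) ^ 2 * ℓ := by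
      nlinarith [Nat.zero_le (ν * ℓ), Nat.zero_le (ν * ν * ℓ), Nat.mul_le_mul_left ν hℓ]
    have h2 : 1 ≤ ℓ ^ (4 * (ν + 1) + 3) := Nat.one_le_pow _ _ hℓ
    calc mixingGap ν ℓ ≤ 10 * (ν + 1) ^ 2 * ℓ * (2 * ℓ ^ (4 * (ν + 1) + 2)) + 1 :=
          Nat.add_le_add_right (Nat.mul_le_mul_right _ h1) 1
      _ = 20 * (ν + 1) ^ 2 * ℓ ^ (4 * (ν + 1) + 3) + 1 := by ring
      _ ≤ _ := by rw [add_mul, one_mul]; omega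
  exact_mod_cast h

/-- The length of the tested words is of the order of `ℓ`. -/
lemma eventually_escBlockLength_bounds {R ε₀ : ℝ} (hR : 0 < R) (hR1 : R < 1) (hε : 0 < ε₀)
    (hεR : ε₀ < R) {δ : ℝ} (hδ : 0 < δ) (hδ1 : δ ≤ (2 : ℝ) ^ (-180 : ℝ)) {K : ℕ} (hK : 1 ≤ K) :
    ∃ ξ : ℝ, 0 < ξ ∧ ∀ᶠ ℓ : ℕ in atTop, ∀ k₀ ≤ ⌈(2 : ℝ) ^ ((R + ε₀) * (ℓ : ℝ))⌉₊,
      ξ * ℓ ≤ escBlockLength K k₀ δ ε₀ ⌈(2 : ℝ) ^ ((R + ε₀) * (ℓ : ℝ))⌉₊ ∧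
        60 * escBlockLength K k₀ δ ε₀ ⌈(2 : ℝ) ^ ((R + ε₀) * (ℓ : ℝ))⌉₊ ≤ ℓ := by
  -- The sample length is at most `2^{3ℓ}`, so the tested word has at most `3ℓ/180 = ℓ/60` letters.
  have hlog : 180 ≤ Real.logb 2 (1 / δ) := by
    rw [Real.le_logb_iff_rpow_le (by norm_num) (by positivity), le_div_iff₀ hδ]
    calc (2 : ℝ) ^ (180 : ℝ) * δ ≤ (2 : ℝ) ^ (180 : ℝ) * (2 : ℝ) ^ (-180 : ℝ) :=
          mul_le_mul_of_nonneg_left hδ1 (by positivity)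
      _ = 1 := by rw [← Real.rpow_add (by norm_num)]; norm_num
  set D := Real.logb 2 (1 / δ) + ε₀ with hD
  have hD0 : 0 < D := by linarith
  set ξ := R / (2 * D) with hξ
  have hξ0 : 0 < ξ := by positivity
  refine ⟨ξ, hξ0, ?_⟩
  filter_upwards [eventually_poly_le_rpow ξ 1 (by positivity : 0 < R + ε₀),
    eventually_poly_le_rpow (6 * K) 0 zero_lt_one, eventually_ge_atTop ⌈1 / ξ⌉₊] with ℓ h1 h2 h3 k₀ hk
  set N := ⌈(2 : ℝ) ^ ((R + ε₀) * (ℓ : ℝ))⌉₊ with hN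
  have hℓ0 : (0 : ℝ) ≤ ℓ := Nat.cast_nonneg _
  have hNge : (2 : ℝ) ^ ((R + ε₀) * (ℓ : ℝ)) ≤ N := Nat.le_ceil _
  have hNpos : (0 : ℝ) < N := lt_of_lt_of_le (by positivity) hNge
  have hξℓ : 1 ≤ ξ * ℓ := by
    have := (Nat.le_ceil (1 / ξ)).trans (Nat.cast_le.2 h3)
    rw [div_le_iff₀ hξ0] at this
    linarith
  have hLge : (N : ℝ) ≤ sampleLength K k₀ N := by
    exact_mod_cast (Nat.le_add_left N (K * (N + k₀)))
  have hLle : (sampleLength K k₀ N : ℝ) ≤ (2 : ℝ) ^ (3 * (ℓ : ℝ)) := by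
    have e1 : sampleLength K k₀ N ≤ 3 * K * N := by
      unfold sampleLength
      nlinarith
    have e2 : (N : ℝ) ≤ 2 * (2 : ℝ) ^ (2 * (ℓ : ℝ)) := by
      have h4 : (N : ℝ) < (2 : ℝ) ^ ((R + ε₀) * (ℓ : ℝ)) + 1 := Nat.ceil_lt_add_one (by positivity)
      have h5 : (2 : ℝ) ^ ((R + ε₀) * (ℓ : ℝ)) ≤ (2 : ℝ) ^ (2 * (ℓ : ℝ)) :=
        Real.rpow_le_rpow_of_exponent_le (by norm_num)
          (mul_le_mul_of_nonneg_right (by linarith) hℓ0)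
      have h6 : (1 : ℝ) ≤ (2 : ℝ) ^ (2 * (ℓ : ℝ)) := Real.one_le_rpow (by norm_num) (by positivity)
      linarith
    rw [pow_zero, mul_one, one_mul] at h2
    calc (sampleLength K k₀ N : ℝ) ≤ 3 * K * N := by exact_mod_cast e1
      _ ≤ 3 * K * (2 * (2 : ℝ) ^ (2 * (ℓ : ℝ))) := mul_le_mul_of_nonneg_left e2 (by positivity)
      _ = 6 * K * (2 : ℝ) ^ (2 * (ℓ : ℝ)) := by ring
      _ ≤ (2 : ℝ) ^ (ℓ : ℝ) * (2 : ℝ) ^ (2 * (ℓ : ℝ)) := mul_le_mul_of_nonneg_right h2 (by positivity)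
      _ = _ := by
          rw [← Real.rpow_add (by norm_num)]
          congr 1
          ring
  have hLpos : (0 : ℝ) < sampleLength K k₀ N := hNpos.trans_le hLge
  have hlogL : (R + ε₀) * ℓ ≤ Real.logb 2 (sampleLength K k₀ N) := by
    rw [Real.le_logb_iff_rpow_le (by norm_num) hLpos]
    exact hNge.trans hLge
  have hlogL' : Real.logb 2 (sampleLength K k₀ N) ≤ 3 * ℓ := by
    rw [Real.logb_le_iff_le_rpow (by norm_num) hLpos]
    exact hLle
  have hlogL0 : 0 ≤ Real.logb 2 (sampleLength K k₀ N) := le_trans (by positivity) hlogL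
  constructor
  · rw [escBlockLength, Nat.cast_min, le_min_iff]
    constructor
    · rw [pow_one] at h1
      exact h1.trans hNge
    · have h4 := Nat.lt_floor_add_one (Real.logb 2 (sampleLength K k₀ N) / D)
      have h5 : 2 * (ξ * ℓ) ≤ Real.logb 2 (sampleLength K k₀ N) / D := by
        rw [le_div_iff₀ hD0]
        have e : 2 * (ξ * ℓ) * D = R * ℓ := by rw [hξ]; field_simp
        rw [e]
        refine le_trans (mul_le_mul_of_nonneg_right (by linarith) hℓ0) hlogL
      linarith
  · have h4 : escBlockLength K k₀ δ ε₀ N ≤ ⌊Real.logb 2 (sampleLength K k₀ N) / D⌋₊ :=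
      min_le_right _ _
    have h5 : (⌊Real.logb 2 (sampleLength K k₀ N) / D⌋₊ : ℝ) ≤ ℓ / 60 := by
      refine (Nat.floor_le (by positivity)).trans ?_
      rw [div_le_iff₀ hD0]
      refine hlogL'.trans ?_
      have : (ℓ : ℝ) / 60 * 180 ≤ ℓ / 60 * D := mul_le_mul_of_nonneg_left (by linarith) (by positivity)
      linarith
    have h6 : ((60 * escBlockLength K k₀ δ ε₀ N : ℕ) : ℝ) ≤ ℓ := by
      have : (escBlockLength K k₀ δ ε₀ N : ℝ) ≤ _ := Nat.cast_le.2 h4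
      push_cast
      linarith
    exact_mod_cast h6

/-- The analytic conditions of `le_pairError_esc` hold for large `ℓ`. -/
lemma eventually_inaccuracy_small {R ε₀ Δ η ξ : ℝ} (hε : 0 < ε₀)
    (hΔ : 0 < Δ) (hη : 0 < η) (hξ : 0 < ξ) (hβ : 1 < β) (hδ : 0 < δ) (hδ1 : δ < 1) {K : ℕ}
    (hK : 1 ≤ K) (ν : ℕ) :
    ∀ᶠ ℓ : ℕ in atTop, ∀ k₀ ≤ ⌈(2 : ℝ) ^ ((R + ε₀) * (ℓ : ℝ))⌉₊, ∀ n,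
      escBlockLength K k₀ δ ε₀ ⌈(2 : ℝ) ^ ((R + ε₀) * (ℓ : ℝ))⌉₊ = n → ξ * ℓ ≤ n → n ≤ ℓ →
      ∃ A : ℝ, 1 ≤ A ∧ A / δ ^ n ≤ ⌈(2 : ℝ) ^ ((R + ε₀) * (ℓ : ℝ))⌉₊ ∧
        (ℓ : ℝ) ^ 4 * A ^ 2 < (2 : ℝ) ^ (n * (Δ / 2)) ∧
        (β + 1) * (Real.exp (1 - A / (β * (n + mixingGap ν ℓ))) + K / A) ≤ η := by
  -- The accuracy factor will be `2^{nω}`: small against `2^{nε₀}`, as the sample length requires,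
  -- and against `2^{nΔ/2}`, as the threshold requires. By `n ≥ ξℓ` it is still exponential in `ℓ`,
  -- above the polynomial mixing gap.
  set ω := min ε₀ Δ / 16 with hω
  have hω0 : 0 < ω := by positivity
  have hωε : ω ≤ ε₀ / 16 := div_le_div_of_nonneg_right (min_le_left _ _) (by norm_num)
  have hωΔ : ω ≤ Δ / 16 := div_le_div_of_nonneg_right (min_le_right _ _) (by norm_num)
  obtain ⟨Y, hY⟩ : ∃ Y : ℝ, 0 < Y ∧ (β + 1) * Real.exp (1 - Y) ≤ η / 2 := by
    refine ⟨max 1 (1 - Real.log (η / 2 / (β + 1))), by positivity, ?_⟩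
    have h1 : Real.exp (1 - max 1 (1 - Real.log (η / 2 / (β + 1)))) ≤ η / 2 / (β + 1) := by
      rw [← Real.le_log_iff_exp_le (by positivity)]
      linarith [le_max_right 1 (1 - Real.log (η / 2 / (β + 1)))]
    rwa [le_div_iff₀ (by linarith), mul_comm] at h1
  set d := 4 * (ν + 1) + 3 with hd
  set C : ℝ := 20 * (ν + 1) ^ 2 + 2 with hC
  filter_upwards [eventually_poly_le_rpow (3 * K) 0 (by positivity : 0 < ξ * (ε₀ / 2)),
    eventually_poly_le_rpow 2 4 (by positivity : 0 < ξ * (Δ / 4)),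
    eventually_poly_le_rpow (Y * (β * C)) d (by positivity : 0 < ξ * ω),
    eventually_poly_le_rpow (2 * (β + 1) * K / η) 0 (by positivity : 0 < ξ * ω),
    eventually_ge_atTop 1] with ℓ h1 h2 h3 h4 hℓ k₀ hk n hn hξn hnℓ
  have hℓ0 : (0 : ℝ) < ℓ := by positivity
  have hn0 : (0 : ℝ) < n := lt_of_lt_of_le (by positivity) hξn
  set N := ⌈(2 : ℝ) ^ ((R + ε₀) * (ℓ : ℝ))⌉₊ with hN
  have hN1 : 1 ≤ N := Nat.one_le_ceil_iff.2 (by positivity)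
  have hmono : ∀ κ : ℝ, 0 ≤ κ → (2 : ℝ) ^ (ξ * κ * ℓ) ≤ (2 : ℝ) ^ (n * κ) := fun κ hκ =>
    Real.rpow_le_rpow_of_exponent_le (by norm_num) (by
      calc ξ * κ * ℓ = ξ * ℓ * κ := by ring
        _ ≤ n * κ := mul_le_mul_of_nonneg_right hξn hκ)
  refine ⟨(2 : ℝ) ^ (n * ω), Real.one_le_rpow (by norm_num) (by positivity), ?_, ?_, ?_⟩
  · have e1 := rpow_div_pow_escBlockLength_le (K := K) (k₀ := k₀) hδ hδ1 hε hN1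
    rw [hn] at e1
    have e2 : (sampleLength K k₀ N : ℝ) ≤ 3 * K * N := by
      have : sampleLength K k₀ N ≤ 3 * K * N := by
        unfold sampleLength
        nlinarith
      exact_mod_cast this
    have e3 : 3 * K * (2 : ℝ) ^ (n * ω) ≤ (2 : ℝ) ^ (n * ε₀) := by
      rw [pow_zero, mul_one] at h1
      calc 3 * K * (2 : ℝ) ^ (n * ω) ≤ (2 : ℝ) ^ (n * (ε₀ / 2)) * (2 : ℝ) ^ (n * (ε₀ / 2)) := by
            refine mul_le_mul (h1.trans (hmono _ (by positivity))) ?_ (by positivity) (by positivity)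
            exact Real.rpow_le_rpow_of_exponent_le (by norm_num)
              (mul_le_mul_of_nonneg_left (by linarith) hn0.le)
        _ = _ := by
            rw [← Real.rpow_add (by norm_num)]
            congr 1
            ring
    have hδn : 0 < δ ^ n := by positivity
    have hK0 : (0 : ℝ) < 3 * K := by positivity
    rw [div_le_iff₀ hδn] at e1 ⊢
    have e4 : 3 * K * (2 : ℝ) ^ (n * ω) ≤ 3 * K * (N * δ ^ n) := by
      calc _ ≤ (2 : ℝ) ^ (n * ε₀) := e3
        _ ≤ _ := e1
        _ ≤ 3 * K * N * δ ^ n := mul_le_mul_of_nonneg_right e2 hδn.le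
        _ = _ := by ring
    exact le_of_mul_le_mul_left e4 hK0
  · have e1 := h2.trans (hmono (Δ / 4) (by positivity))
    have e2 : (0 : ℝ) < (ℓ : ℝ) ^ 4 := by positivity
    have e3 : ((2 : ℝ) ^ (n * ω)) ^ 2 ≤ (2 : ℝ) ^ (n * (Δ / 4)) := by
      rw [← Real.rpow_natCast, ← Real.rpow_mul (by norm_num)]
      refine Real.rpow_le_rpow_of_exponent_le (by norm_num) ?_
      push_cast
      nlinarith
    calc (ℓ : ℝ) ^ 4 * ((2 : ℝ) ^ (n * ω)) ^ 2 < (2 * (ℓ : ℝ) ^ 4) * ((2 : ℝ) ^ (n * ω)) ^ 2 :=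
          mul_lt_mul_of_pos_right (by linarith) (by positivity)
      _ ≤ (2 : ℝ) ^ (n * (Δ / 4)) * (2 : ℝ) ^ (n * (Δ / 4)) :=
          mul_le_mul e1 e3 (by positivity) (by positivity)
      _ = _ := by
          rw [← Real.rpow_add (by norm_num)]
          congr 1
          ring
  · set A := (2 : ℝ) ^ (n * ω) with hA
    have hA0 : 0 < A := by positivity
    have e1 : Y * (β * C) * (ℓ : ℝ) ^ d ≤ A := h3.trans (hmono ω hω0.le)
    have e2 : (n : ℝ) + mixingGap ν ℓ ≤ C * (ℓ : ℝ) ^ d := by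
      have f1 := mixingGap_le (ν := ν) hℓ
      have f2 : (n : ℝ) ≤ (ℓ : ℝ) ^ d := by
        calc (n : ℝ) ≤ (ℓ : ℝ) := by exact_mod_cast hnℓ
          _ ≤ (ℓ : ℝ) ^ d := le_self_pow₀ (by exact_mod_cast hℓ) (by omega)
      rw [hC]
      linarith
    have e3 : Y ≤ A / (β * (n + mixingGap ν ℓ)) := by
      have hpos : 0 < β * ((n : ℝ) + mixingGap ν ℓ) := by positivity
      rw [le_div_iff₀ hpos]
      calc Y * (β * (n + mixingGap ν ℓ)) ≤ Y * (β * (C * (ℓ : ℝ) ^ d)) :=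
            mul_le_mul_of_nonneg_left (mul_le_mul_of_nonneg_left e2 (by linarith)) hY.1.le
        _ ≤ A := by linarith
    have e4 : (β + 1) * Real.exp (1 - A / (β * (n + mixingGap ν ℓ))) ≤ η / 2 := by
      refine le_trans (mul_le_mul_of_nonneg_left (Real.exp_le_exp.2 (by linarith)) (by linarith)) hY.2
    have e5 : (β + 1) * (K / A) ≤ η / 2 := by
      have := h4.trans (hmono ω hω0.le)
      rw [pow_zero, mul_one, div_le_iff₀ hη, ← hA] at this
      rw [mul_div_assoc', div_le_iff₀ hA0]
      linarith
    linarith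

end Failure

lemma card_earlyMismatches_le_hammingDist {ℓ : ℕ} (x y : Fin ℓ → Bool) :
    (earlyMismatches x y).card ≤ hammingDist x y := by
  rw [hammingDist, ← Finset.card_map Fin.valEmbedding]
  refine Finset.card_le_card fun i hi => ?_
  obtain ⟨h1, -, h3⟩ := Finset.mem_filter.1 hi
  rw [Finset.mem_range] at h1
  refine Finset.mem_map.2 ⟨⟨i, h1⟩, Finset.mem_filter.2 ⟨Finset.mem_univ _, ?_⟩, rfl⟩
  have := periodicLetter_coe x ⟨i, h1⟩
  have := periodicLetter_coe y ⟨i, h1⟩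
  simp_all

/-- The noise level below which the construction works. -/
lemma exists_noise_bound {ε₀ r : ℝ} (hε : 0 < ε₀) (hr : 0 < r) :
    ∃ δ₀ : ℝ, 0 < δ₀ ∧ δ₀ < 1 ∧ ∀ δ, 0 < δ → δ ≤ δ₀ → δ ≤ 1 / 2 ∧
      1 + √δ ≤ (2 : ℝ) ^ (ε₀ / 32) ∧ 2 * √δ ≤ r ∧ δ ≤ (2 : ℝ) ^ (-180 : ℝ) := by
  have h1 : 0 < (2 : ℝ) ^ (ε₀ / 32) - 1 := by
    have := Real.one_lt_rpow (by norm_num : (1 : ℝ) < 2) (by positivity : 0 < ε₀ / 32)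
    linarith
  set a := min ((2 : ℝ) ^ (ε₀ / 32) - 1) (r / 2) with ha
  have ha0 : 0 < a := by positivity
  have h2 : (0 : ℝ) < (2 : ℝ) ^ (-180 : ℝ) := by positivity
  refine ⟨min (a ^ 2) (min (1 / 2) ((2 : ℝ) ^ (-180 : ℝ))), by positivity, ?_, fun δ hδ hle => ?_⟩
  · exact lt_of_le_of_lt ((min_le_right _ _).trans (min_le_left _ _)) (by norm_num)
  · obtain ⟨h3, h4⟩ := le_min_iff.1 hle
    obtain ⟨h4, h5⟩ := le_min_iff.1 h4
    have h6 : √δ ≤ a := Real.sqrt_le_iff.2 ⟨ha0.le, h3⟩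
    have h7 : a ≤ (2 : ℝ) ^ (ε₀ / 32) - 1 := min_le_left _ _
    have h8 : a ≤ r / 2 := min_le_right _ _
    exact ⟨h4, by linarith, by linarith, h5⟩

lemma eventually_card_cycleStates_le {β : ℝ} (hβ : 1 < β) (ν : ℕ) :
    ∀ᶠ ℓ : ℕ in atTop, ∀ B : Finset (Fin ℓ → Bool),
      Real.exp (-(ℓ : ℝ) ^ 2) * (cycleStates ν B).card ≤ 1 - 1 / β := by
  have hb : 0 < 1 - 1 / β := by
    rw [sub_pos, div_lt_one (by linarith)]; exact hβ
  filter_upwards [eventually_poly_le_rpow ((ν + 1) / (1 - 1 / β)) 2 zero_lt_one,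
    eventually_ge_atTop 2] with ℓ h1 hℓ B
  have hℓ2 : (2 : ℝ) ≤ ℓ := by exact_mod_cast hℓ
  rw [one_mul, Real.rpow_natCast, div_mul_eq_mul_div, div_le_iff₀ hb] at h1
  have hcard : (B.card : ℝ) ≤ 2 ^ ℓ := by
    have := Finset.card_le_univ B
    rw [Fintype.card_fun, Fintype.card_bool, Fintype.card_fin] at this
    exact_mod_cast this
  have hS : ((cycleStates ν B).card : ℝ) ≤ 2 ^ ℓ * (2 ^ ℓ * (1 - 1 / β)) := by
    have e : ((cycleStates ν B).card : ℝ) ≤ B.card * ℓ * ((ν + 1) * ℓ) := by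
      exact_mod_cast card_cycleStates_le
    calc _ ≤ _ := e
      _ = B.card * ((ν + 1) * (ℓ : ℝ) ^ 2) := by ring
      _ ≤ _ := mul_le_mul hcard h1 (by positivity) (by positivity)
  have hexp : Real.exp (-(ℓ : ℝ) ^ 2) * (2 ^ ℓ * 2 ^ ℓ) ≤ 1 := by
    have e1 : (2 : ℝ) ≤ Real.exp 1 := by linarith [Real.add_one_le_exp (1 : ℝ)]
    have e2 : (2 : ℝ) ^ ℓ ≤ Real.exp ℓ := by
      calc (2 : ℝ) ^ ℓ ≤ Real.exp 1 ^ ℓ := pow_le_pow_left₀ (by norm_num) e1 _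
        _ = _ := by rw [← Real.exp_nat_mul, mul_one]
    calc Real.exp (-(ℓ : ℝ) ^ 2) * (2 ^ ℓ * 2 ^ ℓ) ≤
          Real.exp (-(ℓ : ℝ) ^ 2) * (Real.exp ℓ * Real.exp ℓ) := by gcongr
      _ = Real.exp (-(ℓ : ℝ) ^ 2 + (ℓ + ℓ)) := by rw [← Real.exp_add, ← Real.exp_add]
      _ ≤ 1 := Real.exp_le_one_iff.2 (by nlinarith)
  calc _ ≤ Real.exp (-(ℓ : ℝ) ^ 2) * (2 ^ ℓ * (2 ^ ℓ * (1 - 1 / β))) :=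
        mul_le_mul_of_nonneg_left hS (Real.exp_pos _).le
    _ = Real.exp (-(ℓ : ℝ) ^ 2) * (2 ^ ℓ * 2 ^ ℓ) * (1 - 1 / β) := by ring
    _ ≤ 1 * (1 - 1 / β) := mul_le_mul_of_nonneg_right hexp hb.le
    _ = _ := one_mul _

/-- The classifier is not essentially optimal: it fails on a rich sub-class of dithered
repetitions of cyclic codes. -/
theorem esc_not_essentially_optimal (R : ℝ) (hR0 : 0 < R) (hR1 : R < 1) :
    ∃ β₀ c : ℝ, 0 < β₀ ∧ β₀ < 1 / 2 ∧ 0 < c ∧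
    ∀ ε₀ α Δ : ℝ, 0 < ε₀ → ε₀ < R → 0 < α → α < 1 → 0 < Δ →
    ∃ δ₀ : ℝ, 0 < δ₀ ∧ δ₀ < 1 ∧
    ∀ (δ β η : ℝ) (K : ℕ), 0 < δ → δ ≤ δ₀ → 1 < β → 0 < η → 1 ≤ K →
    ∃ ℓ₀ : ℕ, ∀ ℓ : ℕ, ℓ₀ ≤ ℓ →
    ∃ (ν : ℕ) (𝓑 : Finset (Finset (Fin ℓ → Bool)))
      (P : Finset (Fin ℓ → Bool) → Measure (ℤ → Bool)) (k₁ n₁ : ℕ),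
      1 ≤ ν ∧ ℓ ≤ n₁ ∧ k₁ ≤ ⌈(2 : ℝ) ^ ((R + ε₀) * (ℓ : ℝ))⌉₊ ∧
      (2 : ℝ) ^ (c * (ℓ : ℝ)) ≤ (𝓑.card : ℝ) ∧
      (∀ B ∈ 𝓑, IsCyclic B ∧
        (2 : ℝ) ^ ((R - ε₀ / 2) * (ℓ : ℝ)) ≤ (B.card : ℝ) ∧
        (B.card : ℝ) ≤ (2 : ℝ) ^ (R * (ℓ : ℝ))) ∧
      (∀ B ∈ 𝓑, ∀ B' ∈ 𝓑, B ≠ B' → ∀ x ∈ B, ∀ y ∈ B',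
        β₀ * (ℓ : ℝ) ≤ (hammingDist x y : ℝ)) ∧
      (∀ B ∈ 𝓑, IsDitheredRepetition ν δ B (P B)) ∧
      (∀ B ∈ 𝓑, ∀ B' ∈ 𝓑, B ≠ B' → Δ ≤ klDivergence ℓ (P B) (P B')) ∧
      ∀ k₀ n₀ : ℕ, k₁ ≤ k₀ → k₀ ≤ ⌈(2 : ℝ) ^ ((R + ε₀) * (ℓ : ℝ))⌉₊ → n₁ ≤ n₀ →
        P '' (𝓑 : Set (Finset (Fin ℓ → Bool))) ⊆ memoryClass Bool k₀ α β δ R ℓ n₀ ∧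
        ENNReal.ofReal (1 - η) ≤
          classificationError ℓ (sampleLength K k₀ ⌈(2 : ℝ) ^ ((R + ε₀) * (ℓ : ℝ))⌉₊)
            (esc K k₀ δ ε₀ Δ ⌈(2 : ℝ) ^ ((R + ε₀) * (ℓ : ℝ))⌉₊) Δ
            (P '' (𝓑 : Set (Finset (Fin ℓ → Bool)))) := by
  obtain ⟨c, β₁, hc, hβ₁, hβ₁2, hcode⟩ := exists_isCodeFamily hR0 hR1
  refine ⟨β₁, c, hβ₁, hβ₁2, hc, fun ε₀ α Δ hε hεR hα _ hΔ => ?_⟩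
  obtain ⟨δ₀, hδ₀, hδ₀1, hnoise⟩ := exists_noise_bound hε
    (by positivity : 0 < (2 : ℝ) ^ (-((6 + Δ) / β₁)))
  refine ⟨δ₀, hδ₀, hδ₀1, fun δ β η K hδ hδle hβ hη hK => ?_⟩
  obtain ⟨hδhalf, hδ1, hδ2, hδ3⟩ := hnoise δ hδ hδle
  -- The bound `8` serves the long words, `2/α` the words of length `ℓ`. As `ν` does not depend on
  -- `ℓ`, the mixing gap is polynomial in `ℓ`.
  obtain ⟨ν, hνdef⟩ : ∃ ν, ν = max 8 ⌈2 / α⌉₊ := ⟨_, rfl⟩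
  have hν8 : 8 ≤ ν := hνdef ▸ le_max_left _ _
  have hν1 : 1 ≤ ν := by omega
  have hνα : 1 / (ν : ℝ) ≤ α / 2 := by
    have h1 : 2 / α ≤ ν := (Nat.le_ceil _).trans (Nat.cast_le.2 (hνdef ▸ le_max_right _ _))
    rw [div_le_iff₀ hα] at h1
    rw [div_le_div_iff₀ (by positivity) (by norm_num)]
    linarith
  obtain ⟨ξ, hξ, hblock⟩ := eventually_escBlockLength_bounds hR0 hR1 hε hεR hδ hδ3 hK
  refine eventually_atTop.1 ?_
  filter_upwards [hcode ε₀ hε hεR, eventually_card_cycleStates_le hβ ν, hblock,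
    eventually_inaccuracy_small (R := R) hε hΔ hη hξ hβ hδ (by linarith : δ < 1) hK ν,
    eventually_poly_le_rpow (2 * (ν + 1) / α) 1 (by positivity : 0 < ε₀ / 16),
    eventually_poly_le_rpow 1 1 hR0, eventually_poly_le_rpow 2 0 hc,
    eventually_poly_le_rpow (20 * (ν + 1) ^ 2 + 1) (4 * (ν + 1) + 3)
      (by positivity : 0 < R + ε₀), eventually_ge_atTop 2]
    with ℓ ⟨𝓑, h𝓑⟩ hcard hnb hA hlarge hℓR hc2 hgap hℓ
  have hℓ1 : 1 ≤ ℓ := by omega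
  have hℓ0 : (0 : ℝ) < ℓ := by positivity
  set N := ⌈(2 : ℝ) ^ ((R + ε₀) * (ℓ : ℝ))⌉₊ with hN
  have hex : ∀ B ∈ 𝓑, ∃ P, IsDitheredLaw ν β δ B P := fun B hB =>
    exists_isDitheredLaw (h𝓑.nonempty B hB) hℓ hν1 hδ.le hδhalf hβ (hcard B)
  choose! P hP using hex
  have hsmall : ∀ B ∈ 𝓑, ∀ᶠ n : ℕ in atTop, (P B).real
      {ω | blockProb (P B) (block n ω) ≤ (2 : ℝ) ^ (-((n : ℝ) * R))} ≤ 1 / (n : ℝ) := by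
    intro B hB
    refine (hP B hB).eventually_small_n (h𝓑.nonempty B hB) hℓ1 hδ.le (by linarith) hR0 hν8
      (hδ1.trans (Real.rpow_le_rpow_of_exponent_le (by norm_num) (by linarith))) ?_
    rw [one_mul, pow_one] at hℓR
    calc (B.card : ℝ) * ℓ ≤ (2 : ℝ) ^ (R * (ℓ : ℝ)) * (2 : ℝ) ^ (R * (ℓ : ℝ)) := by
          refine mul_le_mul ((h𝓑.size_le B hB).trans ?_) hℓR hℓ0.le (by positivity)
          exact Real.rpow_le_rpow_of_exponent_le (by norm_num)
            (mul_le_mul_of_nonneg_right (by linarith) hℓ0.le)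
      _ = _ := by
          rw [← Real.rpow_add (by norm_num)]
          congr 1
          ring
  -- The family is finite, so one threshold serves all its members.
  obtain ⟨n₁, hn₁⟩ := eventually_atTop.1 ((Filter.eventually_all_finset 𝓑).2 hsmall)
  have hkl : ∀ B ∈ 𝓑, ∀ B' ∈ 𝓑, B ≠ B' → Δ ≤ klDivergence ℓ (P B) (P B') :=
    fun B hB B' hB' hne => (hP B hB).le_klDivergence (hP B' hB') (h𝓑.nonempty B hB)
      (h𝓑.nonempty B' hB') hℓ1 hν1 (h𝓑.cyclic B hB) (h𝓑.cyclic B' hB') hβ₁ hΔ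
      (h𝓑.far B hB B' hB' hne) hδ hδ2
  refine ⟨ν, 𝓑, P, mixingGap ν ℓ, max ℓ n₁, hν1, le_max_left _ _, ?_, h𝓑.card_ge, ?_, ?_, ?_, hkl, ?_⟩
  · have h1 : (mixingGap ν ℓ : ℝ) ≤ N := (mixingGap_le hℓ1).trans (hgap.trans (Nat.le_ceil _))
    exact_mod_cast h1
  · intro B hB
    refine ⟨h𝓑.cyclic B hB, h𝓑.size_ge B hB, (h𝓑.size_le B hB).trans ?_⟩
    exact Real.rpow_le_rpow_of_exponent_le (by norm_num)
      (mul_le_mul_of_nonneg_right (by linarith) hℓ0.le)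
  · intro B hB B' hB' hne x hx y hy
    refine (h𝓑.far B hB B' hB' hne x hx y hy).trans ?_
    exact_mod_cast card_earlyMismatches_le_hammingDist x y
  · intro B hB
    exact (hP B hB).isDitheredRepetition (h𝓑.nonempty B hB) hℓ1 hδ.le (by linarith)
  · intro k₀ n₀ hk₁ hk₀ hn₀
    refine ⟨?_, ?_⟩
    · rintro _ ⟨B, hB, rfl⟩
      refine (hP B hB).regular.isVanishingMemory hβ hk₁ ?_ fun n hn =>
        hn₁ n ((le_max_right _ _).trans (hn₀.trans hn)) B hB
      exact (hP B hB).small_ell (h𝓑.nonempty B hB) hℓ1 hδ.le (by linarith) hν1 hνα hδ1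
        (h𝓑.size_le B hB) hlarge hα hε
    -- Any two distinct members of the family already give the error.
    · have h2 : (1 : ℝ) < 𝓑.card := by
        rw [pow_zero, mul_one] at hc2
        linarith [h𝓑.card_ge]
      obtain ⟨B, hB, B', hB', hne⟩ := Finset.one_lt_card.1 (by exact_mod_cast h2 : 1 < 𝓑.card)
      obtain ⟨n, hn⟩ : ∃ n, escBlockLength K k₀ δ ε₀ N = n := ⟨_, rfl⟩
      obtain ⟨hξn, h60⟩ := hnb k₀ hk₀
      rw [hn] at hξn h60
      have hn1 : 1 ≤ n := by
        have : (0 : ℝ) < n := lt_of_lt_of_le (by positivity) hξn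
        exact_mod_cast this
      have hnN : n ≤ N := hn ▸ min_le_left _ _
      obtain ⟨A, hA1, hAN, hAD, hAη⟩ := hA k₀ hk₀ n hn hξn (by omega)
      have hmain := le_pairError_esc (ℓ := ℓ) (hP B hB).regular (hP B' hB').regular hβ hδ hK hk₁ hn
        hn1 hnN (hkl B hB B' hB' hne) hA1 hAN
        ((hP B hB).blockProb_le (hP B' hB') hδ.le (by linarith) (h𝓑.nonempty B hB)
          (h𝓑.nonempty B' hB') hℓ1 hν1 (h𝓑.cyclic B hB) (h𝓑.cyclic B' hB') h60
          (h𝓑.size_compare B hB B' hB') (h𝓑.prefix_compare B hB B' hB')) hAD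
      refine (ENNReal.ofReal_le_ofReal (by linarith)).trans (hmain.trans ?_)
      unfold classificationError
      exact le_iSup₂_of_le (P B) ⟨B, hB, rfl⟩ (le_iSup₂_of_le (P B') ⟨B', hB', rfl⟩ le_rfl)

end ZivClassifier

end

theorem mainTheorem4 :
    -- the classifier is asymptotically optimal
    (∀ (𝒜 : Type*) [Fintype 𝒜] [DecidableEq 𝒜] [MeasurableSpace 𝒜] [DiscreteMeasurableSpace 𝒜]
      (k₀ : ℕ) (α β δ R : ℝ) (ℓ n₀ : ℕ),
      0 < α → α < 1 → 1 < β → 0 < δ → δ < 1 → 0 < R → 1 ≤ ℓ → ℓ ≤ n₀ →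
      ∀ (K : ℕ) (ε₀ Δ : ℝ), 1 ≤ K → 0 < ε₀ → 4 * ε₀ < Δ →
        Tendsto
          (fun N : ℕ =>
            ZivClassifier.classificationError
              (ZivClassifier.escBlockLength K k₀ δ ε₀ N)
              (ZivClassifier.sampleLength K k₀ N)
              (ZivClassifier.esc K k₀ δ ε₀ Δ N) Δ
              (ZivClassifier.memoryClass 𝒜 k₀ α β δ R ℓ n₀))
          atTop (𝓝 0)) ∧
    -- the classifier is not essentially optimal
    (∀ R : ℝ, 0 < R → R < 1 →
      ∃ β₀ c : ℝ, 0 < β₀ ∧ β₀ < 1 / 2 ∧ 0 < c ∧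
      ∀ ε₀ α Δ : ℝ, 0 < ε₀ → ε₀ < R → 0 < α → α < 1 → 0 < Δ →
      ∃ δ₀ : ℝ, 0 < δ₀ ∧ δ₀ < 1 ∧
      ∀ (δ β η : ℝ) (K : ℕ), 0 < δ → δ ≤ δ₀ → 1 < β → 0 < η → 1 ≤ K →
      ∃ ℓ₀ : ℕ, ∀ ℓ : ℕ, ℓ₀ ≤ ℓ →
      ∃ (ν : ℕ) (𝓑 : Finset (Finset (Fin ℓ → Bool)))
        (P : Finset (Fin ℓ → Bool) → Measure (ℤ → Bool)) (k₁ n₁ : ℕ),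
        1 ≤ ν ∧ ℓ ≤ n₁ ∧ k₁ ≤ ⌈(2 : ℝ) ^ ((R + ε₀) * (ℓ : ℝ))⌉₊ ∧
        -- an exponentially large collection of far apart cyclic sets
        (2 : ℝ) ^ (c * (ℓ : ℝ)) ≤ (𝓑.card : ℝ) ∧
        (∀ B ∈ 𝓑, ZivClassifier.IsCyclic B ∧
          (2 : ℝ) ^ ((R - ε₀ / 2) * (ℓ : ℝ)) ≤ (B.card : ℝ) ∧
          (B.card : ℝ) ≤ (2 : ℝ) ^ (R * (ℓ : ℝ))) ∧
        (∀ B ∈ 𝓑, ∀ B' ∈ 𝓑, B ≠ B' → ∀ x ∈ B, ∀ y ∈ B',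
          β₀ * (ℓ : ℝ) ≤ (hammingDist x y : ℝ)) ∧
        -- the associated sources, pairwise at divergence at least `Δ`
        (∀ B ∈ 𝓑, ZivClassifier.IsDitheredRepetition ν δ B (P B)) ∧
        (∀ B ∈ 𝓑, ∀ B' ∈ 𝓑, B ≠ B' → Δ ≤ ZivClassifier.klDivergence ℓ (P B) (P B')) ∧
        -- they form a sub-class of `M`, over which the error is close to `1`
        ∀ k₀ n₀ : ℕ, k₁ ≤ k₀ → k₀ ≤ ⌈(2 : ℝ) ^ ((R + ε₀) * (ℓ : ℝ))⌉₊ → n₁ ≤ n₀ →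
          P '' (𝓑 : Set (Finset (Fin ℓ → Bool))) ⊆
              ZivClassifier.memoryClass Bool k₀ α β δ R ℓ n₀ ∧
          ENNReal.ofReal (1 - η) ≤
            ZivClassifier.classificationError ℓ
              (ZivClassifier.sampleLength K k₀ ⌈(2 : ℝ) ^ ((R + ε₀) * (ℓ : ℝ))⌉₊)
              (ZivClassifier.esc K k₀ δ ε₀ Δ ⌈(2 : ℝ) ^ ((R + ε₀) * (ℓ : ℝ))⌉₊) Δ
              (P '' (𝓑 : Set (Finset (Fin ℓ → Bool))))) := by
  refine ⟨?_, ?_⟩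
  · intro 𝒜 _ _ _ _ k₀ α β δ R ℓ n₀ _ _ hβ hδ hδ1 _ _ _ K ε₀ Δ hK hε hΔ
    exact ZivClassifier.tendsto_classificationError_esc k₀ α β δ R ℓ n₀ hβ hδ hδ1 K ε₀ Δ hK hε hΔ
  · intro R hR0 hR1
    exact ZivClassifier.esc_not_essentially_optimal R hR0 hR1
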